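/- **Setting.** Let $(G,\pi)$ be a parity game: $G=(V,E)$ is a finite sinkless digraph with $n=|V|\ge 1$, $V=V_0\sqcup V_1$ (nodes of Even and of Odd), $\pi:V\to\{1,\dots,d\}$, $d$ even. Let $\tau:V_1\to V$ be a strategy for Odd ($v\tau(v)\in E$), and let $G_\tau=(V,E_\tau)$ be its strategy subgraph, which consists of all arcs leaving $V_0$ and the arcs $v\tau(v)$, $v\in V_1$; put $m=|E_\tau|$. Let $T$ be the perfect $n$-ary ordered tree of height $h=d/2$. Its leaves are the tuples $\xi=(\xi_{2h-1},\xi_{2h-3},\dots,\xi_1)\in\{0,\dots,n-1\}^h$ in lexicographic order; $\bar L(T)$ is the set of leaves with an additional largest element $\top$. The $p$-truncation $\xi|_p$ deletes the components of index less than $p$, and $\top|_p=\top$; truncated tuples are compared lexicographically. For a labeling $\mu:V\to\bar L(T)$, an arc $vw$ is *violated* unless $\mu(v)|_{\pi(v)}\ge\mu(w)|_{\pi(v)}$ (if $\pi(v)$ is even), respectively $\mu(v)|_{\pi(v)}>\mu(w)|_{\pi(v)}$ or $\mu(v)=\mu(w)=\top$ (if $\pi(v)$ is odd). It is *tight* if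 $\mu(v)$ is the smallest tail label with which it is not violated, and *loose* if it is neither violated nor tight. Let $\mathrm{lift}(\mu,vw)$ be the smallest $\xi\ge\mu(v)$ such that $vw$ with tail label $\xi$ is not violated, and $\mathrm{drop}(\mu,vw)$ the largest $\xi\le\mu(v)$ such that $vw$ with tail label $\xi$ is not loose. The operator $\mathrm{Lift}_v$ replaces $\mu(v)$ by $\min_{vw\in E_\tau}\mathrm{lift}(\mu,vw)$; $\mathrm{Lift}_{vw}$ replaces $\mu(v)$ by $\mathrm{lift}(\mu,vw)$. Let $\mathcal G_\tau^\uparrow=\{\mathrm{Lift}_v: v\in V_0\}\cup\{\mathrm{Lift}_{vw}:v\in V_1,\ vw\in E_\tau\}$, and let $\mu^{\mathcal G_\tau^\uparrow}$ be the least simultaneous fixed point of $\mathcal G_\tau^\uparrow$ that is pointwise at least $\mu$. A *base node* is a node with even priority that has the highest priority on some cycle of $G_\tau$; $B$ is the set of base nodes, and $H$ is $G_\tau$ without the arcs leaving $B$. *Dijkstra's algorithm* on an input labeling $\nu$: set $S=B$ and $\nu(v)=\top$ for $v\notin B$. For every even $p\le d$ take any $\Phi_p:V\to\mathbb Z_{\ge0}$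 with $\Phi_p(v)=0$ iff $\pi(v)>p$, with $\Phi_p(v)\ge\Phi_p(w)$ if $v$ reaches $w$ in $H_p$ (the subgraph of $H$ induced by the nodes of priority at most $p$), and with $\Phi_p(v)=\Phi_p(w)>0$ iff $v,w$ are strongly connected in $H_p$. Drop the tail label, $\nu(v)\gets\mathrm{drop}(\nu,vw)$, for each arc $vw$ entering $S$ from outside. While $S\ne V$, choose $u\notin S$ with lexicographically smallest potential $(\Phi_d(u),\nu(u)_{d-1},\dots,\Phi_2(u),\nu(u)_1)$ ($\infty$ if $\nu(u)=\top$; ties arbitrary), add $u$ to $S$, and drop the tail label of each arc $vu$ with $v\notin S$. Return $\nu$. **Theorem.** Let $\mu:V\to\bar L(T)$ be a labeling without loose arcs in $G_\tau$. Then $\mu^{\mathcal G_\tau^\uparrow}$ exists, and: 1. Let $\mu'$ be obtained from $\mu$ by applying $\mathrm{Lift}_v$ once, in any order, at each base node $v$ whose outgoing arcs in $G_\tau$ are all violated with respect to $\mu$ (if $v\in V_1$, this is $\mathrm{Lift}_{v\tau(v)}$). Then $\mu'(v)=\mu^{\mathcal G_\tau^\uparrow}(v)$ for every base node $v$. 2.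 Dijkstra's algorithm on the input $\mu'$ returns $\mu^{\mathcal G_\tau^\uparrow}$, for all choices of the $\Phi_p$, of the order of arcs and of the ties. 3. $\mu^{\mathcal G_\tau^\uparrow}$ can be computed in $O(d(m+n\log n))$ time: there is a fixed program for a unit-cost word RAM with words of $O(\log(n+m+d))$ bits and absolute implied constants which, given $G_\tau$ by adjacency lists, $\pi$, and $\mu$ (component by component), outputs $\mu^{\mathcal G_\tau^\uparrow}$ within $O(d(m+n\log n))$ steps. -/

import Mathlib

/-! ## Parity games, strategies and one-player games -/

namespace TreeGame

/-- A parity game with priorities in `{1, …, d}` on a sinkless digraph with node set `V`. -/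
structure ParityGame (V : Type) (d : ℕ) where
  /-- the arcs -/
  Arc : V → V → Prop
  sinkless : ∀ v, ∃ w, Arc v w
  /-- the set `V₁` of nodes owned by Odd; Even owns the complement `V₀` -/
  oddNodes : Set V
  /-- the priority function -/
  prio : V → ℕ
  one_le_prio : ∀ v, 1 ≤ prio v
  prio_le : ∀ v, prio v ≤ d

/-- A positional strategy for Odd. -/
structure OddStrategy {V : Type} {d : ℕ} (G : ParityGame V d) where
  move : G.oddNodes → V
  arc_move : ∀ v : G.oddNodes, G.Arc v (move v)

/-- The arcs of the strategy subgraph `G_τ`: all arcs leaving Even's nodes, and the arcs `v τ(v)`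
at Odd's nodes. -/
def OddStrategy.SArc {V : Type} {d : ℕ} {G : ParityGame V d} (τ : OddStrategy G) (v w : V) : Prop :=
  G.Arc v w ∧ ∀ hv : v ∈ G.oddNodes, w = τ.move ⟨v, hv⟩

/-- `v` is a base node of the digraph `A` with priorities `π`: it is a node of highest priority on
some (simple, possibly one-node) cycle, and this priority is even. -/
def IsBase {V : Type} (A : V → V → Prop) (π : V → ℕ) (v : V) : Prop :=
  Even (π v) ∧ ∃ c : Cycle V, c.Nodup ∧ c.Chain A ∧ v ∈ c ∧ ∀ u ∈ c, π u ≤ π v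

/-! ## Labels from the perfect `ℓ`-ary tree of height `h`

The vertices of this ordered tree are the tuples of length at most `h` over `{0, …, ℓ-1}`, ordered
lexicographically, and the leaves are the tuples `(ξ_{2h-1}, ξ_{2h-3}, …, ξ_1)` of length `h`. -/

/-- The leaves of the perfect `ℓ`-ary tree of height `h`; the linear order is the lexicographic
order of lists. -/
abbrev Leaf (ℓ h : ℕ) : Type := {ξ : List (Fin ℓ) // ξ.length = h}

noncomputable instance instFintypeLeaf (ℓ h : ℕ) : Fintype (Leaf ℓ h) :=
  inferInstanceAs (Fintype (List.Vector (Fin ℓ) h))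

/-- The leaves together with an additional largest element `⊤`. -/
abbrev Label (ℓ h : ℕ) : Type := WithTop (Leaf ℓ h)

/-- The `p`-truncation: it deletes the components whose index is less than `p`. The component at
position `i` (counted from `0`) has index `2h-1-2i`, so the first `h - ⌊p/2⌋` components stay. -/
def trunc {ℓ h : ℕ} (p : ℕ) (a : Label ℓ h) : WithTop (List (Fin ℓ)) :=
  WithTop.map (fun ξ : Leaf ℓ h => ξ.1.take (h - p / 2)) a

/-- The condition for an arc `vw` not to be violated, where `p = π(v)` is the priority of the tail,
`a` the label of the tail and `b` the label of the head. -/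
def Respects {ℓ h : ℕ} (p : ℕ) (a b : Label ℓ h) : Prop :=
  (Even p → trunc p b ≤ trunc p a) ∧
    (¬ Even p → trunc p b < trunc p a ∨ (a = ⊤ ∧ b = ⊤))

open Classical in
/-- The smallest tail label with which an arc is not violated, if the tail has priority `p` and
the head has label `b` (the infimum of a finite set of labels that contains `⊤`). -/
noncomputable def tighten {ℓ h : ℕ} (p : ℕ) (b : Label ℓ h) : Label ℓ h :=
  (Finset.univ.filter fun a => Respects p a b).inf id

section Labelings

variable {V : Type} {ℓ h : ℕ}

/-- The arc `vw` is violated with respect to `μ`. -/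
def Violated (π : V → ℕ) (μ : V → Label ℓ h) (v w : V) : Prop :=
  ¬ Respects (π v) (μ v) (μ w)

/-- The arc `vw` is tight with respect to `μ`. -/
def Tight (π : V → ℕ) (μ : V → Label ℓ h) (v w : V) : Prop :=
  μ v = tighten (π v) (μ w)

/-- The arc `vw` is loose with respect to `μ`: neither violated nor tight. -/
def Loose (π : V → ℕ) (μ : V → Label ℓ h) (v w : V) : Prop :=
  ¬ Violated π μ v w ∧ ¬ Tight π μ v w

open Classical in
/-- The smallest label `ξ ≥ μ(v)` such that `vw` is not violated if its tail has label `ξ`. -/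
noncomputable def lift (π : V → ℕ) (μ : V → Label ℓ h) (v w : V) : Label ℓ h :=
  (Finset.univ.filter fun ξ => μ v ≤ ξ ∧ Respects (π v) ξ (μ w)).inf id

open Classical in
/-- The largest label `ξ ≤ μ(v)` such that `vw` is not loose if its tail has label `ξ`. -/
noncomputable def drop (π : V → ℕ) (μ : V → Label ℓ h) (v w : V) : Label ℓ h :=
  if Loose π μ v w then tighten (π v) (μ w) else μ v

open Classical in
/-- Replace the label of `v` by the smallest `lift` over its outgoing arcs in `A`. -/
noncomputable def liftNode [Fintype V] (A : V → V → Prop) (π : V → ℕ)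
    (μ : V → Label ℓ h) (v : V) : V → Label ℓ h :=
  Function.update μ v ((Finset.univ.filter fun w => A v w).inf fun w => lift π μ v w)

open Classical in
/-- Replace the label of `v` by the `lift` over the arc `vw`. -/
noncomputable def liftArc (π : V → ℕ) (μ : V → Label ℓ h) (v w : V) : V → Label ℓ h :=
  Function.update μ v (lift π μ v w)

/-- The family of lift operators of a sinkless digraph `A`: one for every node of Even and one for
every arc that leaves a node of Odd (the nodes in `O`). -/
def liftOps [Fintype V] (A : V → V → Prop) (O : Set V) (π : V → ℕ) :
    Set ((V → Label ℓ h) → V → Label ℓ h) :=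
  {φ | (∃ v, v ∉ O ∧ φ = fun μ => liftNode A π μ v) ∨
    ∃ v w, v ∈ O ∧ A v w ∧ φ = fun μ => liftArc π μ v w}

/-- `μs` is the least simultaneous fixed point of the lift operators that is pointwise at
least `μ`. -/
def IsLeastFixedPoint [Fintype V] (A : V → V → Prop) (O : Set V) (π : V → ℕ)
    (μ μs : V → Label ℓ h) : Prop :=
  IsLeast {ν | μ ≤ ν ∧ ∀ φ ∈ liftOps A O π, φ ν = ν} μs

/-- The list `l` runs, in some order, once through the elements of `s`. -/
def Enumerates {α : Type} (l : List α) (s : Set α) : Prop :=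
  l.Nodup ∧ ∀ x, x ∈ l ↔ x ∈ s

/-- `μ'` is obtained from `μ` by applying the lift operator once at each base node whose outgoing
arcs are all violated with respect to `μ`, in some order. -/
def IsBaseLift [Fintype V] (A : V → V → Prop) (π : V → ℕ) (μ μ' : V → Label ℓ h) : Prop :=
  ∃ l : List V, Enumerates l {v | IsBase A π v ∧ ∀ w, A v w → Violated π μ v w} ∧
    μ' = l.foldl (liftNode A π) μ

/-! ## Dijkstra's algorithm for labels from an ordered tree -/

/-- The arcs of the digraph `H`, in which the arcs leaving base nodes have been deleted. -/
def HArc (A : V → V → Prop) (π : V → ℕ) (v w : V) : Prop :=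
  A v w ∧ ¬ IsBase A π v

/-- `v` can reach `w` in `H_p`, the subgraph of `H` induced by the nodes of priority at most `p`. -/
def HReach (A : V → V → Prop) (π : V → ℕ) (p : ℕ) (v w : V) : Prop :=
  π v ≤ p ∧ π w ≤ p ∧
    Relation.ReflTransGen (fun x y => HArc A π x y ∧ π x ≤ p ∧ π y ≤ p) v w

/-- `Φ p`, for every even priority `p ≤ d`, encodes a topological order of `H_p`. -/
structure IsTopOrder (A : V → V → Prop) (π : V → ℕ) (d : ℕ) (Φ : ℕ → V → ℕ) : Prop where
  eq_zero_iff : ∀ p, 1 ≤ p → p ≤ d → Even p → ∀ v, Φ p v = 0 ↔ p < π v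
  mono : ∀ p, 1 ≤ p → p ≤ d → Even p → ∀ v w, HReach A π p v w → Φ p w ≤ Φ p v
  eq_iff : ∀ p, 1 ≤ p → p ≤ d → Even p → ∀ v w,
    (Φ p v = Φ p w ∧ 0 < Φ p w) ↔ (HReach A π p v w ∧ HReach A π p w v)

/-- The potential of `v`: the interlaced tuple `(Φ_{2h}, ν_{2h-1}, Φ_{2h-2}, …, Φ_2, ν_1)` if the
label `ν(v)` is finite, and `∞` otherwise. Tuples are compared lexicographically. -/
def potential (Φ : ℕ → V → ℕ) (ν : V → Label ℓ h) (v : V) : WithTop (List ℕ) :=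
  WithTop.map
    (fun ξ : Leaf ℓ h => ξ.1.zipIdx.flatMap fun a => [Φ (2 * (h - a.2)) v, (a.1 : ℕ)]) (ν v)

open Classical in
/-- Drop the tail labels of the arcs in the list `l`, one arc after the other. -/
noncomputable def dropAll (π : V → ℕ) (l : List (V × V)) (ν : V → Label ℓ h) : V → Label ℓ h :=
  l.foldl (fun ν e => Function.update ν e.1 (drop π ν e.1 e.2)) ν

open Classical in
/-- `DijkstraReaches A π Φ ν₀ S ν`: on the input labeling `ν₀`, Dijkstra's algorithm can arrive at
the set `S` of fixed nodes with the current labeling `ν`. -/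
inductive DijkstraReaches (A : V → V → Prop) (π : V → ℕ) (Φ : ℕ → V → ℕ) (ν₀ : V → Label ℓ h) :
    Set V → (V → Label ℓ h) → Prop
  | start (l : List (V × V))
      (hl : Enumerates l {e | A e.1 e.2 ∧ ¬ IsBase A π e.1 ∧ IsBase A π e.2}) :
      DijkstraReaches A π Φ ν₀ {v | IsBase A π v}
        (dropAll π l fun v => if IsBase A π v then ν₀ v else ⊤)
  | step {S : Set V} {ν : V → Label ℓ h} (hS : DijkstraReaches A π Φ ν₀ S ν)
      (u : V) (hu : u ∉ S) (hmin : ∀ v, v ∉ S → potential Φ ν u ≤ potential Φ ν v)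
      (l : List (V × V)) (hl : Enumerates l {e | A e.1 e.2 ∧ e.1 ∉ insert u S ∧ e.2 = u}) :
      DijkstraReaches A π Φ ν₀ (insert u S) (dropAll π l ν)

/-- Dijkstra's algorithm, on the input labeling `ν₀`, can return the labeling `ν`. -/
def DijkstraReturns (A : V → V → Prop) (π : V → ℕ) (d : ℕ) (ν₀ ν : V → Label ℓ h) : Prop :=
  ∃ Φ, IsTopOrder A π d Φ ∧ DijkstraReaches A π Φ ν₀ Set.univ ν

end Labelings

/-! ### `tighten`, `lift` and `drop` are the extremal labels that they are said to be -/

theorem respects_top {ℓ h : ℕ} (p : ℕ) (b : Label ℓ h) : Respects p ⊤ b := by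
  refine ⟨fun _ => ?_, fun _ => ?_⟩
  · simp [trunc]
  · rcases eq_or_ne b ⊤ with hb | hb
    · exact Or.inr ⟨rfl, hb⟩
    · left
      obtain ⟨b, rfl⟩ := WithTop.ne_top_iff_exists.mp hb
      simp [trunc]

theorem isLeast_inf_id {ℓ h : ℕ} (s : Finset (Label ℓ h)) (hs : ⊤ ∈ s) :
    IsLeast (s : Set (Label ℓ h)) (s.inf id) := by
  refine ⟨?_, fun a ha => Finset.inf_le (f := id) ha⟩
  obtain ⟨a, ha, hae⟩ := Finset.exists_mem_eq_inf s ⟨⊤, hs⟩ (id : Label ℓ h → Label ℓ h)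
  rw [hae]
  exact ha

theorem isLeast_tighten {ℓ h : ℕ} (p : ℕ) (b : Label ℓ h) :
    IsLeast {a | Respects p a b} (tighten p b) := by
  classical
  have := isLeast_inf_id (Finset.univ.filter fun a => Respects p a b)
    (by simp [respects_top])
  simpa [tighten] using this

theorem isLeast_lift {V : Type} {ℓ h : ℕ} (π : V → ℕ) (μ : V → Label ℓ h) (v w : V) :
    IsLeast {ξ | μ v ≤ ξ ∧ Respects (π v) ξ (μ w)} (lift π μ v w) := by
  classical
  have := isLeast_inf_id (Finset.univ.filter fun ξ => μ v ≤ ξ ∧ Respects (π v) ξ (μ w))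
    (by simp [respects_top])
  simpa [TreeGame.lift] using this

theorem take_le_take {α : Type} [LinearOrder α] (k : ℕ) {x y : List α} (hxy : x ≤ y)
    (hl : x.length = y.length) : x.take k ≤ y.take k := by
  have key : ∀ (k : ℕ) (x y : List α), x.length = y.length → y.take k < x.take k → y < x := by
    intro k
    induction k with
    | zero => intro x y _ hlt; simp at hlt
    | succ k ih =>
      intro x y hl hlt
      cases x with
      | nil => simp at hlt
      | cons a x =>
        cases y with
        | nil => simp at hl
        | cons b y =>
          simp only [List.take_succ_cons, List.cons_lt_cons_iff] at hlt ⊢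
          rcases hlt with h1 | ⟨h1, h2⟩
          · exact Or.inl h1
          · exact Or.inr ⟨h1, ih x y (by simpa using hl) h2⟩
  exact not_lt.mp fun hlt => absurd (key k x y hl hlt) (not_lt.mpr hxy)

theorem Respects.mono {ℓ h : ℕ} {p : ℕ} {a a' b : Label ℓ h} (ha : Respects p a b)
    (haa : a ≤ a') : Respects p a' b := by
  have key : trunc p a ≤ trunc p a' := by
    induction a' using WithTop.recTopCoe with
    | top => simp [trunc]
    | coe y =>
      induction a using WithTop.recTopCoe with
      | top => simp at haa
      | coe x =>
        simp only [trunc, WithTop.map_coe, WithTop.coe_le_coe]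
        have hxy : x ≤ y := WithTop.coe_le_coe.mp haa
        exact take_le_take _ hxy (x.2.trans y.2.symm)
  refine ⟨fun hp => (ha.1 hp).trans key, fun hp => ?_⟩
  rcases ha.2 hp with h1 | ⟨rfl, h2⟩
  · exact Or.inl (h1.trans_le key)
  · exact Or.inr ⟨top_le_iff.mp haa, h2⟩

theorem isGreatest_drop {V : Type} {ℓ h : ℕ} (π : V → ℕ) (μ : V → Label ℓ h) (v w : V) :
    IsGreatest {ξ | ξ ≤ μ v ∧ ¬ (Respects (π v) ξ (μ w) ∧ ξ ≠ tighten (π v) (μ w))}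
      (drop π μ v w) := by
  have ht := isLeast_tighten (π v) (μ w)
  unfold drop
  split_ifs with hl
  · have hr : Respects (π v) (μ v) (μ w) := not_not.mp hl.1
    refine ⟨⟨ht.2 hr, fun hh => hh.2 rfl⟩, fun ξ hξ => ?_⟩
    by_contra hlt
    exact hξ.2 ⟨ht.1.mono (not_le.mp hlt).le, (not_le.mp hlt).ne'⟩
  · exact ⟨⟨le_rfl, fun hh => hl ⟨not_not.mpr hh.1, hh.2⟩⟩, fun ξ hξ => hξ.1⟩

end TreeGame

/-! ## A word RAM

Programs have finitely many registers and arrays of natural numbers. Every elementary operation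
costs one time unit, and a program may only compute numbers (values and addresses) up to a given
word bound `W`. -/

namespace WordRAM

/-- A memory state: the contents of the registers and of the arrays. -/
structure State where
  reg : ℕ → ℕ
  arr : ℕ → ℕ → ℕ

/-- Write `x` into the register `r`. -/
def State.setReg (s : State) (r x : ℕ) : State where
  reg := Function.update s.reg r x
  arr := s.arr

/-- Write `x` into the cell with address `i` of the array `a`. -/
def State.setCell (s : State) (a i x : ℕ) : State where
  reg := s.reg
  arr := Function.update s.arr a (Function.update (s.arr a) i x)

/-- Arithmetic expressions: constants, registers, array cells `a[e]`, sums, truncated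
differences and products. -/
inductive Exp where
  | lit (c : ℕ)
  | reg (r : ℕ)
  | cell (a : ℕ) (e : Exp)
  | plus (e₁ e₂ : Exp)
  | minus (e₁ e₂ : Exp)
  | times (e₁ e₂ : Exp)

/-- The value of an expression. -/
def Exp.val (s : State) : Exp → ℕ
  | .lit c => c
  | .reg r => s.reg r
  | .cell a e => s.arr a (e.val s)
  | .plus e₁ e₂ => e₁.val s + e₂.val s
  | .minus e₁ e₂ => e₁.val s - e₂.val s
  | .times e₁ e₂ => e₁.val s * e₂.val s

/-- The time for evaluating an expression: its number of operations, constants included. -/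
def Exp.cost : Exp → ℕ
  | .lit _ => 1
  | .reg _ => 1
  | .cell _ e => e.cost + 1
  | .plus e₁ e₂ => e₁.cost + e₂.cost + 1
  | .minus e₁ e₂ => e₁.cost + e₂.cost + 1
  | .times e₁ e₂ => e₁.cost + e₂.cost + 1

/-- All numbers that occur during the evaluation are at most `W`. -/
def Exp.Fits (W : ℕ) (s : State) : Exp → Prop
  | .lit c => c ≤ W
  | .reg r => s.reg r ≤ W
  | .cell a e => e.Fits W s ∧ s.arr a (e.val s) ≤ W
  | .plus e₁ e₂ => e₁.Fits W s ∧ e₂.Fits W s ∧ e₁.val s + e₂.val s ≤ W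
  | .minus e₁ e₂ => e₁.Fits W s ∧ e₂.Fits W s
  | .times e₁ e₂ => e₁.Fits W s ∧ e₂.Fits W s ∧ e₁.val s * e₂.val s ≤ W

/-- Programs. Tests are expressions, and a nonzero value means true. -/
inductive Prog where
  | skip
  | assign (r : ℕ) (e : Exp)
  | store (a : ℕ) (i e : Exp)
  | seq (P Q : Prog)
  | ite (b : Exp) (P Q : Prog)
  | while (b : Exp) (P : Prog)

/-- `Exec W P s t s'`: with word bound `W`, the program `P` started in the state `s` terminates in
the state `s'` after `t` time units. -/
inductive Exec (W : ℕ) : Prog → State → ℕ → State → Prop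
  | skip (s : State) : Exec W .skip s 1 s
  | assign (s : State) (r : ℕ) (e : Exp) (he : e.Fits W s) :
      Exec W (.assign r e) s (e.cost + 1) (s.setReg r (e.val s))
  | store (s : State) (a : ℕ) (i e : Exp) (hi : i.Fits W s) (he : e.Fits W s) :
      Exec W (.store a i e) s (i.cost + e.cost + 1)
        (s.setCell a (i.val s) (e.val s))
  | seq {P Q : Prog} {s s₁ s₂ : State} {t₁ t₂ : ℕ} (hP : Exec W P s t₁ s₁)
      (hQ : Exec W Q s₁ t₂ s₂) : Exec W (.seq P Q) s (t₁ + t₂) s₂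
  | ite_true {b : Exp} {P Q : Prog} {s s₁ : State} {t : ℕ} (hb : b.Fits W s)
      (h : b.val s ≠ 0) (hP : Exec W P s t s₁) : Exec W (.ite b P Q) s (b.cost + 1 + t) s₁
  | ite_false {b : Exp} {P Q : Prog} {s s₁ : State} {t : ℕ} (hb : b.Fits W s)
      (h : b.val s = 0) (hQ : Exec W Q s t s₁) : Exec W (.ite b P Q) s (b.cost + 1 + t) s₁
  | while_true {b : Exp} {P : Prog} {s s₁ s₂ : State} {t₁ t₂ : ℕ} (hb : b.Fits W s)
      (h : b.val s ≠ 0) (hP : Exec W P s t₁ s₁) (hW : Exec W (.while b P) s₁ t₂ s₂) :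
      Exec W (.while b P) s (b.cost + 1 + t₁ + t₂) s₂
  | while_false {b : Exp} {P : Prog} {s : State} (hb : b.Fits W s) (h : b.val s = 0) :
      Exec W (.while b P) s (b.cost + 1) s

/-- The state whose registers and arrays hold the given lists of numbers, and `0` elsewhere. -/
def State.ofLists (regs : List ℕ) (arrs : List (List ℕ)) : State where
  reg r := regs.getD r 0
  arr a i := (arrs.getD a []).getD i 0

end WordRAM

/-! ## Input and output of the computational problem -/

namespace TreeGame

/-- The number of arcs of a digraph. -/
noncomputable def arcCount {V : Type} (A : V → V → Prop) : ℕ :=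
  Set.ncard {e : V × V | A e.1 e.2}

/-- `adj` is an adjacency-list representation of the digraph `A`. -/
def IsAdjList {V : Type} (A : V → V → Prop) (adj : V → List V) : Prop :=
  ∀ v, Enumerates (adj v) {w | A v w}

open Classical in
/-- The bit that tells whether a label is `⊤`. -/
noncomputable def topBit {ℓ h : ℕ} (a : Label ℓ h) : ℕ := if a = ⊤ then 1 else 0

/-- The `h` components of a label; all are `0` for the label `⊤`. -/
def comps {ℓ h : ℕ} : Label ℓ h → List ℕ
  | none => List.replicate h 0
  | some ξ => ξ.1.map Fin.val

/-- The input for nodes `0, …, n-1`. Registers `0, 1, 2` hold `n`, the number of arcs and `d`.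
Arrays `0, 1` hold the adjacency lists, one after the other in array `1`, with the list of node `v`
occupying the positions from `a₀[v]` to `a₀[v+1] - 1`. Array `2` holds the priorities. Arrays
`3, 4` hold the labeling: first the `⊤`-bits, then the `h` components of each label, one label
after the other. -/
noncomputable def inputState {n h : ℕ} (d : ℕ) (adj : Fin n → List (Fin n)) (π : Fin n → ℕ)
    (μ : Fin n → Label n h) : WordRAM.State :=
  WordRAM.State.ofLists
    [n, ∑ v, (adj v).length, d]
    [(List.range (n + 1)).map fun k => ∑ v : Fin n, if v.val < k then (adj v).length else 0,
      (List.finRange n).flatMap fun v => (adj v).map Fin.val,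
      (List.finRange n).map π,
      (List.finRange n).map fun v => topBit (μ v),
      (List.finRange n).flatMap fun v => comps (μ v)]

/-- The state `s` holds the labeling `μ` in arrays `3` and `4`, in the same format. -/
def HoldsLabeling {n h : ℕ} (s : WordRAM.State) (μ : Fin n → Label n h) : Prop :=
  ∀ v : Fin n, s.arr 3 v = topBit (μ v) ∧
    ∀ i < h, s.arr 4 (v * h + i) = (comps (μ v)).getD i 0

end TreeGame

open TreeGame WordRAM

/-!
Fixed points. Lifting a label takes the maximum with the smallest label that keeps the arc from
being violated (`lift_eq_max`), and dropping takes the minimum (`drop_eq_min`). Hence the common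
fixed points of the lift operators are the prefixed points of the monotone operator `bestTighten`,
which assigns to a node the best label that one of its arcs allows (`forall_liftOps_iff`). Since
there are finitely many labelings, there is a least prefixed point `μs` above `μ`; as `μ` has no
loose arcs, it is a fixed point of `bestTighten` (`bestTighten_eq_of_isLeast`).

Base nodes. Let `b` be a base node of priority `p`. Going around a cycle on which `p` is the
highest priority, the components of index below `p` are increased fewer than `n` times, so that no
carry reaches a component that `b` sees. Labels that are padded below `p` with the distance to `b`
along the cycle, and `⊤` elsewhere, have with `μs` an infimum that is a prefixed point above `μ`,
and its label at `b` is at most that of `bestTighten μ`. The latter is therefore the label of `b`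
in `μs` (`IsBase.apply_eq_bestTighten`), and the lifts of the base nodes in any order produce it
(`IsBaseLift.apply_eq`).

Dijkstra's algorithm. If an arc that does not leave a base node is not violated, then the head has
a smaller potential than the tail (`IsWeakTopOrder.interlace_lt`). So a node of smallest potential
among those that have not been processed has its final label: for a node `y` of smallest *final*
potential among them, the head of the arc that determines its label has been processed, hence the
current label of `y` is final (`DijkstraInv.eq_of_minimal`). The labels remain upper bounds for
`μs`, and `μs` is returned (`dijkstraReturns_iff`).

Running time. Programs are verified by weakest preconditions with a time budget (`Runs`). As the
budget is part of the assertions, it can be bounded below by an amortised potential. The numbers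
`Φ` are numbers of strongly connected components of the subgraphs of the nodes of priority at most
`p`, for every even `p`, computed by depth-first search and backward searches in the reverse of
the finishing order (`sccProg_does`). They refer to all arcs, including those that leave base
nodes; they still have the two properties that the algorithm needs (`IsScc.isWeakTopOrder`), and a
node of even priority is a base node if and only if one of its arcs stays in its component
(`isBase_iff`). Relaxing an arc takes time `O(h)`, as for comparing and storing labels component
by component.

The potentials form a sequence of `d` numbers at most `n`, hence a number of `d * L` bits with `L
= O(log n)`, but comparing two of them in a heap would take time `O(d)` for each of `O(log n)`
comparisons, also after every decrease. Instead, the queue is a monotone radix heap (`HeapInv`): a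
node is in a list whose level is a position above which its key agrees with the last minimum. To
find the next minimum, the first nonempty list is split by the next bit of the keys, over and
over; a decrease of a key can only decrease the level of a node. Every step moves a node to a
smaller level or is paid by such moves, so that all queue operations take time `O(d * L)` per node
and `O(1)` per arc (`Inst.credit`, `placeProg_runs`, `splitProg_runs`). The bits are read from a
table. In total the time is `O(d * (m + n * L))` (`solveProg_does`), that is `O(d (m + n log n))`,
as `n ≤ m`.
-/

/-! ### Lifting and tightening -/

namespace TreeGame

section Tighten

variable {V : Type} {ℓ h : ℕ}

theorem trunc_mono (p : ℕ) {a b : Label ℓ h} (hab : a ≤ b) : trunc p a ≤ trunc p b := by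
  induction b using WithTop.recTopCoe with
  | top => simp [trunc]
  | coe y =>
    induction a using WithTop.recTopCoe with
    | top => simp at hab
    | coe x =>
      simp only [trunc, WithTop.map_coe, WithTop.coe_le_coe]
      have hxy : x ≤ y := WithTop.coe_le_coe.mp hab
      exact take_le_take _ hxy (x.2.trans y.2.symm)

theorem Respects.anti {p : ℕ} {a b b' : Label ℓ h} (ha : Respects p a b') (hb : b ≤ b') :
    Respects p a b := by
  have key := trunc_mono p hb
  by_cases hat : a = ⊤
  · subst hat; exact respects_top p b
  · refine ⟨fun hp => key.trans (ha.1 hp), fun hp => ?_⟩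
    rcases ha.2 hp with h1 | h1
    · exact Or.inl (key.trans_lt h1)
    · exact absurd h1.1 hat

theorem tighten_le_iff {p : ℕ} {a b : Label ℓ h} : tighten p b ≤ a ↔ Respects p a b :=
  ⟨fun hab => (isLeast_tighten p b).1.mono hab, fun hr => (isLeast_tighten p b).2 hr⟩

theorem respects_tighten (p : ℕ) (b : Label ℓ h) : Respects p (tighten p b) b :=
  (isLeast_tighten p b).1

theorem tighten_mono (p : ℕ) {b b' : Label ℓ h} (hb : b ≤ b') : tighten p b ≤ tighten p b' :=
  tighten_le_iff.mpr ((respects_tighten p b').anti hb)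

theorem tighten_top (p : ℕ) : tighten p (⊤ : Label ℓ h) = ⊤ := by
  have hr := respects_tighten p (⊤ : Label ℓ h)
  by_contra hne
  obtain ⟨x, hx⟩ := WithTop.ne_top_iff_exists.mp hne
  rw [← hx] at hr
  by_cases hp : Even p
  · simpa [trunc] using hr.1 hp
  · simpa [trunc] using hr.2 hp

/-- Lifting takes the maximum with the tight label. -/
theorem lift_eq_max (π : V → ℕ) (μ : V → Label ℓ h) (v w : V) :
    TreeGame.lift π μ v w = max (μ v) (tighten (π v) (μ w)) := by
  refine (isLeast_lift π μ v w).unique ⟨⟨le_max_left _ _, ?_⟩, fun ξ hξ => ?_⟩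
  · exact tighten_le_iff.mp (le_max_right _ _)
  · exact max_le hξ.1 (tighten_le_iff.mpr hξ.2)

/-- Dropping takes the minimum with the tight label. -/
theorem drop_eq_min (π : V → ℕ) (μ : V → Label ℓ h) (v w : V) :
    TreeGame.drop π μ v w = min (μ v) (tighten (π v) (μ w)) := by
  unfold TreeGame.drop
  split_ifs with hl
  · exact (min_eq_right (tighten_le_iff.mpr (not_not.mp hl.1))).symm
  · rw [eq_comm, min_eq_left_iff]
    by_contra hlt
    exact hl ⟨not_not.mpr (tighten_le_iff.mp (not_le.mp hlt).le), (not_le.mp hlt).ne'⟩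

theorem le_tighten_of_not_loose {π : V → ℕ} {μ : V → Label ℓ h} {v w : V}
    (hl : ¬ Loose π μ v w) : μ v ≤ tighten (π v) (μ w) := by
  by_contra hlt
  exact hl ⟨not_not.mpr (tighten_le_iff.mp (not_le.mp hlt).le), (not_le.mp hlt).ne'⟩

/-- The label that node `v` needs if it may choose the best of its outgoing arcs. -/
noncomputable def bestTighten [Fintype V] (A : V → V → Prop) (π : V → ℕ) (ν : V → Label ℓ h)
    (v : V) : Label ℓ h :=
  by classical exact (Finset.univ.filter fun w => A v w).inf fun w => tighten (π v) (ν w)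

section Best

variable [Fintype V] {A : V → V → Prop} {π : V → ℕ} {ν κ : V → Label ℓ h} {v w : V}

theorem bestTighten_le (hvw : A v w) : bestTighten A π ν v ≤ tighten (π v) (ν w) := by
  classical
  unfold bestTighten
  exact Finset.inf_le (f := fun w => tighten (π v) (ν w)) (by simpa using hvw)

theorem le_bestTighten {a : Label ℓ h} (ha : ∀ w, A v w → a ≤ tighten (π v) (ν w)) :
    a ≤ bestTighten A π ν v := by
  classical
  unfold bestTighten
  exact Finset.le_inf fun w hw => ha w (by simpa using hw)

theorem exists_bestTighten (hA : ∃ w, A v w) :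
    ∃ w, A v w ∧ bestTighten A π ν v = tighten (π v) (ν w) := by
  classical
  obtain ⟨w, hw⟩ := hA
  obtain ⟨u, hu, he⟩ := Finset.exists_mem_eq_inf (Finset.univ.filter fun w => A v w)
    ⟨w, by simpa using hw⟩ (fun w => tighten (π v) (ν w))
  exact ⟨u, by simpa using hu, by unfold bestTighten; convert he⟩

theorem bestTighten_mono (h : ν ≤ κ) : bestTighten A π ν ≤ bestTighten A π κ :=
  fun _ => le_bestTighten fun w hw => (bestTighten_le hw).trans (tighten_mono _ (h w))

theorem liftNode_apply_self (hA : ∃ w, A v w) :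
    liftNode A π ν v v = max (ν v) (bestTighten A π ν v) := by
  classical
  unfold liftNode
  rw [Function.update_self]
  apply le_antisymm
  · obtain ⟨w, hw, he⟩ := exists_bestTighten (A := A) (π := π) (ν := ν) hA
    rw [he, ← lift_eq_max]
    exact Finset.inf_le (f := fun w => TreeGame.lift π ν v w) (by simpa using hw)
  · refine Finset.le_inf fun w hw => ?_
    rw [lift_eq_max]
    exact max_le_max le_rfl (bestTighten_le (by simpa using hw))

theorem liftNode_apply_of_ne {u : V} (hu : u ≠ v) : liftNode A π ν v u = ν u := by
  classical
  unfold liftNode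
  rw [Function.update_of_ne hu]

/-- The common fixed points of all lift operators are the prefixed points of `bestTighten`: a node
of `O` has a single outgoing arc, which is the best one. -/
theorem forall_liftOps_iff {O : Set V} (hA : ∀ v, ∃ w, A v w)
    (hO : ∀ v ∈ O, ∀ w w', A v w → A v w' → w = w') :
    (∀ φ ∈ liftOps A O π, φ ν = ν) ↔ bestTighten A π ν ≤ ν := by
  classical
  constructor
  · intro hφ v
    by_cases hv : v ∈ O
    · obtain ⟨w, hw⟩ := hA v
      have := congrFun (hφ _ (Or.inr ⟨v, w, hv, hw, rfl⟩)) v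
      simp only [liftArc, Function.update_self, lift_eq_max] at this
      exact (bestTighten_le hw).trans (max_eq_left_iff.mp this)
    · have := congrFun (hφ _ (Or.inl ⟨v, hv, rfl⟩)) v
      simp only [liftNode_apply_self (hA v)] at this
      exact max_eq_left_iff.mp this
  · rintro hν φ (⟨v, hv, rfl⟩ | ⟨v, w, hv, hvw, rfl⟩)
    · funext u
      by_cases hu : u = v
      · subst hu
        simpa [liftNode_apply_self (hA u)] using hν u
      · exact liftNode_apply_of_ne hu
    · simp only [liftArc, lift_eq_max]
      have h1 : tighten (π v) (ν w) ≤ ν v := by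
        obtain ⟨w', hw', he⟩ := exists_bestTighten (A := A) (π := π) (ν := ν) (hA v)
        rw [hO v hv w w' hvw hw', ← he]
        exact hν v
      rw [max_eq_left h1, Function.update_eq_self]

end Best

end Tighten

/-! ### The least fixed point -/

section FixedPoint

variable {V : Type} [Fintype V] {ℓ h : ℕ} {A : V → V → Prop} {O : Set V} {π : V → ℕ}
  {μ μs : V → Label ℓ h}

/-- There are finitely many labelings, so the infimum of all prefixed points is a finite one; by
monotonicity it is a prefixed point. -/
theorem exists_isLeast_prefixed (A : V → V → Prop) (π : V → ℕ) (μ : V → Label ℓ h) :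
    ∃ μs, IsLeast {ν | μ ≤ ν ∧ bestTighten A π ν ≤ ν} μs := by
  classical
  set s : Finset (V → Label ℓ h) :=
    Finset.univ.filter fun ν => μ ≤ ν ∧ bestTighten A π ν ≤ ν with hs
  refine ⟨s.inf id, ⟨?_, ?_⟩, fun ν hν => Finset.inf_le (f := id) (by simpa [hs] using hν)⟩
  · exact Finset.le_inf fun ν hν => by simp [hs] at hν; exact hν.1
  · refine Finset.le_inf fun ν hν => ?_
    have h1 : s.inf id ≤ ν := Finset.inf_le (f := id) hν
    simp only [hs, Finset.mem_filter, Finset.mem_univ, true_and] at hν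
    exact (bestTighten_mono h1).trans hν.2

/-- Without loose arcs, the least prefixed point is a fixed point. -/
theorem bestTighten_eq_of_isLeast (hμ : μ ≤ bestTighten A π μ)
    (hs : IsLeast {ν | μ ≤ ν ∧ bestTighten A π ν ≤ ν} μs) : bestTighten A π μs = μs := by
  refine le_antisymm hs.1.2 (hs.2 ⟨?_, bestTighten_mono hs.1.2⟩)
  exact hμ.trans (bestTighten_mono hs.1.1)

end FixedPoint

end TreeGame

/-! ### Base nodes -/

namespace TreeGame

section Cycles

variable {V : Type}

/-- A path without repeated nodes. -/
theorem exists_nodup_isChain {R : V → V → Prop} {v w : V} (hw : Relation.ReflTransGen R w v) :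
    ∃ r : List V, (r ++ [v]).Nodup ∧ (r ++ [v]).head? = some w ∧ (r ++ [v]).IsChain R := by
  induction hw using Relation.ReflTransGen.head_induction_on with
  | refl => exact ⟨[], by simp, by simp, by simp⟩
  | head hxy _ ih =>
    rename_i x y _
    obtain ⟨r, hr, hhd, hc⟩ := ih
    by_cases hx : x ∈ r ++ [v]
    · obtain ⟨s, t, hst⟩ := List.append_of_mem hx
      rw [hst] at hr hc
      have hsuf : (x :: t) <:+ s ++ x :: t := List.suffix_append _ _
      have hlast : (x :: t).getLast? = some v := by
        have : (r ++ [v]).getLast? = some v := by simp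
        rw [hst] at this
        simpa [List.getLast?_append] using this
      obtain ⟨r', hr'⟩ := List.getLast?_eq_some_iff.mp hlast
      refine ⟨r', ?_, ?_, ?_⟩
      · rw [← hr']; exact hr.sublist hsuf.sublist
      · rw [← hr']; rfl
      · rw [← hr']; exact hc.suffix hsuf
    · refine ⟨x :: r, ?_, by simp, ?_⟩
      · simpa using List.nodup_cons.mpr ⟨hx, hr⟩
      · rw [List.cons_append]
        exact List.IsChain.cons hc (by intro z hz; rw [hhd] at hz; simp at hz; exact hz ▸ hxy)

/-- An arc from `v` whose head reaches `v` without nodes of greater priority closes a cycle. -/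
theorem isBase_of_reach {A : V → V → Prop} {π : V → ℕ} {v w : V} (hv : Even (π v))
    (hvw : A v w) (hw : π w ≤ π v)
    (hr : Relation.ReflTransGen (fun x y => A x y ∧ π x ≤ π v ∧ π y ≤ π v) w v) :
    IsBase A π v := by
  obtain ⟨r, hnd, hhd, hc⟩ := exists_nodup_isChain hr
  have hc' : (v :: (r ++ [v])).IsChain (fun x y => A x y ∧ π x ≤ π v ∧ π y ≤ π v) :=
    List.IsChain.cons hc (by
      intro z hz; rw [hhd] at hz; simp at hz; subst hz; exact ⟨hvw, le_rfl, hw⟩)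
  refine ⟨hv, ((v :: r : List V) : Cycle V), ?_, ?_, ?_, ?_⟩
  · rw [Cycle.nodup_coe_iff]
    have := List.nodup_append.mp hnd
    refine List.nodup_cons.mpr ⟨fun hmem => ?_, this.1⟩
    exact this.2.2 v hmem v (by simp) rfl
  · rw [Cycle.chain_coe_cons]
    exact hc'.imp fun _ _ hab => hab.1
  · simp
  · intro u hu
    rw [Cycle.mem_coe_iff] at hu
    rcases List.mem_cons.mp hu with rfl | hu
    · exact le_rfl
    · have key : ∀ (l : List V) (x : V),
          (x :: l).IsChain (fun x y => A x y ∧ π x ≤ π v ∧ π y ≤ π v) → ∀ z ∈ l, π z ≤ π v := by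
        intro l
        induction l with
        | nil => intro x _ z hz; simp at hz
        | cons y l ih =>
          intro x hx z hz
          rw [List.isChain_cons_cons] at hx
          rcases List.mem_cons.mp hz with rfl | hz
          · exact hx.1.2.2
          · exact ih y hx.2 z hz
      exact key _ _ hc' u (by simp [hu])

/-- `w` reaches `b` by a walk with exactly `i` steps of `R`. -/
def ReachIn (R : V → V → Prop) (b : V) : ℕ → V → Prop
  | 0, u => u = b
  | i + 1, u => ∃ w, R u w ∧ ReachIn R b i w

theorem exists_reachIn {R : V → V → Prop} {b : V} (r : List V) :
    ∀ x, (x :: (r ++ [b])).IsChain R → ∃ w, R x w ∧ ReachIn R b r.length w := by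
  induction r with
  | nil => intro x hx; exact ⟨b, by simpa using hx, rfl⟩
  | cons y r ih =>
    intro x hx
    rw [List.cons_append, List.isChain_cons_cons] at hx
    obtain ⟨w, hw⟩ := ih y hx.2
    exact ⟨y, hx.1, w, hw⟩

/-- Conversely, from some head of an arc that leaves a base node, the node is reached in fewer steps
than there are nodes. -/
theorem IsBase.exists_reachIn [Fintype V] {A : V → V → Prop} {π : V → ℕ} {b : V}
    (hb : IsBase A π b) :
    ∃ i < Fintype.card V, ∃ w, A b w ∧
      ReachIn (fun x y => A x y ∧ π x ≤ π b ∧ π y ≤ π b) b i w := by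
  obtain ⟨_, c, hnd, hch, hbc, hle⟩ := hb
  induction c using Quotient.inductionOn with
  | h L =>
    have hbL : b ∈ L := hbc
    obtain ⟨s, t, rfl⟩ := List.append_of_mem hbL
    have heq : ((s ++ b :: t : List V) : Cycle V) = ((b :: (t ++ s) : List V) : Cycle V) := by
      rw [Cycle.coe_eq_coe]
      exact ⟨s.length, by simp⟩
    have hnd' : (b :: (t ++ s)).Nodup := by
      rw [← Cycle.nodup_coe_iff, ← heq]; exact hnd
    have hch' : Cycle.Chain A ((b :: (t ++ s) : List V) : Cycle V) := by
      rw [← heq]; exact hch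
    rw [Cycle.chain_coe_cons] at hch'
    have hle' : ∀ u ∈ b :: (t ++ s ++ [b]), π u ≤ π b := by
      intro u hu
      apply hle
      change u ∈ s ++ b :: t
      simp only [List.mem_cons, List.mem_append, List.not_mem_nil] at hu ⊢
      tauto
    have hch2 : (b :: (t ++ s ++ [b])).IsChain (fun x y => A x y ∧ π x ≤ π b ∧ π y ≤ π b) := by
      rw [List.isChain_iff_getElem] at hch' ⊢
      intro i hi
      exact ⟨hch' i hi, hle' _ (List.getElem_mem _), hle' _ (List.getElem_mem _)⟩
    obtain ⟨w, hw, hri⟩ := TreeGame.exists_reachIn _ _ hch2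
    refine ⟨_, ?_, w, hw.1, hri⟩
    have := hnd'.length_le_card
    simpa using this

theorem ReachIn.reflTransGen {R : V → V → Prop} {b : V} {i : ℕ} {u : V} (hu : ReachIn R b i u) :
    Relation.ReflTransGen R u b := by
  induction i generalizing u with
  | zero => rw [show u = b from hu]
  | succ i ih =>
    obtain ⟨w, hw, hr⟩ := hu
    exact Relation.ReflTransGen.head hw (ih hr)

end Cycles

section BaseLabel

variable {ℓ h : ℕ}

/-- The label that agrees with `ξ` on the components of index at least `p`, and whose other
components are all equal to `i`. -/
def padLabel (ξ : Leaf ℓ h) (p : ℕ) (hp : p / 2 ≤ h) (i : Fin ℓ) : Label ℓ h :=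
  ((⟨ξ.1.take (h - p / 2) ++ List.replicate (p / 2) i, by
    have := ξ.2; simp; omega⟩ : Leaf ℓ h) : Label ℓ h)

theorem trunc_padLabel (ξ : Leaf ℓ h) {p q : ℕ} (hp : p / 2 ≤ h) (hq : q ≤ p) (i : Fin ℓ) :
    trunc q (padLabel ξ p hp i) =
      ((ξ.1.take (h - p / 2) ++ List.replicate (p / 2 - q / 2) i : List (Fin ℓ)) :
        WithTop (List (Fin ℓ))) := by
  have hq2 : q / 2 ≤ p / 2 := Nat.div_le_div_right hq
  have hl := ξ.2
  simp only [trunc, padLabel, WithTop.map_coe, WithTop.coe_inj]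
  rw [List.take_append, List.take_take, List.take_replicate]
  congr 2
  · omega
  · simp; omega

theorem append_replicate_lt {α : Type} [LinearOrder α] (l : List α) {k : ℕ} {i j : α}
    (hk : 0 < k) (hij : i < j) : l ++ List.replicate k i < l ++ List.replicate k j := by
  induction l with
  | nil =>
    obtain ⟨k, rfl⟩ := Nat.exists_eq_succ_of_ne_zero hk.ne'
    simp [List.replicate_succ, List.cons_lt_cons_iff, hij]
  | cons a l ih => simp [ih]

theorem append_replicate_le {α : Type} [LinearOrder α] (l : List α) (k : ℕ) {i j : α}
    (hij : i ≤ j) : l ++ List.replicate k i ≤ l ++ List.replicate k j := by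
  rcases Nat.eq_zero_or_pos k with rfl | hk
  · simp
  rcases hij.eq_or_lt with rfl | hlt
  · exact le_rfl
  · exact (append_replicate_lt l hk hlt).le

theorem respects_padLabel (ξ : Leaf ℓ h) {p q : ℕ} (hp : p / 2 ≤ h) (hpe : Even p) (hq : q ≤ p)
    {i j : Fin ℓ} (hij : i < j) : Respects q (padLabel ξ p hp j) (padLabel ξ p hp i) := by
  unfold Respects
  rw [trunc_padLabel ξ hp hq, trunc_padLabel ξ hp hq]
  refine ⟨fun _ => ?_, fun hqo => Or.inl ?_⟩
  · exact WithTop.coe_le_coe.mpr (append_replicate_le _ _ hij.le)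
  · refine WithTop.coe_lt_coe.mpr (append_replicate_lt _ ?_ hij)
    rw [Nat.not_even_iff_odd] at hqo
    obtain ⟨a, rfl⟩ := hqo
    obtain ⟨b, rfl⟩ := hpe
    omega

theorem respects_padLabel_self (ξ : Leaf ℓ h) {p : ℕ} (hp : p / 2 ≤ h) (hpe : Even p)
    (i j : Fin ℓ) : Respects p (padLabel ξ p hp j) (padLabel ξ p hp i) := by
  unfold Respects
  rw [trunc_padLabel ξ hp le_rfl, trunc_padLabel ξ hp le_rfl]
  exact ⟨fun _ => by simp, fun hqo => absurd hpe hqo⟩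

theorem padLabel_mono (ξ : Leaf ℓ h) {p : ℕ} (hp : p / 2 ≤ h)
    {i j : Fin ℓ} (hij : i ≤ j) : padLabel ξ p hp i ≤ padLabel ξ p hp j :=
  WithTop.coe_le_coe.mpr (append_replicate_le _ _ hij)

/-- Going once around a cycle with highest priority `p = π b` even, the components of index below
`p` are increased fewer than `ℓ` times, so no carry reaches the components that `b` sees: the best
label for `b` with respect to `μ` is already final. -/
theorem IsBase.apply_eq_bestTighten {V : Type} [Fintype V] {A : V → V → Prop} {π : V → ℕ}
    {μ μs : V → Label ℓ h} {b : V} (hb : IsBase A π b) (hcard : Fintype.card V ≤ ℓ)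
    (hπ : π b / 2 ≤ h) (hμ : μ ≤ bestTighten A π μ)
    (hs : IsLeast {ν | μ ≤ ν ∧ bestTighten A π ν ≤ ν} μs) :
    μs b = bestTighten A π μ b := by
  classical
  apply le_antisymm
  swap
  · rw [← bestTighten_eq_of_isLeast hμ hs]
    exact bestTighten_mono hs.1.1 b
  obtain ⟨k, hk, c, hbc, hkc⟩ := hb.exists_reachIn
  rcases eq_or_ne (bestTighten A π μ b) ⊤ with htop | htop
  · rw [htop]; exact le_top
  obtain ⟨ξ, hξ⟩ := WithTop.ne_top_iff_exists.mp htop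
  set R : V → V → Prop := fun x y => A x y ∧ π x ≤ π b ∧ π y ≤ π b with hR
  have hl0 : 0 < ℓ := lt_of_lt_of_le (by omega) hcard
  have hpe := hb.1
  -- the labels on the cycle, depending on the distance to `b`
  let Y : V → Label ℓ h := fun u =>
    if hu : ∃ i, i < ℓ ∧ ReachIn R b i u then
      padLabel ξ (π b) hπ ⟨Nat.find hu, (Nat.find_spec hu).1⟩ else ⊤
  have hYb : Y b = padLabel ξ (π b) hπ ⟨0, hl0⟩ := by
    have hu : ∃ i, i < ℓ ∧ ReachIn R b i b := ⟨0, hl0, rfl⟩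
    have h0 : Nat.find hu = 0 := (Nat.find_eq_zero hu).mpr ⟨hl0, rfl⟩
    simp only [Y, dif_pos hu, h0]
  have hY : ∀ u, (∃ i, i < ℓ ∧ ReachIn R b i u) → u ≠ b →
      ∃ w, A u w ∧ tighten (π u) (Y w) ≤ Y u := by
    intro u hu hub
    obtain ⟨hi1, hi2⟩ := Nat.find_spec hu
    obtain ⟨i, hi⟩ : ∃ i, Nat.find hu = i + 1 := by
      apply Nat.exists_eq_succ_of_ne_zero
      intro h0; rw [h0] at hi2; exact hub hi2
    have hi2' : ReachIn R b (i + 1) u := by rw [← hi]; exact hi2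
    obtain ⟨w, hRw, hw⟩ := hi2'
    have hwe : ∃ i, i < ℓ ∧ ReachIn R b i w := ⟨i, by omega, hw⟩
    refine ⟨w, hRw.1, tighten_le_iff.mpr ?_⟩
    have hfind : Nat.find hwe ≤ i := Nat.find_min' hwe ⟨by omega, hw⟩
    simp only [Y, dif_pos hu, dif_pos hwe]
    exact respects_padLabel ξ hπ hpe hRw.2.1 (Fin.mk_lt_mk.mpr (by omega))
  have hYc : tighten (π b) (Y c) ≤ Y b := by
    have hwe : ∃ i, i < ℓ ∧ ReachIn R b i c := ⟨k, by omega, hkc⟩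
    refine tighten_le_iff.mpr ?_
    rw [hYb]
    simp only [Y, dif_pos hwe]
    exact respects_padLabel_self ξ hπ hpe _ _
  have hYbest : Y b ≤ bestTighten A π μ b := by
    rw [← hξ, hYb]
    -- padding with zeros gives the least label with a given truncation
    refine WithTop.coe_le_coe.mpr ?_
    change ξ.1.take _ ++ _ ≤ ξ.1
    conv_rhs => rw [← List.take_append_drop (h - π b / 2) ξ.1]
    have hz : ∀ (s t : List (Fin ℓ)) (k : ℕ), k = t.length →
        s ++ List.replicate k (⟨0, hl0⟩ : Fin ℓ) ≤ s ++ t := by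
      intro s t k hk
      subst hk
      induction s with
      | nil =>
        induction t with
        | nil => simp
        | cons a t ih =>
          simp only [List.nil_append, List.length_cons, List.replicate_succ] at ih ⊢
          refine not_lt.mp fun hlt => ?_
          rcases List.cons_lt_cons_iff.mp hlt with h | h
          · exact absurd h (not_lt.mpr (Fin.mk_le_of_le_val (Nat.zero_le a.val)))
          · exact absurd h.2 (not_lt.mpr ih)
      | cons a s ih =>
        refine not_lt.mp fun hlt => ?_
        rcases List.cons_lt_cons_iff.mp hlt with h | h
        · exact absurd h (lt_irrefl _)
        · exact absurd h.2 (not_lt.mpr ih)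
    apply hz
    have := ξ.2
    simp; omega
  have hbestY : bestTighten A π μ b ≤ Y b := by
    obtain ⟨w, hw, he⟩ := exists_bestTighten (A := A) (π := π) (ν := μ) ⟨c, hbc⟩
    have hr := respects_tighten (π b) (μ w)
    rw [← he, ← hξ] at hr
    rw [he]
    refine tighten_le_iff.mpr ⟨fun hp => (hr.1 hp).trans ?_, fun hp => absurd hpe hp⟩
    rw [hYb, trunc_padLabel ξ hπ le_rfl]
    simp [trunc]
  have hμY : ∀ i, i < ℓ → ∀ u, ReachIn R b i u → μ u ≤ Y u := by
    intro i
    induction i using Nat.strong_induction_on with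
    | _ i ih =>
      intro hi u hu
      by_cases hub : u = b
      · subst hub; exact (hμ u).trans hbestY
      · have hue : ∃ i, i < ℓ ∧ ReachIn R b i u := ⟨i, hi, hu⟩
        obtain ⟨hi1, hi2⟩ := Nat.find_spec hue
        have hfi : Nat.find hue ≤ i := Nat.find_min' hue ⟨hi, hu⟩
        obtain ⟨j, hj⟩ : ∃ j, Nat.find hue = j + 1 := by
          apply Nat.exists_eq_succ_of_ne_zero
          intro h0; rw [h0] at hi2; exact hub hi2
        rw [hj] at hi2
        obtain ⟨w, hRw, hw⟩ := hi2
        have hμw := ih j (by omega) (by omega) w hw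
        have hwe : ∃ i, i < ℓ ∧ ReachIn R b i w := ⟨j, by omega, hw⟩
        have hfind : Nat.find hwe ≤ j := Nat.find_min' hwe ⟨by omega, hw⟩
        refine (hμ u).trans ((bestTighten_le hRw.1).trans ((tighten_mono _ hμw).trans ?_))
        refine tighten_le_iff.mpr ?_
        simp only [Y, dif_pos hue, dif_pos hwe]
        exact respects_padLabel ξ hπ hpe hRw.2.1 (Fin.mk_lt_mk.mpr (by omega))
  have hmem : μs ⊓ Y ∈ {ν | μ ≤ ν ∧ bestTighten A π ν ≤ ν} := by
    refine ⟨le_inf hs.1.1 fun u => ?_, le_inf ?_ fun u => ?_⟩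
    · by_cases hu : ∃ i, i < ℓ ∧ ReachIn R b i u
      · obtain ⟨i, hi, hr⟩ := hu
        exact hμY i hi u hr
      · simp [Y, dif_neg hu]
    · exact (bestTighten_mono inf_le_left).trans hs.1.2
    · by_cases hu : ∃ i, i < ℓ ∧ ReachIn R b i u
      · by_cases hub : u = b
        · rw [hub]
          exact (bestTighten_mono inf_le_right b).trans ((bestTighten_le hbc).trans hYc)
        · obtain ⟨w, hw, hle⟩ := hY u hu hub
          exact (bestTighten_mono inf_le_right u).trans ((bestTighten_le hw).trans hle)
      · simp [Y, dif_neg hu]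
  exact (hs.2 hmem b).trans (inf_le_right.trans hYbest)

end BaseLabel

end TreeGame

namespace TreeGame

section BaseLift

variable {V : Type} [Fintype V] {ℓ h : ℕ} {A : V → V → Prop} {π : V → ℕ} {μ μs : V → Label ℓ h}

/-- The order of the lifts is irrelevant: every intermediate labeling lies between `μ` and `μs`, and
both bounds give the same label to a base node that is lifted. -/
theorem IsBaseLift.apply_eq {μ' : V → Label ℓ h} (hA : ∀ v, ∃ w, A v w)
    (hcard : Fintype.card V ≤ ℓ) (hπ : ∀ v, π v / 2 ≤ h) (hμ : μ ≤ bestTighten A π μ)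
    (hs : IsLeast {ν | μ ≤ ν ∧ bestTighten A π ν ≤ ν} μs) (hμ' : IsBaseLift A π μ μ')
    {v : V} (hv : IsBase A π v) : μ' v = μs v := by
  obtain ⟨l, hl, rfl⟩ := hμ'
  have hfix := bestTighten_eq_of_isLeast hμ hs
  have key : ∀ (l : List V) (κ : V → Label ℓ h), (∀ u ∈ l, IsBase A π u) → μ ≤ κ → κ ≤ μs →
      (κ ≤ l.foldl (liftNode A π) κ ∧ l.foldl (liftNode A π) κ ≤ μs) ∧
        ∀ u ∈ l, l.foldl (liftNode A π) κ u = μs u := by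
    intro l
    induction l with
    | nil => intro κ _ _ h2; exact ⟨⟨le_rfl, h2⟩, by simp⟩
    | cons x l ih =>
      intro κ hb h1 h2
      have hx : liftNode A π κ x x = μs x := by
        rw [liftNode_apply_self (hA x)]
        apply le_antisymm
        · refine max_le (h2 x) ?_
          exact (bestTighten_mono h2 x).trans (congrFun hfix x).le
        · rw [(hb x (by simp)).apply_eq_bestTighten hcard (hπ x) hμ hs]
          exact (bestTighten_mono h1 x).trans (le_max_right _ _)
      have hle : κ ≤ liftNode A π κ x := by
        intro u
        by_cases hu : u = x
        · subst hu; rw [liftNode_apply_self (hA u)]; exact le_max_left _ _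
        · rw [liftNode_apply_of_ne hu]
      have hle2 : liftNode A π κ x ≤ μs := by
        intro u
        by_cases hu : u = x
        · subst hu; exact hx.le
        · rw [liftNode_apply_of_ne hu]; exact h2 u
      obtain ⟨⟨h3, h4⟩, h5⟩ := ih (liftNode A π κ x) (fun u hu => hb u (by simp [hu]))
        (h1.trans hle) hle2
      rw [List.foldl_cons]
      refine ⟨⟨hle.trans h3, h4⟩, fun u hu => ?_⟩
      rcases List.mem_cons.mp hu with rfl | hu
      · exact le_antisymm (h4 _) (hx ▸ h3 _)
      · exact h5 u hu
  obtain ⟨⟨h1, h2⟩, h3⟩ := key l μ (fun u hu => ((hl.2 u).mp hu).1) le_rfl hs.1.1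
  by_cases hvl : v ∈ l
  · exact h3 v hvl
  · have : ¬ ∀ w, A v w → Violated π μ v w := fun hall => hvl ((hl.2 v).mpr ⟨hv, hall⟩)
    push Not at this
    obtain ⟨w, hw, hnv⟩ := this
    refine le_antisymm (h2 v) (le_trans ?_ (h1 v))
    rw [hv.apply_eq_bestTighten hcard (hπ v) hμ hs]
    exact (bestTighten_le hw).trans (tighten_le_iff.mpr (not_not.mp hnv))

end BaseLift

/-! ### Potentials -/

section Potential

variable {V : Type} {ℓ h : ℕ} {A : V → V → Prop} {π : V → ℕ}

/-- The list `f k, l₀, f (k + 1), l₁, …`. -/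
def interlace (f : ℕ → ℕ) (k : ℕ) : List (Fin ℓ) → List ℕ
  | [] => []
  | x :: l => f k :: (x : ℕ) :: interlace f (k + 1) l

theorem interlace_eq_flatMap (f : ℕ → ℕ) (l : List (Fin ℓ)) :
    ∀ k, ((l.zipIdx k).flatMap fun a => [f a.2, (a.1 : ℕ)]) = interlace f k l := by
  induction l with
  | nil => intro k; rfl
  | cons x l ih => intro k; simp [interlace, List.zipIdx_cons, ih]

theorem length_interlace (f : ℕ → ℕ) (l : List (Fin ℓ)) :
    ∀ k, (interlace f k l).length = 2 * l.length := by
  induction l with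
  | nil => intro k; rfl
  | cons x l ih => intro k; simp [interlace, ih]; omega

theorem potential_coe (Φ : ℕ → V → ℕ) (ν : V → Label ℓ h) (v : V) :
    potential Φ ν v =
      (ν v).map fun ξ : Leaf ℓ h => interlace (fun j => Φ (2 * (h - j)) v) 0 ξ.1 := by
  unfold potential
  congr 1
  funext ξ
  exact interlace_eq_flatMap (fun j => Φ (2 * (h - j)) v) ξ.1 0

theorem interlace_lt_of_take_lt {f g : ℕ → ℕ} : ∀ (m : ℕ) (l l' : List (Fin ℓ)) (k : ℕ),
    (∀ j, k ≤ j → j < k + m → f j ≤ g j) → l.take m < l'.take m →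
      interlace f k l < interlace g k l' := by
  intro m
  induction m with
  | zero => intro l l' k _ hlt; simp at hlt
  | succ m ih =>
    intro l l' k hfg hlt
    cases l' with
    | nil => simp at hlt
    | cons y l' =>
      cases l with
      | nil => simp [interlace]
      | cons x l =>
        simp only [List.take_succ_cons, List.cons_lt_cons_iff] at hlt
        simp only [interlace, List.cons_lt_cons_iff]
        rcases (hfg k le_rfl (by omega)).lt_or_eq with h1 | h1
        · exact Or.inl h1
        · refine Or.inr ⟨h1, ?_⟩
          rcases hlt with h2 | ⟨rfl, h2⟩
          · exact Or.inl h2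
          · exact Or.inr ⟨rfl, ih l l' (k + 1) (fun j h3 h4 => hfg j (by omega) (by omega)) h2⟩

theorem interlace_lt_of_lt {f g : ℕ → ℕ} : ∀ (m : ℕ) (l l' : List (Fin ℓ)) (k : ℕ),
    (∀ j, k ≤ j → j < k + m → f j ≤ g j) → f (k + m) < g (k + m) → m < l'.length →
      l.take m ≤ l'.take m → interlace f k l < interlace g k l' := by
  intro m
  induction m with
  | zero =>
    intro l l' k _ hlt hl _
    cases l' with
    | nil => simp at hl
    | cons y l' =>
      cases l with
      | nil => simp [interlace]
      | cons x l =>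
        simp only [interlace, List.cons_lt_cons_iff]
        exact Or.inl hlt
  | succ m ih =>
    intro l l' k hfg hlt hl hle
    rcases hle.lt_or_eq with h0 | h0
    · exact interlace_lt_of_take_lt (m + 1) l l' k hfg h0
    cases l' with
    | nil => simp at hl
    | cons y l' =>
      cases l with
      | nil => simp [interlace]
      | cons x l =>
        simp only [List.take_succ_cons, List.cons.injEq] at h0
        simp only [interlace, List.cons_lt_cons_iff]
        rcases (hfg k le_rfl (by omega)).lt_or_eq with h1 | h1
        · exact Or.inl h1
        · refine Or.inr ⟨h1, Or.inr ⟨by rw [h0.1], ?_⟩⟩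
          exact ih l l' (k + 1) (fun j h3 h4 => hfg j (by omega) (by omega))
            (by rw [show k + 1 + m = k + (m + 1) by ring]; exact hlt) (by simpa using hl) h0.2.le

theorem interlace_lt_iff {f : ℕ → ℕ} {l l' : List (Fin ℓ)} (hl : l.length = l'.length) {k : ℕ} :
    interlace f k l < interlace f k l' ↔ l < l' := by
  have key : ∀ l l' : List (Fin ℓ), l.length = l'.length → l < l' →
      interlace f k l < interlace f k l' := by
    intro l l' hl hlt
    refine interlace_lt_of_take_lt l.length l l' k (fun _ _ _ => le_rfl) ?_
    rw [List.take_length, hl, List.take_length]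
    exact hlt
  refine ⟨fun hlt => ?_, key l l' hl⟩
  rcases lt_trichotomy l l' with h1 | h1 | h1
  · exact h1
  · subst h1; exact absurd hlt (lt_irrefl _)
  · exact absurd hlt (not_lt.mpr (key l' l hl.symm h1).le)

/-- The properties of `Φ` that the correctness of Dijkstra's algorithm needs: along an arc that
leaves a node `v` outside `B`, the value `Φ p` does not increase if `p ≥ π v`, and it decreases if
`p = π v`. -/
structure IsWeakTopOrder (A : V → V → Prop) (B : V → Prop) (π : V → ℕ) (d : ℕ)
    (Φ : ℕ → V → ℕ) : Prop where
  mono : ∀ p, p ≤ d → Even p → ∀ v w, A v w → ¬ B v → π v ≤ p → Φ p w ≤ Φ p v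
  strict : ∀ v w, A v w → ¬ B v → Even (π v) → Φ (π v) w < Φ (π v) v

theorem IsTopOrder.isWeakTopOrder {d : ℕ} {Φ : ℕ → V → ℕ} (hΦ : IsTopOrder A π d Φ)
    (h1 : ∀ v, 1 ≤ π v) (hd : ∀ v, π v ≤ d) : IsWeakTopOrder A (IsBase A π) π d Φ := by
  have hreach : ∀ p v w, A v w → ¬ IsBase A π v → π v ≤ p → π w ≤ p → HReach A π p v w :=
    fun p v w hvw hv hvp hwp =>
      ⟨hvp, hwp, Relation.ReflTransGen.single ⟨⟨hvw, hv⟩, hvp, hwp⟩⟩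
  refine ⟨fun p hp he v w hvw hv hvp => ?_, fun v w hvw hv he => ?_⟩
  · rcases le_or_gt (π w) p with hw | hw
    · exact hΦ.mono p ((h1 v).trans hvp) hp he v w (hreach p v w hvw hv hvp hw)
    · rw [(hΦ.eq_zero_iff p ((h1 v).trans hvp) hp he w).mpr hw]
      exact Nat.zero_le _
  · have hpos : Φ (π v) v ≠ 0 := by
      rw [Ne, hΦ.eq_zero_iff (π v) (h1 v) (hd v) he v]
      exact lt_irrefl _
    rcases le_or_gt (π w) (π v) with hw | hw
    · have hr := hreach (π v) v w hvw hv le_rfl hw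
      refine lt_of_le_of_ne (hΦ.mono (π v) (h1 v) (hd v) he v w hr) fun heq => ?_
      have := ((hΦ.eq_iff (π v) (h1 v) (hd v) he v w).mp ⟨heq.symm, by omega⟩).2
      refine hv (isBase_of_reach he hvw hw ?_)
      exact this.2.2.lift id fun x y hxy => ⟨hxy.1.1, hxy.2⟩
    · rw [(hΦ.eq_zero_iff (π v) (h1 v) (hd v) he w).mpr hw]
      omega

/-- If an arc that leaves a node outside of `B` is not violated, then its head has a smaller
potential than its tail. -/
theorem IsWeakTopOrder.interlace_lt {B : V → Prop} {d : ℕ} {Φ : ℕ → V → ℕ}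
    (hΦ : IsWeakTopOrder A B π d Φ) (hdh : d = 2 * h) (h1 : ∀ v, 1 ≤ π v) (hd : ∀ v, π v ≤ d)
    {v w : V} (hvw : A v w) (hv : ¬ B v) {x y : Leaf ℓ h}
    (hr : Respects (π v) (y : Label ℓ h) (x : Label ℓ h)) :
    interlace (fun j => Φ (2 * (h - j)) w) 0 x.1 <
      interlace (fun j => Φ (2 * (h - j)) v) 0 y.1 := by
  have hv1 := h1 v
  have hvd := hd v
  have hmono : ∀ j, 0 ≤ j → j < 0 + (h - π v / 2) →
      Φ (2 * (h - j)) w ≤ Φ (2 * (h - j)) v := by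
    intro j _ hj
    exact hΦ.mono _ (by omega) (even_two_mul _) v w hvw hv (by omega)
  by_cases he : Even (π v)
  · refine interlace_lt_of_lt (h - π v / 2) _ _ 0 hmono ?_ ?_ ?_
    · have : 2 * (h - (0 + (h - π v / 2))) = π v := by
        obtain ⟨a, ha⟩ := he
        omega
      simp only [this]
      exact hΦ.strict v w hvw hv he
    · rw [y.2]
      obtain ⟨a, ha⟩ := he
      omega
    · have := hr.1 he
      simpa [trunc] using this
  · refine interlace_lt_of_take_lt (h - π v / 2) _ _ 0 hmono ?_
    have := hr.2 he
    simpa [trunc] using this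

end Potential

/-! ### Dijkstra's algorithm -/

section Dijkstra

variable {V : Type} {ℓ h : ℕ} {A : V → V → Prop} {π : V → ℕ} {B : V → Prop}
  {μs ν ν' : V → Label ℓ h} {S : Set V} {u : V}

/-- The invariant of Dijkstra's algorithm: the labels are upper bounds for the fixed point `μs`,
exact on `S` and on `B`, and the arcs that enter `S` are not loose. -/
structure DijkstraInv (A : V → V → Prop) (B : V → Prop) (π : V → ℕ) (μs : V → Label ℓ h)
    (S : Set V) (ν : V → Label ℓ h) : Prop where
  le : μs ≤ ν
  eq : ∀ v ∈ S, ν v = μs v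
  eq_base : ∀ v, B v → ν v = μs v
  relaxed : ∀ v w, w ∈ S → A v w → ν v ≤ tighten (π v) (ν w)

theorem DijkstraInv.insert (hI : DijkstraInv A B π μs S ν) (hu : ν u = μs u) (h1 : μs ≤ ν')
    (h2 : ν' ≤ ν) (h3 : ∀ v, A v u → ν' v ≤ tighten (π v) (ν u)) :
    DijkstraInv A B π μs (insert u S) ν' := by
  have heq : ∀ v, ν v = μs v → ν' v = μs v := fun v hv => le_antisymm (hv ▸ h2 v) (h1 v)
  refine ⟨h1, ?_, fun v hv => heq v (hI.eq_base v hv), ?_⟩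
  · rintro v (rfl | hv)
    · exact heq _ hu
    · exact heq v (hI.eq v hv)
  · rintro v w (rfl | hw) hvw
    · rw [heq _ hu, ← hu]; exact h3 v hvw
    · rw [heq w (hI.eq w hw), ← hI.eq w hw]
      exact (h2 v).trans (hI.relaxed v w hw hvw)

variable [Fintype V]

/-- A node of smallest potential outside `S` has its final label. -/
theorem DijkstraInv.eq_of_minimal {ι : Type} [LinearOrder ι] {P : V → Label ℓ h → ι}
    (hP : ∀ v a b, P v a ≤ P v b → a ≤ b)
    (hstrict : ∀ v w a b, A v w → ¬ B v → a ≠ ⊤ → Respects (π v) a b → P w b < P v a)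
    (hA : ∀ v, ∃ w, A v w) (hfix : bestTighten A π μs = μs) (hI : DijkstraInv A B π μs S ν)
    (hu : u ∉ S) (hmin : ∀ v, v ∉ S → P u (ν u) ≤ P v (ν v)) : ν u = μs u := by
  classical
  obtain ⟨y, hy, hymin⟩ := Finset.exists_min_image (Finset.univ.filter fun v => v ∉ S)
    (fun v => P v (μs v)) ⟨u, by simpa using hu⟩
  simp only [Finset.mem_filter, Finset.mem_univ, true_and] at hy hymin
  have hνy : ν y = μs y := by
    by_cases hB : B y
    · exact hI.eq_base y hB
    by_cases htop : μs y = ⊤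
    · exact le_antisymm (htop ▸ le_top) (hI.le y)
    obtain ⟨z, hz, he⟩ := exists_bestTighten (A := A) (π := π) (ν := μs) (hA y)
    rw [hfix] at he
    have hlt := hstrict y z (μs y) (μs z) hz hB htop (he ▸ respects_tighten _ _)
    have hzS : z ∈ S := by
      by_contra hzS
      exact absurd hlt (not_lt.mpr (hymin z hzS))
    refine le_antisymm ?_ (hI.le y)
    rw [he, ← hI.eq z hzS]
    exact hI.relaxed y z hzS hz
  refine le_antisymm (hP u _ _ ?_) (hI.le u)
  calc P u (ν u) ≤ P y (ν y) := hmin y hy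
    _ = P y (μs y) := by rw [hνy]
    _ ≤ P u (μs u) := hymin u hu

/-- Dropping tail labels along arcs that enter `S` keeps the labels above the fixed point, and none
of the arcs is loose afterwards. -/
theorem dropAll_spec {S : Set V} (hfix : bestTighten A π μs = μs) (l : List (V × V)) :
    ∀ ν : V → Label ℓ h, (∀ e ∈ l, A e.1 e.2 ∧ e.1 ∉ S ∧ e.2 ∈ S) → μs ≤ ν →
      μs ≤ dropAll π l ν ∧ dropAll π l ν ≤ ν ∧ (∀ v ∈ S, dropAll π l ν v = ν v) ∧
        ∀ e ∈ l, dropAll π l ν e.1 ≤ tighten (π e.1) (ν e.2) := by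
  classical
  induction l with
  | nil => intro ν _ h; exact ⟨h, le_rfl, fun _ _ => rfl, by simp⟩
  | cons e l ih =>
    intro ν hl hν
    obtain ⟨hA, h1, h2⟩ := hl e (by simp)
    set κ := Function.update ν e.1 (TreeGame.drop π ν e.1 e.2) with hκ
    have hκe : κ e.1 = min (ν e.1) (tighten (π e.1) (ν e.2)) := by
      rw [hκ, Function.update_self, drop_eq_min]
    have hκne : ∀ v, v ≠ e.1 → κ v = ν v := fun v hv => by rw [hκ, Function.update_of_ne hv]
    have hκν : κ ≤ ν := by
      intro v
      by_cases hv : v = e.1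
      · subst hv; rw [hκe]; exact min_le_left _ _
      · exact (hκne v hv).le
    have hμκ : μs ≤ κ := by
      intro v
      by_cases hv : v = e.1
      · subst hv
        rw [hκe]
        refine le_min (hν _) (le_trans ?_ (tighten_mono _ (hν e.2)))
        rw [← congrFun hfix e.1]
        exact bestTighten_le hA
      · rw [hκne v hv]; exact hν v
    have hκS : ∀ v ∈ S, κ v = ν v := fun v hv => hκne v fun h => h1 (h ▸ hv)
    obtain ⟨a1, a2, a3, a4⟩ := ih κ (fun f hf => hl f (by simp [hf])) hμκ
    have hd : dropAll π (e :: l) ν = dropAll π l κ := by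
      unfold dropAll
      rw [List.foldl_cons]
    rw [hd]
    refine ⟨a1, a2.trans hκν, fun v hv => (a3 v hv).trans (hκS v hv), fun f hf => ?_⟩
    rcases List.mem_cons.mp hf with rfl | hf
    · exact (a2 _).trans (hκe.le.trans (min_le_right _ _))
    · rw [← hκS f.2 (hl f (by simp [hf])).2.2]
      exact a4 f hf

theorem DijkstraReaches.inv {ι : Type} [LinearOrder ι] {P : V → Label ℓ h → ι} {Φ : ℕ → V → ℕ}
    {ν₀ : V → Label ℓ h} (hP : ∀ v a b, P v a ≤ P v b → a ≤ b)
    (hstrict : ∀ v w a b, A v w → ¬ IsBase A π v → a ≠ ⊤ → Respects (π v) a b → P w b < P v a)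
    (hpot : ∀ ν v w, potential Φ ν v ≤ potential Φ ν w → P v (ν v) ≤ P w (ν w))
    (hA : ∀ v, ∃ w, A v w) (hfix : bestTighten A π μs = μs)
    (h0 : ∀ v, IsBase A π v → ν₀ v = μs v) (hr : DijkstraReaches A π Φ ν₀ S ν) :
    DijkstraInv A (IsBase A π) π μs S ν ∧ ∀ v, IsBase A π v → v ∈ S := by
  classical
  have hbest : ∀ v w, A v w → μs v ≤ tighten (π v) (μs w) := fun v w hvw =>
    (congrFun hfix v).symm.le.trans (bestTighten_le hvw)
  induction hr with
  | start l hl =>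
    refine ⟨?_, fun v hv => hv⟩
    obtain ⟨a1, a2, a3, a4⟩ := dropAll_spec (S := {v | IsBase A π v}) hfix l
      (fun v => if IsBase A π v then ν₀ v else ⊤)
      (fun e he => (hl.2 e).mp he) (fun v => by
        dsimp only
        split_ifs with hv
        · exact (h0 v hv).ge
        · exact le_top)
    have hB : ∀ v, IsBase A π v →
        dropAll π l (fun v => if IsBase A π v then ν₀ v else ⊤) v = μs v := fun v hv => by
      rw [a3 v hv, if_pos hv, h0 v hv]
    refine ⟨a1, hB, hB, fun v w hw hvw => ?_⟩
    by_cases hv : IsBase A π v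
    · rw [hB v hv, hB w hw]; exact hbest v w hvw
    · rw [hB w hw]
      have := a4 (v, w) ((hl.2 (v, w)).mpr ⟨hvw, hv, hw⟩)
      rwa [if_pos (show IsBase A π (v, w).2 from hw), h0 w hw] at this
  | step hS u hu hmin l hl ih =>
    rename_i S ν
    obtain ⟨hI, hB⟩ := ih
    refine ⟨?_, fun v hv => Set.mem_insert_of_mem _ (hB v hv)⟩
    have hueq := hI.eq_of_minimal hP hstrict hA hfix hu fun v hv => hpot ν u v (hmin v hv)
    obtain ⟨a1, a2, a3, a4⟩ := dropAll_spec (S := insert u S) hfix l ν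
      (fun e he => by
        obtain ⟨b1, b2, b3⟩ := (hl.2 e).mp he
        exact ⟨b1, b2, b3 ▸ Set.mem_insert _ _⟩) hI.le
    refine hI.insert hueq a1 a2 fun v hv => ?_
    by_cases hvS : v ∈ insert u S
    · rw [a3 v hvS, hueq]
      have : ν v = μs v := by
        rcases hvS with rfl | hvS
        · exact hueq
        · exact hI.eq v hvS
      rw [this]; exact hbest v u hv
    · exact a4 (v, u) ((hl.2 (v, u)).mpr ⟨hv, hvS, rfl⟩)

theorem exists_enumerates {α : Type} [Finite α] (s : Set α) : ∃ l, Enumerates l s := by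
  classical
  have := Fintype.ofFinite α
  exact ⟨(Finset.univ.filter (· ∈ s)).toList, Finset.nodup_toList _, fun x => by simp⟩

theorem exists_dijkstraReaches_univ (Φ : ℕ → V → ℕ) (ν₀ : V → Label ℓ h) :
    ∃ ν, DijkstraReaches A π Φ ν₀ Set.univ ν := by
  classical
  have key : ∀ k, ∀ S ν, DijkstraReaches A π Φ ν₀ S ν → (Sᶜ).ncard = k →
      ∃ ν, DijkstraReaches A π Φ ν₀ Set.univ ν := by
    intro k
    induction k with
    | zero =>
      intro S ν hr hk
      rw [Set.ncard_eq_zero, Set.compl_empty_iff] at hk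
      exact ⟨ν, hk ▸ hr⟩
    | succ k ih =>
      intro S ν hr hk
      have hne : (Finset.univ.filter fun v => v ∉ S).Nonempty := by
        obtain ⟨v, hv⟩ := Set.nonempty_of_ncard_ne_zero (s := Sᶜ) (by omega)
        exact ⟨v, by simpa using hv⟩
      obtain ⟨u, hu, hmin⟩ := Finset.exists_min_image _ (potential Φ ν) hne
      simp only [Finset.mem_filter, Finset.mem_univ, true_and] at hu hmin
      obtain ⟨l, hl⟩ := exists_enumerates {e : V × V | A e.1 e.2 ∧ e.1 ∉ insert u S ∧ e.2 = u}
      refine ih _ _ (hr.step u hu hmin l hl) ?_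
      have : (insert u S)ᶜ = Sᶜ \ {u} := by
        ext x; simp [not_or, and_comm]
      rw [this, Set.ncard_sdiff_singleton_of_mem (by simpa using hu), hk]
      rfl
  obtain ⟨l, hl⟩ := exists_enumerates {e : V × V | A e.1 e.2 ∧ ¬ IsBase A π e.1 ∧ IsBase A π e.2}
  exact key _ _ _ (DijkstraReaches.start l hl) rfl

open Classical in
/-- The set of nodes that `v` reaches, as a number in binary, is an admissible choice of `Φ p v`. -/
theorem exists_isTopOrder (A : V → V → Prop) (π : V → ℕ) (d : ℕ) :
    ∃ Φ, IsTopOrder A π d Φ := by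
  -- encode the set of reachable nodes by a natural number
  let e := Fintype.equivFin V
  let R : ℕ → V → Finset ℕ := fun p v =>
    (Finset.univ.filter fun w => HReach A π p v w).image fun w => (e w : ℕ)
  have hR : ∀ p v w, (e w : ℕ) ∈ R p v ↔ HReach A π p v w := by
    intro p v w
    simp only [R, Finset.mem_image, Finset.mem_filter, Finset.mem_univ, true_and]
    constructor
    · rintro ⟨a, ha, hea⟩
      rwa [← e.injective (Fin.ext hea)]
    · intro hw; exact ⟨w, hw, rfl⟩
  have hrefl : ∀ p v, π v ≤ p → HReach A π p v v := fun p v hv => ⟨hv, hv, .refl⟩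
  have htrans : ∀ p a b c, HReach A π p a b → HReach A π p b c → HReach A π p a c :=
    fun p a b c h1 h2 => ⟨h1.1, h2.2.1, h1.2.2.trans h2.2.2⟩
  have hsub : ∀ p v w, HReach A π p v w → R p w ⊆ R p v := by
    intro p v w hvw x hx
    simp only [R, Finset.mem_image, Finset.mem_filter, Finset.mem_univ, true_and] at hx ⊢
    obtain ⟨a, ha, rfl⟩ := hx
    exact ⟨a, htrans p v w a hvw ha, rfl⟩
  refine ⟨fun p v => ∑ i ∈ R p v, 2 ^ i, ?_, ?_, ?_⟩
  · intro p _ _ _ v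
    constructor
    · intro h0
      by_contra hlt
      have := (hR p v v).mpr (hrefl p v (not_lt.mp hlt))
      rw [Finset.sum_eq_zero_iff] at h0
      exact absurd (h0 _ this) (by positivity)
    · intro hlt
      refine Finset.sum_eq_zero fun i hi => ?_
      simp only [R, Finset.mem_image, Finset.mem_filter, Finset.mem_univ, true_and] at hi
      obtain ⟨a, ha, -⟩ := hi
      exact absurd ha.1 (not_le.mpr hlt)
  · intro p _ _ _ v w hvw
    exact Finset.sum_le_sum_of_subset (hsub p v w hvw)
  · intro p _ _ _ v w
    constructor
    · rintro ⟨heq, hpos⟩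
      have hset : R p v = R p w := by
        have := congrArg (fun k => (Nat.bitIndices k).toFinset) heq
        simpa only [Finset.toFinset_bitIndices_sum_two_pow] using this
      obtain ⟨i, hi⟩ : (R p w).Nonempty := by
        by_contra hne
        rw [Finset.not_nonempty_iff_eq_empty] at hne
        simp [hne] at hpos
      simp only [R, Finset.mem_image, Finset.mem_filter, Finset.mem_univ, true_and] at hi
      obtain ⟨a, ha, rfl⟩ := hi
      have hva : HReach A π p v a := (hR p v a).mp (hset ▸ (hR p w a).mpr ha)
      exact ⟨(hR p v w).mp (hset ▸ (hR p w w).mpr (hrefl p w ha.1)),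
        (hR p w v).mp (hset ▸ (hR p v v).mpr (hrefl p v hva.1))⟩
    · rintro ⟨h1, h2⟩
      have : R p v = R p w := (hsub p w v h2).antisymm (hsub p v w h1)
      refine ⟨by simp only [this], ?_⟩
      exact Finset.sum_pos (fun i _ => by positivity) ⟨_, (hR p w w).mpr (hrefl p w h1.2.1)⟩

/-- Every run of the algorithm returns the fixed point `μs`, and there is a run. -/
theorem dijkstraReturns_iff {d : ℕ} {ν₀ : V → Label ℓ h} (hdh : d = 2 * h) (h1 : ∀ v, 1 ≤ π v)
    (hd : ∀ v, π v ≤ d) (hA : ∀ v, ∃ w, A v w) (hfix : bestTighten A π μs = μs)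
    (h0 : ∀ v, IsBase A π v → ν₀ v = μs v) : DijkstraReturns A π d ν₀ ν ↔ ν = μs := by
  have key : ∀ ν, DijkstraReturns A π d ν₀ ν → ν = μs := by
    rintro ν ⟨Φ, hΦ, hr⟩
    let P : V → Label ℓ h → WithTop (List ℕ) := fun v a =>
      a.map fun ξ : Leaf ℓ h => interlace (fun j => Φ (2 * (h - j)) v) 0 ξ.1
    have hinv := hr.inv (P := P) (μs := μs) ?_ ?_ ?_ hA hfix h0
    · exact funext fun v => hinv.1.eq v (Set.mem_univ v)
    · intro v a b hab
      induction b using WithTop.recTopCoe with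
      | top => exact le_top
      | coe b =>
        induction a using WithTop.recTopCoe with
        | top => simp [P] at hab
        | coe a =>
          simp only [P, WithTop.map_coe, WithTop.coe_le_coe] at hab
          refine WithTop.coe_le_coe.mpr (not_lt.mp fun hlt => ?_)
          exact absurd ((interlace_lt_iff (b.2.trans a.2.symm)).mpr hlt) (not_lt.mpr hab)
    · intro v w a b hvw hv ha hr
      obtain ⟨a, rfl⟩ := WithTop.ne_top_iff_exists.mp ha
      induction b using WithTop.recTopCoe with
      | top =>
        have := tighten_le_iff.mpr hr
        rw [tighten_top, top_le_iff] at this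
        exact absurd this (WithTop.coe_ne_top)
      | coe b =>
        simp only [P, WithTop.map_coe, WithTop.coe_lt_coe]
        exact (hΦ.isWeakTopOrder h1 hd).interlace_lt hdh h1 hd hvw hv hr
    · intro ν v w hvw
      simpa only [potential_coe] using hvw
  refine ⟨key ν, ?_⟩
  rintro rfl
  obtain ⟨Φ, hΦ⟩ := exists_isTopOrder A π d
  obtain ⟨κ, hκ⟩ := exists_dijkstraReaches_univ (A := A) (π := π) Φ ν₀
  have := key κ ⟨Φ, hΦ, hκ⟩
  exact ⟨Φ, hΦ, this ▸ hκ⟩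

end Dijkstra

end TreeGame

/-! ### Reasoning about programs -/

namespace WordRAM

infixl:65 " +ₑ " => Exp.plus
infixl:65 " -ₑ " => Exp.minus
infixl:70 " *ₑ " => Exp.times
infixr:50 " ;; " => Prog.seq

@[simp] theorem State.setReg_reg (s : State) (r x r' : ℕ) :
    (s.setReg r x).reg r' = if r' = r then x else s.reg r' := by
  simp [State.setReg, Function.update_apply]

@[simp] theorem State.setReg_arr (s : State) (r x : ℕ) : (s.setReg r x).arr = s.arr := rfl

@[simp] theorem State.setCell_reg (s : State) (a i x : ℕ) : (s.setCell a i x).reg = s.reg := rfl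

@[simp] theorem State.setCell_arr (s : State) (a i x a' : ℕ) :
    (s.setCell a i x).arr a' =
      if a' = a then Function.update (s.arr a) i x else s.arr a' := by
  simp only [State.setCell, Function.update_apply]

attribute [simp] Exp.Fits Exp.cost Exp.val

/-- `s'` agrees with `s` except for the registers in `R` and the arrays in `A`. -/
def Same (R A : List ℕ) (s s' : State) : Prop :=
  (∀ r, r ∉ R → s'.reg r = s.reg r) ∧ ∀ a, a ∉ A → s'.arr a = s.arr a

@[simp] theorem Same.refl (R A : List ℕ) (s : State) : Same R A s s :=
  ⟨fun _ _ => rfl, fun _ _ => rfl⟩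

theorem Same.trans {R A : List ℕ} {s s' s'' : State} (h : Same R A s s') (h' : Same R A s' s'') :
    Same R A s s'' :=
  ⟨fun r hr => (h'.1 r hr).trans (h.1 r hr), fun a ha => (h'.2 a ha).trans (h.2 a ha)⟩

theorem Same.weaken {R A R' A' : List ℕ} {s s' : State} (h : Same R A s s') (hR : R ⊆ R')
    (hA : A ⊆ A') : Same R' A' s s' :=
  ⟨fun r hr => h.1 r fun h => hr (hR h), fun a ha => h.2 a fun h => ha (hA h)⟩

@[simp] theorem same_setReg {R A : List ℕ} {s s' : State} {r x : ℕ} (hr : r ∈ R) :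
    Same R A s (s'.setReg r x) ↔ Same R A s s' := by
  unfold Same
  refine and_congr (forall_congr' fun r' => ?_) Iff.rfl
  refine imp_congr_right fun hr' => ?_
  rw [State.setReg_reg, if_neg (by rintro rfl; exact hr' hr)]

@[simp] theorem same_setCell {R A : List ℕ} {s s' : State} {a i x : ℕ} (ha : a ∈ A) :
    Same R A s (s'.setCell a i x) ↔ Same R A s s' := by
  unfold Same
  refine and_congr Iff.rfl (forall_congr' fun a' => ?_)
  refine imp_congr_right fun ha' => ?_
  rw [State.setCell_arr, if_neg (by rintro rfl; exact ha' ha)]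

/-- `Runs W P Q s T`: with a budget of `T` time units, the program `P` started in `s` terminates,
and `Q` holds for the final state and the budget that is left. -/
def Runs (W : ℕ) (P : Prog) (Q : State → ℕ → Prop) (s : State) (T : ℕ) : Prop :=
  ∃ t s', Exec W P s t s' ∧ t ≤ T ∧ Q s' (T - t)

/-- `Does W P s c Q`: the program `P` started in `s` terminates after at most `c` time units in
a state that satisfies `Q`. -/
def Does (W : ℕ) (P : Prog) (s : State) (c : ℕ) (Q : State → Prop) : Prop :=
  Runs W P (fun s' _ => Q s') s c

variable {W : ℕ} {P P' : Prog} {s : State} {T c : ℕ} {Q Q' : State → ℕ → Prop}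

@[simp] theorem runs_skip : Runs W .skip Q s T ↔ 1 ≤ T ∧ Q s (T - 1) := by
  constructor
  · rintro ⟨t, s', hE, ht, hQ⟩; cases hE; exact ⟨ht, hQ⟩
  · rintro ⟨ht, hQ⟩; exact ⟨_, _, .skip s, ht, hQ⟩

@[simp] theorem runs_assign {r : ℕ} {e : Exp} : Runs W (.assign r e) Q s T ↔
    e.Fits W s ∧ e.cost + 1 ≤ T ∧ Q (s.setReg r (e.val s)) (T - (e.cost + 1)) := by
  constructor
  · rintro ⟨t, s', hE, ht, hQ⟩; cases hE with | assign _ _ _ he => exact ⟨he, ht, hQ⟩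
  · rintro ⟨he, ht, hQ⟩; exact ⟨_, _, .assign s r e he, ht, hQ⟩

@[simp] theorem runs_store {a : ℕ} {i e : Exp} : Runs W (.store a i e) Q s T ↔
    i.Fits W s ∧ e.Fits W s ∧ i.cost + e.cost + 1 ≤ T ∧
      Q (s.setCell a (i.val s) (e.val s)) (T - (i.cost + e.cost + 1)) := by
  constructor
  · rintro ⟨t, s', hE, ht, hQ⟩; cases hE with | store _ _ _ _ hi he => exact ⟨hi, he, ht, hQ⟩
  · rintro ⟨hi, he, ht, hQ⟩; exact ⟨_, _, .store s a i e hi he, ht, hQ⟩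

@[simp] theorem runs_seq : Runs W (P ;; P') Q s T ↔ Runs W P (Runs W P' Q) s T := by
  constructor
  · rintro ⟨t, s', hE, ht, hQ⟩
    cases hE with
    | seq h1 h2 =>
      rename_i s₁ t₁ t₂
      exact ⟨t₁, s₁, h1, by omega, t₂, s', h2, by omega, by
        rwa [show T - t₁ - t₂ = T - (t₁ + t₂) by omega]⟩
  · rintro ⟨t₁, s₁, h1, ht1, t₂, s', h2, ht2, hQ⟩
    exact ⟨t₁ + t₂, s', .seq h1 h2, by omega, by
      rwa [show T - t₁ - t₂ = T - (t₁ + t₂) by omega] at hQ⟩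

@[simp] theorem runs_ite {b : Exp} : Runs W (.ite b P P') Q s T ↔
    b.Fits W s ∧ b.cost + 1 ≤ T ∧ (b.val s ≠ 0 → Runs W P Q s (T - (b.cost + 1))) ∧
      (b.val s = 0 → Runs W P' Q s (T - (b.cost + 1))) := by
  constructor
  · rintro ⟨t, s', hE, ht, hQ⟩
    cases hE with
    | ite_true hb h hP =>
      rename_i t
      refine ⟨hb, by omega, fun _ => ⟨t, s', hP, by omega, ?_⟩, fun h' => absurd h' h⟩
      rwa [show T - (b.cost + 1) - t = T - (b.cost + 1 + t) by omega]
    | ite_false hb h hP =>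
      rename_i t
      refine ⟨hb, by omega, fun h' => absurd h h', fun _ => ⟨t, s', hP, by omega, ?_⟩⟩
      rwa [show T - (b.cost + 1) - t = T - (b.cost + 1 + t) by omega]
  · rintro ⟨hb, hc, h1, h2⟩
    by_cases h : b.val s = 0
    · obtain ⟨t, s', hE, ht, hQ⟩ := h2 h
      refine ⟨_, s', .ite_false hb h hE, by omega, ?_⟩
      rwa [show T - (b.cost + 1) - t = T - (b.cost + 1 + t) by omega] at hQ
    · obtain ⟨t, s', hE, ht, hQ⟩ := h1 h
      refine ⟨_, s', .ite_true hb h hE, by omega, ?_⟩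
      rwa [show T - (b.cost + 1) - t = T - (b.cost + 1 + t) by omega] at hQ

theorem Runs.mono (h : Runs W P Q s T) (hQ : ∀ s T, Q s T → Q' s T) : Runs W P Q' s T := by
  obtain ⟨t, s', hE, ht, h⟩ := h
  exact ⟨t, s', hE, ht, hQ _ _ h⟩

theorem Does.runs {R : State → Prop} (h : Does W P s c R) (hc : c ≤ T)
    (hQ : ∀ s' T', R s' → T ≤ T' + c → Q s' T') : Runs W P Q s T := by
  obtain ⟨t, s', hE, ht, h⟩ := h
  exact ⟨t, s', hE, ht.trans hc, hQ _ _ h (by omega)⟩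

theorem Runs.does {R : State → Prop} (h : Runs W P Q s T) (hc : T ≤ c)
    (hQ : ∀ s' T', Q s' T' → R s') : Does W P s c R := by
  obtain ⟨t, s', hE, ht, h⟩ := h
  exact ⟨t, s', hE, ht.trans hc, hQ _ _ h⟩

theorem Does.mono {R R' : State → Prop} {c' : ℕ} (h : Does W P s c R) (hc : c ≤ c')
    (hR : ∀ s, R s → R' s) : Does W P s c' R' :=
  Runs.does h hc fun _ _ => hR _

theorem Does.seq {R R' : State → Prop} {c' : ℕ} (h : Does W P s c R)
    (h' : ∀ s, R s → Does W P' s c' R') : Does W (P ;; P') s (c + c') R' := by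
  unfold Does
  rw [runs_seq]
  refine h.runs (by omega) fun s₁ T₁ h1 hT => ?_
  exact (h' s₁ h1).runs (by omega) fun _ _ h _ => h

/-- The rule for loops. The budget bounds the number of rounds, so no variant is needed. -/
theorem Runs.while {b : Exp} {I : State → ℕ → Prop} (h0 : I s T)
    (hstep : ∀ s T, I s T → b.Fits W s ∧ b.cost + 1 ≤ T ∧
      (b.val s ≠ 0 → Runs W P I s (T - (b.cost + 1))) ∧
      (b.val s = 0 → Q s (T - (b.cost + 1)))) : Runs W (.while b P) Q s T := by
  induction T using Nat.strong_induction_on generalizing s with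
  | _ T ih =>
    obtain ⟨hb, hc, h1, h2⟩ := hstep s T h0
    by_cases h : b.val s = 0
    · exact ⟨_, s, .while_false hb h, hc, h2 h⟩
    · obtain ⟨t, s₁, hE, ht, hI⟩ := h1 h
      obtain ⟨t', s', hE', ht', hQ⟩ := ih (T - (b.cost + 1) - t) (by omega) hI
      refine ⟨_, s', .while_true hb h hE hE', by omega, ?_⟩
      rwa [show T - (b.cost + 1) - t - t' = T - (b.cost + 1 + t + t') by omega] at hQ

/-- `for r < rb do P`, starting from the current value of the register `r`. -/
def Prog.for (r rb : ℕ) (P : Prog) : Prog :=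
  .while (.reg rb -ₑ .reg r) (P ;; .assign r (.reg r +ₑ .lit 1))

/-- The rule for counting loops. -/
theorem Runs.for {r rb N i : ℕ} {I : ℕ → State → ℕ → Prop} (hr : s.reg r = i)
    (hrb : s.reg rb = N) (hi : i ≤ N) (hN : N ≤ W) (h0 : I i s T)
    (hbody : ∀ j s T, i ≤ j → j < N → s.reg r = j → s.reg rb = N → I j s T → 4 ≤ T ∧
      Runs W P (fun s' T' => s'.reg r = j ∧ s'.reg rb = N ∧ 4 ≤ T' ∧
        I (j + 1) (s'.setReg r (j + 1)) (T' - 4)) s (T - 4))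
    (hexit : ∀ s T, s.reg r = N → s.reg rb = N → I N s T → 4 ≤ T ∧ Q s (T - 4)) :
    Runs W (.for r rb P) Q s T := by
  have hne : ∀ s : State, ∀ j, s.reg r = j → s.reg rb = N → j < N → r ≠ rb := by
    rintro s j h1 h2 h3 rfl; omega
  refine Runs.while (I := fun s T => ∃ j, i ≤ j ∧ j ≤ N ∧ s.reg r = j ∧ s.reg rb = N ∧ I j s T)
    ⟨i, le_rfl, hi, hr, hrb, h0⟩ ?_
  rintro s T ⟨j, hij, hjN, hsr, hsb, hI⟩
  have h4 : 4 ≤ T := by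
    rcases hjN.lt_or_eq with hlt | rfl
    · exact (hbody j s T hij hlt hsr hsb hI).1
    · exact (hexit s T hsr hsb hI).1
  simp only [Exp.Fits, Exp.cost, Exp.val, hsr, hsb]
  refine ⟨⟨by omega, by omega⟩, by omega, fun hne' => ?_, fun heq => ?_⟩
  · have hlt : j < N := by omega
    obtain ⟨-, hb⟩ := hbody j s T hij hlt hsr hsb hI
    rw [runs_seq]
    refine hb.mono ?_
    rintro s' T' ⟨h1, h2, h3, h4⟩
    rw [runs_assign]
    simp only [Exp.Fits, Exp.cost, Exp.val, h1]
    refine ⟨⟨by omega, by omega, by omega⟩, by omega, j + 1, by omega, by omega, by simp, ?_, h4⟩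
    rw [State.setReg_reg, if_neg (Ne.symm (hne s j hsr hsb hlt)), h2]
  · obtain rfl : j = N := by omega
    exact (hexit s T hsr hsb hI).2

theorem Does.for_sum {r rb N i : ℕ} {I : ℕ → State → Prop} (c : ℕ → ℕ) (hr : s.reg r = i)
    (hrb : s.reg rb = N) (hi : i ≤ N) (hN : N ≤ W) (h0 : I i s)
    (hbody : ∀ j s, i ≤ j → j < N → s.reg r = j → s.reg rb = N → I j s →
      Does W P s (c j) (fun s' => s'.reg r = j ∧ s'.reg rb = N ∧
        I (j + 1) (s'.setReg r (j + 1)))) :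
    Does W (.for r rb P) s (∑ j ∈ Finset.Ico i N, (c j + 8) + 4)
      (fun s' => s'.reg r = N ∧ s'.reg rb = N ∧ I N s') := by
  refine Runs.for (I := fun j s T => I j s ∧ ∑ j ∈ Finset.Ico j N, (c j + 8) + 4 ≤ T)
    hr hrb hi hN ⟨h0, le_rfl⟩ ?_ ?_
  · rintro j s T hij hjN hsr hsb ⟨hI, hT⟩
    rw [Finset.sum_eq_sum_Ico_succ_bot hjN] at hT
    refine ⟨by omega, (hbody j s hij hjN hsr hsb hI).runs (by omega) ?_⟩
    rintro s' T' ⟨h1, h2, h3⟩ hT'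
    exact ⟨h1, h2, by omega, h3, by omega⟩
  · rintro s T hsr hsb ⟨hI, hT⟩
    exact ⟨by omega, hsr, hsb, hI⟩

theorem Does.for {r rb N i : ℕ} {I : ℕ → State → Prop} (c : ℕ) (hr : s.reg r = i)
    (hrb : s.reg rb = N) (hi : i ≤ N) (hN : N ≤ W) (h0 : I i s)
    (hbody : ∀ j s, i ≤ j → j < N → s.reg r = j → s.reg rb = N → I j s →
      Does W P s c (fun s' => s'.reg r = j ∧ s'.reg rb = N ∧
        I (j + 1) (s'.setReg r (j + 1)))) :
    Does W (.for r rb P) s ((N - i) * (c + 8) + 4)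
      (fun s' => s'.reg r = N ∧ s'.reg rb = N ∧ I N s') := by
  have := Does.for_sum (I := I) (fun _ => c) hr hrb hi hN h0 hbody
  simpa using this

end WordRAM

/-! ### Tables -/

namespace WordRAM
open Exp Prog

/-- The data of an instance as the word RAM sees it: a digraph with nodes `0, …, n-1` and arcs
`0, …, m-1`, of which those in `[off v, off (v + 1))` leave `v`, the priorities, and the labeling
`(mt, mc)`. The number `L` is a number of bits that suffices for the numbers up to `n`, with one bit
to spare. -/
structure Inst where
  (n m d h L : ℕ)
  (off tgt pri mt mc : ℕ → ℕ)
  n_pos : 0 < n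
  d_eq : d = 2 * h
  off_zero : off 0 = 0
  off_last : off n = m
  off_mono : ∀ v < n, off v ≤ off (v + 1)
  tgt_lt : ∀ e < m, tgt e < n
  pri_pos : ∀ v < n, 1 ≤ pri v
  pri_le : ∀ v < n, pri v ≤ d
  L_eq : L = n.size + 1

/-- The word bound `W` suffices for the numbers that the programs below compute. -/
structure Inst.Bounded (I : Inst) (W : ℕ) : Prop where
  lin : 16 * (I.n + I.m + I.d + I.L + 2) ≤ W
  nh : 4 * (I.n * I.h) ≤ W
  nL : (I.n + 1) * I.L ≤ W
  B : I.d * I.L * (I.n + 1) ≤ W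

variable (I : Inst)

namespace Inst

theorem off_le_off {I : Inst} {v w : ℕ} (hvw : v ≤ w) (hw : w ≤ I.n) : I.off v ≤ I.off w := by
  induction w, hvw using Nat.le_induction with
  | base => exact le_rfl
  | succ w hvw ih => exact (ih (by omega)).trans (I.off_mono w (by omega))

theorem off_le_m {I : Inst} {v : ℕ} (hv : v ≤ I.n) : I.off v ≤ I.m := by
  rw [← I.off_last]; exact off_le_off hv le_rfl

theorem off_inj {I : Inst} {v w e : ℕ} (hv : v < I.n) (hw : w < I.n) (h1 : I.off v ≤ e)
    (h2 : e < I.off (v + 1)) (h3 : I.off w ≤ e) (h4 : e < I.off (w + 1)) : v = w := by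
  rcases lt_trichotomy v w with h | h | h
  · have := off_le_off (I := I) (v := v + 1) (w := w) h (by omega); omega
  · exact h
  · have := off_le_off (I := I) (v := w + 1) (w := v) h (by omega); omega

/-- The arcs before arc `k` that enter `u`, in descending order. -/
def inList (I : Inst) (k u : ℕ) : List ℕ := ((List.range k).filter (I.tgt · = u)).reverse

theorem inList_succ {I : Inst} (k u : ℕ) :
    I.inList (k + 1) u = if I.tgt k = u then k :: I.inList k u else I.inList k u := by
  unfold inList
  rw [List.range_succ, List.filter_append, List.reverse_append]
  split_ifs with h <;> simp [h]

theorem mem_inList {I : Inst} {k u e : ℕ} : e ∈ I.inList k u ↔ e < k ∧ I.tgt e = u := by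
  simp [inList]

/-- There is an arc from `v` to `w`. -/
def Arc (I : Inst) (v w : ℕ) : Prop :=
  v < I.n ∧ ∃ e, I.off v ≤ e ∧ e < I.off (v + 1) ∧ I.tgt e = w

theorem Arc.lt {I : Inst} {v w : ℕ} (h : I.Arc v w) : w < I.n := by
  obtain ⟨hv, e, h1, h2, rfl⟩ := h
  exact I.tgt_lt e (h2.trans_le (off_le_m hv))

end Inst

/-- The linked list of numbers that starts at `x` consists of `l`; a number `e` is stored as
`e + 1`, and `0` marks the end. -/
def Chain (nxt : ℕ → ℕ) : ℕ → List ℕ → Prop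
  | x, [] => x = 0
  | x, e :: l => x = e + 1 ∧ Chain nxt (nxt e) l

theorem Chain.update {nxt : ℕ → ℕ} {k y : ℕ} {l : List ℕ} : ∀ {x}, Chain nxt x l →
    (∀ e ∈ l, e ≠ k) → Chain (Function.update nxt k y) x l := by
  induction l with
  | nil => intro x h _; exact h
  | cons e l ih =>
    intro x h hk
    refine ⟨h.1, ?_⟩
    rw [Function.update_of_ne (hk e (by simp))]
    exact ih h.2 fun e he => hk e (by simp [he])

/-- The memory holds the instance and the tables that are computed from it at the beginning:
the halves of small numbers (array `7`), their bits (array `8`), for every bit of a potential the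
position of the component it belongs to and its position within this component (arrays `9`, `10`),
and linked lists of the arcs that enter a node, with their tails (arrays `11`, `12`, `13`). -/
structure Static (I : Inst) (s : State) : Prop where
  reg0 : s.reg 0 = I.n
  reg1 : s.reg 1 = I.m
  reg2 : s.reg 2 = I.d
  reg3 : s.reg 3 = I.h
  reg4 : s.reg 4 = I.L
  reg5 : s.reg 5 = I.d * I.L
  reg6 : s.reg 6 = I.n * I.h
  arr0 : s.arr 0 = I.off
  arr1 : s.arr 1 = I.tgt
  arr2 : s.arr 2 = I.pri
  arr3 : s.arr 3 = I.mt
  arr4 : s.arr 4 = I.mc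
  half : ∀ c ≤ I.n + I.d, s.arr 7 c = c / 2
  bits : ∀ c ≤ I.n, ∀ j < I.L, s.arr 8 (c * I.L + j) = c / 2 ^ j % 2
  digit : ∀ i < I.d, ∀ j < I.L,
    s.arr 9 (i * I.L + j) = i % 2 * (I.n * I.h) + (I.h - 1 - i / 2)
  bit : ∀ i < I.d, ∀ j < I.L, s.arr 10 (i * I.L + j) = j
  chain : ∀ u < I.n, Chain (s.arr 12) (s.arr 11 u) (I.inList I.m u)
  src : ∀ v < I.n, ∀ e, I.off v ≤ e → e < I.off (v + 1) → s.arr 13 e = v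

theorem Static.congr {I : Inst} {s s' : State} (h : Static I s) (hr : ∀ r < 10, s'.reg r = s.reg r)
    (ha : ∀ a < 20, s'.arr a = s.arr a) : Static I s' := by
  obtain ⟨h0, h1, h2, h3, h4, h5, h6, a0, a1, a2, a3, a4, x1, x2, x3, x4, x5, x6⟩ := h
  constructor
  case chain => rw [ha 12 (by norm_num), ha 11 (by norm_num)]; assumption
  all_goals
    first
      | rw [hr _ (by norm_num)]; assumption
      | rw [ha _ (by norm_num)]; assumption

@[simp] theorem static_setReg {s : State} {r x : ℕ} (hr : 10 ≤ r) :
    Static I (s.setReg r x) ↔ Static I s := by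
  constructor <;> refine fun h => h.congr ?_ (fun _ _ => rfl) <;>
    intro r' hr' <;> simp [State.setReg_reg] <;> omega

@[simp] theorem static_setCell {s : State} {a i x : ℕ} (ha : 20 ≤ a) :
    Static I (s.setCell a i x) ↔ Static I s := by
  constructor <;> refine fun h => h.congr (fun _ _ => rfl) ?_ <;>
    intro a' ha' <;> rw [State.setCell_arr, if_neg (by omega)]

/-- Array `7` receives the halves of the numbers up to `n + d`. -/
def halfProg : Prog :=
  assign 10 (lit 0) ;; assign 11 (reg 0 +ₑ reg 2 +ₑ lit 1) ;;
  Prog.for 10 11 (ite (reg 10 -ₑ lit 1)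
    (store 7 (reg 10) (cell 7 (reg 10 -ₑ lit 2) +ₑ lit 1))
    (store 7 (reg 10) (lit 0)))

theorem halfProg_does {W n d : ℕ} {s : State} (hn : s.reg 0 = n) (hd : s.reg 2 = d)
    (hW : n + d + 4 ≤ W) :
    Does W halfProg s (20 * (n + d + 1) + 20) fun s' =>
      Same [10, 11] [7] s s' ∧ ∀ c ≤ n + d, s'.arr 7 c = c / 2 := by
  unfold Does halfProg
  simp [hn, hd]
  and_intros
  all_goals try omega
  refine (Does.for (N := n + d + 1) (i := 0) 12
    (I := fun j s' => Same [10, 11] [7] s s' ∧ ∀ c < j, s'.arr 7 c = c / 2)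
    (by simp) (by simp) (by omega) (by omega) (by simp) ?_).runs (by omega) ?_
  · rintro j s₁ - hj h10 h11 ⟨hs, hI⟩
    unfold Does
    have h2 : j - 1 ≠ 0 → s₁.arr 7 (j - 2) = j / 2 - 1 := fun h => by
      rw [hI _ (by omega)]; omega
    simp [h10, h11, hs]
    and_intros
    all_goals try omega
    · intro h
      rw [h2 h]
      and_intros
      all_goals try omega
      intro c hc
      rw [Function.update_apply]
      split_ifs with hcj
      · omega
      · exact hI c (by omega)
    · intro h
      refine ⟨by omega, fun c hc => ?_⟩
      rw [Function.update_apply]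
      split_ifs with hcj
      · omega
      · exact hI c (by omega)
  · rintro s₁ T₁ ⟨-, -, hs, hI⟩ -
    exact ⟨hs, fun c hc => hI c (by omega)⟩

/-- Register `4` receives the number of bits. -/
def bitLengthProg : Prog :=
  assign 4 (lit 1) ;; assign 10 (lit 1) ;;
  .while (reg 0 +ₑ lit 1 -ₑ reg 10) (assign 10 (reg 10 +ₑ reg 10) ;; assign 4 (reg 4 +ₑ lit 1))

theorem bitLengthProg_does {W n : ℕ} {s : State} (hn : s.reg 0 = n) (hW : 4 * n + n.size + 4 ≤ W) :
    Does W bitLengthProg s (20 * n.size + 20) fun s' =>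
      Same [4, 10] [] s s' ∧ s'.reg 4 = n.size + 1 := by
  unfold Does bitLengthProg
  simp
  refine ⟨by omega, ?_⟩
  refine Runs.while (I := fun s' T => ∃ k ≤ n.size, Same [4, 10] [] s s' ∧ s'.reg 10 = 2 ^ k ∧
    s'.reg 4 = k + 1 ∧ 20 * (n.size - k) + 10 ≤ T) ⟨0, by simp⟩ ?_
  rintro s₁ T ⟨k, hk, hs, h10, h4, hT⟩
  have h0 : s₁.reg 0 = n := by rw [hs.1 0 (by simp), hn]
  have hpow : k < n.size → 2 ^ k ≤ n := fun h => Nat.lt_size.mp h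
  have hpow' : 2 ^ k ≤ 2 * n + 1 := by
    rcases Nat.eq_zero_or_pos k with rfl | h
    · simp
    · have := Nat.lt_size.mp (show k - 1 < n.size by omega)
      have h2 : 2 ^ k = 2 * 2 ^ (k - 1) := by rw [← pow_succ']; congr 1; omega
      omega
  simp [h0, h10, h4, hs]
  and_intros
  all_goals try omega
  · intro h
    have hlt : k < n.size := Nat.lt_size.mpr (by omega)
    have := hpow hlt
    and_intros
    all_goals try omega

/-- Array `8` receives the bits of the numbers up to `n`. -/
def bitsProg : Prog :=
  assign 10 (lit 0) ;; assign 11 (reg 0 +ₑ lit 1) ;;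
  Prog.for 10 11 (assign 12 (lit 0) ;;
    Prog.for 12 4 (ite (reg 12)
      (store 8 (reg 10 *ₑ reg 4 +ₑ reg 12) (cell 8 (cell 7 (reg 10) *ₑ reg 4 +ₑ (reg 12 -ₑ lit 1))))
      (store 8 (reg 10 *ₑ reg 4 +ₑ reg 12) (reg 10 -ₑ (cell 7 (reg 10) +ₑ cell 7 (reg 10))))))

theorem mul_add_inj {L a b i j : ℕ} (hi : i < L) (hj : j < L) (h : a * L + i = b * L + j) :
    a = b ∧ i = j := by
  have h1 : (a * L + i) / L = a := by
    rw [mul_comm, Nat.mul_add_div (by omega), Nat.div_eq_of_lt hi, add_zero]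
  have h2 : (b * L + j) / L = b := by
    rw [mul_comm, Nat.mul_add_div (by omega), Nat.div_eq_of_lt hj, add_zero]
  have : a = b := by rw [← h1, ← h2, h]
  subst this
  exact ⟨rfl, by omega⟩

theorem mul_add_lt {L a b i : ℕ} (hi : i < L) (h : a < b) : a * L + i < b * L := by
  have : (a + 1) * L ≤ b * L := Nat.mul_le_mul_right _ h
  rw [Nat.succ_mul] at this
  omega

theorem bitsProg_does {W n L : ℕ} {s : State} (hn : s.reg 0 = n) (hL : s.reg 4 = L)
    (hh : ∀ c ≤ n, s.arr 7 c = c / 2) (hW : n + L + 4 ≤ W) (hW' : (n + 1) * L ≤ W) :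
    Does W bitsProg s ((n + 1) * (L * 30 + 20) + 20) fun s' =>
      Same [10, 11, 12] [8] s s' ∧ ∀ c ≤ n, ∀ j < L, s'.arr 8 (c * L + j) = c / 2 ^ j % 2 := by
  unfold Does bitsProg
  simp [hn]
  and_intros
  all_goals try omega
  let J : ℕ → State → Prop := fun x s' => Same [10, 11, 12] [8] s s' ∧
    ∀ c j, j < L → c * L + j < x → s'.arr 8 (c * L + j) = c / 2 ^ j % 2
  refine (Does.for (N := n + 1) (i := 0) (L * 30 + 6) (I := fun c s' => J (c * L) s')
    (by simp) (by simp) (by omega) (by omega) (by simp [J]) ?_).runs ?_ ?_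
  · rintro c s₁ - hc h10 h11 hJ
    unfold Does
    simp
    refine (Does.for (N := L) (i := 0) 20
      (I := fun j s' => s'.reg 10 = c ∧ s'.reg 11 = n + 1 ∧ J (c * L + j) s')
      (by simp) (by simp; rw [hJ.1.1 4 (by simp), hL]) (by omega) (by omega)
      (by simpa [h10, h11, J] using hJ) ?_).runs (by omega) ?_
    · rintro j s₂ - hj h12 h4 ⟨h10, h11, hs, hJ⟩
      have h7 : s₂.arr 7 c = c / 2 := by rw [hs.2 7 (by simp)]; exact hh c (by omega)
      have hlt : c * L + j < (n + 1) * L := mul_add_lt hj hc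
      have hle : c / 2 * L ≤ c * L := Nat.mul_le_mul_right _ (Nat.div_le_self c 2)
      have hnew : ∀ y, y = c / 2 ^ j % 2 → ∀ c' j', j' < L → c' * L + j' < c * L + (j + 1) →
          Function.update (s₂.arr 8) (c * L + j) y (c' * L + j') = c' / 2 ^ j' % 2 := by
        intro y hy c' j' hj' hlt'
        rw [Function.update_apply]
        split_ifs with heq
        · obtain ⟨rfl, rfl⟩ := mul_add_inj hj' hj heq; exact hy
        · exact hJ c' j' hj' (by omega)
      have hrd : j ≠ 0 → s₂.arr 8 (c / 2 * L + (j - 1)) = c / 2 ^ j % 2 := by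
        intro h0
        rw [hJ (c / 2) (j - 1) (by omega) (by omega), Nat.div_div_eq_div_mul, ← pow_succ']
        congr 3; omega
      have h2 : c / 2 ^ j % 2 < 2 := Nat.mod_lt _ (by norm_num)
      unfold Does
      simp [h10, h12, h4, h11, h7, hs, J, and_assoc]
      and_intros
      all_goals try omega
      · intro h0
        rw [hrd h0]
        and_intros
        all_goals try omega
        exact hnew _ rfl
      · intro h0
        subst h0
        and_intros
        all_goals try omega
        exact hnew _ (by simp; omega)
    · rintro s₂ T₂ ⟨-, -, h10, h11, hJ⟩ hT
      refine ⟨h10, h11, ?_⟩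
      rw [Nat.succ_mul]
      simpa [J] using hJ
  · simp only [Nat.sub_zero]
    have : (n + 1) * (L * 30 + 6 + 8) ≤ (n + 1) * (L * 30 + 20) := Nat.mul_le_mul_left _ (by omega)
    omega
  · rintro s₁ T₁ ⟨-, -, hs, hJ⟩ -
    exact ⟨hs, fun c hc j hj => hJ c j hj (mul_add_lt hj (by omega))⟩

end WordRAM

namespace WordRAM
open Exp Prog

/-- Arrays `9` and `10` receive the position of the component of a potential, and the position in
this component, to which a bit of the potential belongs. -/
def levelsProg : Prog :=
  assign 10 (lit 0) ;;
  Prog.for 10 2 (assign 12 (lit 0) ;;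
    Prog.for 12 4 (
      store 9 (reg 10 *ₑ reg 4 +ₑ reg 12)
        ((reg 10 -ₑ (cell 7 (reg 10) +ₑ cell 7 (reg 10))) *ₑ reg 6 +ₑ
          (reg 3 -ₑ lit 1 -ₑ cell 7 (reg 10))) ;;
      store 10 (reg 10 *ₑ reg 4 +ₑ reg 12) (reg 12)))

theorem levelsProg_does {W d L h nh : ℕ} {s : State} (hd : s.reg 2 = d) (hL : s.reg 4 = L)
    (hhr : s.reg 3 = h) (hnh : s.reg 6 = nh)
    (hh : ∀ c ≤ d, s.arr 7 c = c / 2) (hW : 2 * d + h + L + 4 + nh ≤ W) (hW' : d * L ≤ W) :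
    Does W levelsProg s (d * (L * 40 + 20) + 20) fun s' =>
      Same [10, 12] [9, 10] s s' ∧ ∀ i < d, ∀ j < L,
        s'.arr 9 (i * L + j) = i % 2 * nh + (h - 1 - i / 2) ∧ s'.arr 10 (i * L + j) = j := by
  unfold Does levelsProg
  simp
  let J : ℕ → State → Prop := fun x s' => Same [10, 12] [9, 10] s s' ∧
    ∀ c j, j < L → c * L + j < x → s'.arr 9 (c * L + j) = c % 2 * nh + (h - 1 - c / 2) ∧
      s'.arr 10 (c * L + j) = j
  refine (Does.for (N := d) (i := 0) (L * 40 + 6) (I := fun c s' => J (c * L) s')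
    (by simp) (by simpa using hd) (by omega) (by omega) (by simp [J]) ?_).runs ?_ ?_
  · rintro c s₁ - hc h10 h2 hJ
    unfold Does
    simp
    refine (Does.for (N := L) (i := 0) 30
      (I := fun j s' => s'.reg 10 = c ∧ J (c * L + j) s')
      (by simp) (by simp; rw [hJ.1.1 4 (by simp), hL]) (by omega) (by omega)
      (by simpa [h10, J] using hJ) ?_).runs (by omega) ?_
    · rintro j s₂ - hj h12 h4 ⟨h10, hs, hJ⟩
      have h7 : s₂.arr 7 c = c / 2 := by rw [hs.2 7 (by simp)]; exact hh c (by omega)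
      have h6 : s₂.reg 6 = nh := by rw [hs.1 6 (by simp), hnh]
      have h3 : s₂.reg 3 = h := by rw [hs.1 3 (by simp), hhr]
      have hlt : c * L + j < d * L := mul_add_lt hj hc
      have hmod : c - (c / 2 + c / 2) = c % 2 := by omega
      have hm2 : c % 2 * nh ≤ nh := by
        rcases Nat.mod_two_eq_zero_or_one c with h | h <;> simp [h]
      unfold Does
      simp [h10, h12, h4, h7, hs, J, h6, h3, hmod, and_assoc]
      and_intros
      all_goals try omega
      intro c' j' hj' hlt'
      simp only [Function.update_apply]
      split_ifs with heq
      · obtain ⟨rfl, rfl⟩ := mul_add_inj hj' hj heq; exact ⟨rfl, rfl⟩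
      · exact hJ c' j' hj' (by omega)
    · rintro s₂ T₂ ⟨-, -, h10, hJ⟩ hT
      refine ⟨h10, by rw [hJ.1.1 2 (by simp), hd], ?_⟩
      rw [Nat.succ_mul]
      simpa [J] using hJ
  · simp only [Nat.sub_zero]
    have : d * (L * 40 + 6 + 8) ≤ d * (L * 40 + 20) := Nat.mul_le_mul_left _ (by omega)
    omega
  · rintro s₁ T₁ ⟨-, -, hs, hJ⟩ -
    exact ⟨hs, fun c hc j hj => hJ c j hj (mul_add_lt hj (by omega))⟩

/-- Arrays `11`, `12` and `13` receive linked lists of the arcs that enter a node, and the tails of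
the arcs. -/
def inListsProg : Prog :=
  assign 10 (lit 0) ;;
  Prog.for 10 0 (
    assign 12 (cell 0 (reg 10)) ;; assign 13 (cell 0 (reg 10 +ₑ lit 1)) ;;
    Prog.for 12 13 (
      store 13 (reg 12) (reg 10) ;;
      store 12 (reg 12) (cell 11 (cell 1 (reg 12))) ;;
      store 11 (cell 1 (reg 12)) (reg 12 +ₑ lit 1)))

theorem Chain.le {nxt : ℕ → ℕ} {x k : ℕ} {l : List ℕ} (h : Chain nxt x l) (hl : ∀ e ∈ l, e < k) :
    x ≤ k := by
  cases l with
  | nil => rw [show x = 0 from h]; omega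
  | cons e l => have := hl e (by simp); have := h.1; omega

theorem inListsProg_does {I : Inst} {W : ℕ} {s : State} (hn : s.reg 0 = I.n)
    (h0 : s.arr 0 = I.off) (h1 : s.arr 1 = I.tgt) (h11 : ∀ u, s.arr 11 u = 0)
    (hW : I.n + I.m + 4 ≤ W) :
    Does W inListsProg s (30 * I.n + 30 * I.m + 20) fun s' =>
      Same [10, 12, 13] [11, 12, 13] s s' ∧
      (∀ u < I.n, Chain (s'.arr 12) (s'.arr 11 u) (I.inList I.m u)) ∧
      ∀ v < I.n, ∀ e, I.off v ≤ e → e < I.off (v + 1) → s'.arr 13 e = v := by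
  unfold Does inListsProg
  simp
  let J : ℕ → State → Prop := fun k s' => Same [10, 12, 13] [11, 12, 13] s s' ∧
    (∀ u < I.n, Chain (s'.arr 12) (s'.arr 11 u) (I.inList k u)) ∧
    ∀ v < I.n, ∀ e, e < k → I.off v ≤ e → e < I.off (v + 1) → s'.arr 13 e = v
  refine Runs.for (N := I.n) (i := 0)
    (I := fun v s' T => J (I.off v) s' ∧ 30 * (I.n - v) + 30 * (I.m - I.off v) + 10 ≤ T)
    (by simp) (by simpa using hn) (by omega) (by omega) ?_ ?_ ?_
  · refine ⟨⟨by simp, fun u hu => ?_, fun v _ e he => ?_⟩, ?_⟩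
    · simp [I.off_zero, Inst.inList, Chain, h11]
    · simp [I.off_zero] at he
    · simp [I.off_zero]
  · rintro v s₁ T - hv h10 hr0 ⟨hJ, hT⟩
    have a0 : s₁.arr 0 = I.off := by rw [hJ.1.2 0 (by simp), h0]
    have hmono := I.off_mono v hv
    have hm := Inst.off_le_m (I := I) (v := v + 1) hv
    refine ⟨by omega, ?_⟩
    simp [h10, a0]
    and_intros
    all_goals try omega
    refine (Does.for (N := I.off (v + 1)) (i := I.off v) 20
      (I := fun e s' => s'.reg 10 = v ∧ s'.reg 0 = I.n ∧ J e s')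
      (by simp) (by simp) (by omega) (by omega) (by simpa [h10, hr0, J] using hJ) ?_).runs
      (by omega) ?_
    · rintro e s₂ he he' h12 h13 ⟨h10, hr0, hs, hch, hsrc⟩
      have a1 : s₂.arr 1 = I.tgt := by rw [hs.2 1 (by simp), h1]
      have ht := I.tgt_lt e (by omega)
      have h11e : s₂.arr 11 (I.tgt e) ≤ e :=
        (hch _ ht).le fun e' he' => (Inst.mem_inList.mp he').1
      unfold Does
      simp [h10, h12, h13, hr0, a1, J, hs, and_assoc]
      and_intros
      all_goals try omega
      · intro u hu
        rw [Inst.inList_succ]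
        have hne : ∀ e' ∈ I.inList e u, e' ≠ e := fun e' he' =>
          (Inst.mem_inList.mp he').1.ne
        split_ifs with hte
        · subst hte
          rw [Function.update_self]
          refine ⟨rfl, ?_⟩
          rw [Function.update_self]
          exact (hch _ hu).update hne
        · rw [Function.update_of_ne (Ne.symm hte)]
          exact (hch _ hu).update hne
      · intro v' hv' e' hlt h1 h2
        rw [Function.update_apply]
        split_ifs with heq
        · subst heq
          exact Inst.off_inj hv hv' he he' h1 h2
        · exact hsrc v' hv' e' (by omega) h1 h2
    · rintro s₂ T₂ ⟨-, -, h10, hr0, hJ⟩ hT₂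
      refine ⟨h10, hr0, by omega, by simpa [J] using hJ, by omega⟩
  · rintro s₁ T - - ⟨⟨hs, hch, hsrc⟩, hT⟩
    rw [I.off_last] at hch hsrc
    refine ⟨by omega, hs, hch, fun v hv e h1 h2 => ?_⟩
    exact hsrc v hv e (h2.trans_le (Inst.off_le_m hv)) h1 h2

/-- The labeling `⊤` in array `20`, and the level of every node in array `22`. -/
def initProg : Prog :=
  assign 10 (lit 0) ;;
  Prog.for 10 0 (store 20 (reg 10) (lit 1) ;; store 22 (reg 10) (reg 5))

theorem initProg_does {n W B : ℕ} {s : State} (hn : s.reg 0 = n) (hB : s.reg 5 = B)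
    (hW : n + B + 4 ≤ W) :
    Does W initProg s (20 * n + 20) fun s' => Same [10] [20, 22] s s' ∧
      ∀ v < n, s'.arr 20 v = 1 ∧ s'.arr 22 v = B := by
  unfold Does initProg
  simp
  refine (Does.for (N := n) (i := 0) 12
    (I := fun j s' => Same [10] [20, 22] s s' ∧ ∀ v < j, s'.arr 20 v = 1 ∧ s'.arr 22 v = B)
    (by simp) (by simpa using hn) (by omega) (by omega) (by simp) ?_).runs (by omega) ?_
  · rintro j s₁ - hj h10 h0 ⟨hs, hI⟩
    have h5 : s₁.reg 5 = B := by rw [hs.1 5 (by simp), hB]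
    unfold Does
    simp [h10, h0, hs, h5]
    and_intros
    all_goals try omega
    intro v hv
    simp only [Function.update_apply]
    split_ifs with h
    · exact ⟨rfl, rfl⟩
    · exact hI v (by omega)
  · rintro s₁ T₁ ⟨-, -, hs, hI⟩ -
    exact ⟨hs, hI⟩

/-- All tables. -/
def setupProg : Prog :=
  halfProg ;; assign 3 (cell 7 (reg 2)) ;; assign 6 (reg 0 *ₑ reg 3) ;; bitLengthProg ;;
  assign 5 (reg 2 *ₑ reg 4) ;; bitsProg ;; levelsProg ;; inListsProg ;; initProg

theorem setupProg_does {I : Inst} {W : ℕ} (hW : I.Bounded W) {s : State} (h0 : s.reg 0 = I.n)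
    (h1 : s.reg 1 = I.m) (h2 : s.reg 2 = I.d) (a0 : s.arr 0 = I.off) (a1 : s.arr 1 = I.tgt)
    (a2 : s.arr 2 = I.pri) (a3 : s.arr 3 = I.mt) (a4 : s.arr 4 = I.mc)
    (a11 : ∀ u, s.arr 11 u = 0) :
    Does W setupProg s (200 * (I.n * I.L + I.d * I.L + I.n + I.m + I.d + I.L + 1)) fun s' =>
      Static I s' ∧ (∀ a, 20 < a → a ≠ 22 → s'.arr a = s.arr a) ∧
      ∀ v < I.n, s'.arr 20 v = 1 ∧ s'.arr 22 v = I.d * I.L := by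
  obtain ⟨w1, w2, w3, w4⟩ := hW
  have hdL : I.d * I.L ≤ I.d * I.L * (I.n + 1) := Nat.le_mul_of_pos_right _ (by omega)
  have hL := I.L_eq
  have hd := I.d_eq
  have hnp := I.n_pos
  have hdL2 : I.d * I.L * 2 ≤ I.d * I.L * (I.n + 1) := Nat.mul_le_mul_left _ (by omega)
  have hnn : I.n ≤ I.n * I.L := Nat.le_mul_of_pos_right _ (by omega)
  have hsz : 20 * I.n.size + 20 ≤ 40 * I.L := by omega
  have e1 : (I.n + 1) * (I.L * 30 + 20) + 20 ≤ 50 * (I.n * I.L) + 50 * I.L + 40 := by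
    nlinarith
  have e2 : I.d * (I.L * 40 + 20) + 20 = 40 * (I.d * I.L) + 20 * I.d + 20 := by ring
  unfold Does setupProg
  rw [runs_seq]
  refine (halfProg_does h0 h2 (by omega)).runs (by omega) fun s₁ T₁ ⟨f1, p1⟩ hT₁ => ?_
  have r0 : s₁.reg 0 = I.n := by rw [f1.1 0 (by simp), h0]
  have r2 : s₁.reg 2 = I.d := by rw [f1.1 2 (by simp), h2]
  have hhalf : s₁.arr 7 I.d = I.h := by rw [p1 _ (by omega)]; omega
  simp only [runs_seq]
  simp [r0, r2, hhalf]
  and_intros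
  all_goals try omega
  refine (bitLengthProg_does (n := I.n) (by simp [r0]) (by omega)).runs (by omega)
    fun s₂ T₂ ⟨f2, p2⟩ hT₂ => ?_
  have r2' : s₂.reg 2 = I.d := by rw [f2.1 2 (by simp)]; simp [r2]
  have p2' : s₂.reg 4 = I.L := by omega
  simp [r2', p2']
  and_intros
  all_goals try omega
  refine (bitsProg_does (n := I.n) (L := I.L) (by simp; rw [f2.1 0 (by simp)]; simp [r0])
    (by simp [p2']) (fun c hc => ?_) (by omega) w3).runs (by omega) fun s₃ T₃ ⟨f3, p3⟩ hT₃ => ?_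
  · simp; rw [f2.2 7 (by simp)]; simp; exact p1 c (by omega)
  rw [runs_seq]
  refine (levelsProg_does (s := s₃) (W := W) (d := I.d) (L := I.L) (h := I.h) (nh := I.n * I.h)
    ?_ ?_ ?_ ?_ (fun c hc => ?_) (by omega) (by omega)).runs ?_
    fun s₄ T₄ ⟨f4, p4⟩ hT₄ => ?_
  · rw [f3.1 2 (by simp)]; simp [r2']
  · rw [f3.1 4 (by simp)]; simp [p2']
  · rw [f3.1 3 (by simp)]; simp; rw [f2.1 3 (by simp)]; simp
  · rw [f3.1 6 (by simp)]; simp; rw [f2.1 6 (by simp)]; simp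
  · rw [f3.2 7 (by simp)]; simp; rw [f2.2 7 (by simp)]; simp; exact p1 c (by omega)
  · omega
  -- registers and arrays so far
  have R : ∀ r, r ∉ [3, 4, 5, 6, 10, 11, 12] → s₄.reg r = s.reg r := by
    intro r hr
    simp at hr
    rw [f4.1 r (by simp; omega), f3.1 r (by simp; omega), State.setReg_reg, if_neg (by omega),
      f2.1 r (by simp; omega)]
    simp only [State.setReg_reg]
    rw [if_neg (by omega), if_neg (by omega), f1.1 r (by simp; omega)]
  have A : ∀ a, a ∉ [7, 8, 9, 10] → s₄.arr a = s.arr a := by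
    intro a ha
    simp at ha
    rw [f4.2 a (by simp; omega), f3.2 a (by simp; omega), State.setReg_arr, f2.2 a (by simp)]
    simp only [State.setReg_arr]
    rw [f1.2 a (by simp; omega)]
  rw [runs_seq]
  refine (inListsProg_does (I := I) (by rw [R 0 (by simp), h0]) (by rw [A 0 (by simp), a0])
    (by rw [A 1 (by simp), a1]) (fun u => by rw [A 11 (by simp), a11]) (by omega)).runs (by omega)
    fun s₅ T₅ ⟨f5, p5, p5'⟩ hT₅ => ?_
  have hr5 : s₅.reg 5 = I.d * I.L := by
    rw [f5.1 5 (by simp), f4.1 5 (by simp), f3.1 5 (by simp)]; simp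
  refine (initProg_does (n := I.n) (B := I.d * I.L) (by rw [f5.1 0 (by simp), R 0 (by simp), h0])
    hr5 (by omega)).runs (by omega) fun s₆ T₆ ⟨f6, p6⟩ hT₆ => ?_
  refine ⟨?_, ?_, p6⟩
  · constructor
    · rw [f6.1 0 (by simp), f5.1 0 (by simp), R 0 (by simp), h0]
    · rw [f6.1 1 (by simp), f5.1 1 (by simp), R 1 (by simp), h1]
    · rw [f6.1 2 (by simp), f5.1 2 (by simp), R 2 (by simp), h2]
    · rw [f6.1 3 (by simp), f5.1 3 (by simp), f4.1 3 (by simp), f3.1 3 (by simp)]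
      simp; rw [f2.1 3 (by simp)]; simp
    · rw [f6.1 4 (by simp), f5.1 4 (by simp), f4.1 4 (by simp), f3.1 4 (by simp)]
      simp [p2']
    · rw [f6.1 5 (by simp), hr5]
    · rw [f6.1 6 (by simp), f5.1 6 (by simp), f4.1 6 (by simp), f3.1 6 (by simp)]
      simp; rw [f2.1 6 (by simp)]; simp
    · rw [f6.2 0 (by simp), f5.2 0 (by simp), A 0 (by simp), a0]
    · rw [f6.2 1 (by simp), f5.2 1 (by simp), A 1 (by simp), a1]
    · rw [f6.2 2 (by simp), f5.2 2 (by simp), A 2 (by simp), a2]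
    · rw [f6.2 3 (by simp), f5.2 3 (by simp), A 3 (by simp), a3]
    · rw [f6.2 4 (by simp), f5.2 4 (by simp), A 4 (by simp), a4]
    · intro c hc
      rw [f6.2 7 (by simp), f5.2 7 (by simp), f4.2 7 (by simp), f3.2 7 (by simp)]
      simp; rw [f2.2 7 (by simp)]; simp; exact p1 c hc
    · rw [f6.2 8 (by simp), f5.2 8 (by simp), f4.2 8 (by simp)]
      exact p3
    · intro i hi j hj
      rw [f6.2 9 (by simp), f5.2 9 (by simp)]
      exact (p4 i hi j hj).1
    · intro i hi j hj
      rw [f6.2 10 (by simp), f5.2 10 (by simp)]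
      exact (p4 i hi j hj).2
    · rw [f6.2 11 (by simp), f6.2 12 (by simp)]; exact p5
    · rw [f6.2 13 (by simp)]; exact p5'
  · intro a ha ha'
    rw [f6.2 a (by simp; omega), f5.2 a (by simp; omega), A a (by simp; omega)]

end WordRAM

/-! ### Strongly connected components -/

namespace WordRAM

/-- The arcs of the subgraph induced by the nodes of priority at most `p`. -/
def Inst.ArcLE (I : Inst) (p v w : ℕ) : Prop := I.Arc v w ∧ I.pri v ≤ p ∧ I.pri w ≤ p

/-- Reachability in the subgraph induced by the nodes of priority at most `p`. -/
def Inst.ReachLE (I : Inst) (p : ℕ) : ℕ → ℕ → Prop := Relation.ReflTransGen (I.ArcLE p)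

theorem sum_update {n v y : ℕ} {f : ℕ → ℕ} (g : ℕ → ℕ → ℕ) (hv : v < n) :
    (∑ u ∈ Finset.range n, g u (Function.update f v y u)) + g v (f v) =
      (∑ u ∈ Finset.range n, g u (f u)) + g v y := by
  have hmem : v ∈ Finset.range n := Finset.mem_range.mpr hv
  rw [← Finset.add_sum_erase _ _ hmem, ← Finset.add_sum_erase _ (fun u => g u (f u)) hmem,
    Function.update_self]
  have : ∑ u ∈ (Finset.range n).erase v, g u (Function.update f v y u) =
      ∑ u ∈ (Finset.range n).erase v, g u (f u) :=
    Finset.sum_congr rfl fun u hu => by rw [Function.update_of_ne (Finset.ne_of_mem_erase hu)]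
  rw [this]
  ring

/-- The invariant of depth-first search in the subgraph of the nodes of priority at most `p`.
`vis v` is `0` for unvisited nodes, `1` for visited nodes, and `2` for nodes outside of the
subgraph; the arcs that leave `v` have been scanned up to `cur v`; the search is at the path
`stk 0, …, stk (sp - 1)` and has finished the nodes `ord 0, …, ord (cnt - 1)`. -/
structure DfsInv (I : Inst) (p : ℕ) (vis cur stk ord : ℕ → ℕ) (sp cnt : ℕ) : Prop where
  vis_le : ∀ v < I.n, I.pri v ≤ p → vis v ≤ 1
  vis_out : ∀ v < I.n, p < I.pri v → vis v = 2
  cur_mem : ∀ v < I.n, I.off v ≤ cur v ∧ cur v ≤ I.off (v + 1)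
  scanned : ∀ v < I.n, I.pri v ≤ p → ∀ e, I.off v ≤ e → e < cur v → vis (I.tgt e) ≠ 0
  stk_mem : ∀ j < sp, stk j < I.n ∧ vis (stk j) = 1
  ord_mem : ∀ j < cnt, ord j < I.n ∧ vis (ord j) = 1
  stk_inj : ∀ j < sp, ∀ j' < sp, stk j = stk j' → j = j'
  ord_inj : ∀ j < cnt, ∀ j' < cnt, ord j = ord j' → j = j'
  disj : ∀ j < sp, ∀ j' < cnt, stk j ≠ ord j'
  cover : ∀ v < I.n, vis v = 1 → (∃ j < sp, stk j = v) ∨ ∃ j < cnt, ord j = v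
  path : ∀ j j', j ≤ j' → j' < sp → I.ReachLE p (stk j) (stk j')
  fin : ∀ i < cnt, ∀ b, I.ArcLE p (ord i) b →
    (∃ j < cnt, ord j = b ∧ ∀ i', i ≤ i' → i' ≤ j → I.ReachLE p b (ord i')) ∨
    (∃ j < sp, stk j = b ∧ ∀ i', i ≤ i' → i' < cnt → I.ReachLE p b (ord i'))
  count : (∑ v ∈ Finset.range I.n, if vis v = 0 then 1 else 0) + sp + cnt ≤ I.n

namespace DfsInv

variable {I : Inst} {p : ℕ} {vis cur stk ord : ℕ → ℕ} {sp cnt : ℕ}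

theorem pri_le (h : DfsInv I p vis cur stk ord sp cnt) {v : ℕ} (hv : v < I.n) (h1 : vis v ≤ 1) :
    I.pri v ≤ p := by
  by_contra hlt
  have := h.vis_out v hv (by omega)
  omega

theorem advance (h : DfsInv I p vis cur stk ord sp cnt) {v : ℕ} (hv : v < I.n)
    (hc : cur v < I.off (v + 1)) (hw : vis (I.tgt (cur v)) ≠ 0) :
    DfsInv I p vis (Function.update cur v (cur v + 1)) stk ord sp cnt := by
  refine { h with cur_mem := fun u hu => ?_, scanned := fun u hu hpu e h1 h2 => ?_ }
  · rw [Function.update_apply]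
    have := h.cur_mem u hu
    split_ifs with huv
    · subst huv; omega
    · exact this
  · rw [Function.update_apply] at h2
    split_ifs at h2 with huv
    · subst huv
      rcases Nat.lt_succ_iff_lt_or_eq.mp h2 with h3 | rfl
      · exact h.scanned _ hu hpu e h1 h3
      · exact hw
    · exact h.scanned u hu hpu e h1 h2

/-- A node that is pushed onto the stack. -/
theorem push (h : DfsInv I p vis cur stk ord sp cnt) {w : ℕ} (hw : w < I.n) (hvw : vis w = 0)
    (hreach : ∀ j < sp, I.ReachLE p (stk j) w) :
    DfsInv I p (Function.update vis w 1) cur (Function.update stk sp w) ord (sp + 1) cnt := by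
  have hpw := h.pri_le hw (by omega)
  have hvis : ∀ v, vis v = 1 → Function.update vis w 1 v = 1 := fun v hv => by
    rw [Function.update_apply]; split_ifs <;> simp [hv]
  have hstk : ∀ j < sp, Function.update stk sp w j = stk j := fun j hj =>
    Function.update_of_ne (by omega) _ _
  have hnew : Function.update stk sp w sp = w := Function.update_self _ _ _
  have hsw : ∀ j < sp, stk j ≠ w := fun j hj heq => by
    have := (h.stk_mem j hj).2; rw [heq] at this; omega
  have how : ∀ j < cnt, ord j ≠ w := fun j hj heq => by
    have := (h.ord_mem j hj).2; rw [heq] at this; omega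
  refine ⟨?_, ?_, h.cur_mem, ?_, ?_, ?_, ?_, h.ord_inj, ?_, ?_, ?_, ?_, ?_⟩
  · intro v hv hp
    rw [Function.update_apply]; split_ifs
    · exact le_rfl
    · exact h.vis_le v hv hp
  · intro v hv hp
    rw [Function.update_of_ne (by rintro rfl; omega)]
    exact h.vis_out v hv hp
  · intro v hv hpv e h1 h2
    rw [Function.update_apply]; split_ifs
    · exact one_ne_zero
    · exact h.scanned v hv hpv e h1 h2
  · intro j hj
    rcases Nat.lt_succ_iff_lt_or_eq.mp hj with hj | rfl
    · rw [hstk j hj]; exact ⟨(h.stk_mem j hj).1, hvis _ (h.stk_mem j hj).2⟩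
    · rw [hnew]; exact ⟨hw, Function.update_self _ _ _⟩
  · intro j hj
    exact ⟨(h.ord_mem j hj).1, hvis _ (h.ord_mem j hj).2⟩
  · intro j hj j' hj' heq
    rcases Nat.lt_succ_iff_lt_or_eq.mp hj with hj | rfl <;>
      rcases Nat.lt_succ_iff_lt_or_eq.mp hj' with hj' | rfl
    · rw [hstk j hj, hstk j' hj'] at heq; exact h.stk_inj j hj j' hj' heq
    · rw [hstk j hj, hnew] at heq; exact absurd heq (hsw j hj)
    · rw [hstk j' hj', hnew] at heq; exact absurd heq.symm (hsw j' hj')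
    · rfl
  · intro j hj j' hj'
    rcases Nat.lt_succ_iff_lt_or_eq.mp hj with hj | rfl
    · rw [hstk j hj]; exact h.disj j hj j' hj'
    · rw [hnew]; exact (how j' hj').symm
  · intro v hv h1
    by_cases hvw' : v = w
    · exact Or.inl ⟨sp, by omega, by rw [hnew, hvw']⟩
    · rw [Function.update_of_ne hvw'] at h1
      rcases h.cover v hv h1 with ⟨j, hj, heq⟩ | hj
      · exact Or.inl ⟨j, by omega, by rw [hstk j hj, heq]⟩
      · exact Or.inr hj
  · intro j j' hjj hj'
    rcases Nat.lt_succ_iff_lt_or_eq.mp hj' with hj' | rfl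
    · rw [hstk j' hj', hstk j (by omega)]; exact h.path j j' hjj hj'
    · rw [hnew]
      rcases hjj.lt_or_eq with hlt | rfl
      · rw [hstk j hlt]; exact hreach j hlt
      · rw [hnew]; exact .refl
  · intro i hi b hb
    rcases h.fin i hi b hb with h1 | ⟨j, hj, heq, hr⟩
    · exact Or.inl h1
    · exact Or.inr ⟨j, by omega, by rw [hstk j hj, heq], hr⟩
  · have h1 := h.count
    have h2 := sum_update (f := vis) (y := 1) (fun _ x => if x = 0 then 1 else 0) hw
    simp [hvw] at h2 h1 ⊢
    omega

/-- The node on top of the stack is finished when all of its arcs have been scanned. -/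
theorem pop (h : DfsInv I p vis cur stk ord (sp + 1) cnt)
    (hc : I.off (stk sp + 1) ≤ cur (stk sp)) :
    DfsInv I p vis cur stk (Function.update ord cnt (stk sp)) sp (cnt + 1) := by
  have hord : ∀ j < cnt, Function.update ord cnt (stk sp) j = ord j := fun j hj =>
    Function.update_of_ne (by omega) _ _
  have hnew : Function.update ord cnt (stk sp) cnt = stk sp := Function.update_self _ _ _
  have hmem := h.stk_mem sp (by omega)
  refine ⟨h.vis_le, h.vis_out, h.cur_mem, h.scanned, fun j hj => h.stk_mem j (by omega), ?_,
    fun j hj j' hj' => h.stk_inj j (by omega) j' (by omega), ?_, ?_, ?_,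
    fun j j' h1 h2 => h.path j j' h1 (by omega), ?_, by have := h.count; omega⟩
  · intro j hj
    rcases Nat.lt_succ_iff_lt_or_eq.mp hj with hj | rfl
    · rw [hord j hj]; exact h.ord_mem j hj
    · rw [hnew]; exact hmem
  · intro j hj j' hj' heq
    rcases Nat.lt_succ_iff_lt_or_eq.mp hj with hj | rfl <;>
      rcases Nat.lt_succ_iff_lt_or_eq.mp hj' with hj' | rfl
    · rw [hord j hj, hord j' hj'] at heq; exact h.ord_inj j hj j' hj' heq
    · rw [hord j hj, hnew] at heq; exact absurd heq.symm (h.disj sp (by omega) j hj)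
    · rw [hord j' hj', hnew] at heq; exact absurd heq (h.disj sp (by omega) j' hj')
    · rfl
  · intro j hj j' hj'
    rcases Nat.lt_succ_iff_lt_or_eq.mp hj' with hj' | rfl
    · rw [hord j' hj']; exact h.disj j (by omega) j' hj'
    · rw [hnew]; intro heq
      have := h.stk_inj j (by omega) sp (by omega) heq
      omega
  · intro v hv h1
    rcases h.cover v hv h1 with ⟨j, hj, heq⟩ | ⟨j, hj, heq⟩
    · rcases Nat.lt_succ_iff_lt_or_eq.mp hj with hj | rfl
      · exact Or.inl ⟨j, hj, heq⟩
      · exact Or.inr ⟨cnt, by omega, by rw [hnew, heq]⟩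
    · exact Or.inr ⟨j, by omega, by rw [hord j hj, heq]⟩
  · intro i hi b hb
    rcases Nat.lt_succ_iff_lt_or_eq.mp hi with hi | rfl
    · rw [hord i hi] at hb
      rcases h.fin i hi b hb with ⟨j, hj, heq, hr⟩ | ⟨j, hj, heq, hr⟩
      · refine Or.inl ⟨j, by omega, by rw [hord j hj, heq], fun i' h1 h2 => ?_⟩
        rw [hord i' (by omega)]; exact hr i' h1 h2
      · have key : ∀ i', i ≤ i' → i' < cnt + 1 →
            I.ReachLE p b (Function.update ord cnt (stk sp) i') := by
          intro i' h1 h2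
          rcases Nat.lt_succ_iff_lt_or_eq.mp h2 with h2 | rfl
          · rw [hord i' h2]; exact hr i' h1 h2
          · rw [hnew, ← heq]; exact h.path j sp (by omega) (by omega)
        rcases Nat.lt_succ_iff_lt_or_eq.mp hj with hj | rfl
        · exact Or.inr ⟨j, hj, heq, key⟩
        · exact Or.inl ⟨cnt, by omega, by rw [hnew, heq], fun i' h1 h2 => key i' h1 (by omega)⟩
    · rw [hnew] at hb
      obtain ⟨⟨-, e, h1, h2, rfl⟩, hp1, hp2⟩ := hb
      have hb' : vis (I.tgt e) ≠ 0 := h.scanned _ hmem.1 hp1 e h1 (by omega)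
      have htn : I.tgt e < I.n := I.tgt_lt e (h2.trans_le (Inst.off_le_m hmem.1))
      have hb1 := h.vis_le _ htn hp2
      rcases h.cover _ htn (by omega) with ⟨j, hj, heq⟩ | ⟨j, hj, heq⟩
      · rcases Nat.lt_succ_iff_lt_or_eq.mp hj with hj | rfl
        · refine Or.inr ⟨j, hj, heq, fun i' h3 h4 => ?_⟩
          obtain rfl : i' = i := by omega
          rw [hnew, ← heq]; exact h.path j sp (by omega) (by omega)
        · refine Or.inl ⟨i, by omega, by rw [hnew, heq], fun i' h3 h4 => ?_⟩
          obtain rfl : i' = i := by omega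
          rw [hnew, heq]; exact .refl
      · exact Or.inl ⟨j, by omega, by rw [hord j hj, heq], fun i' h3 h4 => by omega⟩

end DfsInv

/-- The finishing order of a depth-first search of the nodes of priority at most `p`. If `b` is
finished after the tail of an arc `ab`, then `b` reaches all nodes that are finished between `a`
and `b`. -/
structure IsFinishOrder (I : Inst) (p : ℕ) (ord : ℕ → ℕ) (cnt : ℕ) : Prop where
  le : cnt ≤ I.n
  mem : ∀ j < cnt, ord j < I.n ∧ I.pri (ord j) ≤ p
  inj : ∀ j < cnt, ∀ j' < cnt, ord j = ord j' → j = j'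
  cover : ∀ v < I.n, I.pri v ≤ p → ∃ j < cnt, ord j = v
  fin : ∀ i < cnt, ∀ b, I.ArcLE p (ord i) b →
    ∃ j < cnt, ord j = b ∧ ∀ i', i ≤ i' → i' ≤ j → I.ReachLE p b (ord i')

theorem DfsInv.isFinishOrder {I : Inst} {p : ℕ} {vis cur stk ord : ℕ → ℕ} {cnt : ℕ}
    (h : DfsInv I p vis cur stk ord 0 cnt) (hv : ∀ v < I.n, vis v ≠ 0) :
    IsFinishOrder I p ord cnt := by
  refine ⟨by have := h.count; omega, fun j hj => ⟨(h.ord_mem j hj).1, ?_⟩, h.ord_inj, ?_, ?_⟩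
  · exact h.pri_le (h.ord_mem j hj).1 (h.ord_mem j hj).2.le
  · intro v hvn hp
    have := h.vis_le v hvn hp
    have := hv v hvn
    rcases h.cover v hvn (by omega) with ⟨j, hj, -⟩ | hj
    · omega
    · exact hj
  · intro i hi b hb
    rcases h.fin i hi b hb with h1 | ⟨j, hj, -⟩
    · exact h1
    · omega

/-- `x` reaches `ord k` by a path of nodes that are not finished after `ord k`. -/
def Within (I : Inst) (p : ℕ) (ord : ℕ → ℕ) (k x : ℕ) : Prop :=
  Relation.ReflTransGen (fun x y => I.ArcLE p x y ∧ ∃ j ≤ k, ord j = x) x (ord k)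

theorem Within.reach {I : Inst} {p : ℕ} {ord : ℕ → ℕ} {k x : ℕ} (h : Within I p ord k x) :
    I.ReachLE p x (ord k) :=
  h.lift id fun _ _ hxy => hxy.1

/-- The nodes found by the backward search from `ord k` belong to its component. -/
theorem IsFinishOrder.reach_of_within {I : Inst} {p : ℕ} {ord : ℕ → ℕ} {cnt k x : ℕ}
    (ho : IsFinishOrder I p ord cnt) (hk : k < cnt) (h : Within I p ord k x) :
    I.ReachLE p (ord k) x := by
  have key : ∃ j ≤ k, ord j = x ∧ ∀ i, j ≤ i → i ≤ k → I.ReachLE p (ord k) (ord i) := by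
    unfold Within at h
    induction h using Relation.ReflTransGen.head_induction_on with
    | refl =>
      refine ⟨k, le_rfl, rfl, fun i h1 h2 => ?_⟩
      obtain rfl : i = k := by omega
      exact .refl
    | head hxy _ ih =>
      obtain ⟨j, hj, rfl, hr⟩ := ih
      obtain ⟨harc, jx, hjx, rfl⟩ := hxy
      refine ⟨jx, hjx, rfl, fun i h1 h2 => ?_⟩
      obtain ⟨j', hj', heq, hr'⟩ := ho.fin jx (by omega) _ harc
      obtain rfl := ho.inj j' hj' j (by omega) heq
      rcases le_or_gt i j' with h3 | h3
      · exact (hr j' le_rfl hj).trans (hr' i h1 h3)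
      · exact hr i h3.le h2
  obtain ⟨j, hj, rfl, hr⟩ := key
  exact hr j le_rfl hj

/-- `Φ` numbers the strongly connected components of the subgraph induced by the nodes of priority
at most `p` in a topological order; the other nodes have number `0`. -/
structure IsSccOrder (I : Inst) (p : ℕ) (Φ : ℕ → ℕ) : Prop where
  out : ∀ v < I.n, p < I.pri v → Φ v = 0
  pos : ∀ v < I.n, I.pri v ≤ p → 1 ≤ Φ v
  le : ∀ v < I.n, Φ v ≤ I.n
  mono : ∀ v w, I.ArcLE p v w → Φ w ≤ Φ v
  eq : ∀ v w, I.ArcLE p v w → Φ w = Φ v → I.ReachLE p w v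

/-- The invariant of the backward searches from `ord (cnt - 1), …, ord k`, in this order. Found
nodes have `vis v = 2` and are put into the queue `Q`; the arcs entering the first `hd` of them have
been scanned. -/
structure SearchInv (I : Inst) (p : ℕ) (ord : ℕ → ℕ) (cnt : ℕ) (vis Φ Q : ℕ → ℕ) (k hd tl : ℕ) :
    Prop where
  vis_mem : ∀ v < I.n, vis v = 1 ∨ vis v = 2
  vis_out : ∀ v < I.n, p < I.pri v → vis v = 2 ∧ Φ v = 0
  later : ∀ j, k < j → j < cnt → vis (ord j) = 2
  marked : ∀ v < I.n, I.pri v ≤ p → vis v = 2 →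
    k + 1 ≤ Φ v ∧ Φ v ≤ cnt ∧ Within I p ord (Φ v - 1) v ∧ ∃ j < tl, Q j = v
  hd_le : hd ≤ tl
  queue : ∀ j < tl, Q j < I.n ∧ I.pri (Q j) ≤ p ∧ vis (Q j) = 2
  inj : ∀ j < tl, ∀ j' < tl, Q j = Q j' → j = j'
  pending : ∀ j, hd ≤ j → j < tl → Φ (Q j) = k + 1
  closed : ∀ j < hd, ∀ x, I.ArcLE p x (Q j) → vis x = 2 ∧ Φ (Q j) ≤ Φ x
  count : (∑ v ∈ Finset.range I.n, if vis v = 1 then 1 else 0) + tl ≤ I.n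

namespace SearchInv

variable {I : Inst} {p : ℕ} {ord : ℕ → ℕ} {cnt : ℕ} {vis Φ Q : ℕ → ℕ} {k hd tl : ℕ}

/-- A node that is found. -/
theorem mark (h : SearchInv I p ord cnt vis Φ Q k hd tl) {x : ℕ} (hx : x < I.n) (hv : vis x = 1)
    (hk : k < cnt) (hw : Within I p ord k x) :
    SearchInv I p ord cnt (Function.update vis x 2) (Function.update Φ x (k + 1))
      (Function.update Q tl x) k hd (tl + 1) := by
  have hp : I.pri x ≤ p := by
    by_contra hlt
    have := (h.vis_out x hx (by omega)).1; omega
  have hQ : ∀ j < tl, Function.update Q tl x j = Q j := fun j hj =>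
    Function.update_of_ne (by omega) _ _
  have hnew : Function.update Q tl x tl = x := Function.update_self _ _ _
  have hvis : ∀ v, vis v = 2 → Function.update vis x 2 v = 2 := fun v hv => by
    rw [Function.update_apply]; split_ifs <;> simp [hv]
  have hΦ : ∀ v, vis v = 2 → Function.update Φ x (k + 1) v = Φ v := fun v hv' =>
    Function.update_of_ne (by rintro rfl; omega) _ _
  have hQx : ∀ j < tl, Q j ≠ x := fun j hj heq => by
    have := (h.queue j hj).2.2; rw [heq] at this; omega
  have hhd := h.hd_le
  refine ⟨?_, ?_, fun j h1 h2 => hvis _ (h.later j h1 h2), ?_, by omega, ?_, ?_, ?_, ?_, ?_⟩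
  · intro v hvn
    rw [Function.update_apply]; split_ifs
    · exact Or.inr rfl
    · exact h.vis_mem v hvn
  · intro v hvn hpv
    obtain ⟨h1, h2⟩ := h.vis_out v hvn hpv
    rw [hΦ v h1]; exact ⟨hvis v h1, h2⟩
  · intro v hvn hpv h2
    by_cases hvx : v = x
    · subst hvx
      rw [Function.update_self]
      exact ⟨le_rfl, hk, hw, tl, by omega, hnew⟩
    · rw [Function.update_of_ne hvx] at h2 ⊢
      obtain ⟨h3, h4, h5, j, hj, h6⟩ := h.marked v hvn hpv h2
      exact ⟨h3, h4, h5, j, by omega, by rw [hQ j hj, h6]⟩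
  · intro j hj
    rcases Nat.lt_succ_iff_lt_or_eq.mp hj with hj | rfl
    · rw [hQ j hj]; obtain ⟨h1, h2, h3⟩ := h.queue j hj; exact ⟨h1, h2, hvis _ h3⟩
    · rw [hnew]; exact ⟨hx, hp, Function.update_self _ _ _⟩
  · intro j hj j' hj' heq
    rcases Nat.lt_succ_iff_lt_or_eq.mp hj with hj | rfl <;>
      rcases Nat.lt_succ_iff_lt_or_eq.mp hj' with hj' | rfl
    · rw [hQ j hj, hQ j' hj'] at heq; exact h.inj j hj j' hj' heq
    · rw [hQ j hj, hnew] at heq; exact absurd heq (hQx j hj)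
    · rw [hQ j' hj', hnew] at heq; exact absurd heq.symm (hQx j' hj')
    · rfl
  · intro j h1 h2
    rcases Nat.lt_succ_iff_lt_or_eq.mp h2 with h2 | rfl
    · rw [hQ j h2, hΦ _ (h.queue j h2).2.2]; exact h.pending j h1 h2
    · rw [hnew, Function.update_self]
  · intro j hj y hy
    rw [hQ j (by omega)] at hy ⊢
    obtain ⟨h1, h2⟩ := h.closed j hj y hy
    rw [hΦ y h1, hΦ _ (h.queue j (by omega)).2.2]
    exact ⟨hvis y h1, h2⟩
  · have h1 := h.count
    have h2 := sum_update (f := vis) (y := 2) (fun _ x => if x = 1 then 1 else 0) hx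
    simp [hv] at h2 h1 ⊢
    omega

/-- All arcs that enter the next node of the queue have been scanned. -/
theorem dequeue (h : SearchInv I p ord cnt vis Φ Q k hd tl) (hlt : hd < tl)
    (hcl : ∀ x, I.Arc x (Q hd) → vis x = 2) : SearchInv I p ord cnt vis Φ Q k (hd + 1) tl := by
  refine { h with hd_le := hlt, pending := fun j h1 h2 => h.pending j (by omega) h2,
                  closed := fun j hj x hx => ?_ }
  rcases Nat.lt_succ_iff_lt_or_eq.mp hj with hj | rfl
  · exact h.closed j hj x hx
  · have h2 := hcl x hx.1
    rw [h.pending j le_rfl hlt]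
    exact ⟨h2, (h.marked x hx.1.1 hx.2.1 h2).1⟩

/-- The search from `ord k` is complete. -/
theorem next (h : SearchInv I p ord cnt vis Φ Q (k + 1) tl tl) (hk : vis (ord (k + 1)) = 2) :
    SearchInv I p ord cnt vis Φ Q k tl tl := by
  refine { h with later := fun j h1 h2 => ?_, marked := fun v hv hp h2 => ?_,
                  pending := fun j h1 h2 => absurd h2 (by omega) }
  · rcases (show k + 1 ≤ j from h1).lt_or_eq with h3 | rfl
    · exact h.later j h3 h2
    · exact hk
  · obtain ⟨h3, h4, h5, h6⟩ := h.marked v hv hp h2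
    exact ⟨by omega, h4, h5, h6⟩

theorem within_of_arc (h : SearchInv I p ord cnt vis Φ Q k hd tl)
    (ho : IsFinishOrder I p ord cnt) (hlt : hd < tl) {x : ℕ} (hx : I.Arc x (Q hd))
    (hv : vis x = 1) : Within I p ord k x := by
  obtain ⟨h1, h2, h3⟩ := h.queue hd hlt
  have hΦ := h.pending hd le_rfl hlt
  have hw := (h.marked _ h1 h2 h3).2.2.1
  rw [hΦ] at hw
  have hp : I.pri x ≤ p := by
    by_contra hlt
    have := (h.vis_out x hx.1 (by omega)).1; omega
  obtain ⟨j, hj, rfl⟩ := ho.cover x hx.1 hp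
  refine Relation.ReflTransGen.head ⟨⟨hx, hp, h2⟩, j, ?_, rfl⟩ hw
  by_contra hlt
  have := h.later j (by omega) hj
  omega

theorem isSccOrder (h : SearchInv I p ord cnt vis Φ Q 0 tl tl) (ho : IsFinishOrder I p ord cnt)
    (h0 : 0 < cnt → vis (ord 0) = 2) : IsSccOrder I p Φ := by
  have hall : ∀ v < I.n, I.pri v ≤ p → vis v = 2 := by
    intro v hv hp
    obtain ⟨j, hj, rfl⟩ := ho.cover v hv hp
    rcases Nat.eq_zero_or_pos j with rfl | hpos
    · exact h0 hj
    · exact h.later j hpos hj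
  refine ⟨fun v hv hp => (h.vis_out v hv hp).2, ?_, ?_, ?_, ?_⟩
  · intro v hv hp
    exact (h.marked v hv hp (hall v hv hp)).1
  · intro v hv
    rcases le_or_gt (I.pri v) p with hp | hp
    · exact (h.marked v hv hp (hall v hv hp)).2.1.trans ho.le
    · rw [(h.vis_out v hv hp).2]; exact Nat.zero_le _
  · intro v w hvw
    have hw := hvw.1.lt
    obtain ⟨-, -, -, j, hj, rfl⟩ := h.marked w hw hvw.2.2 (hall w hw hvw.2.2)
    exact (h.closed j hj v hvw).2
  · intro v w hvw heq
    have hw := hvw.1.lt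
    obtain ⟨h1, h2, h3, -⟩ := h.marked w hw hvw.2.2 (hall w hw hvw.2.2)
    obtain ⟨h4, h5, h6, -⟩ := h.marked v hvw.1.1 hvw.2.1 (hall v hvw.1.1 hvw.2.1)
    rw [← heq] at h6
    exact h3.reach.trans (ho.reach_of_within (by omega) h6)

end SearchInv

end WordRAM

namespace WordRAM
open Exp Prog

/-! ### Depth-first search on the word RAM -/

/-- Prepare the arrays `23` (`vis`) and `24` (`cur`) for a depth-first search of the nodes of
priority at most the content of register `15`. -/
def dfsResetProg : Prog :=
  assign 17 (lit 0) ;;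
  Prog.for 17 0 (ite (cell 2 (reg 17) -ₑ reg 15) (store 23 (reg 17) (lit 2))
    (store 23 (reg 17) (lit 0)) ;; store 24 (reg 17) (cell 0 (reg 17)))

/-- One step of a depth-first search with stack in array `25` and finishing order in array `26`. -/
def dfsStepProg : Prog :=
  assign 24 (cell 25 (reg 18 -ₑ lit 1)) ;; assign 25 (cell 24 (reg 24)) ;;
  ite (cell 0 (reg 24 +ₑ lit 1) -ₑ reg 25)
    (store 24 (reg 24) (reg 25 +ₑ lit 1) ;; assign 26 (cell 1 (reg 25)) ;;
      ite (cell 23 (reg 26)) .skip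
        (store 23 (reg 26) (lit 1) ;; store 25 (reg 18) (reg 26) ;;
          assign 18 (reg 18 +ₑ lit 1)))
    (assign 18 (reg 18 -ₑ lit 1) ;; store 26 (reg 16) (reg 24) ;;
      assign 16 (reg 16 +ₑ lit 1))

/-- Depth-first search. -/
def dfsProg : Prog :=
  dfsResetProg ;; assign 16 (lit 0) ;; assign 17 (lit 0) ;;
  Prog.for 17 0 (ite (cell 23 (reg 17)) .skip
    (store 23 (reg 17) (lit 1) ;; store 25 (lit 0) (reg 17) ;; assign 18 (lit 1) ;;
      .while (reg 18) dfsStepProg))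

variable {I : Inst} {W p : ℕ}

theorem dfsResetProg_does (hW : I.Bounded W) {s : State} (hs : Static I s) (hp : s.reg 15 = p)
    (hpd : p ≤ I.d) :
    Does W dfsResetProg s (40 * I.n + 20) fun s' => Same [17] [23, 24] s s' ∧
      ∀ v < I.n, s'.arr 23 v = (if p < I.pri v then 2 else 0) ∧ s'.arr 24 v = I.off v := by
  have w1 := hW.lin
  unfold Does dfsResetProg
  simp
  refine (Does.for (N := I.n) (i := 0) 20
    (I := fun j s' => Same [17] [23, 24] s s' ∧
      ∀ v < j, s'.arr 23 v = (if p < I.pri v then 2 else 0) ∧ s'.arr 24 v = I.off v)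
    (by simp) (by simpa using hs.reg0) (by omega) (by omega) (by simp) ?_).runs (by omega) ?_
  · rintro j s₁ - hj h17 h0 ⟨hf, hI⟩
    have a2 : s₁.arr 2 = I.pri := by rw [hf.2 2 (by simp), hs.arr2]
    have a0 : s₁.arr 0 = I.off := by rw [hf.2 0 (by simp), hs.arr0]
    have r15 : s₁.reg 15 = p := by rw [hf.1 15 (by simp), hp]
    have hpri := I.pri_le j hj
    have hoff := Inst.off_le_m (I := I) hj.le
    unfold Does
    simp [h17, h0, hf, a2, a0, r15]
    and_intros
    all_goals try omega
    all_goals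
      intro hlt
      and_intros
      all_goals try omega
      intro v hv
      simp only [Function.update_apply]
      by_cases h : v = j
      · subst h; simp; omega
      · simp only [if_neg h]; exact hI v (by omega)
  · rintro s₁ T₁ ⟨-, -, hs, hI⟩ -
    exact ⟨hs, hI⟩

/-- The number of arcs that a depth-first search still has to scan. -/
def Inst.unscanned (I : Inst) (cur : ℕ → ℕ) : ℕ :=
  ∑ v ∈ Finset.range I.n, (I.off (v + 1) - cur v)

/-- The number of unvisited nodes. -/
def Inst.unvisited (I : Inst) (vis : ℕ → ℕ) : ℕ :=
  ∑ v ∈ Finset.range I.n, if vis v = 0 then 1 else 0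

theorem Inst.unscanned_update {cur : ℕ → ℕ} {v : ℕ} (hv : v < I.n) (hc : cur v < I.off (v + 1)) :
    I.unscanned (Function.update cur v (cur v + 1)) + 1 = I.unscanned cur := by
  have := sum_update (f := cur) (y := cur v + 1) (fun u x => I.off (u + 1) - x) hv
  unfold Inst.unscanned
  omega

theorem Inst.unvisited_update {vis : ℕ → ℕ} {v : ℕ} (hv : v < I.n) (h0 : vis v = 0) :
    I.unvisited (Function.update vis v 1) + 1 = I.unvisited vis := by
  have := sum_update (f := vis) (y := 1) (fun _ x => if x = 0 then 1 else 0) hv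
  simp only [h0] at this
  unfold Inst.unvisited
  simpa using this

/-- The state of the memory during a depth-first search that was started in the state `s₀`. -/
structure DfsState (I : Inst) (p r : ℕ) (s₀ s : State) (sp cnt : ℕ) : Prop where
  same : Same [16, 17, 18, 24, 25, 26] [23, 24, 25, 26] s₀ s
  inv : DfsInv I p (s.arr 23) (s.arr 24) (s.arr 25) (s.arr 26) sp cnt
  reg16 : s.reg 16 = cnt
  reg17 : s.reg 17 = r
  seen : ∀ v < r, s.arr 23 v ≠ 0

/-- The invariant of the loop that searches from one root `r`; `T` is the remaining budget. -/
structure DfsLoop (I : Inst) (p r c : ℕ) (s₀ s : State) (T : ℕ) : Prop where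
  state : ∃ sp cnt, DfsState I p r s₀ s sp cnt ∧ s.reg 18 = sp ∧
    60 * I.unscanned (s.arr 24) + 60 * (2 * I.unvisited (s.arr 23) + sp) + c + 2 ≤ T
  root : s.arr 23 r ≠ 0

/-- The search from one root. A step either scans an arc, or pushes and later pops a node, so that
the weights `1` of the unscanned arcs, `2` of the unvisited nodes and `1` of the nodes on the stack
bound the number of steps. -/
theorem dfsLoop_runs (hW : I.Bounded W) {s₀ s : State} (hs : Static I s₀) {r T c sp cnt : ℕ}
    (hD : DfsState I p r s₀ s sp cnt) (h18 : s.reg 18 = sp) {Q : State → ℕ → Prop}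
    (hT : 60 * I.unscanned (s.arr 24) + 60 * (2 * I.unvisited (s.arr 23) + sp) + c + 2 ≤ T)
    (hr : s.arr 23 r ≠ 0)
    (hQ : ∀ s' T' cnt', DfsState I p r s₀ s' 0 cnt' → s'.arr 23 r ≠ 0 →
      60 * I.unscanned (s'.arr 24) + 60 * (2 * I.unvisited (s'.arr 23)) + c ≤ T' → Q s' T') :
    Runs W (.while (reg 18) dfsStepProg) Q s T := by
  have w1 := hW.lin
  refine Runs.while (I := DfsLoop I p r c s₀) ⟨⟨sp, cnt, hD, h18, hT⟩, hr⟩ ?_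
  clear hD h18 hT hr
  rintro s T ⟨⟨sp, cnt, hD, h18, hT⟩, hr⟩
  obtain ⟨hf, hI, h16, h17, hseen⟩ := hD
  have hcount := hI.count
  have hspc : sp + cnt ≤ I.n := by omega
  simp only [Exp.Fits, Exp.cost, Exp.val, h18]
  refine ⟨by omega, by omega, fun hne => ?_, fun h0 => ?_⟩
  · obtain ⟨k, rfl⟩ := Nat.exists_eq_succ_of_ne_zero hne
    have a0 : s.arr 0 = I.off := by rw [hf.2 0 (by simp), hs.arr0]
    have a1 : s.arr 1 = I.tgt := by rw [hf.2 1 (by simp), hs.arr1]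
    have hmem := hI.stk_mem k (by omega)
    obtain ⟨hvn, hv1⟩ := hmem
    set v := s.arr 25 k with hv
    have hcur := hI.cur_mem v hvn
    have hoff := Inst.off_le_m (I := I) (v := v + 1) hvn
    have hpv := hI.pri_le hvn (by omega)
    unfold dfsStepProg
    simp [h18, ← hv, a0, a1, h16]
    and_intros
    all_goals try omega
    · intro hlt
      have hlt' : s.arr 24 v < I.off (v + 1) := by omega
      have ht := I.tgt_lt (s.arr 24 v) (by omega)
      have hun := Inst.unscanned_update hvn hlt'
      and_intros
      all_goals try omega
      · by_cases hp : I.pri (I.tgt (s.arr 24 v)) ≤ p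
        · have := hI.vis_le _ ht hp; omega
        · have := hI.vis_out _ ht (by omega); omega
      · intro hw
        refine ⟨by omega, ⟨_, cnt, ⟨by simpa using hf, ?_, by simpa using h16, by simpa using h17,
          by simpa using hseen⟩, by simpa using h18, by simp; omega⟩, by simpa using hr⟩
        simpa using hI.advance hvn hlt' hw
      · intro hw
        have hun2 := Inst.unvisited_update ht hw
        and_intros
        all_goals try omega
        refine ⟨⟨k + 1 + 1, cnt, ⟨by simpa using hf, ?_, by simpa using h16, by simpa using h17,
          ?_⟩, by simp, by simp; omega⟩, ?_⟩
        · have h1 := hI.push ht hw fun j hj =>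
            (hI.path j k (by omega) (by omega)).tail ⟨⟨hvn, _, hcur.1, hlt', rfl⟩, hpv,
              hI.pri_le ht (by omega)⟩
          have h2 := h1.advance hvn hlt' (by simp)
          simpa using h2
        · intro u hu
          simp only [State.setReg_arr, State.setCell_arr]
          simp [Function.update_apply]
          split_ifs <;> simp [hseen u hu]
        · simp [Function.update_apply]; split_ifs <;> simp [hr]
    · intro hge
      and_intros
      all_goals try omega
      refine ⟨⟨k, cnt + 1, ⟨by simpa using hf, ?_, by simp, by simpa using h17,
        by simpa using hseen⟩, by simp, by simp; omega⟩, by simpa using hr⟩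
      have := hI.pop (by rw [← hv]; omega)
      rw [← hv] at this
      simpa using this
  · subst h0
    exact hQ s _ cnt ⟨hf, hI, h16, h17, hseen⟩ hr (by omega)

/-- The invariant of the loop over all roots; `T` is the remaining budget. -/
structure DfsRoots (I : Inst) (p : ℕ) (s₀ : State) (r : ℕ) (s : State) (T : ℕ) : Prop where
  state : ∃ cnt, DfsState I p r s₀ s 0 cnt
  time : 60 * I.unscanned (s.arr 24) + 60 * (2 * I.unvisited (s.arr 23)) + 100 * (I.n - r) + 10 ≤ T

theorem dfsProg_does (hW : I.Bounded W) {s : State} (hs : Static I s) (hp : s.reg 15 = p)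
    (hpd : p ≤ I.d) :
    Does W dfsProg s (300 * I.n + 60 * I.m + 100) fun s' =>
      Same [16, 17, 18, 24, 25, 26] [23, 24, 25, 26] s s' ∧
      IsFinishOrder I p (s'.arr 26) (s'.reg 16) ∧
      ∀ v < I.n, s'.arr 23 v = if p < I.pri v then 2 else 1 := by
  have w1 := hW.lin
  unfold Does dfsProg
  rw [runs_seq]
  refine (dfsResetProg_does hW hs hp hpd).runs (by omega) fun s₁ T₁ ⟨f1, p1⟩ hT₁ => ?_
  have hsum : I.unscanned (s₁.arr 24) = I.m := by
    have : ∀ k ≤ I.n, ∑ v ∈ Finset.range k, (I.off (v + 1) - s₁.arr 24 v) = I.off k := by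
      intro k
      induction k with
      | zero => intro _; simp [I.off_zero]
      | succ k ih =>
        intro hk
        rw [Finset.sum_range_succ, ih (by omega), (p1 k (by omega)).2]
        have := I.off_mono k (by omega)
        omega
    rw [← I.off_last, ← this I.n le_rfl]
    rfl
  have hunv : I.unvisited (s₁.arr 23) ≤ I.n := by
    unfold Inst.unvisited
    refine (Finset.sum_le_sum (g := fun _ => 1) fun v _ => ?_).trans (by simp)
    split_ifs <;> omega
  have hinv : DfsInv I p (s₁.arr 23) (s₁.arr 24) (s₁.arr 25) (s₁.arr 26) 0 0 := by
    have hv1 : ∀ v < I.n, s₁.arr 23 v ≠ 1 := fun v hv => by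
      rw [(p1 v hv).1]; split_ifs <;> omega
    refine ⟨?_, ?_, ?_, ?_, by simp, by simp, by simp, by simp, by simp, ?_, by simp, by simp, ?_⟩
    · intro v hv h; rw [(p1 v hv).1, if_neg (by omega)]; omega
    · intro v hv h; rw [(p1 v hv).1, if_pos (by omega)]
    · intro v hv; rw [(p1 v hv).2]; exact ⟨le_rfl, I.off_mono v hv⟩
    · intro v hv _ e h1 h2; rw [(p1 v hv).2] at h2; omega
    · intro v hv h; exact absurd h (hv1 v hv)
    · unfold Inst.unvisited at hunv; omega
  simp
  and_intros
  all_goals try omega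
  refine Runs.for (N := I.n) (i := 0)
    (I := DfsRoots I p s)
    (by simp) (by simp; rw [f1.1 0 (by simp), hs.reg0]) (by omega) (by omega) ?_ ?_ ?_
  · refine ⟨⟨0, ?_, by simpa using hinv, by simp, by simp, by simp⟩, by simp; omega⟩
    simp
    exact f1.weaken (by simp) (by simp)
  · rintro r s₂ T hr hrn h17 h0 ⟨⟨cnt, hD⟩, hT⟩
    obtain ⟨hf, hI, h16, -, hseen⟩ := hD
    have hcount := hI.count
    refine ⟨by omega, ?_⟩
    simp only [runs_ite, runs_skip]
    simp [h17]
    have hvis : s₂.arr 23 r ≤ 2 := by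
      by_cases hp : I.pri r ≤ p
      · have := hI.vis_le _ hrn hp; omega
      · have := hI.vis_out _ hrn (by omega); omega
    and_intros
    all_goals try omega
    · intro hne
      and_intros
      all_goals try omega
      refine ⟨⟨cnt, by simpa using hf, by simpa using hI, by simpa using h16, by simp, ?_⟩,
        by simp; omega⟩
      intro v hv
      simp
      rcases Nat.lt_succ_iff_lt_or_eq.mp hv with hv | rfl
      · exact hseen v hv
      · exact hne
    · intro hz
      have hun := Inst.unvisited_update hrn hz
      and_intros
      all_goals try omega
      refine dfsLoop_runs (p := p) (r := r) (sp := 1) (cnt := cnt)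
        (c := 100 * (I.n - (r + 1)) + 20) hW hs ?_ (by simp)
        (by simp; omega) (by simp) ?_
      · refine ⟨by simpa using hf, ?_, by simpa using h16, by simpa using h17, ?_⟩
        · have := hI.push hrn hz (by simp)
          simpa using this
        · intro v hv
          simp only [State.setReg_arr, State.setCell_arr]
          simp [Function.update_apply]
          split_ifs <;> simp [hseen v hv]
      · rintro s₃ T₃ cnt' hD' hr' hT'
        have h30 : s₃.reg 0 = I.n := by rw [hD'.same.1 0 (by simp), hs.reg0]
        refine ⟨hD'.reg17, h30, by omega,
          ⟨cnt', by simpa using hD'.same, by simpa using hD'.inv, by simpa using hD'.reg16, by simp,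
            ?_⟩, by simp; omega⟩
        intro v hv
        simp
        rcases Nat.lt_succ_iff_lt_or_eq.mp hv with hv | rfl
        · exact hD'.seen v hv
        · exact hr'
  · rintro s₂ T - - ⟨⟨cnt, hD⟩, hT⟩
    refine ⟨by omega, hD.same, ?_, fun v hv => ?_⟩
    · rw [hD.reg16]; exact hD.inv.isFinishOrder hD.seen
    · have := hD.seen v hv
      split_ifs with h
      · exact hD.inv.vis_out v hv h
      · have := hD.inv.vis_le v hv (by omega); omega

end WordRAM

namespace WordRAM
open Exp Prog

/-! ### Numbering the strongly connected components on the word RAM -/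

/-- The node in register `r` is found by the backward search number `k + 1`, where `k` is the
content of register `21`. Its number is stored in column `i` of the numberings in array `21`, where
`i` is the content of register `14`. -/
def markProg (r : ℕ) : Prog :=
  store 23 (reg r) (lit 2) ;;
  store 21 (reg r *ₑ reg 3 +ₑ (reg 6 +ₑ reg 14)) (reg 21 +ₑ lit 1) ;;
  store 27 (reg 20) (reg r) ;; assign 20 (reg 20 +ₑ lit 1)

/-- Find the tails of the arcs entering the node in register `24`. -/
def searchArcsProg : Prog :=
  .while (reg 25) (assign 26 (cell 13 (reg 25 -ₑ lit 1)) ;;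
    ite (lit 2 -ₑ cell 23 (reg 26)) (markProg 26) .skip ;; assign 25 (cell 12 (reg 25 -ₑ lit 1)))

/-- Process the queue of the backward search. -/
def searchQueueProg : Prog :=
  .while (reg 20 -ₑ reg 19) (assign 24 (cell 27 (reg 19)) ;; assign 25 (cell 11 (reg 24)) ;;
    searchArcsProg ;; assign 19 (reg 19 +ₑ lit 1))

/-- The backward searches, from the nodes in array `26` in reverse order. -/
def searchProg : Prog :=
  assign 19 (lit 0) ;; assign 20 (lit 0) ;; assign 21 (reg 16) ;;
  .while (reg 21) (assign 21 (reg 21 -ₑ lit 1) ;; assign 22 (cell 26 (reg 21)) ;;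
    ite (lit 2 -ₑ cell 23 (reg 22)) (markProg 22 ;; searchQueueProg) .skip)

/-- Number the strongly connected components of all subgraphs of bounded even priority. -/
def sccProg : Prog :=
  assign 14 (lit 0) ;;
  Prog.for 14 3 (assign 15 (reg 2 -ₑ (reg 14 +ₑ reg 14)) ;; dfsProg ;; searchProg)

variable {I : Inst} {W p i k : ℕ}

/-- The address, in array `21`, of the number of `v` in column `i`. -/
abbrev Inst.phi (I : Inst) (v i : ℕ) : ℕ := v * I.h + (I.n * I.h + i)

theorem Inst.phi_inj {v w i j : ℕ} (hi : i < I.h) (hj : j < I.h) (h : I.phi v i = I.phi w j) :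
    v = w ∧ i = j :=
  mul_add_inj (L := I.h) hi hj (by unfold Inst.phi at h; omega)

theorem Inst.phi_lt {v i : ℕ} (hv : v < I.n) (hi : i < I.h) : I.phi v i < 2 * (I.n * I.h) := by
  have := mul_add_lt hi hv
  unfold Inst.phi
  omega

theorem Inst.sum_length_inList (I : Inst) :
    ∑ u ∈ Finset.range I.n, (I.inList I.m u).length = I.m := by
  have : ∀ k ≤ I.m, ∑ u ∈ Finset.range I.n, (I.inList k u).length = k := by
    intro k
    induction k with
    | zero => intro _; simp [inList]
    | succ k ih =>
      intro hk
      have h1 : ∀ u, (I.inList (k + 1) u).length =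
          (I.inList k u).length + if I.tgt k = u then 1 else 0 := fun u => by
        rw [Inst.inList_succ]; split_ifs <;> simp
      simp only [h1, Finset.sum_add_distrib, ih (by omega)]
      simp [I.tgt_lt k (by omega)]
  exact this I.m le_rfl

/-- The time that suffices for processing the node `u` in the queue. -/
def Inst.arcWork (I : Inst) (u : ℕ) : ℕ := 40 * (I.inList I.m u).length + 40

/-- The time that suffices for the nodes that are still to be found or to be processed. -/
def Inst.searchWork (I : Inst) (vis Q : ℕ → ℕ) (hd tl : ℕ) : ℕ :=
  (∑ v ∈ Finset.range I.n, if vis v = 1 then I.arcWork v else 0) +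
    ∑ j ∈ Finset.Ico hd tl, I.arcWork (Q j)

/-- The state of the memory during the backward searches that were started in the state `s₀`. -/
structure SearchState (I : Inst) (p i cnt : ℕ) (s₀ : State) (k hd tl T : ℕ) (s : State) :
    Prop where
  same : Same [19, 20, 21, 22, 24, 25, 26] [21, 23, 27] s₀ s
  frame : ∀ a, (∀ v < I.n, a ≠ I.phi v i) → s.arr 21 a = s₀.arr 21 a
  inv : SearchInv I p (s₀.arr 26) cnt (s.arr 23) (fun v => s.arr 21 (I.phi v i)) (s.arr 27) k hd tl
  reg19 : s.reg 19 = hd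
  reg20 : s.reg 20 = tl
  time : I.searchWork (s.arr 23) (s.arr 27) hd tl ≤ T

theorem SearchState.tl_le {cnt hd tl T : ℕ} {s₀ s : State}
    (h : SearchState I p i cnt s₀ k hd tl T s) : tl ≤ I.n := by
  have := h.inv.count; omega

theorem SearchState.tl_lt {cnt hd tl T : ℕ} {s₀ s : State}
    (h : SearchState I p i cnt s₀ k hd tl T s) {x : ℕ} (hx : x < I.n) (h1 : s.arr 23 x = 1) :
    tl < I.n := by
  have h2 := h.inv.count
  have h3 := Finset.single_le_sum (f := fun v => if s.arr 23 v = 1 then 1 else 0)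
    (fun v _ => Nat.zero_le _) (Finset.mem_range.mpr hx)
  simp only [h1, if_true] at h3
  omega

theorem markProg_runs (hW : I.Bounded W) {s₀ s : State} (hs : Static I s₀) {cnt hd tl T T' r x : ℕ}
    (hr : r = 22 ∨ r = 26) (h14 : s₀.reg 14 = i) (hi : i < I.h) (h21 : s.reg 21 = k)
    (hk : k < cnt) (hcn : cnt ≤ I.n)
    (h : SearchState I p i cnt s₀ k hd tl T s) (hrx : s.reg r = x) (hx : x < I.n)
    (hv : s.arr 23 x = 1) (hw : Within I p (s₀.arr 26) k x) {Q : State → ℕ → Prop}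
    (hT' : 21 ≤ T')
    (hQ : ∀ s', SearchState I p i cnt s₀ k hd (tl + 1) T s' →
      (∀ r, r ≠ 20 → s'.reg r = s.reg r) → s'.arr 23 = Function.update (s.arr 23) x 2 →
      s'.arr 27 = Function.update (s.arr 27) tl x → Q s' (T' - 21)) :
    Runs W (markProg r) Q s T' := by
  have w1 := hW.lin
  have w2 := hW.nh
  have hd' := I.d_eq
  have htl := h.tl_lt hx hv
  have hphi := Inst.phi_lt hx hi
  have hb := mul_add_lt hi hx
  unfold Inst.phi at hphi
  have hr20 : r ≠ 20 := by omega
  have hr' : r ≠ 20 ∧ ¬ r = 21 := by omega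
  have h3 : s.reg 3 = I.h := by rw [h.same.1 3 (by simp), hs.reg3]
  have h6 : s.reg 6 = I.n * I.h := by rw [h.same.1 6 (by simp), hs.reg6]
  have h14' : s.reg 14 = i := by rw [h.same.1 14 (by simp), h14]
  unfold markProg
  simp [hrx, h3, h6, h14', h21, h.reg20]
  and_intros
  all_goals try omega
  have heq : T' - 3 - 11 - 3 - 4 = T' - 21 := by omega
  rw [heq]
  refine hQ _ ⟨by simpa using h.same, ?_, ?_, by simpa using h.reg19, by simp, ?_⟩
    (by intro r hr; simp [hr]) (by simp) (by simp)
  · intro a ha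
    simp
    rw [Function.update_of_ne (ha x hx)]
    exact h.frame a ha
  · have := h.inv.mark hx hv hk hw
    simp
    convert this using 1
    funext v
    simp only [Function.update_apply]
    by_cases hvx : v = x
    · simp [hvx]
    · rw [if_neg hvx, if_neg]
      intro heq
      exact hvx (Inst.phi_inj hi hi heq).1
  · refine le_of_eq_of_le ?_ h.time
    have h1 := sum_update (f := s.arr 23) (y := 2) (fun u y => if y = 1 then I.arcWork u else 0) hx
    simp [hv] at h1
    have h2 : ∑ j ∈ Finset.Ico hd tl, I.arcWork (Function.update (s.arr 27) tl x j) =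
        ∑ j ∈ Finset.Ico hd tl, I.arcWork (s.arr 27 j) := by
      refine Finset.sum_congr rfl fun j hj => ?_
      rw [Function.update_of_ne (by have := (Finset.mem_Ico.mp hj).2; omega)]
    unfold Inst.searchWork
    simp
    rw [Finset.sum_Ico_succ_top h.inv.hd_le, h2, Function.update_self]
    omega

/-- The invariant of the scan of the arcs entering `u`; `l` lists the arcs to be scanned. -/
structure SearchArcs (I : Inst) (p i cnt : ℕ) (s₀ : State) (k hd u z Tw c : ℕ) (s : State)
    (T : ℕ) :
    Prop where
  state : ∃ tl l, SearchState I p i cnt s₀ k hd tl Tw s ∧ hd < tl ∧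
    Chain (s₀.arr 12) (s.reg 25) l ∧ (∀ e ∈ l, e ∈ I.inList I.m u) ∧
    (∀ e ∈ I.inList I.m u, e ∉ l → s.arr 23 (s₀.arr 13 e) = 2) ∧ 40 * l.length + c + 2 ≤ T
  reg21 : s.reg 21 = k
  head : s.arr 27 hd = u
  root : s.arr 23 z = 2

theorem Inst.exists_tail {e : ℕ} (he : e < I.m) : ∃ v < I.n, I.off v ≤ e ∧ e < I.off (v + 1) := by
  have : ∀ k ≤ I.n, e < I.off k → ∃ v < k, I.off v ≤ e ∧ e < I.off (v + 1) := by
    intro k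
    induction k with
    | zero => intro _ h; rw [I.off_zero] at h; omega
    | succ k ih =>
      intro hk h
      by_cases h1 : e < I.off k
      · obtain ⟨v, hv, h2⟩ := ih (by omega) h1; exact ⟨v, by omega, h2⟩
      · exact ⟨k, by omega, by omega, h⟩
  exact this I.n le_rfl (by rw [I.off_last]; exact he)

theorem Static.arc_of_mem {s : State} (hs : Static I s) {u e : ℕ} (he : e ∈ I.inList I.m u) :
    I.Arc (s.arr 13 e) u := by
  obtain ⟨h1, h2⟩ := Inst.mem_inList.mp he
  obtain ⟨v, hv, h3, h4⟩ := Inst.exists_tail h1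
  rw [hs.src v hv e h3 h4]
  exact ⟨hv, e, h3, h4, h2⟩

theorem Static.exists_mem_of_arc {s : State} (hs : Static I s) {u v : ℕ} (h : I.Arc v u) :
    ∃ e ∈ I.inList I.m u, s.arr 13 e = v := by
  obtain ⟨hv, e, h1, h2, h3⟩ := h
  exact ⟨e, Inst.mem_inList.mpr ⟨h2.trans_le (Inst.off_le_m hv), h3⟩, hs.src v hv e h1 h2⟩

theorem searchArcsProg_runs (hW : I.Bounded W) {s₀ s : State} (hs : Static I s₀)
    (ho : IsFinishOrder I p (s₀.arr 26) (s₀.reg 16)) (h14 : s₀.reg 14 = i) (hi : i < I.h)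
    {hd u z Tw c T : ℕ} (hk : k < s₀.reg 16)
    (h : SearchArcs I p i (s₀.reg 16) s₀ k hd u z Tw c s T) {Q : State → ℕ → Prop}
    (hQ : ∀ s' T' tl, SearchState I p i (s₀.reg 16) s₀ k hd tl Tw s' → hd < tl →
      s'.reg 21 = k → s'.arr 27 hd = u → (∀ x, I.Arc x u → s'.arr 23 x = 2) →
      s'.arr 23 z = 2 → c ≤ T' → Q s' T') :
    Runs W searchArcsProg Q s T := by
  have w1 := hW.lin
  refine Runs.while (I := SearchArcs I p i (s₀.reg 16) s₀ k hd u z Tw c) h ?_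
  clear h
  rintro s T ⟨⟨tl, l, hS, hlt, hch, hsub, hdone, hT⟩, h21, hQu, hz⟩
  have hle := hch.le fun e he => (Inst.mem_inList.mp (hsub e he)).1
  simp only [Exp.Fits, Exp.cost, Exp.val]
  refine ⟨by omega, by omega, fun hne => ?_, fun h0 => ?_⟩
  · cases l with
    | nil => exact absurd hch hne
    | cons e l =>
      obtain ⟨h25, hch⟩ := hch
      rw [List.length_cons] at hT
      have hx := hs.arc_of_mem (hsub e (by simp))
      have hem := (Inst.mem_inList.mp (hsub e (by simp))).1
      have a13 : s.arr 13 = s₀.arr 13 := hS.same.2 13 (by simp)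
      have a12 : s.arr 12 = s₀.arr 12 := hS.same.2 12 (by simp)
      have hnx := hch.le fun e he => (Inst.mem_inList.mp (hsub e (by simp [he]))).1
      set x := s₀.arr 13 e with hxe
      have hxn := hx.1
      have hvis : s.arr 23 x = 1 ∨ s.arr 23 x = 2 := hS.inv.vis_mem x hxn
      have hdone' : s.arr 23 x = 2 → ∀ e' ∈ I.inList I.m u, e' ∉ l →
          s.arr 23 (s₀.arr 13 e') = 2 := by
        intro h2 e' he' hn
        by_cases hee : e' = e
        · rw [hee]; exact h2
        · exact hdone e' he' (by simp [hee, hn])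
      simp [h25, a13, ← hxe]
      and_intros
      all_goals try omega
      · intro h0
        refine markProg_runs (i := i) (p := p) (k := k) (cnt := s₀.reg 16) (x := x) hW hs
          (Or.inr rfl) h14
          hi (by simpa using h21) hk ho.le (s := s.setReg 26 x) (hd := hd) (tl := tl) (T := Tw)
          ?_ (by simp) hxn (by simp; omega) ?_ (by omega) ?_
        · exact ⟨by simpa using hS.same, hS.frame, hS.inv, by simpa using hS.reg19,
            by simpa using hS.reg20, hS.time⟩
        · refine hS.inv.within_of_arc ho hlt ?_ (by omega)
          rw [hQu]; exact hx
        · intro s' hS' hreg h23 h27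
          have h25' : s'.reg 25 = e + 1 := by rw [hreg 25 (by simp)]; simpa using h25
          have a12' : s'.arr 12 = s₀.arr 12 := hS'.same.2 12 (by simp)
          simp [h25', a12']
          and_intros
          all_goals try omega
          refine ⟨⟨tl + 1, l, ⟨by simpa using hS'.same, hS'.frame, hS'.inv,
            by simpa using hS'.reg19,
            by simpa using hS'.reg20, hS'.time⟩, by omega, by simpa using hch,
            fun e he => hsub e (by simp [he]), ?_, by omega⟩, ?_, ?_, ?_⟩
          · intro e' he' hn
            simp [h23, Function.update_apply]
            intro hne'
            by_cases hee : e' = e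
            · exact absurd (by rw [hee, hxe]) hne'
            · exact hdone e' he' (by simp [hee, hn])
          · simp [hreg, h21]
          · simp [h27]
            rw [Function.update_of_ne (by omega), hQu]
          · simp [h23, Function.update_apply, hz]
      · intro h0
        simp [a12]
        and_intros
        all_goals try omega
        refine ⟨⟨tl, l, ⟨by simpa using hS.same, hS.frame, hS.inv, by simpa using hS.reg19,
          by simpa using hS.reg20, hS.time⟩, hlt, by simpa using hch,
          fun e he => hsub e (by simp [he]), hdone' (by omega), by omega⟩, by simpa using h21,
          by simpa using hQu, by simpa using hz⟩
  · cases l with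
    | cons e l => rw [hch.1] at h0; omega
    | nil =>
      refine hQ s _ tl hS hlt h21 hQu ?_ hz (by omega)
      intro x hx
      obtain ⟨e, he, rfl⟩ := hs.exists_mem_of_arc hx
      exact hdone e he (by simp)

/-- The invariant of the loop over the queue. -/
structure SearchQueue (I : Inst) (p i cnt : ℕ) (s₀ : State) (k c z : ℕ) (s : State) (T : ℕ) :
    Prop where
  state : ∃ hd tl Tw, SearchState I p i cnt s₀ k hd tl Tw s ∧ Tw + c + 4 ≤ T
  reg21 : s.reg 21 = k
  root : s.arr 23 z = 2

theorem SearchState.dequeue_time {cnt hd tl T : ℕ} {s₀ s : State}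
    (h : SearchState I p i cnt s₀ k hd tl T s) (hlt : hd < tl) :
    I.arcWork (s.arr 27 hd) ≤ T ∧
    I.searchWork (s.arr 23) (s.arr 27) (hd + 1) tl ≤ T - I.arcWork (s.arr 27 hd) := by
  have := h.time
  unfold Inst.searchWork at this ⊢
  rw [Finset.sum_eq_sum_Ico_succ_bot hlt] at this
  omega

theorem searchQueueProg_runs (hW : I.Bounded W) {s₀ s : State} (hs : Static I s₀)
    (ho : IsFinishOrder I p (s₀.arr 26) (s₀.reg 16)) (h14 : s₀.reg 14 = i) (hi : i < I.h)
    {z c T : ℕ} (hk : k < s₀.reg 16) (h : SearchQueue I p i (s₀.reg 16) s₀ k c z s T)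
    {Q : State → ℕ → Prop}
    (hQ : ∀ s' T' tl Tw, SearchState I p i (s₀.reg 16) s₀ k tl tl Tw s' → s'.reg 21 = k →
      s'.arr 23 z = 2 → Tw + c ≤ T' → Q s' T') :
    Runs W searchQueueProg Q s T := by
  have w1 := hW.lin
  refine Runs.while (I := SearchQueue I p i (s₀.reg 16) s₀ k c z) h ?_
  clear h
  rintro s T ⟨⟨hd, tl, Tw, hS, hT⟩, h21, hz⟩
  have hhd := hS.inv.hd_le
  have htl := hS.tl_le
  simp only [Exp.Fits, Exp.cost, Exp.val, hS.reg19, hS.reg20]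
  refine ⟨by omega, by omega, fun hne => ?_, fun h0 => ?_⟩
  · have hlt : hd < tl := by omega
    obtain ⟨hw1, hw2⟩ := hS.dequeue_time hlt
    have hu := (hS.inv.queue hd hlt).1
    set u := s.arr 27 hd with hu'
    have hch := hs.chain u hu
    have a11 : s.arr 11 = s₀.arr 11 := hS.same.2 11 (by simp)
    have hle := hch.le fun e he => (Inst.mem_inList.mp he).1
    unfold Inst.arcWork at hw1 hw2
    simp [hS.reg19, ← hu', a11]
    and_intros
    all_goals try omega
    refine searchArcsProg_runs (i := i) (p := p) (k := k) (hd := hd) (u := u) (z := z) (Tw := Tw)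
      (c := Tw - (40 * (I.inList I.m u).length + 40) + c + 8) hW hs ho h14 hi hk ?_ ?_
    · refine ⟨⟨tl, I.inList I.m u, ⟨by simpa using hS.same, hS.frame, hS.inv,
        by simpa using hS.reg19, by simpa using hS.reg20, hS.time⟩, hlt, by simpa using hch,
        fun e he => he, fun e he hn => absurd he hn, by omega⟩, by simpa using h21, by simp [hu'],
        by simpa using hz⟩
    · intro s' T' tl' hS' hlt' h21' hu2 hdone hz' hT'
      obtain ⟨hw3, hw4⟩ := hS'.dequeue_time hlt'
      rw [hu2] at hw3 hw4
      have htl' := hS'.tl_le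
      simp [hS'.reg19]
      and_intros
      all_goals try omega
      exact ⟨⟨hd + 1, tl', Tw - I.arcWork u, ⟨by simpa using hS'.same, hS'.frame,
        hS'.inv.dequeue hlt' fun x hx => hdone x (by rwa [hu2] at hx), by simp,
        by simpa using hS'.reg20, hw4⟩, by unfold Inst.arcWork at hw3 ⊢; omega⟩,
        by simpa using h21', by simpa using hz'⟩
  · obtain rfl : hd = tl := by omega
    exact hQ s _ hd Tw hS h21 hz (by omega)

/-- The invariant of the loop over all backward searches. -/
structure SearchRoots (I : Inst) (p i : ℕ) (s₀ s : State) (T : ℕ) : Prop where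
  state : ∃ k tl Tw, SearchState I p i (s₀.reg 16) s₀ (k - 1) tl tl Tw s ∧ s.reg 21 = k ∧
    k ≤ s₀.reg 16 ∧ Tw + 60 * k + 4 ≤ T
  result : s.reg 21 = 0 → IsSccOrder I p fun v => s.arr 21 (I.phi v i)

/-- The backward searches number the strongly connected components. -/
theorem searchProg_does (hW : I.Bounded W) {s₀ : State} (hs : Static I s₀)
    (ho : IsFinishOrder I p (s₀.arr 26) (s₀.reg 16)) (h14 : s₀.reg 14 = i) (hi : i < I.h)
    (hv : ∀ v < I.n, s₀.arr 23 v = if p < I.pri v then 2 else 1)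
    (h0 : ∀ v < I.n, s₀.arr 21 (I.phi v i) = 0) :
    Does W searchProg s₀ (200 * I.n + 40 * I.m + 40) fun s' =>
      Same [19, 20, 21, 22, 24, 25, 26] [21, 23, 27] s₀ s' ∧
      (∀ a, (∀ v < I.n, a ≠ I.phi v i) → s'.arr 21 a = s₀.arr 21 a) ∧
      IsSccOrder I p fun v => s'.arr 21 (I.phi v i) := by
  have w1 := hW.lin
  have hcn := ho.le
  have hwork : I.searchWork (s₀.arr 23) (s₀.arr 27) 0 0 ≤ 40 * I.m + 40 * I.n := by
    have h1 : ∑ v ∈ Finset.range I.n, I.arcWork v = 40 * I.m + 40 * I.n := by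
      simp only [Inst.arcWork, Finset.sum_add_distrib, ← Finset.mul_sum, I.sum_length_inList]
      simp; ring
    rw [← h1]
    simp only [Inst.searchWork, Finset.Ico_self, Finset.sum_empty, add_zero]
    exact Finset.sum_le_sum fun v _ => by split_ifs <;> simp
  have hinv : SearchInv I p (s₀.arr 26) (s₀.reg 16) (s₀.arr 23)
      (fun v => s₀.arr 21 (I.phi v i)) (s₀.arr 27) (s₀.reg 16 - 1) 0 0 := by
    refine ⟨fun v hvn => ?_, fun v hvn hp => ⟨?_, h0 v hvn⟩, fun j h1 h2 => by omega,
      fun v hvn hp h2 => ?_, le_rfl, by simp, by simp, by simp, by simp, ?_⟩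
    · rw [hv v hvn]; split_ifs <;> simp
    · rw [hv v hvn, if_pos hp]
    · rw [hv v hvn, if_neg (by omega)] at h2; omega
    · rw [add_zero]
      refine (Finset.sum_le_sum (g := fun _ => 1) fun v _ => ?_).trans (by simp)
      split_ifs <;> simp
  unfold Does searchProg
  simp
  and_intros
  all_goals try omega
  refine Runs.while (I := SearchRoots I p i s₀) ?_ ?_
  · refine ⟨⟨s₀.reg 16, 0, 40 * I.m + 40 * I.n, ⟨by simp, by simp, hinv, by simp, by simp, hwork⟩,
      by simp, le_rfl, by omega⟩, fun hz => ?_⟩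
    simp at hz
    rw [hz] at hinv ho
    exact hinv.isSccOrder ho (by simp)
  rintro s T ⟨⟨k, tl, Tw, hS, h21, hk, hT⟩, hres⟩
  simp only [Exp.Fits, Exp.cost, Exp.val, h21]
  refine ⟨by omega, by omega, fun hne => ?_, fun hz => ?_⟩
  · obtain ⟨k, rfl⟩ := Nat.exists_eq_succ_of_ne_zero hne
    simp only [Nat.succ_eq_add_one, Nat.add_sub_cancel] at hS hk
    have a26 : s.arr 26 = s₀.arr 26 := hS.same.2 26 (by simp)
    have hz := (ho.mem k (by omega)).1
    have hvis := hS.inv.vis_mem _ hz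
    set z := s₀.arr 26 k with hzk
    -- the search number `k + 1` is complete
    have hnext : ∀ s' T' tl Tw, SearchState I p i (s₀.reg 16) s₀ k tl tl Tw s' →
        s'.reg 21 = k → s'.arr 23 z = 2 → Tw + 60 * k + 4 ≤ T' → SearchRoots I p i s₀ s' T' := by
      intro s' T' tl' Tw' hS' h21' hz' hT'
      refine ⟨⟨k, tl', Tw', ⟨hS'.same, hS'.frame, ?_, hS'.reg19, hS'.reg20, hS'.time⟩, h21',
        by omega, hT'⟩, fun h0 => ?_⟩
      · cases k with
        | zero => exact hS'.inv
        | succ k => exact hS'.inv.next hz'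
      · obtain rfl : k = 0 := by omega
        exact hS'.inv.isSccOrder ho fun _ => hz'
    simp [h21, a26, ← hzk]
    and_intros
    all_goals try omega
    · intro h1
      refine markProg_runs (p := p) (i := i) (k := k) (cnt := s₀.reg 16) (hd := tl) (tl := tl)
        (T := Tw) (x := z) hW hs (Or.inl rfl) h14 hi (by simp) (by omega) hcn ?_ (by simp) hz
        (by simp; omega) .refl (by omega) ?_
      · exact ⟨by simpa using hS.same, hS.frame, hS.inv, by simpa using hS.reg19,
          by simpa using hS.reg20, hS.time⟩
      · intro s' hS' hreg h23 h27
        refine searchQueueProg_runs (c := 60 * k + 4) (z := z) (p := p) (i := i) (k := k) hW hs ho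
          h14 hi (by omega) ⟨⟨_, _, _, hS', by omega⟩, by simp [hreg], by simp [h23]⟩ ?_
        intro s' T' tl' Tw' h1 h2 h3 h4
        exact hnext s' T' tl' Tw' h1 h2 h3 (by omega)
    · intro h1
      refine ⟨by omega, hnext _ _ tl Tw ⟨by simpa using hS.same, hS.frame, hS.inv,
        by simpa using hS.reg19, by simpa using hS.reg20, hS.time⟩ (by simp) (by simp; omega)
        (by omega)⟩
  · exact ⟨hS.same, hS.frame, hres (by omega)⟩

/-- The column `i` of the table of component numbers belongs to the priority `d - 2 * i`. -/
theorem sccProg_does (hW : I.Bounded W) {s₀ : State} (hs : Static I s₀)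
    (h0 : ∀ a, s₀.arr 21 a = 0) :
    Does W sccProg s₀ (I.h * (600 * I.n + 120 * I.m + 200) + 10) fun s' =>
      Static I s' ∧ (∀ i < I.h, IsSccOrder I (I.d - 2 * i) fun v => s'.arr 21 (I.phi v i)) ∧
      (∀ x < I.n * I.h, s'.arr 21 x = 0) ∧
      ∀ a, 20 ≤ a → a < 21 ∨ 27 < a ∨ a = 22 → s'.arr a = s₀.arr a := by
  have w1 := hW.lin
  have hd := I.d_eq
  unfold Does sccProg
  simp
  refine (Does.for (N := I.h) (i := 0) (600 * I.n + 120 * I.m + 190)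
    (I := fun k s' => Static I s' ∧
      (∀ i < k, IsSccOrder I (I.d - 2 * i) fun v => s'.arr 21 (I.phi v i)) ∧
      (∀ i, k ≤ i → i < I.h → ∀ v < I.n, s'.arr 21 (I.phi v i) = 0) ∧
      (∀ x < I.n * I.h, s'.arr 21 x = 0) ∧
      (∀ a, 20 ≤ a → a < 21 ∨ 27 < a ∨ a = 22 → s'.arr a = s₀.arr a))
    (by simp) (by simpa using hs.reg3) (by omega) (by omega) (by simp [hs, h0]) ?_).runs ?_ ?_
  · rintro i s - hi h14 h3 ⟨hs, hΦ, hzero, hlow, hfr⟩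
    unfold Does
    simp [h14, hs.reg2]
    and_intros
    all_goals try omega
    refine (dfsProg_does (p := I.d - 2 * i) hW (by simpa using hs) (by simp; omega)
      (by omega)).runs (by omega) ?_
    rintro s₁ T₁ ⟨f1, ho, hv⟩ hT₁
    have hs1 : Static I s₁ := hs.congr (fun r hr => by
      rw [f1.1 r (by simp; omega)]; simp; omega) (fun a ha => by rw [f1.2 a (by simp; omega)]; rfl)
    have a21 : s₁.arr 21 = s.arr 21 := by rw [f1.2 21 (by simp)]; rfl
    refine (searchProg_does (i := i) hW hs1 ho (by rw [f1.1 14 (by simp)]; simpa using h14) hi hv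
      ?_).runs (by omega) ?_
    · intro v hvn; rw [a21]; exact hzero i le_rfl hi v hvn
    · rintro s₂ T₂ ⟨f2, hframe, hscc⟩ -
      have hs2 : Static I s₂ := hs1.congr (fun r hr => f2.1 r (by simp; omega))
        (fun a ha => f2.2 a (by simp; omega))
      refine ⟨?_, ?_, by simpa using hs2, fun j hj => ?_, fun j hj1 hj2 v hvn => ?_,
        fun x hx => ?_, fun a h1 h2 => ?_⟩
      · rw [f2.1 14 (by simp), f1.1 14 (by simp)]; simpa using h14
      · rw [hs2.reg3]
      · rcases (show j < i ∨ j = i by omega) with hj | rfl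
        · have : ∀ v, s₂.arr 21 (I.phi v j) = s.arr 21 (I.phi v j) := fun v => by
            rw [hframe _ fun w _ h => ?_, a21]
            have := (Inst.phi_inj (by omega) hi h).2; omega
          simp [this, hΦ j hj]
        · simpa using hscc
      · rw [hframe _ fun w _ h => ?_, a21]
        · exact hzero j (by omega) hj2 v hvn
        · have := (Inst.phi_inj hj2 hi h).2; omega
      · rw [hframe _ fun w _ h => ?_, a21]
        · exact hlow x hx
        · unfold Inst.phi at h; omega
      · rw [f2.2 a (by simp; omega), f1.2 a (by simp; omega)]
        simpa using hfr a h1 h2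
  · simp only [Nat.sub_zero]
    have : I.h * (600 * I.n + 120 * I.m + 190 + 8) ≤ I.h * (600 * I.n + 120 * I.m + 200) :=
      Nat.mul_le_mul_left _ (by omega)
    omega
  · rintro s T ⟨-, -, hs, hΦ, -, hlow, hfr⟩ -
    exact ⟨hs, hΦ, hlow, hfr⟩

end WordRAM

/-! ### Labels as numbers -/

namespace TreeGame

/-- The number with the digits `f 0, …, f (k - 1)` in base `b`, the most significant digit first. -/
def dval (b : ℕ) (f : ℕ → ℕ) : ℕ → ℕ
  | 0 => 0
  | k + 1 => dval b f k * b + f k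

variable {b : ℕ} {f g : ℕ → ℕ} {k : ℕ}

theorem dval_congr (h : ∀ i < k, f i = g i) : dval b f k = dval b g k := by
  induction k with
  | zero => rfl
  | succ k ih => rw [dval, dval, ih fun i hi => h i (by omega), h k (by omega)]

theorem dval_lt (h : ∀ i < k, f i < b) : dval b f k < b ^ k := by
  induction k with
  | zero => simp [dval]
  | succ k ih =>
    have h1 := ih fun i hi => h i (by omega)
    rw [dval, pow_succ]
    exact mul_add_lt (h k (by omega)) h1

theorem dval_lt_succ {x y a c : ℕ} (h : a < b) (hxy : x < y) : x * b + a < y * b + c :=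
  (mul_add_lt h hxy).trans_le (Nat.le_add_right _ _)

theorem dval_lt_of_first {i : ℕ} (hi : i < k) (hf : ∀ j < k, f j < b) (heq : ∀ j < i, f j = g j)
    (hlt : f i < g i) : dval b f k < dval b g k := by
  induction k with
  | zero => omega
  | succ k ih =>
    rw [dval, dval]
    rcases Nat.lt_succ_iff_lt_or_eq.mp hi with h | rfl
    · exact dval_lt_succ (hf k (by omega)) (ih h fun j hj => hf j (by omega))
    · rw [dval_congr heq]; omega

/-- Division by a power of the base truncates. -/
theorem dval_add_div (k r : ℕ) (hf : ∀ i < k + r, f i < b) :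
    dval b f (k + r) / b ^ r = dval b f k := by
  induction r with
  | zero => simp
  | succ r ih =>
    have hb := hf (k + r) (by omega)
    rw [← add_assoc, dval, pow_succ', ← Nat.div_div_eq_div_mul, mul_comm,
      Nat.mul_add_div (by omega),
      Nat.div_eq_of_lt hb, add_zero]
    exact ih fun i hi => hf i (by omega)

theorem dval_add_of_zero (k r : ℕ) (hf : ∀ i, k ≤ i → i < k + r → f i = 0) :
    dval b f (k + r) = dval b f k * b ^ r := by
  induction r with
  | zero => simp
  | succ r ih =>
    rw [← add_assoc, dval, ih fun i h1 h2 => hf i h1 (by omega), hf (k + r) (by omega) (by omega),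
      pow_succ]
    ring

/-- In a base that is a power of two, the bits of a number are those of its digits. -/
theorem dval_bit {L i j : ℕ} (hf : ∀ i < k, f i < 2 ^ L) (hi : i < k) (hj : j < L) :
    dval (2 ^ L) f k / 2 ^ (i * L + j) % 2 = f (k - 1 - i) / 2 ^ j % 2 := by
  obtain ⟨m, rfl⟩ : ∃ m, k = m + 1 + i := ⟨k - 1 - i, by omega⟩
  rw [pow_add, mul_comm i L, pow_mul, ← Nat.div_div_eq_div_mul, dval_add_div _ _ hf, dval,
    show m + 1 + i - 1 - i = m by omega]
  have h1 : 2 ^ L = 2 ^ j * (2 * 2 ^ (L - 1 - j)) := by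
    rw [← pow_succ', ← pow_add]; congr 1; omega
  have h2 : dval (2 ^ L) f m * 2 ^ L + f m =
      2 ^ j * (2 * (2 ^ (L - 1 - j) * dval (2 ^ L) f m)) + f m := by
    rw [h1]; ring
  rw [h2, Nat.mul_add_div (by positivity), Nat.mul_add_mod]

/-- The lexicographic order of lists of digits is the order of the numbers they represent. -/
theorem lt_iff_dval_lt {l l' : List ℕ} (hl : l.length = k) (hl' : l'.length = k)
    (hb : ∀ x ∈ l, x < b) (hb' : ∀ x ∈ l', x < b) :
    l < l' ↔ dval b (l.getD · 0) k < dval b (l'.getD · 0) k := by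
  have key : ∀ l l' : List ℕ, l.length = k → l'.length = k → (∀ x ∈ l, x < b) → l < l' →
      dval b (l.getD · 0) k < dval b (l'.getD · 0) k := by
    intro l l' hl hl' hb hlt
    rcases List.lt_iff_exists.mp hlt with ⟨-, h⟩ | ⟨i, h1, h2, h3, h4⟩
    · omega
    · refine dval_lt_of_first (i := i) (by omega) (fun j hj => ?_) (fun j hj => ?_) ?_
      · rw [List.getD_eq_getElem _ _ (by omega)]; exact hb _ (List.getElem_mem _)
      · rw [List.getD_eq_getElem _ _ (by omega), List.getD_eq_getElem _ _ (by omega)]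
        exact h3 j hj
      · rw [List.getD_eq_getElem _ _ (by omega), List.getD_eq_getElem _ _ (by omega)]
        exact h4
  refine ⟨key l l' hl hl' hb, fun h => ?_⟩
  rcases lt_trichotomy l l' with h1 | rfl | h1
  · exact h1
  · omega
  · have := key l' l hl' hl hb' h1; omega

variable {n h : ℕ}

/-- The position of a label in the order of all labels. -/
noncomputable def num (a : Label n h) : ℕ :=
  if a = ⊤ then n ^ h else dval n ((comps a).getD · 0) h

theorem comps_length (a : Label n h) : (comps a).length = h := by
  cases a with
  | none => simp [comps]
  | some ξ => simp [comps, ξ.2]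

theorem comps_lt (hn : 0 < n) {a : Label n h} {x : ℕ} (hx : x ∈ comps a) : x < n := by
  cases a with
  | none => rw [(List.mem_replicate.mp hx).2]; exact hn
  | some ξ =>
    obtain ⟨y, -, rfl⟩ := List.mem_map.mp hx
    exact y.2

theorem comps_getD_lt (hn : 0 < n) (a : Label n h) (i : ℕ) : (comps a).getD i 0 < n := by
  by_cases hi : i < (comps a).length
  · rw [List.getD_eq_getElem _ _ hi]; exact comps_lt hn (List.getElem_mem _)
  · rw [List.getD_eq_default _ _ (by omega)]; exact hn

@[simp] theorem comps_top_getD (i : ℕ) : (comps (⊤ : Label n h)).getD i 0 = 0 := by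
  rw [show (comps (⊤ : Label n h)) = List.replicate h 0 from rfl]
  by_cases hi : i < h <;> simp [hi]

@[simp] theorem num_top : num (⊤ : Label n h) = n ^ h := if_pos rfl

theorem num_coe (ξ : Leaf n h) : num (ξ : Label n h) = dval n ((ξ.1.map Fin.val).getD · 0) h :=
  if_neg (WithTop.coe_ne_top)

theorem num_coe_lt (hn : 0 < n) (ξ : Leaf n h) : num (ξ : Label n h) < n ^ h := by
  rw [num_coe]
  exact dval_lt fun i _ => comps_getD_lt hn (ξ : Label n h) i

theorem map_val_lt_iff {l l' : List (Fin n)} :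
    l.map Fin.val < l'.map Fin.val ↔ l < l' := by
  induction l generalizing l' with
  | nil => cases l' <;> simp
  | cons x l ih =>
    cases l' with
    | nil => simp
    | cons y l' => simp [List.cons_lt_cons_iff, ih, Fin.ext_iff]

theorem take_lt_take_iff (hn : 0 < n) {r : ℕ} (hr : r ≤ h) (ξ ξ' : Leaf n h) :
    ξ.1.take (h - r) < ξ'.1.take (h - r) ↔
      num (ξ : Label n h) / n ^ r < num (ξ' : Label n h) / n ^ r := by
  have key : ∀ ξ : Leaf n h, num (ξ : Label n h) / n ^ r =
      dval n (((ξ.1.take (h - r)).map Fin.val).getD · 0) (h - r) := by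
    intro ξ
    obtain ⟨m, rfl⟩ := Nat.exists_eq_add_of_le' hr
    have hdig : ∀ i < m + r, (ξ.1.map Fin.val).getD i 0 < n := fun i _ =>
      comps_getD_lt hn ((ξ : Leaf n _) : Label n (m + r)) i
    rw [num_coe, dval_add_div _ _ hdig]
    rw [Nat.add_sub_cancel]
    refine dval_congr fun i hi => ?_
    have := ξ.2
    rw [List.getD_eq_getElem _ _ (by simp; omega), List.getD_eq_getElem _ _ (by simp; omega)]
    simp
  rw [key, key, ← map_val_lt_iff]
  refine lt_iff_dval_lt ?_ ?_ ?_ ?_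
  · simp [ξ.2]
  · simp [ξ'.2]
  · intro x hx; obtain ⟨y, -, rfl⟩ := List.mem_map.mp hx; exact y.2
  · intro x hx; obtain ⟨y, -, rfl⟩ := List.mem_map.mp hx; exact y.2

theorem num_lt_iff (hn : 0 < n) {a a' : Label n h} : num a < num a' ↔ a < a' := by
  induction a using WithTop.recTopCoe with
  | top =>
    induction a' using WithTop.recTopCoe with
    | top => simp
    | coe y => have := num_coe_lt hn y; simp; omega
  | coe x =>
    induction a' using WithTop.recTopCoe with
    | top => simp [num_coe_lt hn x]
    | coe y =>
      have := take_lt_take_iff hn (r := 0) (Nat.zero_le h) x y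
      rw [WithTop.coe_lt_coe, ← Subtype.coe_lt_coe]
      simpa [x.2, y.2, List.take_of_length_le] using this.symm

theorem num_le_iff (hn : 0 < n) {a a' : Label n h} : num a ≤ num a' ↔ a ≤ a' := by
  rw [← not_lt, num_lt_iff hn, not_lt]

theorem num_le (hn : 0 < n) (a : Label n h) : num a ≤ n ^ h := by
  rw [← num_top (n := n) (h := h), num_le_iff hn]; exact le_top

/-- The smallest tail label with which an arc is not violated: the components of the head label of
index less than `p` are replaced by zeros, and for odd `p` one is added to the rest. An overflow
yields `n ^ h`, which is the number of `⊤`. -/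
theorem respects_iff_num (hn : 0 < n) {p : ℕ} (hp : p / 2 ≤ h) {a a' : Label n h} :
    Respects p a a' ↔ min (n ^ h) ((num a' / n ^ (p / 2) + p % 2) * n ^ (p / 2)) ≤ num a := by
  set r := p / 2 with hr
  have hpow : 0 < n ^ r := pow_pos hn r
  have hsplit : n ^ h = n ^ (h - r) * n ^ r := by rw [← pow_add]; congr 1; omega
  have htop : n ^ h / n ^ r = n ^ (h - r) := by rw [hsplit, Nat.mul_div_cancel _ hpow]
  have hlt : ∀ x : Leaf n h, num (x : Label n h) / n ^ r < n ^ (h - r) := fun x => by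
    rw [Nat.div_lt_iff_lt_mul hpow, ← hsplit]; exact num_coe_lt hn x
  have hle : ∀ c, c * n ^ r ≤ num a ↔ c ≤ num a / n ^ r := fun c =>
    (Nat.le_div_iff_mul_le hpow).symm
  rw [min_le_iff, hle]
  induction a using WithTop.recTopCoe with
  | top => simp [respects_top]
  | coe x =>
    have h1 := hlt x
    have h2 := num_coe_lt hn x
    induction a' using WithTop.recTopCoe with
    | top =>
      have h3 : ¬ Respects p (x : Label n h) ⊤ := by
        rw [← tighten_le_iff, tighten_top]; simp
      simp only [h3, false_iff, num_top, htop]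
      omega
    | coe y =>
      have hT := take_lt_take_iff hn hp x y
      have hT' := take_lt_take_iff hn hp y x
      unfold Respects
      simp only [trunc, WithTop.map_coe, WithTop.coe_le_coe, WithTop.coe_lt_coe,
        WithTop.coe_ne_top, false_and, or_false, ← hr]
      rw [hT', ← not_lt (a := List.take _ x.1), hT]
      rcases Nat.even_or_odd p with he | ho
      · have := Nat.even_iff.mp he
        simp only [he, true_implies, not_true, false_implies, and_true]
        omega
      · have h0 := Nat.not_even_iff_odd.mpr ho
        have := Nat.odd_iff.mp ho
        simp only [h0, false_implies, true_and, not_false_eq_true, true_implies]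
        omega

theorem eq_tighten_of_num (hn : 0 < n) {p : ℕ} (hp : p / 2 ≤ h) {a a' : Label n h}
    (ha : num a = min (n ^ h) ((num a' / n ^ (p / 2) + p % 2) * n ^ (p / 2))) :
    a = tighten p a' := by
  refine le_antisymm ?_ ?_
  · rw [← num_le_iff hn, ha]
    exact (respects_iff_num hn hp).mp (respects_tighten p a')
  · rw [tighten_le_iff, respects_iff_num hn hp, ha]

/-- The label with given components. -/
theorem exists_label (h : ℕ) (f : ℕ → ℕ) (hf : ∀ i < h, f i < n) :
    ∃ ξ : Leaf n h, ∀ i < h, (comps (ξ : Label n h)).getD i 0 = f i := by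
  refine ⟨⟨List.ofFn fun i : Fin h => (⟨f i, hf i i.2⟩ : Fin n), by simp⟩, fun i hi => ?_⟩
  show ((List.ofFn fun i : Fin h => (⟨f i, hf i i.2⟩ : Fin n)).map Fin.val).getD i 0 = f i
  rw [List.getD_eq_getElem _ _ (by simpa using hi)]
  simp

end TreeGame

/-! ### Relaxing an arc on the word RAM -/

namespace WordRAM
open Exp Prog

/-- Array `30` receives the components of the label of node `w` (register `31`), read from array
`b`, with `π v / 2` components replaced by zeros, where `v` is the node in register `30`. -/
def truncProg (b : ℕ) : Prog :=
  assign 33 (cell 7 (cell 2 (reg 30))) ;; assign 34 (reg 3 -ₑ reg 33) ;; assign 35 (lit 0) ;;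
  Prog.for 35 34 (store 30 (reg 35) (cell b (reg 31 *ₑ reg 3 +ₑ reg 35))) ;;
  Prog.for 35 3 (store 30 (reg 35) (lit 0))

/-- Add one to the number that consists of the components before position `reg 34`. Register `36`
records an overflow. -/
def carryProg : Prog :=
  assign 35 (reg 34) ;;
  .while (reg 35 *ₑ (lit 1 -ₑ (reg 0 -ₑ lit 1 -ₑ cell 30 (reg 35 -ₑ lit 1))))
    (assign 35 (reg 35 -ₑ lit 1) ;; store 30 (reg 35) (lit 0)) ;;
  ite (reg 35) (store 30 (reg 35 -ₑ lit 1) (cell 30 (reg 35 -ₑ lit 1) +ₑ lit 1))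
    (assign 36 (lit 1))

/-- Compute, in register `36` and array `30`, the smallest label with which the arc from the node in
register `30` to the node in register `31` is not violated. The label of the latter is read from the
arrays `a` and `b`. -/
def tightenProg (a b : ℕ) : Prog :=
  truncProg b ;; assign 36 (cell a (reg 31)) ;;
  ite (cell 2 (reg 30) -ₑ (reg 33 +ₑ reg 33)) carryProg .skip

variable {I : Inst} {W : ℕ}

/-- The arrays `t` and `c` hold the label `a` of the node `v`. -/
def LabelAt (I : Inst) (t c : ℕ → ℕ) (v : ℕ) (a : Label I.n I.h) : Prop :=
  t v = topBit a ∧ ∀ i < I.h, c (v * I.h + i) = (comps a).getD i 0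

theorem topBit_le {n h : ℕ} (a : Label n h) : topBit a ≤ 1 := by
  unfold topBit; split_ifs <;> simp

theorem LabelAt.lt {t c : ℕ → ℕ} {v i : ℕ} {a : Label I.n I.h} (h : LabelAt I t c v a)
    (hi : i < I.h) : c (v * I.h + i) < I.n := by
  rw [h.2 i hi]; exact comps_getD_lt I.n_pos a i

theorem LabelAt.num_eq {t c : ℕ → ℕ} {v : ℕ} {a : Label I.n I.h} (h : LabelAt I t c v a)
    (ha : a ≠ ⊤) : num a = dval I.n (fun i => c (v * I.h + i)) I.h := by
  rw [num, if_neg ha]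
  exact dval_congr fun i hi => (h.2 i hi).symm

theorem truncProg_does (hW : I.Bounded W) {s : State} (hs : Static I s) {v w b : ℕ}
    (hv : v < I.n) (hw : w < I.n) (h30 : s.reg 30 = v) (h31 : s.reg 31 = w) (hb : b ≠ 30)
    (hlt : ∀ i < I.h, s.arr b (w * I.h + i) < I.n) :
    Does W (truncProg b) s (40 * I.h + 40) fun s' =>
      Same [33, 34, 35] [30] s s' ∧ s'.reg 33 = I.pri v / 2 ∧ s'.reg 34 = I.h - I.pri v / 2 ∧
      ∀ i < I.h, s'.arr 30 i = if i < I.h - I.pri v / 2 then s.arr b (w * I.h + i) else 0 := by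
  have w1 := hW.lin
  have w2 := hW.nh
  have hd := I.d_eq
  have hpv := I.pri_le v hv
  have hhalf : s.arr 7 (I.pri v) = I.pri v / 2 := hs.half _ (by omega)
  unfold Does truncProg
  simp [h30, hs.reg3, hs.arr2, hhalf]
  and_intros
  all_goals try omega
  set k := I.h - I.pri v / 2 with hk
  refine (Does.for (N := k) (i := 0) 8
    (I := fun j s' => (Same [33, 34, 35] [30] s s' ∧ s'.reg 33 = I.pri v / 2) ∧
      ∀ i < j, s'.arr 30 i = s.arr b (w * I.h + i)) (by simp) (by simp) (by omega) (by omega)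
      (by simp) ?_).runs (by omega) ?_
  · rintro j s₁ - hj h35 h34 ⟨⟨hf, h33⟩, hI⟩
    have h3 : s₁.reg 3 = I.h := by rw [hf.1 3 (by simp), hs.reg3]
    have h31' : s₁.reg 31 = w := by rw [hf.1 31 (by simp), h31]
    have hab : s₁.arr b = s.arr b := hf.2 b (by simpa using hb)
    have hx := hlt j (by omega)
    have hm := mul_add_lt (show j < I.h by omega) hw
    unfold Does
    simp [h35, h34, hf, h33, h3, h31', hab]
    and_intros
    all_goals try omega
    intro i hi
    rw [Function.update_apply]
    split_ifs with hij
    · rw [hij]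
    · exact hI i (by omega)
  · rintro s₁ T₁ ⟨h35, h34, ⟨hf, h33⟩, hI⟩ hT₁
    refine (Does.for (N := I.h) (i := k) 3
      (I := fun j s' => (Same [33, 34, 35] [30] s s' ∧ s'.reg 33 = I.pri v / 2 ∧ s'.reg 34 = k) ∧
        ∀ i < j, s'.arr 30 i = if i < k then s.arr b (w * I.h + i) else 0) h35
        (by rw [hf.1 3 (by simp), hs.reg3]) (by omega) (by omega)
        ⟨⟨hf, h33, h34⟩, fun i hi => by rw [if_pos hi, hI i hi]⟩ ?_).runs (by omega) ?_
    · rintro j s₂ hj1 hj h35 h3 ⟨⟨hf, h33, h34⟩, hI⟩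
      unfold Does
      simp [h35, h34, hf, h33, h3]
      and_intros
      all_goals try omega
      intro i hi
      rw [Function.update_apply]
      split_ifs with hij hik
      · omega
      · rfl
      · rw [hI i (by omega), if_pos (by assumption)]
      · rw [hI i (by omega), if_neg (by assumption)]
    · rintro s₂ T₂ ⟨-, -, ⟨hf, h33, h34⟩, hI⟩ -
      exact ⟨hf, h33, h34, hI⟩

/-- The invariant of the loop that looks for the position where a carry stops; `N` is the number
that is to be computed. -/
structure CarryLoop (I : Inst) (N : ℕ) (s₀ s : State) (T : ℕ) : Prop where
  same : Same [35] [30] s₀ s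
  state : ∃ j ≤ I.h, s.reg 35 = j ∧ (∀ i < I.h, s.arr 30 i < I.n) ∧
    (∀ i, j ≤ i → i < I.h → s.arr 30 i = 0) ∧
    N = (dval I.n (s.arr 30) j + 1) * I.n ^ (I.h - j) ∧ 20 * j + 30 ≤ T

theorem carryProg_does (hW : I.Bounded W) {s : State} {k N : ℕ} (hh : 0 < I.h)
    (h0 : s.reg 0 = I.n) (hk : k ≤ I.h) (h34 : s.reg 34 = k)
    (hlt : ∀ i < I.h, s.arr 30 i < I.n) (hz : ∀ i, k ≤ i → i < I.h → s.arr 30 i = 0)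
    (hN : N = (dval I.n (s.arr 30) k + 1) * I.n ^ (I.h - k)) :
    Does W carryProg s (20 * I.h + 40) fun s' =>
      Same [35, 36] [30] s s' ∧ (∀ i < I.h, s'.arr 30 i < I.n) ∧
      ((s'.reg 36 = s.reg 36 ∧ N = dval I.n (s'.arr 30) I.h) ∨
        (s'.reg 36 = 1 ∧ N = I.n ^ I.h)) := by
  have w1 := hW.lin
  have w2 := hW.nh
  have hd := I.d_eq
  have hn := I.n_pos
  unfold Does carryProg
  simp [h34]
  and_intros
  all_goals try omega
  refine Runs.while (I := CarryLoop I N s)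
    ⟨by simp, k, hk, by simp, by simpa using hlt, by simpa using hz, by simpa using hN, by omega⟩ ?_
  rintro s₁ T ⟨hf, j, hj, h35, hlt, hz, hN, hT⟩
  have h0 : s₁.reg 0 = I.n := by rw [hf.1 0 (by simp), h0]
  have hcell : j ≠ 0 → s₁.arr 30 (j - 1) < I.n := fun h => hlt _ (by omega)
  simp only [Exp.Fits, Exp.cost, Exp.val, h35, h0]
  have hb : j * (1 - (I.n - 1 - s₁.arr 30 (j - 1))) ≤ j :=
    (Nat.mul_le_mul_left j (show _ ≤ 1 by omega)).trans (by omega)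
  have hcell' : s₁.arr 30 (j - 1) ≤ W := by
    have := hlt (j - 1) (by omega); omega
  refine ⟨by and_intros <;> omega, by omega, fun hne => ?_, fun heq => ?_⟩
  · rw [Nat.mul_ne_zero_iff] at hne
    obtain ⟨m, rfl⟩ := Nat.exists_eq_succ_of_ne_zero hne.1
    simp only [Nat.succ_eq_add_one, Nat.add_sub_cancel] at *
    have hm : s₁.arr 30 m = I.n - 1 := by have := hcell (by omega); omega
    simp [h35]
    and_intros
    all_goals try omega
    refine ⟨by simpa using hf, m, by omega, by simp, fun i hi => ?_, fun i h1 h2 => ?_, ?_,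
      by omega⟩
    · simp [Function.update_apply]; split_ifs
      · exact hn
      · exact hlt i hi
    · simp [Function.update_apply]; intro him; exact hz i (Nat.lt_of_le_of_ne h1 (Ne.symm him)) h2
    · rw [hN, dval, hm]
      simp
      rw [dval_congr (k := m) (f := Function.update (s₁.arr 30) m 0) (g := s₁.arr 30)
          fun i hi => Function.update_of_ne (by omega) _ _,
        show I.h - m = I.h - (m + 1) + 1 by omega, pow_succ]
      have : dval I.n (s₁.arr 30) m * I.n + (I.n - 1) + 1 = (dval I.n (s₁.arr 30) m + 1) * I.n := by
        rw [Nat.add_mul]; omega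
      rw [this]; ring
  · have hsame : Same [35, 36] [30] s s₁ := hf.weaken (by simp) (by simp)
    have h36 : s₁.reg 36 = s.reg 36 := hf.1 36 (by simp)
    simp [h35, hsame]
    refine ⟨by omega, by omega, fun hne => ?_, fun hj0 => ?_⟩
    · obtain ⟨m, rfl⟩ := Nat.exists_eq_succ_of_ne_zero hne
      simp only [Nat.succ_eq_add_one, Nat.add_sub_cancel] at *
      have hm : s₁.arr 30 m < I.n - 1 := by
        rcases Nat.mul_eq_zero.mp heq with h | h <;> omega
      and_intros
      all_goals try omega
      · intro i hi
        simp [Function.update_apply]; split_ifs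
        · omega
        · exact hlt i hi
      · refine Or.inl ⟨h36, ?_⟩
        obtain ⟨r, hr⟩ := Nat.exists_eq_add_of_le hj
        rw [hr, dval_add_of_zero, dval, Function.update_self,
          dval_congr (g := s₁.arr 30) fun i hi => Function.update_of_ne (by omega) _ _, hN, dval,
          hr,
          Nat.add_sub_cancel_left, add_assoc]
        intro i h1 h2
        rw [Function.update_of_ne (by omega)]
        exact hz i (by omega) (by omega)
    · subst hj0
      and_intros
      all_goals try omega
      refine Or.inr ?_
      rw [hN]; simp [dval]

theorem tightenProg_does (hW : I.Bounded W) {s : State} (hs : Static I s) {v w t c : ℕ}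
    (hv : v < I.n) (hw : w < I.n) (h30 : s.reg 30 = v) (h31 : s.reg 31 = w) (ht : t ≠ 30)
    (hc : c ≠ 30) {a : Label I.n I.h} (ha : LabelAt I (s.arr t) (s.arr c) w a) :
    Does W (tightenProg t c) s (60 * I.h + 100) fun s' =>
      Same [33, 34, 35, 36] [30] s s' ∧ (∀ i < I.h, s'.arr 30 i < I.n) ∧
      s'.reg 36 = topBit (tighten (I.pri v) a) ∧
      (tighten (I.pri v) a ≠ ⊤ →
        ∀ i < I.h, s'.arr 30 i = (comps (tighten (I.pri v) a)).getD i 0) := by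
  have w1 := hW.lin
  have w2 := hW.nh
  have hd := I.d_eq
  have hn := I.n_pos
  have hpv := I.pri_le v hv
  have hp1 := I.pri_pos v hv
  have htb := topBit_le a
  unfold Does tightenProg
  rw [runs_seq]
  refine (truncProg_does hW hs hv hw h30 h31 hc fun i hi => ha.lt hi).runs (by omega) ?_
  rintro s₁ T₁ ⟨f1, h33, h34, hX⟩ hT₁
  have h31' : s₁.reg 31 = w := by rw [f1.1 31 (by simp), h31]
  have h30' : s₁.reg 30 = v := by rw [f1.1 30 (by simp), h30]
  have h0 : s₁.reg 0 = I.n := by rw [f1.1 0 (by simp), hs.reg0]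
  have at' : s₁.arr t w = topBit a := by rw [f1.2 t (by simpa using ht), ha.1]
  have a2 : s₁.arr 2 = I.pri := by rw [f1.2 2 (by simp), hs.arr2]
  have hpar := Nat.div_add_mod (I.pri v) 2
  set r := I.pri v / 2 with hr
  set k := I.h - r with hk
  have hXlt : ∀ i < I.h, s₁.arr 30 i < I.n := fun i hi => by
    rw [hX i hi]; split_ifs
    · exact ha.lt hi
    · exact hn
  have hXz : ∀ i, k ≤ i → i < I.h → s₁.arr 30 i = 0 := fun i h1 h2 => by
    rw [hX i h2, if_neg (by omega)]
  have hdiv : a ≠ ⊤ → num a / I.n ^ r = dval I.n (s₁.arr 30) k := fun hne => by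
    have h1 : I.h = k + r := by omega
    rw [ha.num_eq hne, show I.h = k + r by omega, dval_add_div]
    · refine dval_congr fun i hi => ?_
      rw [← h1, hX i (by omega), if_pos hi]
    · intro i hi; rw [← h1]; exact ha.lt (by omega)
  -- a label with the computed number is the tightened one
  have key : ∀ s' : State, (∀ i < I.h, s'.arr 30 i < I.n) → a ≠ ⊤ → s'.reg 36 = 0 →
      (num a / I.n ^ r + I.pri v % 2) * I.n ^ r = dval I.n (s'.arr 30) I.h →
      s'.reg 36 = topBit (tighten (I.pri v) a) ∧ (tighten (I.pri v) a ≠ ⊤ →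
        ∀ i < I.h, s'.arr 30 i = (comps (tighten (I.pri v) a)).getD i 0) := by
    intro s' hlt hne h36 hnum
    obtain ⟨ξ, hξ⟩ := exists_label I.h (s'.arr 30) hlt
    have hnξ : num (ξ : Label I.n I.h) = dval I.n (s'.arr 30) I.h := by
      rw [num, if_neg WithTop.coe_ne_top]; exact dval_congr hξ
    have heq : (ξ : Label I.n I.h) = tighten (I.pri v) a := by
      refine eq_tighten_of_num hn (by omega) ?_
      rw [← hr, hnum, hnξ, min_eq_right (dval_lt hlt).le]
    rw [← heq, h36]
    exact ⟨by simp [topBit], fun _ i hi => (hξ i hi).symm⟩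
  have ktop : ∀ s' : State, s'.reg 36 = 1 → tighten (I.pri v) a = ⊤ →
      s'.reg 36 = topBit (tighten (I.pri v) a) ∧ (tighten (I.pri v) a ≠ ⊤ →
        ∀ i < I.h, s'.arr 30 i = (comps (tighten (I.pri v) a)).getD i 0) := by
    intro s' h36 htop
    rw [htop, h36]
    exact ⟨by simp [topBit], fun h => absurd rfl h⟩
  simp only [runs_seq, runs_assign, runs_ite, runs_skip]
  simp [h31', h30', at', a2, h33]
  and_intros
  all_goals try omega
  · intro hodd
    refine (carryProg_does (N := (dval I.n (s₁.arr 30) k + 1) * I.n ^ (I.h - k)) hW (by omega)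
      (by simpa using h0) (show k ≤ I.h by omega) (by simpa using h34) (by simpa using hXlt)
      (by simpa using hXz)
      (by simp)).runs (by omega) ?_
    rintro s₂ T₂ ⟨f2, hlt2, hres⟩ -
    have f2' : Same [33, 34, 35, 36] [30] s₁ s₂ := by
      refine Same.trans (s' := s₁.setReg 36 (topBit a)) (by simp) (f2.weaken (by simp) (by simp))
    refine ⟨(f1.weaken (by simp) (by simp)).trans f2', hlt2, ?_⟩
    by_cases htop : a = ⊤
    · refine ktop s₂ ?_ (by rw [htop, tighten_top])
      rcases hres with ⟨h1, -⟩ | ⟨h1, -⟩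
      · rw [h1]; simp [htop, topBit]
      · exact h1
    · have hkr : I.h - k = r := by omega
      rw [← hdiv htop, hkr] at hres
      have hp1 : I.pri v % 2 = 1 := by omega
      rcases hres with ⟨h1, h2⟩ | ⟨h1, h2⟩
      · exact key s₂ hlt2 htop (by rw [h1]; simp [htop, topBit]) (by rw [hp1, h2])
      · refine ktop s₂ h1 (eq_tighten_of_num hn (by omega) ?_).symm
        rw [← hr, hp1, h2]; simp
  · intro heven
    refine ⟨by omega, ?_, hXlt, ?_⟩
    · exact f1.weaken (by simp) (by simp)
    by_cases htop : a = ⊤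
    · exact ktop (s₁.setReg 36 (topBit a)) (by simp [htop, topBit]) (by rw [htop, tighten_top])
    · refine key (s₁.setReg 36 (topBit a)) hXlt htop (by simp [htop, topBit]) ?_
      have hp0 : I.pri v % 2 = 0 := by omega
      rw [hp0, add_zero, hdiv htop]
      have h1 : I.h = k + r := by omega
      rw [State.setReg_arr]
      conv_rhs => rw [h1]
      rw [dval_add_of_zero]
      intro i h2 h3
      exact hXz i h2 (by omega)

end WordRAM

namespace WordRAM
open Exp Prog

/-- Compare the label in register `36` and array `30` with the current label of the node in
register `30`. Register `38` receives `1` if the former is smaller. -/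
def compareProg : Prog :=
  assign 38 (reg 36 +ₑ reg 36 +ₑ (lit 1 -ₑ reg 36) *ₑ cell 20 (reg 30)) ;; assign 35 (lit 0) ;;
  Prog.for 35 3 (ite (reg 38) .skip
    (ite (cell 21 (reg 30 *ₑ reg 3 +ₑ reg 35) -ₑ cell 30 (reg 35)) (assign 38 (lit 1))
      (ite (cell 30 (reg 35) -ₑ cell 21 (reg 30 *ₑ reg 3 +ₑ reg 35)) (assign 38 (lit 2)) .skip)))

/-- The label in array `30` becomes the current label of the node in register `30`. -/
def storeProg : Prog :=
  store 20 (reg 30) (lit 0) ;; assign 35 (lit 0) ;;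
  Prog.for 35 3 (store 21 (reg 30 *ₑ reg 3 +ₑ reg 35) (cell 30 (reg 35)))

variable {I : Inst} {W : ℕ}

/-- Register `36` and array `30` hold the label `b`. -/
structure HoldsNew (I : Inst) (s : State) (b : Label I.n I.h) : Prop where
  lt : ∀ i < I.h, s.arr 30 i < I.n
  reg36 : s.reg 36 = topBit b
  comps : b ≠ ⊤ → ∀ i < I.h, s.arr 30 i = (comps b).getD i 0

theorem HoldsNew.congr {s s' : State} {b : Label I.n I.h} (h : HoldsNew I s b)
    (hr : s'.reg 36 = s.reg 36) (ha : s'.arr 30 = s.arr 30) : HoldsNew I s' b := by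
  obtain ⟨h1, h2, h3⟩ := h
  exact ⟨by rwa [ha], by rwa [hr], by rwa [ha]⟩

theorem HoldsNew.num_eq {s : State} {b : Label I.n I.h} (h : HoldsNew I s b) (hb : b ≠ ⊤) :
    num b = dval I.n (s.arr 30) I.h := by
  rw [num, if_neg hb]
  exact dval_congr fun i hi => (h.comps hb i hi).symm

/-- The three outcomes of the comparison of two numbers after the first `j` digits. -/
structure CompareState (n : ℕ) (f g : ℕ → ℕ) (j x : ℕ) : Prop where
  le : x ≤ 2
  eq : x = 0 → dval n f j = dval n g j
  lt : x = 1 → dval n f j < dval n g j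
  gt : x = 2 → dval n g j < dval n f j

theorem compareProg_does (hW : I.Bounded W) {s : State} (hs : Static I s) {v : ℕ} (hv : v < I.n)
    (h30 : s.reg 30 = v) {a b : Label I.n I.h} (hb : HoldsNew I s b)
    (ha : LabelAt I (s.arr 20) (s.arr 21) v a) :
    Does W compareProg s (50 * I.h + 50) fun s' =>
      Same [35, 38] [] s s' ∧ s'.reg 38 ≤ 2 ∧ (s'.reg 38 = 1 ↔ b < a) := by
  have w1 := hW.lin
  have w2 := hW.nh
  have hd := I.d_eq
  have hn := I.n_pos
  have hta := topBit_le a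
  have htb := topBit_le b
  have hle : (1 - topBit b) * topBit a ≤ 1 := by
    calc _ ≤ 1 * 1 := Nat.mul_le_mul (by omega) hta
      _ = 1 := rfl
  have h20 : s.arr 20 v = topBit a := ha.1
  unfold Does compareProg
  simp [h30, hb.reg36, h20]
  and_intros
  all_goals try omega
  refine (Does.for (N := I.h) (i := 0) 40
    (I := fun j s' => Same [35, 38] [] s s' ∧ s'.reg 38 ≤ 2 ∧ (b = ⊤ → s'.reg 38 = 2) ∧
      (b ≠ ⊤ → a = ⊤ → s'.reg 38 = 1) ∧ (b ≠ ⊤ → a ≠ ⊤ →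
        CompareState I.n (s.arr 30) (fun i => s.arr 21 (v * I.h + i)) j (s'.reg 38)))
    (by simp) (by simpa using hs.reg3) (by omega) (by omega) ?_ ?_).runs (by omega) ?_
  · refine ⟨by simp, ?_, ?_, ?_, ?_⟩
    · simp; rcases Nat.le_one_iff_eq_zero_or_eq_one.mp htb with h | h <;> simp [h]; omega
    · intro h; simp [h, topBit]
    · intro h h'; simp [h, h', topBit]
    · intro h h'
      simp [h, h', topBit]
      exact ⟨by simp, fun _ => rfl, by simp, by simp⟩
  · rintro j s₁ - hj h35 h3 ⟨hf, h38, hI⟩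
    have a30 : s₁.arr 30 = s.arr 30 := hf.2 30 (by simp)
    have a21 : s₁.arr 21 = s.arr 21 := hf.2 21 (by simp)
    have h30' : s₁.reg 30 = v := by rw [hf.1 30 (by simp), h30]
    have hX := hb.lt j hj
    have hY := ha.lt hj
    have hm := mul_add_lt hj hv
    -- the outcome is fixed by the first difference
    have hstep : ∀ x, (s₁.reg 38 ≠ 0 → x = s₁.reg 38) →
        (s₁.reg 38 = 0 → s.arr 30 j < s.arr 21 (v * I.h + j) → x = 1) →
        (s₁.reg 38 = 0 → s.arr 21 (v * I.h + j) < s.arr 30 j → x = 2) →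
        (s₁.reg 38 = 0 → s.arr 30 j = s.arr 21 (v * I.h + j) → x = 0) →
        x ≤ 2 ∧ (b = ⊤ → x = 2) ∧ (b ≠ ⊤ → a = ⊤ → x = 1) ∧ (b ≠ ⊤ → a ≠ ⊤ →
          CompareState I.n (s.arr 30) (fun i => s.arr 21 (v * I.h + i)) (j + 1) x) := by
      intro x h1 h2 h3 h4
      obtain ⟨i1, i2, i3⟩ := hI
      by_cases h0 : s₁.reg 38 = 0
      · specialize h2 h0; specialize h3 h0; specialize h4 h0
        refine ⟨?_, fun h => ?_, fun h h' => ?_, fun h h' => ?_⟩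
        · rcases lt_trichotomy (s.arr 30 j) (s.arr 21 (v * I.h + j)) with h | h | h
          · rw [h2 h]; omega
          · rw [h4 h]; omega
          · rw [h3 h]
        · have := i1 h; omega
        · have := i2 h h'; omega
        · have heq := (i3 h h').eq h0
          rcases lt_trichotomy (s.arr 30 j) (s.arr 21 (v * I.h + j)) with h | h | h
          · rw [h2 h]
            refine ⟨by omega, by omega, fun _ => ?_, by omega⟩
            simp only [dval, heq]; omega
          · rw [h4 h]
            refine ⟨by omega, fun _ => ?_, by omega, by omega⟩
            simp only [dval, heq]; omega
          · rw [h3 h]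
            refine ⟨by omega, by omega, by omega, fun _ => ?_⟩
            simp only [dval, heq]; omega
      · rw [h1 h0]
        refine ⟨h38, i1, i2, fun h h' => ⟨h38, fun h => absurd h h0, fun h1 => ?_, fun h2 => ?_⟩⟩
        · exact dval_lt_succ hX ((i3 h h').lt h1)
        · exact dval_lt_succ hY ((i3 h h').gt h2)
    clear hI
    unfold Does
    simp [h35, h3, a30, a21, h30', hf]
    refine ⟨by omega, fun h => hstep _ (fun _ => rfl) (by omega) (by omega) (by omega),
      fun h => ⟨by and_intros <;> omega, fun h1 => ⟨by omega, ?_⟩, fun h1 => ⟨by omega,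
        fun h2 => ⟨by omega, ?_⟩, fun h2 => ?_⟩⟩⟩
    · simpa using hstep 1 (by omega) (by omega) (by omega) (by omega)
    · simpa using hstep 2 (by omega) (by omega) (by omega) (by omega)
    · exact hstep _ (by omega) (by omega) (by omega) (by omega)
  · rintro s₁ T₁ ⟨-, -, hf, h38, h1, h2, h3⟩ -
    refine ⟨hf, h38, ?_⟩
    by_cases hb' : b = ⊤
    · have := h1 hb'
      simp [this, hb']
    by_cases ha' : a = ⊤
    · have := h2 hb' ha'
      simp [this, ha', lt_top_iff_ne_top, hb']
    · obtain ⟨c1, c2, c3, c4⟩ := h3 hb' ha'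
      rw [← num_lt_iff hn, hb.num_eq hb', ha.num_eq ha']
      constructor
      · exact c3
      · intro hlt
        by_contra hne
        rcases (show s₁.reg 38 = 0 ∨ s₁.reg 38 = 2 by omega) with h | h
        · have := c2 h; omega
        · have := c4 h; omega

theorem storeProg_does (hW : I.Bounded W) {s : State} (hs : Static I s) {v : ℕ} (hv : v < I.n)
    (h30 : s.reg 30 = v) {b : Label I.n I.h} (hb : HoldsNew I s b) (hne : b ≠ ⊤) :
    Does W storeProg s (20 * I.h + 20) fun s' =>
      Same [35] [20, 21] s s' ∧ LabelAt I (s'.arr 20) (s'.arr 21) v b ∧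
      (∀ w, w ≠ v → s'.arr 20 w = s.arr 20 w) ∧
      ∀ x, (∀ i < I.h, x ≠ v * I.h + i) → s'.arr 21 x = s.arr 21 x := by
  have w1 := hW.lin
  have w2 := hW.nh
  have hd := I.d_eq
  unfold Does storeProg
  simp [h30]
  and_intros
  all_goals try omega
  refine (Does.for (N := I.h) (i := 0) 8
    (I := fun j s' => (Same [35] [20, 21] s s' ∧ s'.arr 20 = Function.update (s.arr 20) v 0) ∧
      (∀ i < j, s'.arr 21 (v * I.h + i) = s.arr 30 i) ∧
      ∀ x, (∀ i < I.h, x ≠ v * I.h + i) → s'.arr 21 x = s.arr 21 x)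
    (by simp) (by simpa using hs.reg3) (by omega) (by omega) (by simp) ?_).runs (by omega) ?_
  · rintro j s₁ - hj h35 h3 ⟨⟨hf, h20⟩, hI, hx⟩
    have a30 : s₁.arr 30 = s.arr 30 := hf.2 30 (by simp)
    have h30' : s₁.reg 30 = v := by rw [hf.1 30 (by simp), h30]
    have hX := hb.lt j hj
    have hm := mul_add_lt hj hv
    unfold Does
    simp [h35, h3, a30, h30', hf, h20]
    and_intros
    all_goals try omega
    · intro i hi
      rw [Function.update_apply]
      split_ifs with hij
      · rw [show i = j by omega]
      · exact hI i (by omega)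
    · intro x hx'
      rw [Function.update_of_ne (hx' j hj)]
      exact hx x hx'
  · rintro s₁ T₁ ⟨-, -, ⟨hf, h20⟩, hI, hx⟩ -
    refine ⟨hf, ⟨by rw [h20]; simp [topBit, hne], fun i hi => ?_⟩, fun w hw => ?_, hx⟩
    · rw [hI i hi, hb.comps hne i hi]
    · rw [h20, Function.update_of_ne hw]

end WordRAM

/-! ### A monotone priority queue -/

namespace WordRAM

/-- The invariant of a priority queue whose keys are never smaller than the last key that was
removed. The nodes in `act` are in the queue and have the keys `N`, which are numbers of `B` bits;
the nodes in `don` have been removed. The number `last` agrees with the smallest key in all bits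
above position `cur`. The level `lev v` of a node in the queue is such that its key agrees with
`last` in all bits from this position on, and the next bit of the key exceeds the bit of `last`,
unless the level is less than `cur + f`; here `f = 1` if the list of level `cur` has been created by
splitting the list above it, `f = 2` while that list is being split, and `f = 0` otherwise. For
every level `b` there is a list `A (b * n), …, A (b * n + sz b - 1)` that contains the nodes of
level `b` and possibly nodes that have moved to smaller levels. -/
structure HeapInv (n B : ℕ) (N lev LB sz A : ℕ → ℕ) (act don : ℕ → Prop) (cur f last : ℕ) :
    Prop where
  lev_le : ∀ v < n, lev v ≤ B
  act_lt : ∀ v, act v → v < n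
  le_lev : ∀ v, act v → cur ≤ lev v
  lev_lt : ∀ v, act v → lev v < B
  mem : ∀ v, act v → ∃ j < sz (lev v), A (lev v * n + j) = v
  agree : ∀ v, act v → N v / 2 ^ lev v = last / 2 ^ lev v
  step : ∀ v, act v → 0 < lev v → cur + f ≤ lev v →
    N v / 2 ^ (lev v - 1) = last / 2 ^ (lev v - 1) + 1
  disj : ∀ v, act v → ¬ don v
  done : ∀ v < n, don v → lev v = 0
  rest : ∀ v < n, ¬ act v → ¬ don v → lev v = B
  entry : ∀ b < B, ∀ j < sz b, A (b * n + j) < n ∧ lev (A (b * n + j)) ≤ b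
  entry_zero : ∀ j < sz 0, act (A j)
  inj : ∀ b < B, ∀ j < sz b, ∀ j' < sz b, A (b * n + j) = A (b * n + j') → j = j'
  below : ∀ b < cur, sz b = 0
  bits : ∀ b, cur ≤ b → b < B → LB b = last / 2 ^ b % 2
  last_lt : last < 2 ^ (B - 1)

namespace HeapInv

variable {n B : ℕ} {N N' lev LB sz A : ℕ → ℕ} {act don act' don' : ℕ → Prop} {cur f last : ℕ}

theorem sz_le (H : HeapInv n B N lev LB sz A act don cur f last) {b : ℕ} (hb : b < B) :
    sz b ≤ n := by
  have := Finset.card_le_card_of_injOn (s := Finset.range (sz b)) (t := Finset.range n)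
    (fun j => A (b * n + j)) (fun j hj => by
      simpa using (H.entry b hb j (by simpa using hj)).1)
    (fun j hj j' hj' h => H.inj b hb j (by simpa using hj) j' (by simpa using hj') h)
  simpa using this

theorem sz_lt (H : HeapInv n B N lev LB sz A act don cur f last) {b v : ℕ} (hv : v < n)
    (hb : b < lev v) : sz b < n := by
  have hbB : b < B := hb.trans_le (H.lev_le v hv)
  have := Finset.card_le_card_of_injOn (s := Finset.range (sz b)) (t := (Finset.range n).erase v)
    (fun j => A (b * n + j)) (fun j hj => by
      have := H.entry b hbB j (by simpa using hj)
      simp only [Finset.coe_erase, Finset.coe_range, Set.mem_sdiff, Set.mem_Iio,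
        Set.mem_singleton_iff]
      exact ⟨this.1, fun h => by rw [h] at this; omega⟩)
    (fun j hj j' hj' h => H.inj b hbB j (by simpa using hj) j' (by simpa using hj') h)
  rw [Finset.card_range, Finset.card_erase_of_mem (by simpa using hv), Finset.card_range] at this
  omega

theorem act_of_lev (H : HeapInv n B N lev LB sz A act don cur f last) {v : ℕ} (hv : v < n)
    (h0 : lev v ≠ 0) (hB : lev v ≠ B) : act v := by
  by_contra ha
  by_cases hd : don v
  · exact h0 (H.done v hv hd)
  · exact hB (H.rest v hv ha hd)

/-- The pointer `cur` advances when its list is empty. -/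
theorem up (H : HeapInv n B N lev LB sz A act don cur f last) (hf : f ≤ 1) (hz : sz cur = 0) :
    HeapInv n B N lev LB sz A act don (cur + 1) 0 last := by
  refine { H with le_lev := fun v hv => ?_, step := fun v hv h1 h2 => H.step v hv h1 (by omega),
                  below := fun b hb => ?_, bits := fun b h1 h2 => H.bits b (by omega) h2 }
  · rcases (H.le_lev v hv).lt_or_eq with h | h
    · exact h
    · obtain ⟨j, hj, -⟩ := H.mem v hv
      rw [← h, hz] at hj
      omega
  · rcases Nat.lt_succ_iff_lt_or_eq.mp hb with h | rfl
    · exact H.below b h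
    · exact hz

/-- At `cur = 0` the nodes in the list of level `0` have smallest key. -/
theorem le_of_lev_zero (H : HeapInv n B N lev LB sz A act don 0 0 last) {u v : ℕ} (hu : act u)
    (h0 : lev u = 0) (hv : act v) : N u ≤ N v := by
  have h1 := H.agree u hu
  rw [h0] at h1
  simp only [pow_zero, Nat.div_one] at h1
  rcases Nat.eq_zero_or_pos (lev v) with h | h
  · have h2 := H.agree v hv
    rw [h] at h2
    simp only [pow_zero, Nat.div_one] at h2
    omega
  · have h2 := H.step v hv h (by omega)
    by_contra hlt
    have := Nat.div_le_div_right (c := 2 ^ (lev v - 1)) (not_le.mp hlt).le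
    rw [h1] at this
    omega

theorem eq_last (H : HeapInv n B N lev LB sz A act don cur f last) {u : ℕ} (hu : act u)
    (h0 : lev u = 0) : N u = last := by
  have h1 := H.agree u hu
  rw [h0] at h1
  simpa using h1

/-- Remove the last node from the list of level `0`. -/
theorem pop (H : HeapInv n B N lev LB sz A act don 0 f last) (hB : 0 < B) {k : ℕ}
    (hk : sz 0 = k + 1) (ha : ∀ v, act' v ↔ act v ∧ v ≠ A k) (hd : ∀ v, don' v ↔ don v ∨ v = A k) :
    HeapInv n B N lev LB (Function.update sz 0 k) A act' don' 0 f last := by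
  have hsz : ∀ b, Function.update sz 0 k b ≤ sz b := fun b => by
    rw [Function.update_apply]; split_ifs with h
    · subst h; omega
    · exact le_rfl
  have hu := H.entry_zero k (by omega)
  have hl : lev (A k) = 0 := by
    have := (H.entry 0 hB k (by omega)).2
    rw [Nat.zero_mul, Nat.zero_add] at this
    omega
  refine ⟨H.lev_le, fun v hv => H.act_lt v ((ha v).mp hv).1, fun v _ => Nat.zero_le _,
    fun v hv => H.lev_lt v ((ha v).mp hv).1, fun v hv => ?_,
    fun v hv => H.agree v ((ha v).mp hv).1, fun v hv => H.step v ((ha v).mp hv).1,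
    fun v hv hv' => ?_, fun v hv hv' => ?_, fun v hv h1 h2 => ?_,
    fun b hb j hj => H.entry b hb j (hj.trans_le (hsz b)), fun j hj => ?_,
    fun b hb j hj j' hj' => H.inj b hb j (hj.trans_le (hsz b)) j' (hj'.trans_le (hsz b)),
    fun b hb => absurd hb (Nat.not_lt_zero b), H.bits, H.last_lt⟩
  · obtain ⟨h1, h2⟩ := (ha v).mp hv
    obtain ⟨j, hj, hA⟩ := H.mem v h1
    refine ⟨j, ?_, hA⟩
    rw [Function.update_apply]; split_ifs with h
    · rw [h, hk] at hj
      rw [h, Nat.zero_mul, Nat.zero_add] at hA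
      have : j ≠ k := by rintro rfl; exact h2 hA.symm
      omega
    · exact hj
  · obtain ⟨h1, h2⟩ := (ha v).mp hv
    rcases (hd v).mp hv' with h | h
    · exact H.disj v h1 h
    · exact h2 h
  · rcases (hd v).mp hv' with h | h
    · exact H.done v hv h
    · rw [h, hl]
  · rw [hd, not_or] at h2
    exact H.rest v hv (fun h => h1 ((ha v).mpr ⟨h, h2.2⟩)) h2.1
  · rw [Function.update_self] at hj
    refine (ha _).mpr ⟨H.entry_zero j (by omega), fun h => ?_⟩
    have := H.inj 0 hB j (by omega) k (by omega) (by simpa using h)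
    omega

/-- A node is moved to a smaller level, possibly with a new key. -/
theorem push (H : HeapInv n B N lev LB sz A act don cur f last) {v b : ℕ} (hv : v < n)
    (hd : ¬ don v) (hN : ∀ u, u ≠ v → N' u = N u) (hb : b < lev v) (hcur : cur ≤ b)
    (hx : N' v / 2 ^ b = last / 2 ^ b)
    (hstep : 0 < b → cur + f ≤ b → N' v / 2 ^ (b - 1) = last / 2 ^ (b - 1) + 1)
    (ha : ∀ u, act' u ↔ act u ∨ u = v) :
    HeapInv n B N' (Function.update lev v b) LB (Function.update sz b (sz b + 1))
      (Function.update A (b * n + sz b) v) act' don cur f last := by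
  have hbB : b < B := hb.trans_le (H.lev_le v hv)
  have hszn := H.sz_lt hv hb
  have hA : ∀ b' < B, ∀ j < sz b',
      Function.update A (b * n + sz b) v (b' * n + j) = A (b' * n + j) :=
    fun b' hb' j hj => by
      refine Function.update_of_ne (fun h => ?_) _ _
      obtain ⟨rfl, rfl⟩ := mul_add_inj (hj.trans_le (H.sz_le hb')) hszn h
      omega
  have hAnew : Function.update A (b * n + sz b) v (b * n + sz b) = v := Function.update_self _ _ _
  have hnot : ∀ j < sz b, A (b * n + j) ≠ v := fun j hj h => by
    have := (H.entry b hbB j hj).2; rw [h] at this; omega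
  -- the entries of the new lists
  have hcase : ∀ b' < B, ∀ j < Function.update sz b (sz b + 1) b',
      (j < sz b' ∧ Function.update A (b * n + sz b) v (b' * n + j) = A (b' * n + j)) ∨
      (b' = b ∧ j = sz b ∧ Function.update A (b * n + sz b) v (b' * n + j) = v) := by
    intro b' hb' j hj
    rw [Function.update_apply] at hj
    split_ifs at hj with h
    · subst h
      rcases Nat.lt_succ_iff_lt_or_eq.mp hj with h1 | rfl
      · exact Or.inl ⟨h1, hA _ hb' j h1⟩
      · exact Or.inr ⟨rfl, rfl, hAnew⟩
    · exact Or.inl ⟨hj, hA b' hb' j hj⟩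
  have hlev : ∀ u, Function.update lev v b u ≤ lev u := fun u => by
    rw [Function.update_apply]; split_ifs with h
    · subst h; omega
    · exact le_rfl
  have hsz : ∀ b', sz b' ≤ Function.update sz b (sz b + 1) b' := fun b' => by
    rw [Function.update_apply]; split_ifs with h
    · subst h; omega
    · exact le_rfl
  have hself : Function.update lev v b v = b := Function.update_self _ _ _
  have hne : ∀ u, u ≠ v → Function.update lev v b u = lev u := fun u hu =>
    Function.update_of_ne hu _ _
  have hact : ∀ u, act' u → u = v ∨ (u ≠ v ∧ act u) := fun u hu => by
    by_cases h : u = v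
    · exact Or.inl h
    · exact Or.inr ⟨h, ((ha u).mp hu).resolve_right h⟩
  refine ⟨fun u hu => (hlev u).trans (H.lev_le u hu), fun u hu => ?_, fun u hu => ?_,
    fun u hu => ?_,
    fun u hu => ?_, fun u hu => ?_, fun u hu => ?_, fun u hu hdu => ?_, fun u hu hdu => ?_,
    fun u hu h1 h2 => ?_, fun b' hb' j hj => ?_, fun j hj => ?_, fun b' hb' j hj j' hj' h => ?_,
    fun b' hb' => ?_, H.bits, H.last_lt⟩
  · rcases hact u hu with rfl | ⟨-, h⟩
    · exact hv
    · exact H.act_lt u h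
  · rcases hact u hu with rfl | ⟨h1, h⟩
    · rw [hself]; exact hcur
    · rw [hne u h1]; exact H.le_lev u h
  · rcases hact u hu with rfl | ⟨h1, h⟩
    · rw [hself]; exact hbB
    · rw [hne u h1]; exact H.lev_lt u h
  · rcases hact u hu with rfl | ⟨h1, h⟩
    · rw [hself]; exact ⟨sz b, by simp, hAnew⟩
    · rw [hne u h1]
      obtain ⟨j, hj, hAj⟩ := H.mem u h
      exact ⟨j, hj.trans_le (hsz _), by rw [hA _ (H.lev_lt u h) j hj, hAj]⟩
  · rcases hact u hu with rfl | ⟨h1, h⟩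
    · rw [hself]; exact hx
    · rw [hne u h1, hN u h1]; exact H.agree u h
  · rcases hact u hu with rfl | ⟨h1, h⟩
    · rw [hself]; exact hstep
    · rw [hne u h1, hN u h1]; exact H.step u h
  · rcases hact u hu with rfl | ⟨h1, h⟩
    · exact hd hdu
    · exact H.disj u h hdu
  · rw [hne u (by rintro rfl; exact hd hdu)]; exact H.done u hu hdu
  · rw [ha, not_or] at h1
    rw [hne u h1.2]; exact H.rest u hu h1.1 h2
  · rcases hcase b' hb' j hj with ⟨h1, h2⟩ | ⟨rfl, -, h2⟩
    · rw [h2]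
      obtain ⟨h3, h4⟩ := H.entry b' hb' j h1
      exact ⟨h3, (hlev _).trans h4⟩
    · rw [h2, hself]; exact ⟨hv, le_rfl⟩
  · have := hcase 0 (by omega) j hj
    rw [Nat.zero_mul, Nat.zero_add] at this
    rw [ha]
    rcases this with ⟨h1, h2⟩ | ⟨-, -, h2⟩
    · rw [h2]; exact Or.inl (H.entry_zero j h1)
    · exact Or.inr h2
  · rcases hcase b' hb' j hj with ⟨h1, h2⟩ | ⟨rfl, h1, h2⟩ <;>
      rcases hcase _ hb' j' hj' with ⟨h3, h4⟩ | ⟨h5, h3, h4⟩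
    · rw [h2, h4] at h; exact H.inj b' hb' j h1 j' h3 h
    · rw [h2, h4] at h; subst h5; exact absurd h (hnot j h1)
    · rw [h2, h4] at h; exact absurd h.symm (hnot j' h3)
    · omega
  · rw [Function.update_of_ne (by omega)]; exact H.below b' hb'

/-- The key of a node in the queue changes, but its level does not. -/
theorem rekey (H : HeapInv n B N lev LB sz A act don cur f last) {v : ℕ}
    (hN : ∀ u, u ≠ v → N' u = N u) (hx : N' v / 2 ^ lev v = last / 2 ^ lev v)
    (hstep : 0 < lev v → cur + f ≤ lev v →
      N' v / 2 ^ (lev v - 1) = last / 2 ^ (lev v - 1) + 1) :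
    HeapInv n B N' lev LB sz A act don cur f last := by
  refine { H with agree := fun u hu => ?_, step := fun u hu => ?_ }
  · by_cases h : u = v
    · subst h; exact hx
    · rw [hN u h]; exact H.agree u hu
  · by_cases h : u = v
    · subst h; exact hstep
    · rw [hN u h]; exact H.step u hu

theorem two_mul_add_div {a b z : ℕ} (hz : z ≤ 1) (hb : 0 < b) :
    ∀ c, b ≤ c → (2 * (a / 2 ^ b) + z) * 2 ^ (b - 1) / 2 ^ c = a / 2 ^ c := by
  intro c hc
  obtain ⟨e, rfl⟩ := Nat.exists_eq_add_of_le hc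
  have h1 : 2 ^ b = 2 ^ (b - 1) * 2 := by rw [← pow_succ]; congr 1; omega
  have h2 : (2 * (a / 2 ^ b) + z) * 2 ^ (b - 1) / 2 ^ b = a / 2 ^ b := by
    generalize a / 2 ^ b = q
    rw [h1, ← Nat.div_div_eq_div_mul, Nat.mul_div_cancel _ (by positivity)]
    omega
  rw [pow_add, ← Nat.div_div_eq_div_mul, h2, Nat.div_div_eq_div_mul]

/-- Before the list of the level `b` is split, `last` is extended by the bit `z`. -/
theorem beginSplit {b z : ℕ} (H : HeapInv n B N lev LB sz A act don b f last) (hf : f ≤ 1)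
    (h0 : 0 < b) (hb : b < B) (hz : z ≤ 1) :
    HeapInv n B N lev (Function.update LB (b - 1) z) sz A act don (b - 1) 2
      ((2 * (last / 2 ^ b) + z) * 2 ^ (b - 1)) := by
  have hdiv := two_mul_add_div (a := last) hz h0
  refine { H with le_lev := fun v hv => ?_, agree := fun v hv => ?_, step := fun v hv h1 h2 => ?_,
                  below := fun c hc => H.below c (by omega), bits := fun c h1 h2 => ?_,
                  last_lt := ?_ }
  · have := H.le_lev v hv; omega
  · rw [hdiv _ (H.le_lev v hv)]; exact H.agree v hv
  · rw [hdiv _ (by omega)]; exact H.step v hv h1 (by omega)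
  · rw [Function.update_apply]
    split_ifs with h
    · subst h
      rw [Nat.mul_div_cancel _ (by positivity)]; omega
    · rw [hdiv c (by omega)]; exact H.bits c (by omega) h2
  · have h1 := hdiv (B - 1) (by omega)
    rw [Nat.div_eq_of_lt H.last_lt] at h1
    by_contra hle
    have := (Nat.one_le_div_iff (by positivity)).mpr (not_lt.mp hle)
    omega

/-- The list has been split when the remaining nodes of its level have a greater bit. -/
theorem endSplit {b : ℕ} (H : HeapInv n B N lev LB sz A act don b 2 last)
    (h : ∀ v, act v → lev v = b + 1 → N v / 2 ^ b = last / 2 ^ b + 1) :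
    HeapInv n B N lev LB sz A act don b 1 last := by
  refine { H with step := fun v hv h1 h2 => ?_ }
  rcases h2.lt_or_eq with h3 | h3
  · exact H.step v hv h1 (by omega)
  · rw [← h3]; exact h v hv h3.symm

/-- Discard a list of nodes that have all moved to smaller levels. -/
theorem clear {b : ℕ} (H : HeapInv n B N lev LB sz A act don cur f last)
    (h : ∀ v, act v → lev v ≠ b) :
    HeapInv n B N lev LB (Function.update sz b 0) A act don cur f last := by
  have hsz : ∀ b', Function.update sz b 0 b' ≤ sz b' := fun b' => by
    rw [Function.update_apply]; split_ifs <;> simp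
  refine { H with mem := fun v hv => ?_,
                  entry := fun b' hb' j hj => H.entry b' hb' j (hj.trans_le (hsz b')),
                  entry_zero := fun j hj => H.entry_zero j (hj.trans_le (hsz 0)),
                  inj := fun b' hb' j hj j' hj' =>
                    H.inj b' hb' j (hj.trans_le (hsz b')) j' (hj'.trans_le (hsz b')),
                  below := fun b' hb' => by have := hsz b'; have := H.below b' hb'; omega }
  obtain ⟨j, hj, hA⟩ := H.mem v hv
  exact ⟨j, by rw [Function.update_of_ne (h v hv)]; exact hj, hA⟩

theorem f_zero (H : HeapInv n B N lev LB sz A act don 0 1 last) :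
    HeapInv n B N lev LB sz A act don 0 0 last :=
  { H with step := fun v hv h1 _ => H.step v hv h1 (by omega) }

end HeapInv

theorem heapInv_empty {n B : ℕ} {N lev LB sz A : ℕ → ℕ} (hl : ∀ v < n, lev v = B)
    (hLB : ∀ b, LB b = 0) (hsz : ∀ b, sz b = 0) :
    HeapInv n B N lev LB sz A (fun _ => False) (fun _ => False) 0 0 0 := by
  constructor <;> simp_all

end WordRAM

namespace WordRAM
open Exp Prog

variable {I : Inst} {W : ℕ}

/-! ### The queue on the word RAM -/

/-- The components of the potential of `v`, the most significant one first. The components with even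
index are numbers of strongly connected components, the others belong to the label. -/
def Inst.keyDig (I : Inst) (c : ℕ → ℕ) (v t : ℕ) : ℕ :=
  c (v * I.h + ((t + 1) % 2 * (I.n * I.h) + t / 2))

/-- The potential of `v` as a number. -/
def Inst.key (I : Inst) (c : ℕ → ℕ) (v : ℕ) : ℕ := dval (2 ^ I.L) (I.keyDig c v) I.d

/-- The number of bits of the keys. -/
abbrev Inst.B (I : Inst) : ℕ := I.d * I.L

/-- The components of all potentials are at most `n`. -/
def DigitsLe (I : Inst) (c : ℕ → ℕ) : Prop := ∀ v < I.n, ∀ t < I.d, I.keyDig c v t ≤ I.n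

theorem Inst.lt_two_pow (I : Inst) : I.n < 2 ^ (I.L - 1) := by
  rw [I.L_eq, Nat.add_sub_cancel]; exact Nat.lt_size_self I.n

theorem Inst.L_pos (I : Inst) : 0 < I.L := by rw [I.L_eq]; omega

theorem Inst.h_pos (I : Inst) : 0 < I.h := by
  have := I.pri_pos 0 I.n_pos
  have := I.pri_le 0 I.n_pos
  have := I.d_eq
  omega

theorem Inst.B_pos (I : Inst) : 0 < I.B :=
  Nat.mul_pos (by have := I.h_pos; have := I.d_eq; omega) I.L_pos

theorem DigitsLe.lt {c : ℕ → ℕ} (hD : DigitsLe I c) {v t : ℕ} (hv : v < I.n) (ht : t < I.d) :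
    I.keyDig c v t < 2 ^ I.L :=
  (hD v hv t ht).trans_lt (I.lt_two_pow.trans_le (Nat.pow_le_pow_right (by norm_num) (by omega)))

/-- The most significant bit of a key is zero. -/
theorem DigitsLe.key_lt {c : ℕ → ℕ} (hD : DigitsLe I c) {v : ℕ} (hv : v < I.n) :
    I.key c v < 2 ^ (I.B - 1) := by
  have key : ∀ k, k + 1 ≤ I.d →
      dval (2 ^ I.L) (I.keyDig c v) (k + 1) < 2 ^ (I.L - 1) * (2 ^ I.L) ^ k := by
    intro k
    induction k with
    | zero =>
      intro hk
      simpa [dval] using (hD v hv 0 (by omega)).trans_lt I.lt_two_pow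
    | succ k ih =>
      intro hk
      rw [dval, pow_succ, ← mul_assoc]
      exact mul_add_lt (hD.lt hv (by omega)) (ih (by omega))
  have hd : 0 < I.d := by have := I.h_pos; have := I.d_eq; omega
  have := key (I.d - 1) (by omega)
  rw [Nat.sub_add_cancel hd] at this
  refine this.trans_le (le_of_eq ?_)
  rw [← pow_mul, ← pow_add]
  congr 1
  unfold Inst.B
  obtain ⟨e, he⟩ := Nat.exists_eq_succ_of_ne_zero hd.ne'
  have hL := I.L_pos
  rw [he, Nat.succ_sub_one, Nat.succ_mul, mul_comm e]
  omega

/-- The expression for a bit of the key of a node. -/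
def bitExp (v b : Exp) : Exp := cell 8 (cell 21 (v *ₑ reg 3 +ₑ cell 9 b) *ₑ reg 4 +ₑ cell 10 b)

/-- The value of this expression, and the size of the numbers that occur in its evaluation. -/
theorem Static.bit_eq (hW : I.Bounded W) {s : State} (hs : Static I s) (hD : DigitsLe I (s.arr 21))
    {v b : ℕ} (hv : v < I.n) (hb : b < I.B) :
    s.arr 8 (s.arr 21 (v * I.h + s.arr 9 b) * I.L + s.arr 10 b) =
      I.key (s.arr 21) v / 2 ^ b % 2 ∧
    v * I.h + s.arr 9 b ≤ W ∧ s.arr 21 (v * I.h + s.arr 9 b) * I.L + s.arr 10 b ≤ W ∧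
    s.arr 21 (v * I.h + s.arr 9 b) ≤ W := by
  have hL := I.L_pos
  have hd := I.d_eq
  obtain ⟨i, j, hj, rfl⟩ : ∃ i j, j < I.L ∧ b = i * I.L + j :=
    ⟨b / I.L, b % I.L, Nat.mod_lt _ hL, (Nat.div_add_mod' b I.L).symm⟩
  have hi : i < I.d := by
    by_contra hlt
    have := Nat.mul_le_mul_right I.L (not_lt.mp hlt)
    unfold Inst.B at hb
    omega
  rw [hs.digit i hi j hj, hs.bit i hi j hj]
  have haddr : i % 2 * (I.n * I.h) + (I.h - 1 - i / 2) =
      (I.d - 1 - i + 1) % 2 * (I.n * I.h) + (I.d - 1 - i) / 2 := by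
    congr 2 <;> omega
  have hdig : s.arr 21 (v * I.h + (i % 2 * (I.n * I.h) + (I.h - 1 - i / 2))) =
      I.keyDig (s.arr 21) v (I.d - 1 - i) := by rw [haddr]; rfl
  have hle := hD v hv (I.d - 1 - i) (by omega)
  rw [hdig]
  refine ⟨?_, ?_, ?_, ?_⟩
  · rw [hs.bits _ hle j hj]
    exact (dval_bit (fun t ht => hD.lt hv ht) hi hj).symm
  · have h1 : i % 2 * (I.n * I.h) ≤ 1 * (I.n * I.h) := Nat.mul_le_mul_right _ (by omega)
    have h2 := mul_add_lt (show I.h - 1 - i / 2 < I.h by have := I.h_pos; omega) hv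
    have := hW.nh
    omega
  · have := mul_add_lt (L := I.L) (a := I.keyDig (s.arr 21) v (I.d - 1 - i)) (b := I.n + 1) hj
      (by omega)
    have := hW.nL
    omega
  · have := hW.lin
    omega

/-- The state of the priority queue. -/
abbrev HeapAt (I : Inst) (s : State) (act don : ℕ → Prop) (cur f last : ℕ) : Prop :=
  HeapInv I.n I.B (I.key (s.arr 21)) (s.arr 22) (s.arr 31) (s.arr 33) (s.arr 32) act don cur f last

/-- The time that suffices for future operations on the queue. A node that moves down by at least
one level releases `1000` units. Of these, `300` stay with its entry in the new list and pay for the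
scan after which this list is discarded; if the move is part of a split, another `300` pay for the
split of the list that it creates; the rest pays for the move itself. -/
def Inst.credit (I : Inst) (lev sz : ℕ → ℕ) : ℕ :=
  (∑ v ∈ Finset.range I.n, 1000 * lev v) + ∑ b ∈ Finset.range I.B, 300 * sz b

theorem Inst.credit_push {lev sz : ℕ → ℕ} {v b : ℕ} (hv : v < I.n) (hb : b < I.B) :
    I.credit (Function.update lev v b) (Function.update sz b (sz b + 1)) + 1000 * lev v =
      I.credit lev sz + 1000 * b + 300 := by
  have h1 := sum_update (f := lev) (y := b) (fun _ x => 1000 * x) hv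
  have h2 := sum_update (f := sz) (y := sz b + 1) (fun _ x => 300 * x) hb
  unfold Inst.credit
  omega

theorem Inst.credit_sz {lev sz : ℕ → ℕ} {b x : ℕ} (hb : b < I.B) :
    I.credit lev (Function.update sz b x) + 300 * sz b = I.credit lev sz + 300 * x := by
  have h2 := sum_update (f := sz) (y := x) (fun _ x => 300 * x) hb
  unfold Inst.credit
  omega

theorem Inst.le_credit {lev sz : ℕ → ℕ} {v : ℕ} (hv : v < I.n) :
    1000 * lev v ≤ I.credit lev sz := by
  have := Finset.single_le_sum (f := fun v => 1000 * lev v) (fun v _ => Nat.zero_le _)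
    (Finset.mem_range.mpr hv)
  unfold Inst.credit
  omega

/-- The node in register `30` moves to the level in register `r`. -/
def pushProg (r : ℕ) : Prog :=
  store 32 (reg r *ₑ reg 0 +ₑ cell 33 (reg r)) (reg 30) ;;
  store 33 (reg r) (cell 33 (reg r) +ₑ lit 1) ;; store 22 (reg 30) (reg r)

/-- The key of the node in register `30` has been set or has decreased. -/
def placeProg : Prog :=
  assign 40 (cell 22 (reg 30)) ;;
  .while (reg 40 *ₑ (lit 1 -ₑ
      ((bitExp (reg 30) (reg 40 -ₑ lit 1) -ₑ cell 31 (reg 40 -ₑ lit 1)) +ₑ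
        (cell 31 (reg 40 -ₑ lit 1) -ₑ bitExp (reg 30) (reg 40 -ₑ lit 1)))))
    (assign 40 (reg 40 -ₑ lit 1)) ;;
  ite (cell 22 (reg 30) -ₑ reg 40) (pushProg 40) .skip

theorem Inst.Bounded.addr_le (hW : I.Bounded W) {b j : ℕ} (hb : b < I.B) (hj : j ≤ I.n) :
    b * I.n + j ≤ W := by
  have h1 : (b + 1) * I.n ≤ I.B * I.n := Nat.mul_le_mul_right _ hb
  have h2 := hW.B
  have h3 : I.d * I.L * (I.n + 1) = I.B * I.n + I.B := by unfold Inst.B; ring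
  rw [Nat.succ_mul] at h1
  omega

theorem Inst.Bounded.B_le (hW : I.Bounded W) : I.B + 2 ≤ W := by
  have h2 := hW.B
  have h3 : I.d * I.L * (I.n + 1) = I.B * I.n + I.B := by unfold Inst.B; ring
  have h4 := Nat.mul_le_mul_left I.B I.n_pos
  have h5 := I.B_pos
  have h6 := hW.lin
  by_contra
  omega

theorem div_two_pow_pred (x : ℕ) {b : ℕ} (hb : 0 < b) :
    x / 2 ^ (b - 1) = 2 * (x / 2 ^ b) + x / 2 ^ (b - 1) % 2 := by
  have : x / 2 ^ b = x / 2 ^ (b - 1) / 2 := by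
    rw [Nat.div_div_eq_div_mul, ← pow_succ, Nat.sub_add_cancel hb]
  omega

/-- The invariant of the loop that determines the level of a node. -/
structure PlaceLoop (I : Inst) (v last c : ℕ) (s₀ s : State) (T : ℕ) : Prop where
  same : Same [40] [] s₀ s
  state : ∃ b ≤ s₀.arr 22 v, s.reg 40 = b ∧ I.key (s₀.arr 21) v / 2 ^ b = last / 2 ^ b ∧
    I.credit (s₀.arr 22) (s₀.arr 33) + c + 90 ≤ T + 60 * (s₀.arr 22 v - b)

/-- The new level is found by going down from the old one as long as the bits of the key agree with
those of `last`; every step of the loop is paid by a level. -/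
theorem placeProg_runs (hW : I.Bounded W) {s : State} (hs : Static I s) {v last c T : ℕ}
    {N : ℕ → ℕ} {act don act' : ℕ → Prop} (hD : DigitsLe I (s.arr 21))
    (H : HeapInv I.n I.B N (s.arr 22) (s.arr 31) (s.arr 33) (s.arr 32) act don 0 0 last)
    (h30 : s.reg 30 = v) (hv : v < I.n) (hd : ¬ don v) (ha : ∀ u, act' u ↔ act u ∨ u = v)
    (hN : ∀ u, u ≠ v → I.key (s.arr 21) u = N u) (hlast : last ≤ I.key (s.arr 21) v)
    (hle : act v → I.key (s.arr 21) v ≤ N v)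
    (hT : I.credit (s.arr 22) (s.arr 33) + c + 100 ≤ T) {Q : State → ℕ → Prop}
    (hQ : ∀ s' T', HeapAt I s' act' don 0 0 last → Same [40] [22, 32, 33] s s' →
      I.credit (s'.arr 22) (s'.arr 33) + c ≤ T' → Q s' T') : Runs W placeProg Q s T := by
  have w1 := hW.lin
  have hBW := hW.B_le
  have hB0 := I.B_pos
  have hd2 := I.d_eq
  have hlv := H.lev_le v hv
  have hcr := I.le_credit (lev := s.arr 22) (sz := s.arr 33) hv
  set x := I.key (s.arr 21) v with hx
  have hagree : x / 2 ^ s.arr 22 v = last / 2 ^ s.arr 22 v := by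
    by_cases hav : act v
    · refine le_antisymm ?_ (Nat.div_le_div_right hlast)
      rw [← H.agree v hav]
      exact Nat.div_le_div_right (hle hav)
    · rw [H.rest v hv hav hd]
      have h1 : 2 ^ (I.B - 1) ≤ 2 ^ I.B := Nat.pow_le_pow_right (by norm_num) (by omega)
      rw [Nat.div_eq_of_lt ((hD.key_lt hv).trans_le h1), Nat.div_eq_of_lt (H.last_lt.trans_le h1)]
  unfold placeProg
  rw [runs_seq]
  simp [h30]
  and_intros
  all_goals try omega
  refine Runs.while (I := PlaceLoop I v last c s)
    ⟨by simp, s.arr 22 v, le_rfl, by simp, hagree, by omega⟩ ?_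
  rintro s₁ T ⟨hf, b, hb, h40, hag, hT⟩
  rw [← hx] at hag
  have h3 : s₁.reg 3 = I.h := by rw [hf.1 3 (by simp), hs.reg3]
  have h4 : s₁.reg 4 = I.L := by rw [hf.1 4 (by simp), hs.reg4]
  have h0 : s₁.reg 0 = I.n := by rw [hf.1 0 (by simp), hs.reg0]
  have h30' : s₁.reg 30 = v := by rw [hf.1 30 (by simp), h30]
  have harr : s₁.arr = s.arr := funext fun a => hf.2 a (by simp)
  obtain ⟨hbit, b1, b2, b3⟩ := hs.bit_eq hW hD hv (show b - 1 < I.B by omega)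
  rw [← hx] at hbit
  have hLB := H.bits (b - 1) (by omega) (by omega)
  simp only [bitExp, Exp.Fits, Exp.cost, Exp.val, h40, h3, h4, h30', harr, hbit, hLB]
  have hm1 : x / 2 ^ (b - 1) % 2 < 2 := Nat.mod_lt _ (by norm_num)
  have hm2 : last / 2 ^ (b - 1) % 2 < 2 := Nat.mod_lt _ (by norm_num)
  have hprod : b * (1 - (x / 2 ^ (b - 1) % 2 - last / 2 ^ (b - 1) % 2 +
      (last / 2 ^ (b - 1) % 2 - x / 2 ^ (b - 1) % 2))) ≤ b :=
    (Nat.mul_le_mul_left b (show _ ≤ 1 by omega)).trans (by omega)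
  refine ⟨by and_intros <;> omega, by omega, fun hne => ?_, fun heq => ?_⟩
  · rw [Nat.mul_ne_zero_iff] at hne
    have hb0 : 0 < b := by omega
    simp [h40]
    refine ⟨by omega, by omega, by simpa using hf, b - 1, by omega, by simp, ?_, by omega⟩
    rw [div_two_pow_pred x hb0, div_two_pow_pred last hb0]
    omega
  · have hstep : 0 < b → x / 2 ^ (b - 1) = last / 2 ^ (b - 1) + 1 := by
      intro hb0
      have h1 := div_two_pow_pred x hb0
      have h2 := div_two_pow_pred last hb0
      have h3 := Nat.div_le_div_right (c := 2 ^ (b - 1)) hlast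
      rcases Nat.mul_eq_zero.mp heq with h | h <;> omega
    have hbB : b < I.B := by
      rcases (hb.trans hlv).lt_or_eq with h | h
      · exact h
      · have h1 := hstep (by omega)
        have h2 : x / 2 ^ (b - 1) = 0 := by rw [h]; exact Nat.div_eq_of_lt (hD.key_lt hv)
        rw [h2] at h1
        exact absurd h1.symm (Nat.succ_ne_zero _)
    simp only [pushProg, runs_ite, runs_seq, runs_store, runs_skip]
    simp [h40, h30', harr, h0]
    and_intros
    all_goals try omega
    · intro hlt
      have hsz := H.sz_lt hv (show b < s.arr 22 v by omega)
      have haddr := hW.addr_le hbB hsz.le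
      have hc := I.credit_push (lev := s.arr 22) (sz := s.arr 33) hv hbB
      and_intros
      all_goals try omega
      refine hQ _ _ ?_ ?_ ?_
      · have := H.push hv hd hN (by omega) (by omega) hag (fun h _ => hstep h) ha
        simpa [HeapAt, harr] using this
      · simpa using hf.weaken (by simp) (by simp)
      · simp [harr]; omega
    · intro hge
      have hbe : b = s.arr 22 v := by omega
      refine ⟨by omega, hQ _ _ ?_ (hf.weaken (by simp) (by simp)) (by simp [harr]; omega)⟩
      have hav : act v := by
        by_contra hav
        have := H.rest v hv hav hd
        omega
      have hact : act' = act := funext fun u => propext ((ha u).trans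
        ⟨fun h => h.elim id fun h => h ▸ hav, Or.inl⟩)
      rw [hact]
      have := H.rekey hN (v := v) (by rw [← hbe]; exact hag)
          (fun h _ => by rw [← hbe]; exact hstep (by omega))
      simpa [HeapAt, harr] using this

/-- Move the nodes with smallest keys in the list of the current level, which is the content of
register `41`, to the next smaller level. -/
def splitProg : Prog :=
  assign 43 (reg 41 -ₑ lit 1) ;; assign 42 (cell 33 (reg 41)) ;; assign 44 (lit 1) ;;
  assign 45 (lit 0) ;;
  Prog.for 45 42 (assign 30 (cell 32 (reg 41 *ₑ reg 0 +ₑ reg 45)) ;;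
    ite (reg 41 -ₑ cell 22 (reg 30)) .skip
      (assign 44 (reg 44 *ₑ bitExp (reg 30) (reg 43)))) ;;
  store 31 (reg 43) (reg 44) ;; assign 45 (lit 0) ;;
  Prog.for 45 42 (assign 30 (cell 32 (reg 41 *ₑ reg 0 +ₑ reg 45)) ;;
    ite (reg 41 -ₑ cell 22 (reg 30)) .skip
      (ite (bitExp (reg 30) (reg 43) -ₑ reg 44) .skip (pushProg 43))) ;;
  ite (reg 44) (store 33 (reg 41) (lit 0)) .skip ;; assign 41 (reg 43)

/-- The invariant of the loop that computes the smallest bit `z` of the nodes in a list. -/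
structure MinBit (I : Inst) (b f : ℕ) (s₀ : State) (j : ℕ) (s : State) : Prop where
  same : Same [30, 44, 45] [] s₀ s
  le_one : s.reg 44 ≤ 1
  min : ∀ i < j, s₀.arr 22 (s₀.arr 32 (b * I.n + i)) = b →
    s.reg 44 ≤ I.key (s₀.arr 21) (s₀.arr 32 (b * I.n + i)) / 2 ^ (b - 1) % 2
  one : f = 0 → s.reg 44 = 1

/-- The invariant of the loop that moves the nodes whose next bit is `z`. The number `e` is a debt,
to be paid when the list is discarded. -/
structure MoveLoop (I : Inst) (b z last c e : ℕ) (act don : ℕ → Prop) (s₀ : State) (j : ℕ)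
    (s : State) (T : ℕ) : Prop where
  same : Same [30, 45] [22, 32, 33] s₀ s
  heap : HeapAt I s act don (b - 1) 2 last
  size : s.arr 33 b = s₀.arr 33 b
  list : ∀ i < s₀.arr 33 b, s.arr 32 (b * I.n + i) = s₀.arr 32 (b * I.n + i)
  level : ∀ v, s.arr 22 v = b → s₀.arr 22 v = b
  moved : ∀ i < j, s.arr 22 (s₀.arr 32 (b * I.n + i)) = b →
    I.key (s₀.arr 21) (s₀.arr 32 (b * I.n + i)) / 2 ^ (b - 1) % 2 ≠ z
  time : I.credit (s.arr 22) (s.arr 33) + 300 * s.arr 33 (b - 1) + c + 60 * (s₀.arr 33 b - j) + 40 ≤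
    T + e

end WordRAM

namespace WordRAM
open Exp Prog

variable {I : Inst} {W : ℕ}

theorem Inst.le_credit_sz {lev sz : ℕ → ℕ} {b : ℕ} (hb : b < I.B) :
    300 * sz b ≤ I.credit lev sz := by
  have := Finset.single_le_sum (f := fun b => 300 * sz b) (fun v _ => Nat.zero_le _)
    (Finset.mem_range.mpr hb)
  unfold Inst.credit
  omega

/-- One round of the loop that computes the smallest bit. -/
theorem minBit_step (hW : I.Bounded W) {s₀ s : State} (hs : Static I s₀) {b f j last : ℕ}
    {act don : ℕ → Prop} (hD : DigitsLe I (s₀.arr 21)) (H : HeapAt I s₀ act don b f last)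
    (h0 : 0 < b) (hb : b < I.B) (h41 : s₀.reg 41 = b) (h43 : s₀.reg 43 = b - 1)
    (hj : j < s₀.arr 33 b) (h45 : s.reg 45 = j) (hI : MinBit I b f s₀ j s) :
    Does W (assign 30 (cell 32 (reg 41 *ₑ reg 0 +ₑ reg 45)) ;;
      ite (reg 41 -ₑ cell 22 (reg 30)) .skip (assign 44 (reg 44 *ₑ bitExp (reg 30) (reg 43)))) s 28
      fun s' => s'.reg 45 = j ∧ s'.reg 42 = s₀.reg 42 ∧
        MinBit I b f s₀ (j + 1) (s'.setReg 45 (j + 1)) := by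
  obtain ⟨hf, hle, hmin, hone⟩ := hI
  have w1 := hW.lin
  have hBW := hW.B_le
  have hd2 := I.d_eq
  have harr : s.arr = s₀.arr := funext fun a => hf.2 a (by simp)
  have r0 : s.reg 0 = I.n := by rw [hf.1 0 (by simp), hs.reg0]
  have r3 : s.reg 3 = I.h := by rw [hf.1 3 (by simp), hs.reg3]
  have r4 : s.reg 4 = I.L := by rw [hf.1 4 (by simp), hs.reg4]
  have r41 : s.reg 41 = b := by rw [hf.1 41 (by simp), h41]
  have r42 : s.reg 42 = s₀.reg 42 := hf.1 42 (by simp)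
  have r43 : s.reg 43 = b - 1 := by rw [hf.1 43 (by simp), h43]
  obtain ⟨hvn, hlev⟩ := H.entry b hb j hj
  have hsz := H.sz_le hb
  have haddr := hW.addr_le hb (hj.le.trans hsz)
  set v := s₀.arr 32 (b * I.n + j) with hv
  obtain ⟨hbit, b1, b2, b3⟩ := hs.bit_eq hW hD hvn (show b - 1 < I.B by omega)
  set x := I.key (s₀.arr 21) v / 2 ^ (b - 1) % 2 with hx
  have hx1 : x ≤ 1 := by
    have := Nat.mod_lt (I.key (s₀.arr 21) v / 2 ^ (b - 1)) (y := 2) (by norm_num)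
    omega
  have hmul : s.reg 44 * x ≤ s.reg 44 := (Nat.mul_le_mul_left _ hx1).trans (by omega)
  have hmul' : s.reg 44 * x ≤ x := (Nat.mul_le_mul_right _ hle).trans (by omega)
  unfold Does
  simp [bitExp, h45, r0, r3, r4, r41, r43, harr, ← hv, hbit, r42]
  and_intros
  all_goals try (show (_ : ℕ) ≤ _; omega)
  · intro hlt
    refine ⟨by simpa using hf, by simpa using hle, fun i hi hi2 => ?_, by simpa using hone⟩
    rcases Nat.lt_succ_iff_lt_or_eq.mp hi with h | rfl
    · simpa using hmin i h hi2
    · rw [← hv] at hi2; omega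
  · intro hge
    and_intros
    all_goals try (show (_ : ℕ) ≤ _; omega)
    refine ⟨by simpa using hf, by simp; omega, fun i hi hi2 => ?_, fun h => ?_⟩
    · rcases Nat.lt_succ_iff_lt_or_eq.mp hi with h | rfl
      · have := hmin i h hi2
        simp; omega
      · rw [← hv, ← hx]; simpa using hmul'
    · have hlb : s₀.arr 22 v = b := by omega
      have hav : act v := H.act_of_lev hvn (by omega) (by omega)
      have h1 := H.step v hav (by omega) (by omega)
      have h2 := H.agree v hav
      have h3 := div_two_pow_pred (I.key (s₀.arr 21) v) h0
      have h4 := div_two_pow_pred last h0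
      rw [hlb] at h1 h2
      have : x = 1 := by
        have := Nat.mod_lt (last / 2 ^ (b - 1)) (y := 2) (by norm_num)
        omega
      simp [hone h, this]

/-- One round of the loop that moves nodes to the next smaller level. -/
theorem move_step (hW : I.Bounded W) {s₀ s : State} (hs : Static I s₀) {b z j last last₀ c e T : ℕ}
    {act don : ℕ → Prop} (hD : DigitsLe I (s₀.arr 21))
    (H : HeapInv I.n I.B (I.key (s₀.arr 21)) (s₀.arr 22) (s₀.arr 31) (s₀.arr 33) (s₀.arr 32)
      act don (b - 1) 2 last₀) (h0 : 0 < b) (hb : b < I.B)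
    (hz : last / 2 ^ (b - 1) % 2 = z)
    (hmin : ∀ i < s₀.arr 33 b, s₀.arr 22 (s₀.arr 32 (b * I.n + i)) = b →
      z ≤ I.key (s₀.arr 21) (s₀.arr 32 (b * I.n + i)) / 2 ^ (b - 1) % 2)
    (h41 : s₀.reg 41 = b)
    (h43 : s₀.reg 43 = b - 1) (h44 : s₀.reg 44 = z) (hj : j < s₀.arr 33 b)
    (h45 : s.reg 45 = j) (he : e ≤ 96 * s₀.arr 33 b + 120)
    (hI : MoveLoop I b z last c e act don s₀ j s T) : 60 ≤ T ∧
    Runs W (assign 30 (cell 32 (reg 41 *ₑ reg 0 +ₑ reg 45)) ;;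
      ite (reg 41 -ₑ cell 22 (reg 30)) .skip
        (ite (bitExp (reg 30) (reg 43) -ₑ reg 44) .skip (pushProg 43)))
      (fun s' T' => s'.reg 45 = j ∧ s'.reg 42 = s₀.reg 42 ∧ 4 ≤ T' ∧
        MoveLoop I b z last c e act don s₀ (j + 1) (s'.setReg 45 (j + 1)) (T' - 4)) s (T - 4) := by
  obtain ⟨hf, hH, hsize, hlist, hlevel, hmoved, hT⟩ := hI
  have w1 := hW.lin
  have hBW := hW.B_le
  have hd2 := I.d_eq
  have hcr := I.le_credit_sz (lev := s.arr 22) (sz := s.arr 33) hb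
  rw [hsize] at hcr
  have hT60 : 60 ≤ T := by omega
  refine ⟨hT60, ?_⟩
  have r0 : s.reg 0 = I.n := by rw [hf.1 0 (by simp), hs.reg0]
  have r3 : s.reg 3 = I.h := by rw [hf.1 3 (by simp), hs.reg3]
  have r4 : s.reg 4 = I.L := by rw [hf.1 4 (by simp), hs.reg4]
  have r41 : s.reg 41 = b := by rw [hf.1 41 (by simp), h41]
  have r42 : s.reg 42 = s₀.reg 42 := hf.1 42 (by simp)
  have r43 : s.reg 43 = b - 1 := by rw [hf.1 43 (by simp), h43]
  have r44 : s.reg 44 = z := by rw [hf.1 44 (by simp), h44]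
  have a8 : s.arr 8 = s₀.arr 8 := hf.2 8 (by simp)
  have a9 : s.arr 9 = s₀.arr 9 := hf.2 9 (by simp)
  have a10 : s.arr 10 = s₀.arr 10 := hf.2 10 (by simp)
  have a21 : s.arr 21 = s₀.arr 21 := hf.2 21 (by simp)
  have hent := hH.entry b hb j (by rw [hsize]; exact hj)
  rw [hlist j hj] at hent
  obtain ⟨hvn, hlev⟩ := hent
  have hsz := H.sz_le hb
  have haddr := hW.addr_le hb (hj.le.trans hsz)
  have hA := hlist j hj
  set v := s₀.arr 32 (b * I.n + j) with hv
  obtain ⟨hbit, b1, b2, b3⟩ := hs.bit_eq hW hD hvn (show b - 1 < I.B by omega)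
  set x := I.key (s₀.arr 21) v / 2 ^ (b - 1) % 2 with hx
  have hx1 : x < 2 := Nat.mod_lt _ (by norm_num)
  have hz1 : z < 2 := by rw [← hz]; exact Nat.mod_lt _ (by norm_num)
  -- an entry that is not moved
  have hskip : ∀ T', (s.arr 22 v = b → x ≠ z) → T ≤ T' + 60 →
      MoveLoop I b z last c e act don s₀ (j + 1) ((s.setReg 30 v).setReg 45 (j + 1)) T' := by
    intro T' hne hT'
    refine ⟨by simpa using hf, by simpa [HeapAt] using hH, hsize, hlist, hlevel,
      fun i hi hi2 => ?_, ?_⟩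
    · rcases Nat.lt_succ_iff_lt_or_eq.mp hi with h | rfl
      · exact hmoved i h hi2
      · exact hne hi2
    · simp; omega
  simp only [pushProg, runs_seq, runs_ite, runs_assign, runs_skip, runs_store]
  simp [bitExp, h45, r0, r3, r4, r41, r43, r44, a8, a9, a10, a21, hA, hbit, r42]
  and_intros
  all_goals try (show (_ : ℕ) ≤ _; omega)
  · intro hlt
    exact ⟨by omega, by omega, hskip _ (by omega) (by omega)⟩
  · intro hge
    and_intros
    all_goals try (show (_ : ℕ) ≤ _; omega)
    · intro hxz
      exact ⟨by omega, by omega, hskip _ (by omega) (by omega)⟩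
    · intro hxz
      have hlb : s.arr 22 v = b := by omega
      have hav : act v := hH.act_of_lev hvn (by omega) (by omega)
      have hag := hH.agree v hav
      have hxz' : x = z := by
        have := hmin j hj (hlevel v hlb)
        rw [← hv, ← hx] at this
        omega
      rw [a21, hlb] at hag
      have hnew : I.key (s₀.arr 21) v / 2 ^ (b - 1) = last / 2 ^ (b - 1) := by
        have h3 := div_two_pow_pred (I.key (s₀.arr 21) v) h0
        have h4 := div_two_pow_pred last h0
        omega
      have hsz' := hH.sz_lt hvn (show b - 1 < s.arr 22 v by omega)
      have haddr' := hW.addr_le (show b - 1 < I.B by omega) hsz'.le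
      have hc := I.credit_push (lev := s.arr 22) (sz := s.arr 33) hvn (show b - 1 < I.B by omega)
      and_intros
      all_goals try (show (_ : ℕ) ≤ _; omega)
      refine ⟨by simpa using hf, ?_, ?_, fun i hi => ?_, fun u hu => ?_, fun i hi hi2 => ?_, ?_⟩
      · have := hH.push (N' := I.key (s.arr 21)) (act' := act) hvn (hH.disj v hav)
          (fun _ _ => rfl) (show b - 1 < s.arr 22 v by omega) le_rfl (by rw [a21]; exact hnew)
          (fun _ h => by omega) (fun u => ⟨Or.inl, fun h => h.elim id fun h => h ▸ hav⟩)
        simpa [HeapAt] using this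
      · simp
        rw [Function.update_of_ne (by omega)]; exact hsize
      · simp
        rw [Function.update_of_ne]
        · exact hlist i hi
        · intro h
          have := (mul_add_inj (show i < I.n by omega) hsz' h).1
          omega
      · simp [Function.update_apply] at hu
        split_ifs at hu with huv
        · omega
        · exact hlevel u hu
      · simp [Function.update_apply] at hi2
        split_ifs at hi2 with huv
        · omega
        · rcases Nat.lt_succ_iff_lt_or_eq.mp hi with h | rfl
          · exact hmoved i h hi2
          · exact absurd hv.symm huv
      · simp; omega

set_option maxHeartbeats 600000 in
/-- Splitting the list of level `b`. If `f = 0`, then all nodes in the list have next bit one, so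
they all move and the list is discarded, which releases its credit. If `f = 1`, then nodes may stay
in the list, and the scan is paid by the additional budget that the previous split has left. -/
theorem splitProg_runs (hW : I.Bounded W) {s : State} (hs : Static I s) {b f last c T : ℕ}
    {act don : ℕ → Prop} (hD : DigitsLe I (s.arr 21)) (H : HeapAt I s act don b f last)
    (hf : f ≤ 1) (h41 : s.reg 41 = b) (h0 : 0 < b) (hb : b < I.B) (hsz : s.arr 33 b ≠ 0)
    (hT : I.credit (s.arr 22) (s.arr 33) + f * (300 * s.arr 33 b) + c ≤ T)
    {Q : State → ℕ → Prop}
    (hQ : ∀ s' T' last', HeapAt I s' act don (b - 1) 1 last' →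
      Same [30, 40, 41, 42, 43, 44, 45] [22, 31, 32, 33] s s' → s'.reg 41 = b - 1 →
      I.credit (s'.arr 22) (s'.arr 33) + 300 * s'.arr 33 (b - 1) + 80 + c ≤ T' → Q s' T') :
    Runs W splitProg Q s T := by
  have w1 := hW.lin
  have hBW := hW.B_le
  have hkn := H.sz_le hb
  have hcr := I.le_credit_sz (lev := s.arr 22) (sz := s.arr 33) hb
  set k := s.arr 33 b with hk
  unfold splitProg
  simp only [runs_seq, runs_assign]
  simp only [Exp.Fits, Exp.cost, Exp.val, State.setReg_reg, State.setReg_arr, reduceIte,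
    Nat.reduceEqDiff, h41, ← hk]
  and_intros
  all_goals try (show (_ : ℕ) ≤ _; omega)
  set s₀ := (((s.setReg 43 (b - 1)).setReg 42 k).setReg 44 1).setReg 45 0 with hs₀
  have hf₀ : Same [42, 43, 44, 45] [] s s₀ := by simp [hs₀]
  have hs0 : Static I s₀ := by simpa [hs₀] using hs
  have H0 : HeapAt I s₀ act don b f last := by simpa [hs₀, HeapAt] using H
  have hD0 : DigitsLe I (s₀.arr 21) := by simpa [hs₀] using hD
  have ha0 : s₀.arr = s.arr := by simp [hs₀]
  refine (Does.for (N := k) (i := 0) 28 (I := MinBit I b f s₀) (by simp [hs₀]) (by simp [hs₀])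
    (by omega) (by omega) ⟨by simp, by simp [hs₀], by simp, by simp [hs₀]⟩ ?_).runs (by omega) ?_
  · rintro j s₁ - hj h45 h42 hI
    have := minBit_step hW hs0 hD0 H0 h0 hb (by simp [hs₀, h41]) (by simp [hs₀])
      (by rw [ha0, ← hk]; exact hj) h45 hI
    exact this.mono le_rfl fun s' hs' => ⟨hs'.1, by rw [hs'.2.1]; simp [hs₀], hs'.2.2⟩
  rintro s₁ T₁ ⟨h45, h42, hI⟩ hT₁
  obtain ⟨hf1, hle, hmin, hone⟩ := hI
  have ha1 : s₁.arr = s.arr := funext fun a => by rw [hf1.2 a (by simp), ha0]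
  have r41 : s₁.reg 41 = b := by rw [hf1.1 41 (by simp)]; simp [hs₀, h41]
  have r43 : s₁.reg 43 = b - 1 := by rw [hf1.1 43 (by simp)]; simp [hs₀]
  simp only [runs_seq, runs_store, runs_assign]
  simp only [Exp.Fits, Exp.cost, Exp.val, r43]
  set z := s₁.reg 44 with hz
  and_intros
  all_goals try (show (_ : ℕ) ≤ _; omega)
  set last' := (2 * (last / 2 ^ b) + z) * 2 ^ (b - 1) with hlast'
  have HB := H.beginSplit hf h0 hb hle
  rw [← hlast'] at HB
  set s₂ := (s₁.setCell 31 (b - 1) z).setReg 45 0 with hs₂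
  have hf2 : Same [42, 43, 44, 45, 30] [31] s s₂ := by
    have h1 : Same [42, 43, 44, 45, 30] [31] s s₁ :=
      (hf₀.weaken (by simp) (by simp)).trans (hf1.weaken (by simp) (by simp))
    simpa [hs₂] using h1
  have hs2 : Static I s₂ := hs.congr (fun r hr => hf2.1 r (by simp; omega))
    fun a ha => hf2.2 a (by simp; omega)
  have a21 : s₂.arr 21 = s.arr 21 := hf2.2 21 (by simp)
  have a22 : s₂.arr 22 = s.arr 22 := hf2.2 22 (by simp)
  have a32 : s₂.arr 32 = s.arr 32 := hf2.2 32 (by simp)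
  have a33 : s₂.arr 33 = s.arr 33 := hf2.2 33 (by simp)
  have a31 : s₂.arr 31 = Function.update (s.arr 31) (b - 1) z := by simp [hs₂, ha1]
  have H2 : HeapAt I s₂ act don (b - 1) 2 last' := by
    unfold HeapAt; rw [a21, a22, a31, a32, a33]; exact HB
  have hk2 : s₂.arr 33 b = k := by rw [a33]
  have hmin2 : ∀ i < k, s.arr 22 (s.arr 32 (b * I.n + i)) = b →
      z ≤ I.key (s.arr 21) (s.arr 32 (b * I.n + i)) / 2 ^ (b - 1) % 2 := by
    rw [ha0] at hmin; exact hmin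
  have hzl : last' / 2 ^ (b - 1) % 2 = z := by
    rw [hlast', Nat.mul_div_cancel _ (by positivity)]; omega
  clear HB
  clear_value last'
  clear hlast'
  have hsz0 : s₂.arr 33 (b - 1) = 0 := by rw [a33]; exact H.below _ (by omega)
  -- for `f = 0` the scan is paid by a debt, which is covered as the list will be discarded
  obtain ⟨e, he1, he2⟩ : ∃ e, (e = 0 ∨ z = 1 ∧ e = 96 * k + 120) ∧
      I.credit (s.arr 22) (s.arr 33) + c + 96 * k + 120 ≤ T + e := by
    rcases Nat.le_one_iff_eq_zero_or_eq_one.mp hf with h | h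
    · exact ⟨96 * k + 120, Or.inr ⟨hone h, rfl⟩, by omega⟩
    · subst h
      exact ⟨0, Or.inl rfl, by omega⟩
  refine Runs.for (N := k) (i := 0) (I := MoveLoop I b z last' (c + 60) e act don s₂)
    (by simp [hs₂]) (by simp [hs₂, h42]) (by omega) (by omega)
    ⟨by simp, H2, rfl, fun _ _ => rfl, fun _ h => h, by simp, ?_⟩ ?_ ?_
  · rw [a22, hsz0, a33, ← hk]
    omega
  · rintro j s₃ T₃ - hj h45 h42 hI
    have h := move_step hW hs2 (by rw [a21]; exact hD) H2 h0 hb hzl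
      (by rw [a21, a22, a32, hk2]; exact hmin2) (by simp [hs₂, r41]) (by simp [hs₂, r43])
      (by simp [hs₂, hz]) (by rw [hk2]; exact hj) h45 (by rw [hk2]; omega) hI
    refine ⟨by omega, h.2.mono fun s' T' hs' => ⟨hs'.1, ?_, hs'.2.2⟩⟩
    rw [hs'.2.1]
    simp [hs₂, ‹s₁.reg 42 = _›]
  · rintro s₃ T₃ h45 h42 ⟨hf3, H3, hsize, hlist, hlevel, hmoved, hT3⟩
    have r41' : s₃.reg 41 = b := by rw [hf3.1 41 (by simp)]; simp [hs₂, r41]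
    have r43' : s₃.reg 43 = b - 1 := by rw [hf3.1 43 (by simp)]; simp [hs₂, r43]
    have r44' : s₃.reg 44 = z := by rw [hf3.1 44 (by simp)]; simp [hs₂, hz]
    have a21' : s₃.arr 21 = s.arr 21 := by rw [hf3.2 21 (by simp), a21]
    rw [hk2] at hsize hlist hT3
    have hf' : Same [30, 40, 41, 42, 43, 44, 45] [22, 31, 32, 33] s s₃ :=
      (hf2.weaken (by simp) (by simp)).trans (hf3.weaken (by simp) (by simp))
    have hcs := I.credit_sz (lev := s₃.arr 22) (sz := s₃.arr 33) (x := 0) hb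
    have hcr3 := I.le_credit_sz (lev := s₃.arr 22) (sz := s₃.arr 33) hb
    rw [hsize] at hcs hcr3
    rw [Nat.sub_self] at hT3
    have hleft : ∀ v, act v → s₃.arr 22 v = b → z = 0 ∧
        I.key (s₃.arr 21) v / 2 ^ (b - 1) % 2 = 1 := by
      intro v hv hlv
      obtain ⟨i, hi, hA⟩ := H3.mem v hv
      rw [hlv] at hi hA
      rw [hsize] at hi
      rw [hlist i hi, a32] at hA
      have h1 := hmoved i hi (by rw [a32, hA]; exact hlv)
      have h2 := hmin2 i hi (by
        rw [hA, ← a22]; exact hlevel v hlv)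
      rw [a32, a21, hA] at h1
      rw [hA] at h2
      rw [a21']
      have := Nat.mod_lt (I.key (s.arr 21) v / 2 ^ (b - 1)) (y := 2) (by norm_num)
      omega
    have H4 : HeapAt I s₃ act don (b - 1) 1 last' := by
      refine H3.endSplit fun v hv hlv => ?_
      rw [Nat.sub_add_cancel h0] at hlv
      obtain ⟨h1, h2⟩ := hleft v hv hlv
      have h3 := H3.agree v hv
      rw [hlv] at h3
      have h4 := div_two_pow_pred (I.key (s₃.arr 21) v) h0
      have h5 := div_two_pow_pred last' h0
      rw [h2] at h4
      rw [hzl, h1, add_zero] at h5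
      rw [h4, h5, h3]
    have hz0 : z = 0 →
        I.credit (s₃.arr 22) (s₃.arr 33) + 300 * s₃.arr 33 (b - 1) + c + 100 ≤ T₃ := by omega
    have hz1 : z ≠ 0 → I.credit (s₃.arr 22) (Function.update (s₃.arr 33) b 0) +
        300 * s₃.arr 33 (b - 1) + c + 100 ≤ T₃ := by omega
    have hTc : 100 ≤ T₃ := by omega
    clear H3 hlist hlevel hmoved he1 he2 hT hT₁ hT3 hcr hcs hcr3
    refine ⟨by omega, ?_⟩
    simp only [runs_ite, runs_skip, runs_store, runs_assign, runs_seq]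
    simp only [Exp.Fits, Exp.cost, Exp.val, State.setCell_reg, r41', r43', r44']
    and_intros
    all_goals try (show (_ : ℕ) ≤ _; omega)
    · intro hz
      and_intros
      all_goals try (show (_ : ℕ) ≤ _; omega)
      refine hQ _ _ last' ?_ (by simpa using hf') (by simp) ?_
      · have := H4.clear (b := b) fun v hv hlv => by have := hleft v hv hlv; omega
        simpa [HeapAt] using this
      · simp [Function.update_of_ne (show b - 1 ≠ b by omega)]
        omega
    · intro hz
      and_intros
      all_goals try (show (_ : ℕ) ≤ _; omega)
      refine hQ _ _ last' (by simpa [HeapAt] using H4) (by simpa using hf') (by simp) ?_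
      simp
      omega

end WordRAM

/-! ### Potentials as numbers -/

namespace TreeGame

/-- The interlaced tuple `(Φ 0, a₀, Φ 1, a₁, …)` as a number in base `b`, if the label is `a`. -/
def pot {n h : ℕ} (b : ℕ) (Φ : ℕ → ℕ) (a : Label n h) : ℕ :=
  dval b (fun t => if t % 2 = 0 then Φ (t / 2) else (comps a).getD (t / 2) 0) (2 * h)

theorem interlace_getD {n : ℕ} (f : ℕ → ℕ) (l : List (Fin n)) : ∀ k t, t < 2 * l.length →
    (interlace f k l).getD t 0 =
      if t % 2 = 0 then f (k + t / 2) else (l.map Fin.val).getD (t / 2) 0 := by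
  induction l with
  | nil => intro k t h; simp at h
  | cons x l ih =>
    intro k t h
    match t with
    | 0 => simp [interlace]
    | 1 => simp [interlace]
    | t + 2 =>
      have h1 : t < 2 * l.length := by simp at h; omega
      have h2 : (t + 2) / 2 = t / 2 + 1 := by omega
      rw [interlace, List.getD_cons_succ, List.getD_cons_succ, ih _ _ h1, h2, Nat.add_mod_right,
        List.map_cons, List.getD_cons_succ, show k + (t / 2 + 1) = k + 1 + t / 2 by omega]

theorem interlace_lt_base {n b : ℕ} {f : ℕ → ℕ} {l : List (Fin n)} {k x : ℕ} (hn : n ≤ b)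
    (hf : ∀ i, i < k + l.length → f i < b) (hx : x ∈ interlace f k l) : x < b := by
  induction l generalizing k with
  | nil => simp [interlace] at hx
  | cons y l ih =>
    simp only [interlace, List.mem_cons] at hx
    rcases hx with rfl | rfl | hx
    · exact hf k (by simp)
    · exact y.2.trans_le hn
    · exact ih (fun i hi => hf i (by simp; omega)) hx

theorem pot_lt_pot_iff {n h b : ℕ} (hn : n ≤ b) {Φ Ψ : ℕ → ℕ} (hΦ : ∀ i < h, Φ i < b)
    (hΨ : ∀ i < h, Ψ i < b) (x y : Leaf n h) :
    pot b Φ (x : Label n h) < pot b Ψ (y : Label n h) ↔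
      interlace Φ 0 x.1 < interlace Ψ 0 y.1 := by
  have hlen : ∀ (f : ℕ → ℕ) (z : Leaf n h), (interlace f 0 z.1).length = 2 * h := fun f z => by
    rw [length_interlace, z.2]
  have hval : ∀ (f : ℕ → ℕ) (z : Leaf n h),
      pot b f (z : Label n h) = dval b ((interlace f 0 z.1).getD · 0) (2 * h) := fun f z =>
    dval_congr fun t ht => by
      rw [interlace_getD f z.1 0 t (by rw [z.2]; exact ht), zero_add]; rfl
  rw [hval, hval]
  exact (lt_iff_dval_lt (hlen _ _) (hlen _ _)
    (fun _ => interlace_lt_base hn fun i hi => hΦ i (by rw [x.2] at hi; omega))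
    (fun _ => interlace_lt_base hn fun i hi => hΨ i (by rw [y.2] at hi; omega))).symm

theorem pot_lt_pot_iff_lt {n h b : ℕ} (hn : n ≤ b) {Φ : ℕ → ℕ} (hΦ : ∀ i < h, Φ i < b)
    (x y : Leaf n h) : pot b Φ (x : Label n h) < pot b Φ (y : Label n h) ↔ x < y := by
  rw [pot_lt_pot_iff hn hΦ hΦ, interlace_lt_iff (x.2.trans y.2.symm), Subtype.coe_lt_coe]

end TreeGame

/-! ### The digraph of an instance -/

namespace WordRAM

variable {I : Inst}

namespace Inst

/-- The arcs between the nodes, as elements of `Fin n`. -/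
def FArc (I : Inst) (v w : Fin I.n) : Prop := I.Arc v w

/-- The priorities of the nodes, as elements of `Fin n`. -/
def fpri (I : Inst) (v : Fin I.n) : ℕ := I.pri v

/-- The numbers `Φ v i` are numbers of strongly connected components, for every column `i`. -/
def IsScc (I : Inst) (Φ : ℕ → ℕ → ℕ) : Prop :=
  ∀ i < I.h, IsSccOrder I (I.d - 2 * i) fun v => Φ v i

/-- The priority of `v` is even, and an arc that leaves `v` does not leave the strongly connected
component of `v` in the subgraph of the nodes of at most this priority. -/
def InnerArc (I : Inst) (Φ : ℕ → ℕ → ℕ) (v w : ℕ) : Prop :=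
  Even (I.pri v) ∧ I.Arc v w ∧ Φ w (I.h - I.pri v / 2) = Φ v (I.h - I.pri v / 2)

theorem IsScc.column {Φ : ℕ → ℕ → ℕ} (hΦ : I.IsScc Φ) {p : ℕ} (hp : Even p) (h0 : 1 ≤ p)
    (h1 : p ≤ I.d) : I.h - p / 2 < I.h ∧ IsSccOrder I p fun v => Φ v (I.h - p / 2) := by
  have hd := I.d_eq
  obtain ⟨a, rfl⟩ := hp
  have h2 : I.h - (a + a) / 2 < I.h := by omega
  have := hΦ _ h2
  rw [show I.d - 2 * (I.h - (a + a) / 2) = a + a by omega] at this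
  exact ⟨h2, this⟩

theorem IsScc.le {Φ : ℕ → ℕ → ℕ} (hΦ : I.IsScc Φ) {v i : ℕ} (hv : v < I.n) (hi : i < I.h) :
    Φ v i ≤ I.n := (hΦ i hi).le v hv

theorem reachLE_iff {p : ℕ} {v w : Fin I.n} : I.ReachLE p v w ↔ Relation.ReflTransGen
    (fun x y : Fin I.n => I.FArc x y ∧ I.fpri x ≤ p ∧ I.fpri y ≤ p) v w := by
  constructor
  · intro h
    have : ∀ y, I.ReachLE p v y → ∃ hy : y < I.n, Relation.ReflTransGen
        (fun x y : Fin I.n => I.FArc x y ∧ I.fpri x ≤ p ∧ I.fpri y ≤ p) v ⟨y, hy⟩ := by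
      intro y hy
      induction hy with
      | refl => exact ⟨v.2, .refl⟩
      | tail _ hyz ih =>
        obtain ⟨hy, ih⟩ := ih
        exact ⟨hyz.1.lt, ih.tail hyz⟩
    exact (this w h).2
  · intro h
    exact h.lift Fin.val fun _ _ hxy => hxy

/-- Base nodes are recognized by comparing the component numbers of the two ends of arcs. -/
theorem isBase_iff {Φ : ℕ → ℕ → ℕ} (hΦ : I.IsScc Φ) (v : Fin I.n) :
    IsBase I.FArc I.fpri v ↔ ∃ w, I.InnerArc Φ v w := by
  have hp0 := I.pri_pos v v.2
  have hp1 := I.pri_le v v.2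
  constructor
  · intro hb
    obtain ⟨i, -, w, hvw, hr⟩ := hb.exists_reachIn
    obtain ⟨-, hscc⟩ := hΦ.column hb.1 hp0 hp1
    have hr' : I.ReachLE (I.pri v) w v := reachLE_iff.mpr hr.reflTransGen
    have hw : I.pri w ≤ I.pri v := by
      rcases hr'.cases_head with h | ⟨c, h, -⟩
      · rw [h]
      · exact h.2.1
    refine ⟨w, hb.1, hvw, le_antisymm (hscc.mono v w ⟨hvw, le_rfl, hw⟩) ?_⟩
    clear hr hvw hw
    have : ∀ y, I.ReachLE (I.pri v) w y → Φ y (I.h - I.pri v / 2) ≤ Φ w (I.h - I.pri v / 2) := by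
      intro y hy
      induction hy with
      | refl => exact le_rfl
      | tail _ hyz ih => exact (hscc.mono _ _ hyz).trans ih
    exact this v hr'
  · rintro ⟨w, he, hvw, heq⟩
    obtain ⟨-, hscc⟩ := hΦ.column he hp0 hp1
    have hw : I.pri w ≤ I.pri v := by
      by_contra hlt
      have h1 := hscc.out w hvw.lt (by omega)
      have h2 := hscc.pos v v.2 le_rfl
      omega
    have hr := hscc.eq v w ⟨hvw, le_rfl, hw⟩ heq
    exact isBase_of_reach (w := ⟨w, hvw.lt⟩) he hvw hw (reachLE_iff.mp hr)

/-- The component numbers refer to the digraph with the arcs leaving base nodes. They need not be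
admissible for the algorithm as it is stated, but they have the properties that its correctness
depends on. -/
theorem IsScc.isWeakTopOrder {Φ : ℕ → ℕ → ℕ} (hΦ : I.IsScc Φ) :
    IsWeakTopOrder I.FArc (IsBase I.FArc I.fpri) I.fpri I.d fun p v => Φ v (I.h - p / 2) := by
  have hmono : ∀ p, p ≤ I.d → Even p → ∀ v w : Fin I.n, I.FArc v w → I.fpri v ≤ p →
      Φ w (I.h - p / 2) ≤ Φ v (I.h - p / 2) := by
    intro p hp he v w hvw hvp
    obtain ⟨-, hscc⟩ := hΦ.column he ((I.pri_pos v v.2).trans hvp) hp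
    by_cases hw : I.pri w ≤ p
    · exact hscc.mono v w ⟨hvw, hvp, hw⟩
    · have := hscc.out w w.2 (by omega)
      omega
  refine ⟨fun p hp he v w hvw _ => hmono p hp he v w hvw, fun v w hvw hv he => ?_⟩
  refine lt_of_le_of_ne (hmono _ (I.pri_le v v.2) he v w hvw le_rfl) fun heq => hv ?_
  exact (isBase_iff hΦ v).mpr ⟨w, he, hvw, heq⟩

/-- The potential of the node `v`, if its label is `a`. -/
def pt (I : Inst) (Φ : ℕ → ℕ → ℕ) (v : ℕ) (a : Label I.n I.h) : ℕ := pot (2 ^ I.L) (Φ v) a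

theorem n_lt_two_pow (I : Inst) : I.n < 2 ^ I.L :=
  I.lt_two_pow.trans_le (Nat.pow_le_pow_right (by norm_num) (by omega))

theorem IsScc.pt_lt_iff {Φ : ℕ → ℕ → ℕ} (hΦ : I.IsScc Φ) {v : ℕ} (hv : v < I.n)
    {a b : Label I.n I.h} (ha : a ≠ ⊤) (hb : b ≠ ⊤) : I.pt Φ v a < I.pt Φ v b ↔ a < b := by
  obtain ⟨x, rfl⟩ := WithTop.ne_top_iff_exists.mp ha
  obtain ⟨y, rfl⟩ := WithTop.ne_top_iff_exists.mp hb
  rw [WithTop.coe_lt_coe]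
  exact pot_lt_pot_iff_lt I.n_lt_two_pow.le
    (fun i hi => (hΦ.le hv hi).trans_lt I.n_lt_two_pow) x y

/-- If an arc that does not leave a base node is not violated, then its head has a smaller potential
than its tail. -/
theorem IsScc.pt_lt {Φ : ℕ → ℕ → ℕ} (hΦ : I.IsScc Φ) {v w : Fin I.n} (hvw : I.FArc v w)
    (hv : ¬ IsBase I.FArc I.fpri v) {a b : Label I.n I.h} (ha : a ≠ ⊤) (hb : b ≠ ⊤)
    (hr : Respects (I.fpri v) a b) : I.pt Φ w b < I.pt Φ v a := by
  obtain ⟨x, rfl⟩ := WithTop.ne_top_iff_exists.mp ha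
  obtain ⟨y, rfl⟩ := WithTop.ne_top_iff_exists.mp hb
  have hlt : ∀ u : Fin I.n, ∀ i < I.h, Φ u i < 2 ^ I.L :=
    fun u i hi => (hΦ.le u.2 hi).trans_lt I.n_lt_two_pow
  unfold pt
  have h1 := hΦ.isWeakTopOrder.interlace_lt I.d_eq (fun v => I.pri_pos v v.2)
    (fun v => I.pri_le v v.2) hvw hv hr
  have h2 : ∀ u : Fin I.n, ∀ z : Leaf I.n I.h,
      pot (2 ^ I.L) (fun j => Φ u (I.h - 2 * (I.h - j) / 2)) (z : Label I.n I.h) =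
        pot (2 ^ I.L) (Φ u) (z : Label I.n I.h) := fun u z => dval_congr fun t ht => by
    simp only [show I.h - 2 * (I.h - t / 2) / 2 = t / 2 by omega]
  rw [← h2 w, ← h2 v]
  exact (pot_lt_pot_iff I.n_lt_two_pow.le (fun i hi => hlt w _ (by have := I.h_pos; omega))
    (fun i hi => hlt v _ (by have := I.h_pos; omega)) y x).mpr h1

/-- The potential of `v`, which is infinite if the label is `⊤`. -/
def wpt (I : Inst) (Φ : ℕ → ℕ → ℕ) (v : Fin I.n) (a : Label I.n I.h) : WithTop ℕ :=
  a.map fun ξ : Leaf I.n I.h => I.pt Φ v (ξ : Label I.n I.h)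

theorem wpt_of_ne_top (I : Inst) (Φ : ℕ → ℕ → ℕ) (v : Fin I.n) {a : Label I.n I.h} (ha : a ≠ ⊤) :
    I.wpt Φ v a = WithTop.some (I.pt Φ v a) := by
  obtain ⟨x, rfl⟩ := WithTop.ne_top_iff_exists.mp ha
  rfl

theorem wpt_top (I : Inst) (Φ : ℕ → ℕ → ℕ) (v : Fin I.n) :
    I.wpt Φ v (⊤ : Label I.n I.h) = ⊤ := rfl

/-- A node of smallest potential has its final label. -/
theorem IsScc.eq_of_minimal {Φ : ℕ → ℕ → ℕ} (hΦ : I.IsScc Φ) {μs ν : Fin I.n → Label I.n I.h}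
    {S : Set (Fin I.n)} (hA : ∀ v, ∃ w, I.FArc v w) (hfix : bestTighten I.FArc I.fpri μs = μs)
    (hI : DijkstraInv I.FArc (IsBase I.FArc I.fpri) I.fpri μs S ν) {u : Fin I.n} (hu : u ∉ S)
    (hmin : ∀ v, v ∉ S → I.wpt Φ u (ν u) ≤ I.wpt Φ v (ν v)) : ν u = μs u := by
  refine hI.eq_of_minimal (P := I.wpt Φ) (fun v a b hab => ?_) (fun v w a b hvw hv ha hr => ?_) hA
    hfix hu hmin
  · by_cases hb : b = ⊤
    · exact hb ▸ le_top
    by_cases ha : a = ⊤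
    · rw [ha, wpt_top, wpt_of_ne_top _ _ _ hb] at hab
      simp at hab
    rw [wpt_of_ne_top _ _ _ ha, wpt_of_ne_top _ _ _ hb, WithTop.coe_le_coe] at hab
    by_contra hlt
    have := (hΦ.pt_lt_iff v.2 hb ha).mpr (not_le.mp hlt)
    omega
  · have hb : b ≠ ⊤ := by
      rintro rfl
      have := tighten_le_iff.mpr hr
      rw [tighten_top] at this
      exact ha (top_le_iff.mp this)
    rw [wpt_of_ne_top _ _ _ ha, wpt_of_ne_top _ _ _ hb, WithTop.coe_lt_coe]
    exact hΦ.pt_lt hvw hv ha hb hr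

end Inst

end WordRAM

/-! ### Relaxing an arc and updating the queue -/

namespace WordRAM
open Exp Prog

/-- The label of the node in register `30` drops to the smallest label with which the arc from this
node to the node in register `31` is not violated, if it exceeds that label. The label of the head
is read from the arrays `a` and `b`. -/
def relaxProg (a b : ℕ) : Prog :=
  tightenProg a b ;; compareProg ;;
  ite (reg 38 *ₑ (lit 2 -ₑ reg 38)) (storeProg ;; placeProg) .skip

variable {I : Inst} {W : ℕ} {Φ : ℕ → ℕ → ℕ} {ν : ℕ → Label I.n I.h} {don : ℕ → Prop}

/-- The arrays `20` and `21` hold the labeling `ν` and the numbers `Φ`. -/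
structure Labels (I : Inst) (Φ : ℕ → ℕ → ℕ) (ν : ℕ → Label I.n I.h) (s : State) : Prop where
  label : ∀ v < I.n, LabelAt I (s.arr 20) (s.arr 21) v (ν v)
  phi : ∀ v < I.n, ∀ i < I.h, s.arr 21 (I.phi v i) = Φ v i

theorem Labels.keyDig_eq {s : State} (h : Labels I Φ ν s) {v t : ℕ} (hv : v < I.n)
    (ht : t < 2 * I.h) : I.keyDig (s.arr 21) v t =
      if t % 2 = 0 then Φ v (t / 2) else (comps (ν v)).getD (t / 2) 0 := by
  unfold Inst.keyDig
  split_ifs with h0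
  · rw [show (t + 1) % 2 = 1 by omega, one_mul]
    exact h.phi v hv _ (by omega)
  · rw [show (t + 1) % 2 = 0 by omega, zero_mul, zero_add]
    exact (h.label v hv).2 _ (by omega)

theorem Labels.key_eq {s : State} (h : Labels I Φ ν s) {v : ℕ} (hv : v < I.n) :
    I.key (s.arr 21) v = I.pt Φ v (ν v) := by
  unfold Inst.key Inst.pt pot
  rw [I.d_eq]
  exact dval_congr fun t ht => h.keyDig_eq hv ht

theorem Labels.digitsLe {s : State} (h : Labels I Φ ν s) (hΦ : I.IsScc Φ) :
    DigitsLe I (s.arr 21) := by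
  intro v hv t ht
  have hd := I.d_eq
  rw [h.keyDig_eq hv (by omega)]
  split_ifs
  · exact hΦ.le hv (by omega)
  · exact (comps_getD_lt I.n_pos _ _).le

/-- The nodes in the queue: their labels are finite, and they have not been removed. -/
def Queued (I : Inst) (ν : ℕ → Label I.n I.h) (don : ℕ → Prop) (v : ℕ) : Prop :=
  v < I.n ∧ ¬ don v ∧ ν v ≠ ⊤

/-- The memory during Dijkstra's algorithm, with the labeling `ν`; the nodes in `don` have been
removed from the queue. -/
structure MemAt (I : Inst) (Φ : ℕ → ℕ → ℕ) (ν : ℕ → Label I.n I.h) (don : ℕ → Prop)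
    (cur f last : ℕ) (s : State) : Prop where
  static : Static I s
  labels : Labels I Φ ν s
  heap : HeapAt I s (Queued I ν don) don cur f last

theorem MemAt.congr {s s' : State} {cur f last : ℕ} {R A : List ℕ}
    (h : MemAt I Φ ν don cur f last s) (hf : Same R A s s') (hR : ∀ r ∈ R, 10 ≤ r)
    (hA : ∀ a ∈ A, 20 ≤ a ∧ (a < 20 ∨ 22 < a) ∧ (a < 31 ∨ 33 < a)) :
    MemAt I Φ ν don cur f last s' := by
  have harr : ∀ a, 20 ≤ a ∧ a ≤ 22 ∨ 31 ≤ a ∧ a ≤ 33 → s'.arr a = s.arr a := fun a ha =>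
    hf.2 a fun hm => by have := hA a hm; omega
  obtain ⟨h1, ⟨h2, h3⟩, h4⟩ := h
  refine ⟨h1.congr (fun r hr => hf.1 r fun hm => ?_) (fun a ha => hf.2 a fun hm => ?_),
    ⟨?_, ?_⟩, ?_⟩
  · have := hR r hm; omega
  · have := hA a hm; omega
  · rw [harr 20 (by omega), harr 21 (by omega)]; exact h2
  · rw [harr 21 (by omega)]; exact h3
  · unfold HeapAt
    rw [harr 21 (by omega), harr 22 (by omega), harr 31 (by omega), harr 32 (by omega),
      harr 33 (by omega)]
    exact h4

/-- Relaxing an arc takes `O(h)` time, apart from the time that is paid by the credit of the queue.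
The hypothesis `hlt` says that the queue remains monotone: a label only drops if its node has not
been removed from the queue, and the new potential is not smaller than `last`. -/
theorem relaxProg_runs (hW : I.Bounded W) (hΦ : I.IsScc Φ) {s : State} {v w t c cost T last : ℕ}
    (hM : MemAt I Φ ν don 0 0 last s) (hv : v < I.n) (hw : w < I.n) (h30 : s.reg 30 = v)
    (h31 : s.reg 31 = w) (ht : t ≠ 30) (hc : c ≠ 30) {a : Label I.n I.h}
    (ha : LabelAt I (s.arr t) (s.arr c) w a)
    (hlt : tighten (I.pri v) a < ν v → ¬ don v ∧ last ≤ I.pt Φ v (tighten (I.pri v) a))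
    (hT : I.credit (s.arr 22) (s.arr 33) + (140 * I.h + 300) + cost ≤ T) {Q : State → ℕ → Prop}
    (hQ : ∀ s' T',
      MemAt I Φ (Function.update ν v (min (ν v) (tighten (I.pri v) a))) don 0 0 last s' →
      Same [33, 34, 35, 36, 38, 40] [20, 21, 22, 30, 32, 33] s s' →
      I.credit (s'.arr 22) (s'.arr 33) + cost ≤ T' → Q s' T') : Runs W (relaxProg t c) Q s T := by
  have w1 := hW.lin
  obtain ⟨hs, hL, hH⟩ := hM
  set b := tighten (I.pri v) a with hb
  unfold relaxProg
  rw [runs_seq]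
  refine (tightenProg_does hW hs hv hw h30 h31 ht hc ha).runs (by omega) ?_
  rintro s₁ T₁ ⟨f1, hnew1, hnew2, hnew3⟩ hT₁
  have hnew : HoldsNew I s₁ b := ⟨hnew1, hnew2, hnew3⟩
  have hs1 : Static I s₁ := hs.congr (fun r hr => f1.1 r (by simp; omega))
    fun x hx => f1.2 x (by simp; omega)
  have a20 : s₁.arr 20 = s.arr 20 := f1.2 20 (by simp)
  have a21 : s₁.arr 21 = s.arr 21 := f1.2 21 (by simp)
  rw [runs_seq]
  refine (compareProg_does hW hs1 hv (by rw [f1.1 30 (by simp), h30]) hnew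
    (by rw [a20, a21]; exact hL.label v hv)).runs (by omega) ?_
  rintro s₂ T₂ ⟨f2, h38, hcmp⟩ hT₂
  have f12 : Same [33, 34, 35, 36, 38, 40] [30] s s₂ :=
    (f1.weaken (by simp) (by simp)).trans (f2.weaken (by simp) (by simp))
  have hs2 : Static I s₂ := hs.congr (fun r hr => f12.1 r (by simp; omega))
    fun x hx => f12.2 x (by simp; omega)
  have h30' : s₂.reg 30 = v := by rw [f12.1 30 (by simp), h30]
  rw [runs_ite]
  have hprod : s₂.reg 38 * (2 - s₂.reg 38) ≤ 4 := by
    have := Nat.mul_le_mul h38 (Nat.sub_le 2 (s₂.reg 38)); omega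
  simp only [Exp.Fits, Exp.cost, Exp.val]
  refine ⟨⟨by omega, ⟨by omega, by omega⟩, by omega⟩, by omega, fun hne => ?_, fun h0 => ?_⟩
  · have hlt' : b < ν v := hcmp.mp (by rw [Nat.mul_ne_zero_iff] at hne; omega)
    have hbt : b ≠ ⊤ := (lt_of_lt_of_le hlt' le_top).ne
    obtain ⟨hd, hlast⟩ := hlt hlt'
    rw [runs_seq]
    refine (storeProg_does hW hs2 hv h30' (hnew.congr (f2.1 36 (by simp)) (f2.2 30 (by simp)))
      hbt).runs (by omega) ?_
    rintro s₃ T₃ ⟨f3, hlab, h20, h21⟩ hT₃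
    have f13 : Same [33, 34, 35, 36, 38, 40] [20, 21, 30] s s₃ :=
      (f12.weaken (by simp) (by simp)).trans (f3.weaken (by simp) (by simp))
    have hs3 : Static I s₃ := hs.congr (fun r hr => f13.1 r (by simp; omega))
      fun x hx => f13.2 x (by simp; omega)
    rw [f12.2 20 (by simp)] at h20
    rw [f12.2 21 (by simp)] at h21
    have hmin : min (ν v) b = b := min_eq_right hlt'.le
    have hL3 : Labels I Φ (Function.update ν v b) s₃ := by
      refine ⟨fun u hu => ?_, fun u hu i hi => ?_⟩
      · rcases eq_or_ne u v with rfl | huv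
        · rw [Function.update_self]; exact hlab
        · rw [Function.update_of_ne huv]
          refine ⟨by rw [h20 u huv]; exact (hL.label u hu).1, fun i hi => ?_⟩
          rw [h21 _ fun j hj h => huv (mul_add_inj hi hj h).1]
          exact (hL.label u hu).2 i hi
      · rw [h21, hL.phi u hu i hi]
        intro j hj h
        have := mul_add_lt hj hv
        unfold Inst.phi at h
        omega
    have a22 : s₃.arr 22 = s.arr 22 := f13.2 22 (by simp)
    have a31 : s₃.arr 31 = s.arr 31 := f13.2 31 (by simp)
    have a32 : s₃.arr 32 = s.arr 32 := f13.2 32 (by simp)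
    have a33 : s₃.arr 33 = s.arr 33 := f13.2 33 (by simp)
    have hkey : I.key (s₃.arr 21) v = I.pt Φ v b := by rw [hL3.key_eq hv, Function.update_self]
    refine placeProg_runs (N := I.key (s.arr 21)) (v := v) (last := last) (c := cost) (don := don)
      (act := Queued I ν don) (act' := Queued I (Function.update ν v b) don) hW hs3
      (hL3.digitsLe hΦ) ?_ (by rw [f13.1 30 (by simp), h30]) hv hd ?_ ?_ (by rw [hkey]; exact hlast)
      ?_ (by rw [a22, a33]; omega) ?_
    · rw [a22, a31, a32, a33]; exact hH
    · intro u
      unfold Queued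
      rcases eq_or_ne u v with rfl | huv
      · simp [hv, hd, hbt]
      · simp [huv]
    · intro u huv
      unfold Inst.key Inst.keyDig
      refine dval_congr fun i hi => h21 _ fun j hj h => huv ?_
      have hh := I.d_eq
      rcases Nat.mod_two_eq_zero_or_one (i + 1) with h1 | h1
      · rw [h1, zero_mul, zero_add] at h
        exact (mul_add_inj (by omega) hj h).1
      · have := mul_add_lt hj hv
        rw [h1, one_mul] at h
        omega
    · rintro ⟨-, -, hav⟩
      rw [hkey, hL.key_eq hv]
      exact ((hΦ.pt_lt_iff hv hbt hav).mpr hlt').le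
    · intro s₄ T₄ hH4 f4 hT₄
      have f14 : Same [33, 34, 35, 36, 38, 40] [20, 21, 22, 30, 32, 33] s s₄ :=
        (f13.weaken (by simp) (by simp)).trans (f4.weaken (by simp) (by simp))
      refine hQ s₄ T₄ ⟨hs.congr (fun r hr => f14.1 r (by simp; omega))
        fun x hx => f14.2 x (by simp; omega), ?_, by rw [hmin]; exact hH4⟩ f14 hT₄
      rw [hmin]
      obtain ⟨l1, l2⟩ := hL3
      rw [← f4.2 20 (by simp), ← f4.2 21 (by simp)] at l1
      rw [← f4.2 21 (by simp)] at l2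
      exact ⟨l1, l2⟩
  · have hge : ν v ≤ b := by
      by_contra hlt'
      rw [hcmp.mpr (not_le.mp hlt')] at h0
      simp at h0
    rw [runs_skip]
    refine ⟨by omega, hQ s₂ _ ?_ (f12.weaken (by simp) (by simp)) ?_⟩
    · rw [min_eq_left hge, Function.update_eq_self]
      exact MemAt.congr ⟨hs, hL, hH⟩ f12 (by simp) (by simp)
    · rw [f12.2 22 (by simp), f12.2 33 (by simp)]; omega

end WordRAM

/-! ### The labels of the base nodes -/

namespace WordRAM
open Exp Prog

/-- Decide whether an arc leaving the node in register `46` stays in the strongly connected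
component of this node in the subgraph of the nodes of at most the same priority. -/
def innerProg : Prog :=
  assign 49 (lit 0) ;; assign 47 (cell 0 (reg 46)) ;; assign 48 (cell 0 (reg 46 +ₑ lit 1)) ;;
  assign 50 (reg 6 +ₑ (reg 3 -ₑ cell 7 (cell 2 (reg 46)))) ;;
  Prog.for 47 48 (ite ((cell 21 (reg 46 *ₑ reg 3 +ₑ reg 50) -ₑ
      cell 21 (cell 1 (reg 47) *ₑ reg 3 +ₑ reg 50)) +ₑ
    (cell 21 (cell 1 (reg 47) *ₑ reg 3 +ₑ reg 50) -ₑ cell 21 (reg 46 *ₑ reg 3 +ₑ reg 50)))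
    .skip (assign 49 (lit 1)))

/-- Relax the arcs leaving the node in register `46`; the labels of the heads are read from the
input. -/
def relaxOutProg : Prog :=
  assign 30 (reg 46) ;; assign 47 (cell 0 (reg 46)) ;;
  Prog.for 47 48 (assign 31 (cell 1 (reg 47)) ;; relaxProg 3 4)

/-- Relax the arcs leaving the base nodes. -/
def baseProg : Prog :=
  assign 46 (lit 0) ;;
  Prog.for 46 0 (ite
    (cell 2 (reg 46) -ₑ (cell 7 (cell 2 (reg 46)) +ₑ cell 7 (cell 2 (reg 46)))) .skip
    (innerProg ;; ite (reg 49) relaxOutProg .skip))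

variable {I : Inst} {W : ℕ} {Φ : ℕ → ℕ → ℕ} {ν μ : ℕ → Label I.n I.h} {don : ℕ → Prop}

theorem innerProg_does (hW : I.Bounded W) (hΦ : I.IsScc Φ) {s : State} (hs : Static I s)
    (hL : Labels I Φ ν s) {v : ℕ} (hv : v < I.n) (he : Even (I.pri v)) (h46 : s.reg 46 = v) :
    Does W innerProg s (40 * (I.off (v + 1) - I.off v) + 30) fun s' =>
      Same [47, 48, 49, 50] [] s s' ∧ s'.reg 48 = I.off (v + 1) ∧ s'.reg 49 ≤ 1 ∧
      (s'.reg 49 ≠ 0 ↔ ∃ w, I.InnerArc Φ v w) := by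
  have w1 := hW.lin
  have w2 := hW.nh
  have hd := I.d_eq
  have h0 := Inst.off_le_m (I := I) (v := v) (by omega)
  have h1 := Inst.off_le_m (I := I) (v := v + 1) (by omega)
  have h2 := I.off_mono v hv
  have hp := I.pri_le v hv
  have hp1 := I.pri_pos v hv
  have hhalf := hs.half (I.pri v) (by omega)
  have hcol := (hΦ.column he hp1 hp).1
  set i := I.h - I.pri v / 2 with hi
  unfold Does innerProg
  simp [h46, hs.arr0, hs.arr2, hs.reg6, hs.reg3, hhalf, ← hi]
  and_intros
  all_goals try omega
  refine (Does.for (N := I.off (v + 1)) (i := I.off v) 32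
    (I := fun j s' => Same [47, 48, 49, 50] [] s s' ∧ s'.reg 50 = I.n * I.h + i ∧ s'.reg 49 ≤ 1 ∧
      (s'.reg 49 ≠ 0 ↔ ∃ e, I.off v ≤ e ∧ e < j ∧ Φ (I.tgt e) i = Φ v i))
    (by simp) (by simp) h2 (by omega) ?_ ?_).runs (by omega) ?_
  · refine ⟨by simp, by simp, by simp, by simp; omega⟩
  · rintro j s₁ hj1 hj2 h47 h48 ⟨hf, h50, h49, hI⟩
    have ha : s₁.arr = s.arr := funext fun a => hf.2 a (by simp)
    have r46 : s₁.reg 46 = v := by rw [hf.1 46 (by simp), h46]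
    have r3 : s₁.reg 3 = I.h := by rw [hf.1 3 (by simp), hs.reg3]
    have hw := I.tgt_lt j (by omega)
    have p1 := hL.phi v hv i hcol
    have p2 := hL.phi (I.tgt j) hw i hcol
    have q1 := hΦ.le hv hcol
    have q2 := hΦ.le hw hcol
    have l1 := Inst.phi_lt hv hcol
    have l2 := Inst.phi_lt hw hcol
    unfold Inst.phi at p1 p2 l1 l2
    unfold Does
    simp [h47, h48, h50, ha, r46, r3, hs.arr1, p1, p2, hf]
    refine ⟨by and_intros <;> omega, fun hne => ⟨h49, ?_⟩, fun heq _ => ⟨by omega, j, hj1,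
      by omega, by omega⟩⟩
    rw [← Ne, hI]
    refine exists_congr fun e => and_congr_right fun _ =>
      ⟨fun h => ⟨by omega, h.2⟩, fun h => ⟨?_, h.2⟩⟩
    rcases h.1.lt_or_eq with h' | rfl
    · exact h'
    · omega
  · rintro s₁ T₁ ⟨-, h48, hf, -, h49, hI⟩ -
    refine ⟨hf, h48, h49, ?_⟩
    simp only [← Ne.eq_def] at *
    rw [hI]
    constructor
    · rintro ⟨e, h1, h2, h3⟩
      exact ⟨I.tgt e, he, ⟨hv, e, h1, h2, rfl⟩, h3⟩
    · rintro ⟨w, -, ⟨-, e, h1, h2, rfl⟩, h3⟩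
      exact ⟨e, h1, h2, h3⟩

/-- The invariant of the loop over the arcs that leave `v`, of which those before `j` have been
relaxed. -/
structure RelaxOut (I : Inst) (Φ : ℕ → ℕ → ℕ) (ν μ : ℕ → Label I.n I.h) (don : ℕ → Prop)
    (v c : ℕ) (s₀ : State) (j : ℕ) (s : State) (T : ℕ) : Prop where
  same : Same [30, 31, 33, 34, 35, 36, 38, 40, 47] [20, 21, 22, 30, 32, 33] s₀ s
  reg30 : s.reg 30 = v
  mem : ∃ x, MemAt I Φ (Function.update ν v x) don 0 0 0 s ∧
    ∀ a, a ≤ x ↔ ∀ e, I.off v ≤ e → e < j → a ≤ tighten (I.pri v) (μ (I.tgt e))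
  time : I.credit (s.arr 22) (s.arr 33) + (140 * I.h + 340) * (I.off (v + 1) - j) + c + 4 ≤ T

theorem relaxOutProg_runs (hW : I.Bounded W) (hΦ : I.IsScc Φ) {s : State} {v c T : ℕ}
    (hM : MemAt I Φ ν don 0 0 0 s) (hμ : ∀ w < I.n, LabelAt I I.mt I.mc w (μ w)) (hv : v < I.n)
    (hd : ¬ don v) (hν : ν v = ⊤) (h46 : s.reg 46 = v) (h48 : s.reg 48 = I.off (v + 1))
    (hT : I.credit (s.arr 22) (s.arr 33) + (140 * I.h + 340) * (I.off (v + 1) - I.off v) +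
      c + 20 ≤ T)
    {Q : State → ℕ → Prop}
    (hQ : ∀ s' T' x, MemAt I Φ (Function.update ν v x) don 0 0 0 s' →
      Same [30, 31, 33, 34, 35, 36, 38, 40, 47] [20, 21, 22, 30, 32, 33] s s' →
      (∀ a, a ≤ x ↔ ∀ w, I.Arc v w → a ≤ tighten (I.pri v) (μ w)) →
      I.credit (s'.arr 22) (s'.arr 33) + c ≤ T' → Q s' T') : Runs W relaxOutProg Q s T := by
  have w1 := hW.lin
  have h0 := Inst.off_le_m (I := I) (v := v) (by omega)
  have h1 := Inst.off_le_m (I := I) (v := v + 1) (by omega)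
  have h2 := I.off_mono v hv
  unfold relaxOutProg
  simp [h46, hM.static.arr0]
  and_intros
  all_goals try omega
  refine Runs.for (N := I.off (v + 1)) (i := I.off v) (I := RelaxOut I Φ ν μ don v c s)
    (by simp) (by simpa using h48) h2 (by omega) ?_ ?_ ?_
  · refine ⟨by simp, by simp, ⟨ν v, ?_, ?_⟩, by simp; omega⟩
    · rw [Function.update_eq_self]
      exact hM.congr (R := [30, 47]) (A := []) (by simp) (by simp) (by simp)
    · intro a; rw [hν]; simp; omega
  · rintro j s₁ T₁ hj1 hj2 h47 h48 ⟨hf, h30, ⟨x, hM1, hx⟩, hT1⟩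
    have hs1 := hM1.static
    have hw := I.tgt_lt j (by omega)
    have hsplit : I.off (v + 1) - j = (I.off (v + 1) - (j + 1)) + 1 := by omega
    rw [hsplit, Nat.mul_succ] at hT1
    refine ⟨by omega, ?_⟩
    simp only [runs_seq, runs_assign]
    simp [h47, hs1.arr1]
    and_intros
    all_goals try omega
    refine relaxProg_runs (v := v) (w := I.tgt j) (a := μ (I.tgt j)) (last := 0)
      (cost := (140 * I.h + 340) * (I.off (v + 1) - (j + 1)) + c + 8)
      hW hΦ (hM1.congr (R := [31]) (A := []) (by simp) (by simp) (by simp)) hv hw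
      (by simpa using h30)
      (by simp) (by norm_num) (by norm_num) ?_ (fun _ => ⟨hd, Nat.zero_le _⟩) (by simp; omega) ?_
    · simp only [State.setReg_arr, hs1.arr3, hs1.arr4]; exact hμ _ hw
    · intro s₂ T₂ hM2 hf2 hT2
      rw [Function.update_self, Function.update_idem] at hM2
      refine ⟨by rw [hf2.1 47 (by simp)]; simpa using h47,
        by rw [hf2.1 48 (by simp)]; simpa using h48, by omega, ?_, ?_,
        ⟨_, hM2.congr (R := [47]) (A := []) (by simp) (by simp) (by simp), ?_⟩, ?_⟩
      · have h12 : Same [30, 31, 33, 34, 35, 36, 38, 40, 47] [20, 21, 22, 30, 32, 33] s₁ s₂ := by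
          refine Same.trans (s' := s₁.setReg 31 (I.tgt j)) (by simp)
            (hf2.weaken (by simp) (by simp))
        simpa using hf.trans h12
      · simp; rw [hf2.1 30 (by simp)]; simpa using h30
      · intro a
        rw [le_min_iff, hx]
        constructor
        · rintro ⟨h1, h2⟩ e he1 he2
          rcases Nat.lt_succ_iff_lt_or_eq.mp he2 with h | rfl
          · exact h1 e he1 h
          · exact h2
        · intro h
          exact ⟨fun e he1 he2 => h e he1 (by omega), h j hj1 (by omega)⟩
      · simp; omega
  · rintro s₁ T₁ h47 h48 ⟨hf, h30, ⟨x, hM1, hx⟩, hT1⟩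
    refine ⟨by omega, hQ s₁ _ x hM1 hf
      (fun a => (hx a).trans ⟨fun h w hw => ?_, fun h e h1 h2 => ?_⟩)
      (by omega)⟩
    · obtain ⟨-, e, h1, h2, rfl⟩ := hw
      exact h e h1 h2
    · exact h _ ⟨hv, e, h1, h2, rfl⟩

/-- The labels after the arcs leaving the base nodes among the nodes before `k` have been relaxed:
at these base nodes they are the best ones with respect to `μ`, at the other nodes they are `⊤`. -/
structure BaseLabels (I : Inst) (Φ : ℕ → ℕ → ℕ) (μ : ℕ → Label I.n I.h) (k : ℕ)
    (ν : ℕ → Label I.n I.h) : Prop where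
  base : ∀ v < I.n, v < k → (∃ w, I.InnerArc Φ v w) →
    ∀ a, a ≤ ν v ↔ ∀ w, I.Arc v w → a ≤ tighten (I.pri v) (μ w)
  top : ∀ v < I.n, (k ≤ v ∨ ¬ ∃ w, I.InnerArc Φ v w) → ν v = ⊤

theorem BaseLabels.succ {k : ℕ} (h : BaseLabels I Φ μ k ν) (hk : ¬ ∃ w, I.InnerArc Φ k w) :
    BaseLabels I Φ μ (k + 1) ν := by
  refine ⟨fun v hv hvk hi => h.base v hv ?_ hi, fun v hv hc => h.top v hv ?_⟩
  · rcases Nat.lt_succ_iff_lt_or_eq.mp hvk with h | rfl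
    · exact h
    · exact absurd hi hk
  · rcases hc with h | h
    · exact Or.inl (by omega)
    · exact Or.inr h

theorem BaseLabels.succ_update {k : ℕ} {x : Label I.n I.h} (h : BaseLabels I Φ μ k ν)
    (hk : ∃ w, I.InnerArc Φ k w) (hx : ∀ a, a ≤ x ↔ ∀ w, I.Arc k w → a ≤ tighten (I.pri k) (μ w)) :
    BaseLabels I Φ μ (k + 1) (Function.update ν k x) := by
  refine ⟨fun v hv hvk hi => ?_, fun v hv hc => ?_⟩
  · rcases Nat.lt_succ_iff_lt_or_eq.mp hvk with h' | rfl
    · rw [Function.update_of_ne (by omega)]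
      exact h.base v hv h' hi
    · rw [Function.update_self]; exact hx
  · have : v ≠ k := by
      rintro rfl
      rcases hc with h | h
      · omega
      · exact h hk
    rw [Function.update_of_ne this]
    refine h.top v hv ?_
    rcases hc with h | h
    · exact Or.inl (by omega)
    · exact Or.inr h

/-- The invariant of the loop over the nodes `k` that determines the labels of the base nodes. -/
structure BaseLoop (I : Inst) (Φ : ℕ → ℕ → ℕ) (μ : ℕ → Label I.n I.h) (c k : ℕ) (s : State)
    (T : ℕ) : Prop where
  mem : ∃ ν, MemAt I Φ ν (fun _ => False) 0 0 0 s ∧ BaseLabels I Φ μ k ν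
  time : I.credit (s.arr 22) (s.arr 33) + (140 * I.h + 400) * (I.m - I.off k) + 80 * (I.n - k) +
    c + 4 ≤ T

theorem baseProg_runs (hW : I.Bounded W) (hΦ : I.IsScc Φ) {s : State} {c T : ℕ}
    (hM : MemAt I Φ (fun _ => ⊤) (fun _ => False) 0 0 0 s)
    (hμ : ∀ w < I.n, LabelAt I I.mt I.mc w (μ w))
    (hT : I.credit (s.arr 22) (s.arr 33) + (140 * I.h + 400) * I.m + 80 * I.n + c + 10 ≤ T)
    {Q : State → ℕ → Prop}
    (hQ : ∀ s' T' ν, MemAt I Φ ν (fun _ => False) 0 0 0 s' → BaseLabels I Φ μ I.n ν →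
      I.credit (s'.arr 22) (s'.arr 33) + c ≤ T' → Q s' T') : Runs W baseProg Q s T := by
  have w1 := hW.lin
  have hd := I.d_eq
  unfold baseProg
  simp
  and_intros
  all_goals try omega
  refine Runs.for (N := I.n) (i := 0) (I := BaseLoop I Φ μ c) (by simp)
    (by simpa using hM.static.reg0) (by omega) (by omega) ?_ ?_ ?_
  · refine ⟨⟨fun _ => ⊤, hM.congr (R := [46]) (A := []) (by simp) (by simp) (by simp),
      fun _ _ h => by omega, fun _ _ _ => rfl⟩, ?_⟩
    simp [I.off_zero]
    omega
  · rintro v s T - hv h46 h0 ⟨⟨ν, hM, hν⟩, hT⟩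
    have hs := hM.static
    have hp := I.pri_le v hv
    have hhalf := hs.half (I.pri v) (by omega)
    have hm := Inst.off_le_m (I := I) (v := v + 1) (by omega)
    have hm2 := I.off_mono v hv
    have hsplit : I.m - I.off v = (I.m - I.off (v + 1)) + (I.off (v + 1) - I.off v) := by omega
    have hsum : (140 * I.h + 400) * (I.off (v + 1) - I.off v) =
        (140 * I.h + 340) * (I.off (v + 1) - I.off v) + 60 * (I.off (v + 1) - I.off v) := by ring
    rw [hsplit, Nat.mul_add, hsum] at hT
    refine ⟨by omega, ?_⟩
    -- the two ways to end a round
    have hend : ∀ s' T' ν', s'.reg 46 = v → MemAt I Φ ν' (fun _ => False) 0 0 0 s' →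
        BaseLabels I Φ μ (v + 1) ν' →
        I.credit (s'.arr 22) (s'.arr 33) + (140 * I.h + 400) * (I.m - I.off (v + 1)) +
          80 * (I.n - (v + 1)) + c + 8 ≤ T' →
        s'.reg 46 = v ∧ s'.reg 0 = I.n ∧ 4 ≤ T' ∧
          BaseLoop I Φ μ c (v + 1) (s'.setReg 46 (v + 1)) (T' - 4) := by
      intro s' T' ν' h1 h2 h3 h4
      refine ⟨h1, h2.static.reg0, by omega,
        ⟨ν', h2.congr (R := [46]) (A := []) (by simp) (by simp) (by simp), h3⟩, by simp; omega⟩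
    simp only [runs_ite, runs_seq, runs_skip]
    simp only [Exp.Fits, Exp.cost, Exp.val, h46, hs.arr2, hhalf]
    refine ⟨by and_intros <;> omega, by omega, fun hne => ⟨by omega, ?_⟩, fun heq => ?_⟩
    · refine ⟨trivial, (hend s _ ν h46 hM (hν.succ ?_) ?_).2⟩
      · rintro ⟨w, ⟨b, hb⟩, -⟩
        omega
      · omega
    · have he : Even (I.pri v) := ⟨I.pri v / 2, by omega⟩
      refine (innerProg_does hW hΦ hs hM.labels hv he h46).runs (by omega) ?_
      rintro s₁ T₁ ⟨hf, h48, h49, hin⟩ hT₁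
      have hM1 : MemAt I Φ ν (fun _ => False) 0 0 0 s₁ := hM.congr hf (by simp) (by simp)
      have r46 : s₁.reg 46 = v := by rw [hf.1 46 (by simp), h46]
      have a22 : s₁.arr 22 = s.arr 22 := hf.2 22 (by simp)
      have a33 : s₁.arr 33 = s.arr 33 := hf.2 33 (by simp)
      simp only [runs_ite, runs_skip, Exp.Fits, Exp.cost, Exp.val]
      refine ⟨by omega, by omega, fun hne => ?_, fun heq => ⟨by omega, ?_⟩⟩
      · refine relaxOutProg_runs (v := v) (c := (140 * I.h + 400) * (I.m - I.off (v + 1)) +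
          80 * (I.n - (v + 1)) + c + 8) hW hΦ hM1 hμ hv id (hν.top v hv (Or.inl le_rfl)) r46 h48
          (by rw [a22, a33]; omega) ?_
        intro s' T' x h1 h2 h3 h4
        exact hend s' T' _ (by rw [h2.1 46 (by simp), r46]) h1 (hν.succ_update (hin.mp hne) h3)
          (by omega)
      · refine hend s₁ _ ν r46 hM1 (hν.succ fun h => hin.mpr h heq) ?_
        rw [a22, a33]
        omega
  · rintro s T h46 h0 ⟨⟨ν, hM, hν⟩, hT⟩
    exact ⟨by omega, hQ s _ ν hM hν (by omega)⟩

end WordRAM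

/-! ### Dijkstra's algorithm on the word RAM -/

namespace WordRAM
open Exp Prog

/-- Relax the arcs entering the node in register `51`. -/
def relaxInProg : Prog :=
  assign 52 (cell 11 (reg 51)) ;;
  .while (reg 52) (assign 30 (cell 13 (reg 52 -ₑ lit 1)) ;; assign 31 (reg 51) ;;
    relaxProg 20 21 ;; assign 52 (cell 12 (reg 52 -ₑ lit 1)))

/-- Remove a node from the list of level `0` and relax the arcs entering it. -/
def popProg : Prog :=
  store 33 (lit 0) (cell 33 (lit 0) -ₑ lit 1) ;; assign 51 (cell 32 (cell 33 (lit 0))) ;;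
  relaxInProg

/-- Remove nodes of smallest potential from the queue until it is empty. -/
def dijkstraProg : Prog :=
  assign 41 (lit 0) ;;
  .while (reg 5 -ₑ reg 41) (ite (cell 33 (reg 41)) (ite (reg 41) splitProg popProg)
    (assign 41 (reg 41 +ₑ lit 1)))

variable {I : Inst} {W : ℕ} {Φ : ℕ → ℕ → ℕ} {ν ν₀ μs : ℕ → Label I.n I.h} {don : ℕ → Prop}

/-- The invariant of the loop over the arcs that enter the node `u`. -/
structure RelaxIn (I : Inst) (Φ : ℕ → ℕ → ℕ) (μs ν₀ : ℕ → Label I.n I.h) (don : ℕ → Prop)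
    (u last c : ℕ) (s₀ s : State) (T : ℕ) : Prop where
  same : Same [30, 31, 33, 34, 35, 36, 38, 40, 52] [20, 21, 22, 30, 32, 33] s₀ s
  state : ∃ ν l, MemAt I Φ ν don 0 0 last s ∧ Chain (s₀.arr 12) (s.reg 52) l ∧
    (∀ e ∈ l, e ∈ I.inList I.m u) ∧ (∀ v < I.n, μs v ≤ ν v ∧ ν v ≤ ν₀ v) ∧
    (∀ e ∈ I.inList I.m u, e ∉ l →
      ν (s₀.arr 13 e) ≤ tighten (I.pri (s₀.arr 13 e)) (μs u)) ∧
    I.credit (s.arr 22) (s.arr 33) + (140 * I.h + 340) * l.length + c + 2 ≤ T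

theorem relaxInProg_runs (hW : I.Bounded W) (hΦ : I.IsScc Φ) {s : State} {u last c T : ℕ}
    (hM : MemAt I Φ ν don 0 0 last s) (hu : u < I.n) (h51 : s.reg 51 = u)
    (hle : ∀ v < I.n, μs v ≤ ν v) (heq : ∀ v < I.n, don v → ν v = μs v) (hdu : don u)
    (hbase : ∀ v : Fin I.n, IsBase I.FArc I.fpri v → ν v = μs v)
    (hfix : ∀ v < I.n, I.Arc v u → μs v ≤ tighten (I.pri v) (μs u)) (hfin : μs u ≠ ⊤)
    (hlast : last = I.pt Φ u (μs u))
    (hT : I.credit (s.arr 22) (s.arr 33) + (140 * I.h + 340) * (I.inList I.m u).length + c + 5 ≤ T)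
    {Q : State → ℕ → Prop}
    (hQ : ∀ s' T' ν', MemAt I Φ ν' don 0 0 last s' →
      Same [30, 31, 33, 34, 35, 36, 38, 40, 52] [20, 21, 22, 30, 32, 33] s s' →
      (∀ v < I.n, μs v ≤ ν' v ∧ ν' v ≤ ν v) →
      (∀ v, I.Arc v u → ν' v ≤ tighten (I.pri v) (μs u)) →
      I.credit (s'.arr 22) (s'.arr 33) + c ≤ T' → Q s' T') : Runs W relaxInProg Q s T := by
  have w1 := hW.lin
  have hs := hM.static
  have hch := hs.chain u hu
  have hcl := hch.le fun e he => (Inst.mem_inList.mp he).1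
  unfold relaxInProg
  simp [h51]
  and_intros
  all_goals try omega
  refine Runs.while (I := RelaxIn I Φ μs ν don u last c s) ?_ ?_
  · refine ⟨by simp, ν, I.inList I.m u,
      hM.congr (R := [52]) (A := []) (by simp) (by simp) (by simp), by simpa using hch,
      fun _ h => h, fun v hv => ⟨hle v hv, le_rfl⟩, fun e h h' => absurd h h', ?_⟩
    simp; omega
  rintro s₁ T₁ ⟨hf, ν₁, l, hM1, hchl, hsub, hbd, hdone, hT1⟩
  have hxle := hchl.le fun e he => (Inst.mem_inList.mp (hsub e he)).1
  simp only [Exp.Fits, Exp.cost, Exp.val]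
  refine ⟨by omega, by omega, fun hne => ?_, fun h0 => ?_⟩
  · cases l with
    | nil => exact absurd hchl hne
    | cons e l =>
      obtain ⟨h52, hchl⟩ := hchl
      have hem := hsub e (by simp)
      have hem' := (Inst.mem_inList.mp hem).1
      have harc := hs.arc_of_mem hem
      have a11 : s₁.arr 11 = s.arr 11 := hf.2 11 (by simp)
      have a12 : s₁.arr 12 = s.arr 12 := hf.2 12 (by simp)
      have a13 : s₁.arr 13 = s.arr 13 := hf.2 13 (by simp)
      have r51 : s₁.reg 51 = u := by rw [hf.1 51 (by simp), h51]
      have hv := harc.1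
      have hnext := hchl.le fun e' he' => (Inst.mem_inList.mp (hsub e' (by simp [he']))).1
      rw [List.length_cons, Nat.mul_succ] at hT1
      set v := s.arr 13 e with hvd
      have huν : ν₁ u = μs u := le_antisymm ((hbd u hu).2.trans (heq u hu hdu).le) (hbd u hu).1
      simp only [runs_seq, runs_assign]
      simp [h52, a13, r51, ← hvd]
      and_intros
      all_goals try omega
      refine relaxProg_runs (v := v) (w := u) (a := ν₁ u) (last := last)
        (cost := (140 * I.h + 340) * l.length + c + 20) hW hΦ
        (hM1.congr (R := [30, 31]) (A := []) (by simp) (by simp) (by simp)) hv hu (by simp)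
        (by simp)
        (by norm_num) (by norm_num) ?_ ?_ (by simp; omega) ?_
      · simpa using hM1.labels.label u hu
      · rw [huν]
        intro hlt
        have hne : ν v ≠ μs v := fun h =>
          absurd (hlt.trans_le ((hbd v hv).2.trans (h.le.trans (hfix v hv harc)))) (lt_irrefl _)
        refine ⟨fun hd => hne (heq v hv hd), ?_⟩
        have hbt : tighten (I.pri v) (μs u) ≠ ⊤ := (lt_of_lt_of_le hlt le_top).ne
        rw [hlast]
        exact (hΦ.pt_lt (v := ⟨v, hv⟩) (w := ⟨u, hu⟩) harc (fun hb => hne (hbase _ hb)) hbt hfin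
          (respects_tighten _ _)).le
      · rw [huν]
        intro s₂ T₂ hM2 hf2 hT2
        have h12 : Same [30, 31, 33, 34, 35, 36, 38, 40, 52] [20, 21, 22, 30, 32, 33] s₁ s₂ := by
          refine Same.trans (s' := (s₁.setReg 30 v).setReg 31 u) (by simp)
            (hf2.weaken (by simp) (by simp))
        have h52' : s₂.reg 52 = e + 1 := by rw [hf2.1 52 (by simp)]; simpa using h52
        have a12' : s₂.arr 12 = s.arr 12 := by rw [h12.2 12 (by simp), a12]
        simp [h52', a12']
        and_intros
        all_goals try omega
        refine ⟨by simpa using hf.trans h12, _, l,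
          hM2.congr (R := [52]) (A := []) (by simp) (by simp) (by simp), by simpa using hchl,
          fun e' he' => hsub e' (by simp [he']), fun x hx => ?_, fun e' he' hn => ?_, ?_⟩
        · rcases eq_or_ne x v with rfl | hxv
          · rw [Function.update_self]
            exact ⟨le_min (hbd _ hx).1 (hfix _ hx harc), (min_le_left _ _).trans (hbd _ hx).2⟩
          · rw [Function.update_of_ne hxv]; exact hbd x hx
        · by_cases hxv : s.arr 13 e' = v
          · rw [hxv, Function.update_self]; exact min_le_right _ _
          · rw [Function.update_of_ne hxv]
            refine hdone e' he' fun hm => ?_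
            rcases List.mem_cons.mp hm with rfl | h
            · exact hxv rfl
            · exact hn h
        · simp; omega
  · have hl : l = [] := by
      cases l with
      | nil => rfl
      | cons e l => obtain ⟨h, -⟩ := hchl; omega
    subst hl
    refine hQ s₁ _ ν₁ hM1 hf hbd (fun v hv => ?_) (by simp at hT1; omega)
    obtain ⟨e, he, rfl⟩ := hs.exists_mem_of_arc hv
    exact hdone e he (by simp)

open Classical in
/-- The time that suffices for relaxing the arcs that enter the nodes outside `don`. -/
noncomputable def Inst.relaxWork (I : Inst) (don : ℕ → Prop) : ℕ :=
  ∑ u ∈ Finset.range I.n,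
    if don u then 0 else (140 * I.h + 340) * (I.inList I.m u).length + 60

theorem Inst.relaxWork_insert {u : ℕ} (hu : u < I.n) (hd : ¬ don u) :
    I.relaxWork (fun v => don v ∨ v = u) + (140 * I.h + 340) * (I.inList I.m u).length + 60 =
      I.relaxWork don := by
  classical
  unfold Inst.relaxWork
  rw [← Finset.sum_erase_add _ _ (Finset.mem_range.mpr hu),
    ← Finset.sum_erase_add (Finset.range I.n) (fun v => if don v then 0 else _)
      (Finset.mem_range.mpr hu)]
  simp only [or_true, if_true, hd, if_false, add_zero, ← add_assoc]
  congr 2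
  refine Finset.sum_congr rfl fun v hv => ?_
  simp [Finset.ne_of_mem_erase hv]

theorem Inst.relaxWork_false (I : Inst) :
    I.relaxWork (fun _ => False) = (140 * I.h + 340) * I.m + 60 * I.n := by
  unfold Inst.relaxWork
  simp only [if_false, Finset.sum_add_distrib, ← Finset.mul_sum, I.sum_length_inList]
  simp; ring

/-- The invariant of the main loop. The pointer `cur` goes down by one with every split, and
`40 * (B - cur)` pays for its way up. -/
structure MainLoop (I : Inst) (Φ : ℕ → ℕ → ℕ) (μs : ℕ → Label I.n I.h) (c : ℕ) (s : State)
    (T : ℕ) : Prop where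
  state : ∃ ν don cur f last, MemAt I Φ ν don cur f last s ∧ s.reg 41 = cur ∧ cur ≤ I.B ∧ f ≤ 1 ∧
    (cur = 0 → f = 0) ∧ DijkstraInv I.FArc (IsBase I.FArc I.fpri) I.fpri (fun v => μs v)
      {v : Fin I.n | don v} (fun v => ν v) ∧
    I.credit (s.arr 22) (s.arr 33) + f * (300 * s.arr 33 cur) + 40 * (I.B - cur) +
      I.relaxWork don + c + 10 ≤ T

/-- The removed node has smallest potential, hence its label is final. -/
theorem popProg_runs (hW : I.Bounded W) (hΦ : I.IsScc Φ) (hA : ∀ v, ∃ w, I.FArc v w)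
    (hfix : bestTighten I.FArc I.fpri (fun v => μs v) = fun v : Fin I.n => μs v)
    {s : State} {last c T : ℕ}
    (hM : MemAt I Φ ν don 0 0 last s) (h41 : s.reg 41 = 0)
    (hI : DijkstraInv I.FArc (IsBase I.FArc I.fpri) I.fpri (fun v => μs v)
      {v : Fin I.n | don v} (fun v => ν v)) (hne : s.arr 33 0 ≠ 0)
    (hT : I.credit (s.arr 22) (s.arr 33) + 40 * I.B + I.relaxWork don + c ≤ T) :
    Runs W popProg (MainLoop I Φ μs c) s T := by
  have w1 := hW.lin
  have hBW := hW.B_le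
  have hB := I.B_pos
  obtain ⟨hs, hL, hH⟩ := hM
  obtain ⟨k, hk⟩ := Nat.exists_eq_succ_of_ne_zero hne
  have hkn := hH.sz_le hB
  have hq := hH.entry_zero k (by omega)
  have hlev : s.arr 22 (s.arr 32 k) = 0 := by
    have := (hH.entry 0 hB k (by omega)).2
    rw [Nat.zero_mul, Nat.zero_add] at this
    omega
  have hpop := hH.pop (act' := Queued I ν fun v => don v ∨ v = s.arr 32 k)
    (don' := fun v => don v ∨ v = s.arr 32 k) hB hk
    (fun v => by unfold Queued; tauto) fun v => Iff.rfl
  have hkey := hH.eq_last hq hlev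
  have hmin := fun v hv => hH.le_of_lev_zero (v := v) hq hlev hv
  set u := s.arr 32 k with hu
  obtain ⟨hun, hud, hut⟩ := hq
  have hwork := Inst.relaxWork_insert hun hud
  have hcs := I.credit_sz (lev := s.arr 22) (sz := s.arr 33) (x := k) hB
  rw [hk] at hcs
  have huν : ν u = μs u := by
    refine hΦ.eq_of_minimal (u := ⟨u, hun⟩) hA hfix hI hud fun v hv => ?_
    by_cases hvt : ν v = ⊤
    · simp only [hvt, Inst.wpt_top, le_top]
    · have := hmin v ⟨v.2, hv, hvt⟩
      rw [hL.key_eq hun, hL.key_eq v.2] at this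
      rw [Inst.wpt_of_ne_top _ _ _ hut, Inst.wpt_of_ne_top _ _ _ hvt, WithTop.coe_le_coe]
      exact this
  rw [hL.key_eq hun, huν] at hkey
  unfold popProg
  simp [hk, ← hu]
  and_intros
  all_goals try omega
  refine relaxInProg_runs (ν := ν) (μs := μs) (u := u) (last := last)
    (don := fun v => don v ∨ v = u) (c := 40 * I.B + I.relaxWork (fun v => don v ∨ v = u) + c + 10)
    hW hΦ ?_ hun (by simp) (fun v hv => hI.le ⟨v, hv⟩) (fun v hv hd => ?_) (Or.inr rfl)
    (fun v hv => hI.eq_base v hv) (fun v hv hvu => ?_) (huν ▸ hut) hkey.symm ?_ ?_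
  · refine ⟨by simpa using hs, ?_, by simpa [HeapAt] using hpop⟩
    obtain ⟨l1, l2⟩ := hL
    exact ⟨by simpa using l1, by simpa using l2⟩
  · rcases hd with hd | rfl
    · exact hI.eq ⟨v, hv⟩ hd
    · exact huν
  · have := bestTighten_le (A := I.FArc) (π := I.fpri) (ν := fun v => μs v) (v := ⟨v, hv⟩)
      (w := ⟨u, hun⟩) hvu
    rw [hfix] at this
    exact this
  · simp
    omega
  · intro s' T' ν' hM' hf hbd hrel hT'
    refine ⟨ν', _, 0, 0, last, hM', ?_, by omega, by omega, fun _ => rfl, ?_, by omega⟩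
    · rw [hf.1 41 (by simp)]; simpa using h41
    · have hset : {v : Fin I.n | don v ∨ (v : ℕ) = u} = insert ⟨u, hun⟩ {v : Fin I.n | don v} := by
        ext v
        simp [Fin.ext_iff, or_comm]
      rw [hset]
      refine hI.insert huν (fun v => (hbd v v.2).1) (fun v => (hbd v v.2).2) fun v hv => ?_
      rw [huν]
      exact hrel v hv

/-- When the queue is empty, every node that was not removed has the label `⊤`, and it is final. -/
theorem dijkstraProg_runs (hW : I.Bounded W) (hΦ : I.IsScc Φ) (hA : ∀ v, ∃ w, I.FArc v w)
    (hfix : bestTighten I.FArc I.fpri (fun v => μs v) = fun v : Fin I.n => μs v)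
    {s : State} {c T : ℕ}
    (hM : MemAt I Φ ν (fun _ => False) 0 0 0 s)
    (hle : ∀ v < I.n, μs v ≤ ν v) (hbase : ∀ v : Fin I.n, IsBase I.FArc I.fpri v → ν v = μs v)
    (hT : I.credit (s.arr 22) (s.arr 33) + 40 * I.B + (140 * I.h + 340) * I.m + 60 * I.n + c + 12
      ≤ T)
    {Q : State → ℕ → Prop}
    (hQ : ∀ s' T', Static I s' → (∀ v < I.n, LabelAt I (s'.arr 20) (s'.arr 21) v (μs v)) →
      c ≤ T' → Q s' T') : Runs W dijkstraProg Q s T := by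
  have w1 := hW.lin
  have hBW := hW.B_le
  unfold dijkstraProg
  simp
  and_intros
  all_goals try omega
  refine Runs.while (I := MainLoop I Φ μs c) ?_ ?_
  · refine ⟨ν, _, 0, 0, 0, hM.congr (R := [41]) (A := []) (by simp) (by simp) (by simp), by simp,
      by omega, by omega, fun _ => rfl, ⟨fun v => hle v v.2, by simp, hbase, by simp⟩, ?_⟩
    rw [I.relaxWork_false]
    simp
    omega
  rintro s T ⟨ν, don, cur, f, last, hM, h41, hcur, hf, hf0, hI, hT⟩
  have h5 : s.reg 5 = I.B := hM.static.reg5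
  simp only [Exp.Fits, Exp.cost, Exp.val, h41, h5]
  refine ⟨by and_intros <;> omega, by omega, fun hne => ?_, fun h0 => ?_⟩
  · have hlt : cur < I.B := by omega
    have hsz := hM.heap.sz_le hlt
    simp only [runs_ite, Exp.Fits, Exp.cost, Exp.val, h41]
    refine ⟨by and_intros <;> omega, by omega, fun hsz0 => ⟨by omega, by omega, fun hc0 => ?_,
      fun hc0 => ?_⟩, fun hsz0 => ?_⟩
    · refine splitProg_runs (b := cur) (f := f) (last := last) (don := don)
        (act := Queued I ν don) (c := 40 * (I.B - cur) + I.relaxWork don + c + 1)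
        hW hM.static (hM.labels.digitsLe hΦ) hM.heap hf h41 (by omega) hlt hsz0 (by omega) ?_
      intro s' T' last' hH' hs' h41' hT'
      have hst' : Static I s' := hM.static.congr (fun r hr => hs'.1 r (by simp; omega))
        fun a ha => hs'.2 a (by simp; omega)
      have hL' : Labels I Φ ν s' := by
        obtain ⟨l1, l2⟩ := hM.labels
        rw [← hs'.2 20 (by simp), ← hs'.2 21 (by simp)] at l1
        rw [← hs'.2 21 (by simp)] at l2
        exact ⟨l1, l2⟩
      by_cases hc1 : cur - 1 = 0
      · rw [hc1] at hH'
        exact ⟨ν, don, 0, 0, last', ⟨hst', hL', hH'.f_zero⟩, by omega, by omega, by omega,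
          fun _ => rfl, hI, by omega⟩
      · exact ⟨ν, don, cur - 1, 1, last', ⟨hst', hL', hH'⟩, h41', by omega, le_rfl,
          fun h => absurd h hc1, hI, by omega⟩
    · subst hc0
      rw [hf0 rfl] at hM hT
      refine popProg_runs (last := last) hW hΦ hA hfix hM h41 hI hsz0 (by omega)
    · rw [hsz0] at hT
      simp [h41]
      and_intros
      all_goals try omega
      refine ⟨ν, don, cur + 1, 0, last, ?_, by simp, hlt, by omega, fun _ => rfl, hI,
        by simp; omega⟩
      obtain ⟨h1, ⟨h2, h3⟩, h4⟩ := hM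
      exact ⟨by simpa using h1, ⟨h2, h3⟩, h4.up hf hsz0⟩
  · have hcB : cur = I.B := by omega
    have htop : ∀ v : Fin I.n, ¬ don v → ν v = ⊤ := by
      intro v hd
      by_contra hvt
      have h1 := hM.heap.le_lev v ⟨v.2, hd, hvt⟩
      have h2 := hM.heap.lev_lt v ⟨v.2, hd, hvt⟩
      omega
    refine hQ s _ hM.static (fun v hv => ?_) (by omega)
    have : ν v = μs v := by
      by_cases hd : don v
      · exact hI.eq ⟨v, hv⟩ hd
      · refine hΦ.eq_of_minimal (u := ⟨v, hv⟩) hA hfix hI hd fun w hw => ?_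
        simp only [htop w hw, Inst.wpt_top, le_top]
    rw [← this]
    exact hM.labels.label v hv

end WordRAM

/-! ### The complete program -/

namespace WordRAM
open Exp Prog

/-- Write the result into the arrays `3` and `4`. -/
def outputProg : Prog :=
  assign 14 (lit 0) ;; Prog.for 14 0 (store 3 (reg 14) (cell 20 (reg 14))) ;;
  assign 14 (lit 0) ;; Prog.for 14 6 (store 4 (reg 14) (cell 21 (reg 14)))

/-- The program that computes the least fixed point. -/
def solveProg : Prog := setupProg ;; sccProg ;; baseProg ;; dijkstraProg ;; outputProg

variable {I : Inst} {W : ℕ}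

theorem outputProg_does (hW : I.Bounded W) {s : State} (hs : Static I s) {μs : ℕ → Label I.n I.h}
    (hL : ∀ v < I.n, LabelAt I (s.arr 20) (s.arr 21) v (μs v)) :
    Does W outputProg s (12 * I.n + 12 * (I.n * I.h) + 20) fun s' =>
      ∀ v < I.n, LabelAt I (s'.arr 3) (s'.arr 4) v (μs v) := by
  have w1 := hW.lin
  have w2 := hW.nh
  unfold Does outputProg
  simp
  refine (Does.for (N := I.n) (i := 0) 4
    (I := fun k s' => Same [14] [3] s s' ∧ ∀ v < k, s'.arr 3 v = s.arr 20 v)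
    (by simp) (by simpa using hs.reg0) (by omega) (by omega) (by simp) ?_).runs (by omega) ?_
  · rintro k s₁ - hk h14 h0 ⟨hf, hI⟩
    have a20 : s₁.arr 20 = s.arr 20 := hf.2 20 (by simp)
    have := (hL k hk).1
    have := topBit_le (μs k)
    unfold Does
    simp [h14, h0, a20, hf]
    refine ⟨by omega, ⟨by omega, by omega⟩, fun v hv => ?_⟩
    rw [Function.update_apply]
    split_ifs with h
    · rw [h]
    · exact hI v (by omega)
  rintro s₁ T₁ ⟨-, -, f1, h3⟩ hT₁
  simp
  and_intros
  all_goals try omega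
  refine (Does.for (N := I.n * I.h) (i := 0) 4
    (I := fun k s' => Same [14] [4] s₁ s' ∧ ∀ x < k, s'.arr 4 x = s.arr 21 x)
    (by simp) (by simp [f1.1 6, hs.reg6]) (by omega) (by omega) (by simp) ?_).runs (by omega) ?_
  · rintro k s₂ - hk h14 h0 ⟨hf, hI⟩
    have a21 : s₂.arr 21 = s.arr 21 := by rw [hf.2 21 (by simp), f1.2 21 (by simp)]
    have hlt : s.arr 21 k ≤ W := by
      have h1 := I.h_pos
      have h2 : k / I.h < I.n := by rw [Nat.div_lt_iff_lt_mul h1]; exact hk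
      have h3 := (hL _ h2).lt (Nat.mod_lt k h1)
      rw [Nat.div_add_mod'] at h3
      omega
    unfold Does
    simp [h14, h0, a21, hf]
    refine ⟨by omega, ⟨by omega, by omega⟩, fun v hv => ?_⟩
    rw [Function.update_apply]
    split_ifs with h
    · rw [h]
    · exact hI v (by omega)
  · rintro s₂ T₂ ⟨-, -, f2, h4⟩ - v hv
    refine ⟨?_, fun i hi => ?_⟩
    · rw [f2.2 3 (by simp), h3 v hv]; exact (hL v hv).1
    · rw [h4 _ (mul_add_lt hi hv)]; exact (hL v hv).2 i hi

theorem Inst.n_le_m (hA : ∀ v, ∃ w, I.FArc v w) : I.n ≤ I.m := by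
  have : ∀ k ≤ I.n, k ≤ I.off k := by
    intro k
    induction k with
    | zero => simp
    | succ k ih =>
      intro hk
      obtain ⟨w, -, e, h1, h2, -⟩ := hA ⟨k, hk⟩
      have := ih (by omega)
      have h3 : I.off k < I.off (k + 1) := h1.trans_lt h2
      omega
  rw [← I.off_last]
  exact this _ le_rfl

/-- The queue starts with credit `1000 * B * n = 1000 * d * L * n`, and `O(h)` time is spent for
each of the `m` arcs, both for relaxing it and for the component numbers. -/
theorem solveProg_does (hW : I.Bounded W) {s : State} (h0 : s.reg 0 = I.n)
    (h1 : s.reg 1 = I.m) (h2 : s.reg 2 = I.d) (a0 : s.arr 0 = I.off) (a1 : s.arr 1 = I.tgt)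
    (a2 : s.arr 2 = I.pri) (a3 : s.arr 3 = I.mt) (a4 : s.arr 4 = I.mc)
    (hz : ∀ a, 5 ≤ a → ∀ i, s.arr a i = 0) (hA : ∀ v, ∃ w, I.FArc v w) {μ μs : ℕ → Label I.n I.h}
    (hμ : ∀ v < I.n, LabelAt I I.mt I.mc v (μ v))
    (hfix : bestTighten I.FArc I.fpri (fun v => μs v) = fun v : Fin I.n => μs v)
    (hbase : ∀ v : Fin I.n, IsBase I.FArc I.fpri v →
      μs v = bestTighten I.FArc I.fpri (fun v => μ v) v) :
    Does W solveProg s (4000 * (I.d * (I.m + I.n * I.L))) fun s' =>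
      ∀ v < I.n, LabelAt I (s'.arr 3) (s'.arr 4) v (μs v) := by
  have w1 := hW.lin
  have hd := I.d_eq
  have hh := I.h_pos
  have hL := I.L_pos
  have hn := I.n_pos
  have hnm := I.n_le_m hA
  set X := I.d * (I.m + I.n * I.L) with hX
  have hX0 : X = I.d * I.m + I.B * I.n := by rw [hX]; unfold Inst.B; ring
  have hB1 : I.B ≤ I.B * I.n := Nat.le_mul_of_pos_right _ hn
  have hB2 : I.L ≤ I.B := Nat.le_mul_of_pos_left _ (by omega)
  have hm1 : I.m ≤ I.d * I.m := Nat.le_mul_of_pos_left _ (by omega)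
  have hm2 : I.d ≤ I.d * I.m := Nat.le_mul_of_pos_right _ (by omega)
  have hm3 : I.d * I.m = 2 * (I.h * I.m) := by rw [hd]; ring
  have hn1 : I.h * I.n ≤ I.h * I.m := Nat.mul_le_mul_left _ hnm
  have hn2 : I.n * I.L ≤ I.B * I.n := by
    have : I.B * I.n = I.d * (I.n * I.L) := by unfold Inst.B; ring
    rw [this]; exact Nat.le_mul_of_pos_left _ (by omega)
  have hn3 : I.n * I.h = I.h * I.n := mul_comm _ _
  unfold Does solveProg
  rw [runs_seq]
  refine (setupProg_does hW h0 h1 h2 a0 a1 a2 a3 a4 (hz 11 (by norm_num))).runs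
    (T := 4000 * X) ?_ ?_
  · have : I.d * I.L = I.B := rfl
    omega
  rintro s₁ T₁ ⟨hs1, hfr1, h20⟩ hT₁
  rw [show I.d * I.L = I.B from rfl] at hT₁ h20
  rw [runs_seq]
  have hscc : I.h * (600 * I.n + 120 * I.m + 200) =
    600 * (I.h * I.n) + 120 * (I.h * I.m) + 200 * I.h := by ring
  refine (sccProg_does hW hs1 fun a => by
    rw [hfr1 21 (by norm_num) (by norm_num), hz 21 (by norm_num)]).runs (by omega) ?_
  rintro s₂ T₂ ⟨hs2, hscc2, hlow, hfr2⟩ hT₂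
  set Φ : ℕ → ℕ → ℕ := fun v i => s₂.arr 21 (I.phi v i) with hΦ
  have hΦs : I.IsScc Φ := hscc2
  have a22 : ∀ v < I.n, s₂.arr 22 v = I.B := fun v hv => by
    rw [hfr2 22 (by norm_num) (by norm_num)]; exact (h20 v hv).2
  have hzero : ∀ a, 27 < a → ∀ i, s₂.arr a i = 0 := fun a ha i => by
    rw [hfr2 a (by omega) (by omega), hfr1 a (by omega) (by omega), hz a (by omega)]
  have hM : MemAt I Φ (fun _ => ⊤) (fun _ => False) 0 0 0 s₂ := by
    refine ⟨hs2, ⟨fun v hv => ⟨?_, fun i hi => ?_⟩, fun _ _ _ _ => rfl⟩, ?_⟩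
    · rw [hfr2 20 (by norm_num) (by norm_num), (h20 v hv).1]; simp [topBit]
    · rw [hlow _ (mul_add_lt hi hv), comps_top_getD]
    · have : Queued I (fun _ => ⊤) (fun _ => False) = fun _ => False := by
        funext v; simp [Queued]
      rw [this]
      exact heapInv_empty a22 (hzero 31 (by norm_num)) (hzero 33 (by norm_num))
  have hcr : I.credit (s₂.arr 22) (s₂.arr 33) = 1000 * (I.B * I.n) := by
    unfold Inst.credit
    rw [Finset.sum_congr rfl fun v hv => by rw [a22 v (Finset.mem_range.mp hv)]]
    simp [hzero 33 (by norm_num)]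
    ring
  have e1 : (140 * I.h + 400) * I.m = 140 * (I.h * I.m) + 400 * I.m := by ring
  have e2 : (140 * I.h + 340) * I.m = 140 * (I.h * I.m) + 340 * I.m := by ring
  rw [runs_seq]
  refine baseProg_runs (μ := μ)
    (c := 40 * I.B + (140 * I.h + 340) * I.m + 60 * I.n + 12 + (12 * I.n + 12 * (I.n * I.h) + 20))
    hW hΦs hM hμ (by rw [hcr]; omega) ?_
  intro s₃ T₃ ν hM3 hν hT₃
  have hνb : ∀ v : Fin I.n, IsBase I.FArc I.fpri v → ν v = μs v := by
    intro v hv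
    have h := hν.base v v.2 v.2 ((I.isBase_iff hΦs v).mp hv)
    rw [hbase v hv]
    refine le_antisymm (le_bestTighten fun w hw => (h _).mp le_rfl w hw)
      ((h _).mpr fun w hw => ?_)
    exact bestTighten_le (A := I.FArc) (π := I.fpri) (ν := fun v => μ v) (w := ⟨w, hw.lt⟩) hw
  rw [runs_seq]
  refine dijkstraProg_runs (μs := μs) (c := 12 * I.n + 12 * (I.n * I.h) + 20) hW hΦs hA hfix hM3
    (fun v hv => ?_) hνb (by omega) ?_
  · by_cases hb : IsBase I.FArc I.fpri ⟨v, hv⟩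
    · exact (hνb _ hb).symm.le
    · rw [hν.top v hv (Or.inr fun h => hb ((I.isBase_iff hΦs ⟨v, hv⟩).mpr h))]
      exact le_top
  · intro s₄ T₄ hs4 hL4 hT₄
    exact (outputProg_does hW hs4 hL4).runs hT₄ fun _ _ h _ => h

end WordRAM

/-! ### The input -/

namespace WordRAM

/-- The concatenation of lists, indexed by the total length of the lists before a given one. -/
theorem getD_flatMap_finRange {n : ℕ} (f : Fin n → List ℕ) (v : Fin n) {i : ℕ}
    (hi : i < (f v).length) :
    ((List.finRange n).flatMap f).getD
        ((∑ u : Fin n, if u.val < v then (f u).length else 0) + i) 0 =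
      (f v).getD i 0 := by
  induction n with
  | zero => exact v.elim0
  | succ n ih =>
    rw [List.finRange_succ, List.flatMap_cons, List.flatMap_map, Fin.sum_univ_succ]
    cases v using Fin.cases with
    | zero => simp [List.getElem?_append_left hi]
    | succ w =>
      have := ih (fun u => f u.succ) w hi
      simp only [Fin.val_zero, Fin.val_succ, Nat.succ_pos, if_true, Nat.add_lt_add_iff_right]
      rw [List.getD_append_right _ _ _ _ (by omega), ← this]
      congr 1
      omega

theorem sum_ite_lt_succ {n : ℕ} (f : Fin n → ℕ) {v : ℕ} (hv : v < n) :
    (∑ u : Fin n, if u.val < v + 1 then f u else 0) =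
      (∑ u : Fin n, if u.val < v then f u else 0) + f ⟨v, hv⟩ := by
  have : ∀ u : Fin n, (if u.val < v + 1 then f u else 0) =
      (if u.val < v then f u else 0) + if u = ⟨v, hv⟩ then f u else 0 := by
    intro u
    by_cases h : u = ⟨v, hv⟩
    · subst h; simp
    · have : u.val ≠ v := fun h' => h (Fin.ext h')
      simp only [h, if_false, add_zero]
      congr 1
      exact propext ⟨fun h => by omega, fun h => by omega⟩
  simp only [this, Finset.sum_add_distrib, Finset.sum_ite_eq', Finset.mem_univ, if_true]

theorem sum_ite_lt_const {n : ℕ} (h : ℕ) : ∀ v ≤ n,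
    (∑ u : Fin n, if u.val < v then h else 0) = v * h := by
  intro v
  induction v with
  | zero => simp
  | succ v ih =>
    intro hv
    rw [sum_ite_lt_succ (fun _ => h) hv, ih (by omega), Nat.succ_mul]

theorem getD_map_finRange {n : ℕ} (f : Fin n → ℕ) {v : ℕ} (hv : v < n) :
    ((List.finRange n).map f).getD v 0 = f ⟨v, hv⟩ := by
  rw [List.getD_eq_getElem _ _ (by simpa using hv)]
  simp

theorem arcCount_eq {n : ℕ} {A : Fin n → Fin n → Prop} {adj : Fin n → List (Fin n)}
    (hadj : IsAdjList A adj) : arcCount A = ∑ v, (adj v).length := by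
  have h1 : arcCount A = Nat.card {e : Fin n × Fin n // A e.1 e.2} := rfl
  rw [h1, Nat.card_congr (Equiv.subtypeProdEquivSigmaSubtype A), Nat.card_sigma]
  refine Finset.sum_congr rfl fun v _ => ?_
  have h2 : {w | A v w} = ((adj v).toFinset : Set (Fin n)) := by
    ext w; simp [(hadj v).2 w]
  rw [← List.toFinset_card_of_nodup (hadj v).1, ← Set.ncard_coe_finset, ← h2]
  rfl

section Input

variable {n d : ℕ} {adj : Fin n → List (Fin n)} {π : Fin n → ℕ} {μ : Fin n → Label n (d / 2)}

theorem input_off {k : ℕ} (hk : k ≤ n) : (inputState d adj π μ).arr 0 k =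
    ∑ v : Fin n, if v.val < k then (adj v).length else 0 := by
  simp only [inputState, State.ofLists, List.getD_cons_zero]
  rw [List.getD_eq_getElem _ _ (by simp; omega)]
  simp

theorem input_pri {v : ℕ} (hv : v < n) : (inputState d adj π μ).arr 2 v = π ⟨v, hv⟩ :=
  getD_map_finRange π hv

theorem input_tgt_lt (hn : 0 < n) (e : ℕ) : (inputState d adj π μ).arr 1 e < n := by
  have : (inputState d adj π μ).arr 1 e =
    ((List.finRange n).flatMap fun v => (adj v).map Fin.val).getD e 0 := rfl
  rw [this]
  by_cases h : e < ((List.finRange n).flatMap fun v => (adj v).map Fin.val).length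
  · rw [List.getD_eq_getElem _ _ h]
    have := List.getElem_mem h
    generalize ((List.finRange n).flatMap fun v => (adj v).map Fin.val)[e] = x at *
    simp only [List.mem_flatMap, List.mem_map] at this
    obtain ⟨-, -, w, -, rfl⟩ := this
    exact w.2
  · rw [List.getD_eq_default _ _ (by omega)]; exact hn

theorem input_tgt (v : Fin n) {i : ℕ} (hi : i < (adj v).length) :
    (inputState d adj π μ).arr 1 ((inputState d adj π μ).arr 0 v + i) = (adj v)[i] := by
  rw [input_off v.2.le]
  have h1 := getD_flatMap_finRange (fun v => (adj v).map Fin.val) v (i := i) (by simpa using hi)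
  simp only [List.length_map] at h1
  refine h1.trans ?_
  rw [List.getD_eq_getElem _ _ (by simpa using hi)]
  simp

theorem input_label (v : Fin n) {i : ℕ} (hi : i < d / 2) :
    (inputState d adj π μ).arr 4 (v * (d / 2) + i) = (comps (μ v)).getD i 0 := by
  have h1 := getD_flatMap_finRange (fun v => comps (μ v)) v (i := i)
    (by rw [comps_length]; exact hi)
  simp only [comps_length] at h1
  rw [sum_ite_lt_const _ _ v.2.le] at h1
  exact h1

/-- The instance that is given by the input. -/
noncomputable def inputInst (hn : 0 < n) (hd : Even d) (adj : Fin n → List (Fin n)) (π : Fin n → ℕ)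
    (h1 : ∀ v, 1 ≤ π v) (h2 : ∀ v, π v ≤ d) (μ : Fin n → Label n (d / 2)) : Inst where
  n := n
  m := ∑ v, (adj v).length
  d := d
  h := d / 2
  L := n.size + 1
  off := (inputState d adj π μ).arr 0
  tgt := (inputState d adj π μ).arr 1
  pri := (inputState d adj π μ).arr 2
  mt := (inputState d adj π μ).arr 3
  mc := (inputState d adj π μ).arr 4
  n_pos := hn
  d_eq := (Nat.two_mul_div_two_of_even hd).symm
  off_zero := by simp [input_off (Nat.zero_le n)]
  off_last := by simp [input_off le_rfl]
  off_mono v hv := by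
    rw [input_off hv.le, input_off hv, sum_ite_lt_succ _ hv]
    exact Nat.le_add_right _ _
  tgt_lt e _ := input_tgt_lt hn e
  pri_pos v hv := by rw [input_pri hv]; exact h1 _
  pri_le v hv := by rw [input_pri hv]; exact h2 _
  L_eq := rfl

variable {A : Fin n → Fin n → Prop} {hn : 0 < n} {hd : Even d} {h1 : ∀ v, 1 ≤ π v}
  {h2 : ∀ v, π v ≤ d}

theorem inputInst_fArc (hadj : IsAdjList A adj) :
    (inputInst hn hd adj π h1 h2 μ).FArc = A := by
  suffices ∀ v w : Fin n, (inputInst hn hd adj π h1 h2 μ).Arc v w ↔ A v w from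
    funext fun v => funext fun w => propext (this v w)
  intro v w
  have hoff : (inputState d adj π μ).arr 0 (v + 1) =
      (inputState d adj π μ).arr 0 v + (adj v).length := by
    rw [input_off v.2.le, input_off v.2, sum_ite_lt_succ _ v.2]
  have hw : A v w ↔ w ∈ adj v := ((hadj v).2 w).symm
  rw [hw]
  refine ⟨?_, fun h => ?_⟩
  · rintro ⟨-, e, he1, he2, he3⟩
    obtain ⟨i, rfl⟩ := Nat.exists_eq_add_of_le he1
    have hi : i < (adj v).length := by
      have : (inputState d adj π μ).arr 0 v + i < (inputState d adj π μ).arr 0 (v + 1) := he2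
      omega
    have : ((adj v)[i] : ℕ) = w := (input_tgt v hi).symm.trans he3
    rw [← Fin.ext this]
    exact List.getElem_mem hi
  · obtain ⟨i, hi, rfl⟩ := List.getElem_of_mem h
    refine ⟨v.2, (inputState d adj π μ).arr 0 v + i, Nat.le_add_right _ _, ?_, input_tgt v hi⟩
    show (inputState d adj π μ).arr 0 v + i < (inputState d adj π μ).arr 0 (v + 1)
    omega

theorem inputInst_fpri : (inputInst hn hd adj π h1 h2 μ).fpri = π :=
  funext fun v => input_pri v.2

/-- The word bound is a power of the size of the input. -/
theorem inputInst_bounded (hadj : IsAdjList A adj) (hA : ∀ v, ∃ w, A v w) :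
    (inputInst hn hd adj π h1 h2 μ).Bounded ((n + arcCount A + d) ^ 4) := by
  rw [arcCount_eq hadj]
  set I := inputInst hn hd adj π h1 h2 μ with hI
  have hnm : I.n ≤ I.m := Inst.n_le_m (by rw [inputInst_fArc hadj]; exact hA)
  have hd2 := I.d_eq
  have hh := I.h_pos
  have hn1 := I.n_pos
  have hL : I.L ≤ I.n + 1 := by
    rw [I.L_eq]
    have : I.n.size ≤ I.n := Nat.size_le.mpr Nat.lt_two_pow_self
    omega
  have hW : n + (∑ v, (adj v).length) + d = I.n + I.m + I.d := rfl
  rw [hW]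
  set N := I.n + I.m + I.d with hN
  have hN4 : 4 ≤ N := by omega
  have p2 : 4 * N ≤ N ^ 2 := by rw [pow_two]; exact Nat.mul_le_mul_right _ hN4
  have p3 : 4 * N ^ 2 ≤ N ^ 3 := by rw [pow_succ N 2, mul_comm]; exact Nat.mul_le_mul_left _ hN4
  have p4 : 4 * N ^ 3 ≤ N ^ 4 := by rw [pow_succ N 3, mul_comm]; exact Nat.mul_le_mul_left _ hN4
  have q1 : I.n * I.h ≤ N * N := Nat.mul_le_mul (by omega) (by omega)
  have q2 : (I.n + 1) * I.L ≤ N * N := Nat.mul_le_mul (by omega) (by omega)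
  have q3 : I.d * I.L * (I.n + 1) ≤ N * N * N :=
    Nat.mul_le_mul (Nat.mul_le_mul (by omega) (by omega)) (by omega)
  have e2 : N * N = N ^ 2 := (pow_two N).symm
  have e3 : N * N * N = N ^ 3 := by ring
  rw [e2] at q1 q2
  rw [e3] at q3
  exact ⟨by omega, by omega, by omega, by omega⟩

end Input

/-- The number of bits of `n` exceeds `log n` by a constant factor and a constant, which are
absorbed by the number of arcs. -/
theorem mul_size_le {n m : ℕ} (hn : 0 < n) (hnm : n ≤ m) :
    ((m + n * (n.size + 1) : ℕ) : ℝ) ≤ 3 * ((m : ℝ) + (n : ℝ) * Real.log n) := by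
  have hpow : 2 ^ (n.size - 1) ≤ n :=
    Nat.lt_size.mp (Nat.sub_lt (Nat.size_pos.mpr hn) Nat.one_pos)
  have hlog : ((n.size - 1 : ℕ) : ℝ) * Real.log 2 ≤ Real.log n := by
    rw [← Real.log_pow]
    exact Real.log_le_log (by positivity) (by exact_mod_cast hpow)
  have h2 := Real.log_two_gt_d9
  have hs : ((n.size - 1 : ℕ) : ℝ) ≤ 2 * Real.log n := by
    have h0 : (0 : ℝ) ≤ ((n.size - 1 : ℕ) : ℝ) := Nat.cast_nonneg _
    nlinarith
  have hsz : (n.size : ℝ) = ((n.size - 1 : ℕ) : ℝ) + 1 := by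
    have := Nat.size_pos.mpr hn
    exact_mod_cast (Nat.sub_add_cancel this).symm
  have hnm' : (n : ℝ) ≤ m := by exact_mod_cast hnm
  have hn0 : (0 : ℝ) ≤ n := Nat.cast_nonneg _
  have hlog0 : 0 ≤ (n : ℝ) * Real.log n := mul_nonneg hn0 (Real.log_natCast_nonneg n)
  push_cast
  rw [hsz]
  have := mul_le_mul_of_nonneg_left hs hn0
  nlinarith

end WordRAM

namespace WordRAM

/-- Extend a labeling of `Fin n` to all numbers. -/
noncomputable def extendLabeling {n h : ℕ} (μ : Fin n → Label n h) (v : ℕ) : Label n h :=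
  if hv : v < n then μ ⟨v, hv⟩ else ⊤

theorem extendLabeling_val {n h : ℕ} (μ : Fin n → Label n h) (v : Fin n) :
    extendLabeling μ v = μ v := by
  simp [extendLabeling]

/-- The factor `12000` is `4000` from the time bound of the program times `3` from replacing the
number of bits by the logarithm. -/
theorem exists_exec_solveProg {n d : ℕ} (hn : 0 < n) (hd : Even d) {A : Fin n → Fin n → Prop}
    {π : Fin n → ℕ} {μ μs : Fin n → Label n (d / 2)} (h1 : ∀ v, 1 ≤ π v) (h2 : ∀ v, π v ≤ d)
    (hA : ∀ v, ∃ w, A v w) (hfix : bestTighten A π μs = μs)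
    (hbase : ∀ v, IsBase A π v → μs v = bestTighten A π μ v) {adj : Fin n → List (Fin n)}
    (hadj : IsAdjList A adj) :
    ∃ (t : ℕ) (s : State),
      Exec ((n + arcCount A + d) ^ 4) solveProg (inputState d adj π μ) t s ∧
      (t : ℝ) ≤ 12000 * ((d : ℝ) * ((arcCount A : ℝ) + (n : ℝ) * Real.log n)) ∧
      HoldsLabeling s μs := by
  set I := inputInst hn hd adj π h1 h2 μ with hI
  have hW : I.Bounded ((n + arcCount A + d) ^ 4) := inputInst_bounded hadj hA
  have hFA : I.FArc = A := inputInst_fArc hadj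
  have hFp : I.fpri = π := inputInst_fpri
  have hA' : ∀ v, ∃ w, I.FArc v w := by rw [hFA]; exact hA
  have hext : ∀ κ : Fin n → Label n (d / 2),
      (fun v : Fin I.n => (extendLabeling κ v : Label I.n I.h)) = κ := fun κ =>
    funext fun v => extendLabeling_val κ v
  have hlab : ∀ v < n, (inputState d adj π μ).arr 3 v = topBit (extendLabeling μ v) ∧ ∀ i < d / 2,
      (inputState d adj π μ).arr 4 (v * (d / 2) + i) = (comps (extendLabeling μ v)).getD i 0 := by
    intro v hv
    have h := extendLabeling_val μ ⟨v, hv⟩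
    simp only at h
    rw [h]
    exact ⟨getD_map_finRange (fun v => topBit (μ v)) hv, fun i hi => input_label ⟨v, hv⟩ hi⟩
  obtain ⟨t, s, hE, ht, hL⟩ := solveProg_does (I := I) (s := inputState d adj π μ)
    (μ := extendLabeling μ) (μs := extendLabeling μs) hW rfl rfl rfl rfl rfl rfl rfl rfl
    (fun a ha i => by
      obtain ⟨b, rfl⟩ := Nat.exists_eq_add_of_le' ha
      rfl)
    hA' hlab
    (by rw [hext, hFA, hFp]; exact hfix)
    (fun v hv => by
      rw [hFA, hFp] at hv
      rw [hext, hFA, hFp]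
      exact (extendLabeling_val μs v).trans (hbase v hv))
  refine ⟨t, s, hE, ?_, fun v => ?_⟩
  · have hm : I.m = arcCount A := (arcCount_eq hadj).symm
    have hnm : n ≤ arcCount A := hm ▸ Inst.n_le_m hA'
    have ht' : (t : ℝ) ≤ ((4000 * (d * (arcCount A + n * (n.size + 1))) : ℕ) : ℝ) := by
      rw [← hm]
      exact_mod_cast ht
    refine ht'.trans ?_
    have := mul_le_mul_of_nonneg_left (mul_size_le hn hnm) (Nat.cast_nonneg (α := ℝ) d)
    rw [Nat.cast_mul 4000, Nat.cast_mul d]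
    push_cast at this ⊢
    linarith
  · have h : s.arr 3 v = topBit (extendLabeling μs v) ∧ ∀ i < d / 2,
        s.arr 4 (v * (d / 2) + i) = (comps (extendLabeling μs v)).getD i 0 := hL v v.2
    rwa [extendLabeling_val μs v] at h

end WordRAM

theorem mainTheorem10 :
    ∃ (P : WordRAM.Prog) (C : ℝ) (k : ℕ),
      ∀ (n d : ℕ), 0 < n → Even d →
      ∀ (G : ParityGame (Fin n) d) (τ : OddStrategy G) (μ : Fin n → Label n (d / 2)),
      (∀ v w, τ.SArc v w → ¬ Loose G.prio μ v w) →
      ∃ μs : Fin n → Label n (d / 2),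
        IsLeastFixedPoint τ.SArc G.oddNodes G.prio μ μs ∧
        (∀ μ' : Fin n → Label n (d / 2), IsBaseLift τ.SArc G.prio μ μ' →
          (∀ v, IsBase τ.SArc G.prio v → μ' v = μs v) ∧
          ∀ ν, DijkstraReturns τ.SArc G.prio d μ' ν ↔ ν = μs) ∧
        ∀ adj : Fin n → List (Fin n), IsAdjList τ.SArc adj →
          ∃ (t : ℕ) (s : WordRAM.State),
            Exec ((n + arcCount τ.SArc + d) ^ k) P (inputState d adj G.prio μ) t s ∧
            (t : ℝ) ≤ C * ((d : ℝ) * ((arcCount τ.SArc : ℝ) + (n : ℝ) * Real.log n)) ∧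
            HoldsLabeling s μs := by
  refine ⟨solveProg, 12000, 4, fun n d hn hd G τ μ hμ => ?_⟩
  have hA : ∀ v, ∃ w, τ.SArc v w := by
    intro v
    by_cases hv : v ∈ G.oddNodes
    · exact ⟨τ.move ⟨v, hv⟩, τ.arc_move ⟨v, hv⟩, fun _ => rfl⟩
    · obtain ⟨w, hw⟩ := G.sinkless v
      exact ⟨w, hw, fun h => absurd h hv⟩
  have hO : ∀ v ∈ G.oddNodes, ∀ w w', τ.SArc v w → τ.SArc v w' → w = w' :=
    fun v hv w w' hw hw' => (hw.2 hv).trans (hw'.2 hv).symm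
  have hπ : ∀ v, G.prio v / 2 ≤ d / 2 := fun v => Nat.div_le_div_right (G.prio_le v)
  have hbest : μ ≤ bestTighten τ.SArc G.prio μ := fun v =>
    le_bestTighten fun w hw => le_tighten_of_not_loose (hμ v w hw)
  obtain ⟨μs, hs⟩ := exists_isLeast_prefixed τ.SArc G.prio μ
  have hfix := bestTighten_eq_of_isLeast hbest hs
  have hcard : Fintype.card (Fin n) ≤ n := (Fintype.card_fin n).le
  refine ⟨μs, ?_, fun μ' hμ' => ?_, fun adj hadj => ?_⟩
  · unfold IsLeastFixedPoint
    simp only [forall_liftOps_iff hA hO]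
    exact hs
  · have h1 : ∀ v, IsBase τ.SArc G.prio v → μ' v = μs v := fun v hv =>
      hμ'.apply_eq hA hcard hπ hbest hs hv
    exact ⟨h1, fun ν => dijkstraReturns_iff (Nat.two_mul_div_two_of_even hd).symm G.one_le_prio
      G.prio_le hA hfix h1⟩
  · exact exists_exec_solveProg hn hd G.one_le_prio G.prio_le hA hfix
      (fun v hv => hv.apply_eq_bestTighten hcard (hπ v) hbest hs) hadj
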